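/- Theorem 1.4. Let $V:\mathbb R\to\mathbb R$ be real analytic and strongly convex, i.e. there is $c>0$ with $V''(x)\ge c$ for all $x\in\mathbb R$. Then $V$ is one-cut regular: $V(x)/(|x|+1)\to+\infty$ as $x\to\pm\infty$, and there exist $a<b$ and a probability measure $d\mu_V(x)=\psi_V(x)\,dx$ with $\operatorname{supp}\mu_V=[a,b]$, $\psi_V>0$ on $(a,b)$, such that $\lim_{x\to a_+}\psi_V(x)/\sqrt{x-a}$ and $\lim_{x\to b_-}\psi_V(x)/\sqrt{b-x}$ exist and are nonzero, and such that for some constant $\ell\in\mathbb R$ the function $$F(x)=\int\log|t-x|^{-1}d\mu_V(t)+\int\log|e^t-e^x|^{-1}d\mu_V(t)+V(x)+\ell$$ (with both integrals absolutely convergent) satisfies $F(x)=0$ for $x\in[a,b]$ and $F(x)>0$ for $x\in\mathbb R\setminus[a,b]$. Moreover, $\mu_V$ is the unique minimizer, among all Borel probability measures on $\mathbb R$, of $$I_V(\mu)=\iint\Big(\tfrac12\log|t-s|^{-1}+\tfrac12\log|e^t-e^s|^{-1}+\tfrac12V(t)+\tfrac12V(s)\Big)d\mu(t)\,d\mu(s)\in(-\infty,+\infty],$$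 and the support and the density are found as follows. For $x_1>0$, $x_0\in\mathbb R$ and $s\in\mathbb C\setminus[-\frac12,\frac12]$ put $\mathbf J_{x_1,x_0}(s)=x_1s+x_0-\log\frac{s-1/2}{s+1/2}$ (principal logarithm). Put $s_b=-s_a=\sqrt{\frac14+\frac1{x_1}}$. Let $\gamma=\mathbf J_{x_1,x_0}^{-1}\big([\mathbf J_{x_1,x_0}(s_a),\mathbf J_{x_1,x_0}(s_b)]\big)$, a closed curve around $[-\frac12,\frac12]$ oriented counterclockwise, and let $D$ be the region enclosed by $\gamma$. Consider the equations $$x_1^{-1}=\frac1{2\pi i}\oint_\gamma V'(\mathbf J_{x_1,x_0}(s))\,ds,\qquad 1=\frac1{2\pi i}\oint_\gamma\frac{V'(\mathbf J_{x_1,x_0}(s))}{s-\frac12}\,ds .$$ They have exactly one solution $(x_1,x_0)=(c_1,c_0)$ with $c_1>0$ and $c_0\in\mathbb R$. With $x_1=c_1$, $x_0=c_0$ and $\mathbf J=\mathbf J_{c_1,c_0}$, one has $a=\mathbf J(s_a)$, $b=\mathbf J(s_b)$, and hence $$c_0=\frac{b+a}2,\qquad c_1\sqrt{\tfrac14+\tfrac1{c_1}}-\log\frac{\sqrt{\frac14+\frac1{c_1}}-\frac12}{\sqrt{\frac14+\frac1{c_1}}+\frac12}=\frac{b-a}2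 .$$ The map $\mathbf J$ is a bijection from $\mathbb C\setminus\overline D$ onto $\mathbb C\setminus[a,b]$; let $\mathbf I_1$ be its inverse. For $x\in(a,b)$ the limits $\mathbf I_\pm(x)=\lim_{\epsilon\to0_+}\mathbf I_1(x\pm i\epsilon)$ exist, and $$\psi_V(x)=\frac1{2\pi^2}\int_a^bV''(u)\log\left|\frac{\mathbf I_+(u)-\mathbf I_-(x)}{\mathbf I_+(u)-\mathbf I_+(x)}\right|du,\qquad x\in(a,b),$$ where the integral converges absolutely. -/

import Mathlib

open MeasureTheory Set Filter Topology

namespace EquiSource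

noncomputable section

/-! ### Equilibrium problem -/

/-- The kernel `k^V(t,s) = ½ log|t-s|⁻¹ + ½ log|e^t-e^s|⁻¹ + ½ V(t) + ½ V(s)`, which is `+∞` on the
diagonal. -/
def energyKernel (V : ℝ → ℝ) (t s : ℝ) : EReal :=
  if t = s then ⊤
  else (((1 / 2) * Real.log |t - s|⁻¹ + (1 / 2) * Real.log |Real.exp t - Real.exp s|⁻¹
    + (1 / 2) * V t + (1 / 2) * V s : ℝ) : EReal)

/-- The energy `I_V(μ) = ∬ k^V(t,s) dμ(t) dμ(s)` as an extended real number: integral of the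
positive part minus integral of the negative part (the latter is finite for a probability
measure `μ` as soon as `V(x)/(|x|+1) → ∞`, since `k^V` is then bounded below). -/
def energy (V : ℝ → ℝ) (μ : Measure ℝ) : EReal :=
  ((∫⁻ p : ℝ × ℝ, (energyKernel V p.1 p.2).toENNReal ∂(μ.prod μ) : ENNReal) : EReal)
    - ((∫⁻ p : ℝ × ℝ, (-energyKernel V p.1 p.2).toENNReal ∂(μ.prod μ) : ENNReal) : EReal)

/-- `μ` minimizes the energy among all Borel probability measures on `ℝ`. -/
def IsEquilibriumMeasure (V : ℝ → ℝ) (μ : Measure ℝ) : Prop :=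
  IsProbabilityMeasure μ ∧
    ∀ ν : Measure ℝ, IsProbabilityMeasure ν → energy V μ ≤ energy V ν

/-- The measure `ψ(x) dx`, for a nonnegative measurable function `ψ`. -/
def densityMeasure (ψ : ℝ → ℝ) : Measure ℝ :=
  volume.withDensity (fun x => ENNReal.ofReal (ψ x))

/-- `∫ log|t-x|⁻¹ dμ(t) + ∫ log|e^t-e^x|⁻¹ dμ(t) + V(x)`. -/
def effectivePotential (V : ℝ → ℝ) (μ : Measure ℝ) (x : ℝ) : ℝ :=
  (∫ t, Real.log |t - x|⁻¹ ∂μ) + (∫ t, Real.log |Real.exp t - Real.exp x|⁻¹ ∂μ) + V x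

/-- The measure `ψ(x) dx` satisfies the conditions (i)-(v) of one-cut regularity with
support `[a,b]`. -/
structure IsOneCutDensity (V : ℝ → ℝ) (a b : ℝ) (ψ : ℝ → ℝ) : Prop where
  measurable : Measurable ψ
  nonneg : ∀ x, 0 ≤ ψ x
  lt : a < b
  support_eq : (densityMeasure ψ).support = Icc a b
  isProbabilityMeasure : IsProbabilityMeasure (densityMeasure ψ)
  pos : ∀ x ∈ Ioo a b, 0 < ψ x
  sqrt_left : ∃ L : ℝ, L ≠ 0 ∧ Tendsto (fun x => ψ x / Real.sqrt (x - a)) (𝓝[>] a) (𝓝 L)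
  sqrt_right : ∃ L : ℝ, L ≠ 0 ∧ Tendsto (fun x => ψ x / Real.sqrt (b - x)) (𝓝[<] b) (𝓝 L)
  /-- the two logarithmic potentials are given by convergent integrals -/
  integrable_log : ∀ x, Integrable (fun t => Real.log |t - x|⁻¹) (densityMeasure ψ)
  integrable_log_exp : ∀ x,
    Integrable (fun t => Real.log |Real.exp t - Real.exp x|⁻¹) (densityMeasure ψ)
  variational : ∃ l : ℝ,
    (∀ x ∈ Icc a b, effectivePotential V (densityMeasure ψ) x + l = 0) ∧
    (∀ x, x ∉ Icc a b → 0 < effectivePotential V (densityMeasure ψ) x + l)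

/-- One-cut regularity of a real analytic external field with `V(x)/(|x|+1) → ∞`. -/
def IsOneCutRegular (V : ℝ → ℝ) : Prop :=
  AnalyticOnNhd ℝ V univ ∧
  Tendsto (fun x => V x / (|x| + 1)) atTop atTop ∧
  Tendsto (fun x => V x / (|x| + 1)) atBot atTop ∧
  ∃ (a b : ℝ) (ψ : ℝ → ℝ), IsOneCutDensity V a b ψ

/-! ### The transformation `J` and its inverse -/

/-- `J_{c₁,c₀}(s) = c₁ s + c₀ - log ((s-½)/(s+½))`, used for `s ∈ ℂ \ [-½,½]`, with the principal
logarithm. -/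
def J (c₁ c₀ : ℝ) (s : ℂ) : ℂ :=
  (c₁ : ℂ) * s + (c₀ : ℂ) - Complex.log ((s - 1 / 2) / (s + 1 / 2))

/-- The critical point `s_b = √(¼ + 1/c₁)`; the other one is `s_a = -s_b`. -/
def sB (c₁ : ℝ) : ℝ := Real.sqrt (1 / 4 + 1 / c₁)

/-- The critical point `s_a = -√(¼ + 1/c₁)`. -/
def sA (c₁ : ℝ) : ℝ := -Real.sqrt (1 / 4 + 1 / c₁)

/-- The real number `J_{c₁,c₀}(s_a)`. -/
def leftEnd (c₁ c₀ : ℝ) : ℝ := (J c₁ c₀ (sA c₁ : ℂ)).re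

/-- The real number `J_{c₁,c₀}(s_b)`. -/
def rightEnd (c₁ c₀ : ℝ) : ℝ := (J c₁ c₀ (sB c₁ : ℂ)).re

/-- A real set, seen in the complex plane. -/
def realSet (S : Set ℝ) : Set ℂ := (fun x : ℝ => (x : ℂ)) '' S

/-- The closed curve `γ = J⁻¹([J(s_a), J(s_b)])` in `ℂ \ [-½,½]`. -/
def curve (c₁ c₀ : ℝ) : Set ℂ :=
  {s | s ∉ realSet (Icc (-1 / 2) (1 / 2)) ∧
    J c₁ c₀ s ∈ realSet (Icc (leftEnd c₁ c₀) (rightEnd c₁ c₀))}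

/-- The region `D` enclosed by `γ`: the points of the bounded components of `ℂ \ γ`. -/
def region (c₁ c₀ : ℝ) : Set ℂ :=
  {s | s ∉ curve c₁ c₀ ∧
    Bornology.IsBounded (connectedComponentIn (curve c₁ c₀)ᶜ s)}

/-- `I₁`, the inverse of `J` from `ℂ \ [a,b]` to `ℂ \ closure D`. -/
def I₁ (c₁ c₀ : ℝ) : ℂ → ℂ :=
  Function.invFunOn (J c₁ c₀) (closure (region c₁ c₀))ᶜ

/-- `I₊(x) = lim_{ε → 0+} I₁(x + iε)`. -/
def Iplus (c₁ c₀ : ℝ) (x : ℝ) : ℂ :=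
  limUnder (𝓝[>] (0 : ℝ)) (fun ε : ℝ => I₁ c₁ c₀ ((x : ℂ) + Complex.I * (ε : ℂ)))

/-- `I₋(x) = lim_{ε → 0+} I₁(x - iε)`. -/
def Iminus (c₁ c₀ : ℝ) (x : ℝ) : ℂ :=
  limUnder (𝓝[>] (0 : ℝ)) (fun ε : ℝ => I₁ c₁ c₀ ((x : ℂ) - Complex.I * (ε : ℂ)))

/-- `∫ f(s) ds` along the curve `p` parametrized by `[a,b]`. -/
def curveInt (p : ℝ → ℂ) (a b : ℝ) (f : ℂ → ℂ) : ℂ :=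
  ∫ x in a..b, f (p x) * deriv p x

/-- The contour integral `∮_γ f(s) ds` over the counterclockwise curve `γ`: the lower arc,
parametrized by `I₋` on `[a,b]`, from `s_a` to `s_b`, followed by the upper arc, parametrized by
`I₊` on `[a,b]`, traversed backwards from `s_b` to `s_a`. -/
def contourInt (c₁ c₀ : ℝ) (f : ℂ → ℂ) : ℂ :=
  curveInt (Iminus c₁ c₀) (leftEnd c₁ c₀) (rightEnd c₁ c₀) f
    - curveInt (Iplus c₁ c₀) (leftEnd c₁ c₀) (rightEnd c₁ c₀) f

/-- `s ↦ V'(J(s))` on `γ`, where `J(s)` is a real number. -/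
def derivAlong (V : ℝ → ℝ) (c₁ c₀ : ℝ) (s : ℂ) : ℂ :=
  ((deriv V (J c₁ c₀ s).re : ℝ) : ℂ)

/-- The pair of equations `x₁⁻¹ = (1/2πi) ∮_γ V'(J(s)) ds` and
`1 = (1/2πi) ∮_γ V'(J(s)) / (s-½) ds`, with `J = J_{x₁,x₀}` and its curve `γ`. -/
def SolvesEndpointEquations (V : ℝ → ℝ) (x₁ x₀ : ℝ) : Prop :=
  ((x₁⁻¹ : ℝ) : ℂ) = 1 / (2 * (Real.pi : ℂ) * Complex.I) *
      contourInt x₁ x₀ (fun s => derivAlong V x₁ x₀ s) ∧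
  (1 : ℂ) = 1 / (2 * (Real.pi : ℂ) * Complex.I) *
      contourInt x₁ x₀ (fun s => derivAlong V x₁ x₀ s / (s - 1 / 2))

/-- The integrand `V''(u) log |(I₊(u) - I₋(x)) / (I₊(u) - I₊(x))|` of the density formula. -/
def densityIntegrand (V : ℝ → ℝ) (c₁ c₀ x u : ℝ) : ℝ :=
  deriv (deriv V) u * Real.log
    ‖(Iplus c₁ c₀ u - Iminus c₁ c₀ x) / (Iplus c₁ c₀ u - Iplus c₁ c₀ x)‖

end

end EquiSource

open EquiSource

/-!
Both contour integral equations and the density live on the curve `γ = {h = c₁}`, where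
`h(s) = ∫ dt / |t - s|²` over `[-½,½]`; `Im J = Im s · (c₁ - h)`. Where `h ≤ c₁` the divided
difference of `J` vanishes only between conjugate points (`J_inj`), and quantitatively so: hence `J`
is univalent on the exterior `{h < c₁}` (`J_bijOn`), and `γ` has a Hölder continuous parametrization
`bp`, the centred form of `I₊` (`Iplus_eq`). As `h` decreases along rays and vertical lines, the
region inside `γ` is star-shaped about `0` (`mul_mem_In`, `region_eq`). Dilating `γ` outwards or
inwards and letting the factor tend to `1` evaluates all contour integrals along it
(`im_integral_outer`, `im_integral_inner`, `im_integral_limit`).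

*The equations.* Integrating by parts along `γ`, the two equations say that the average of `V''`
against `Im I₊` is `π / c₁` and the average of `V'` against a probability measure is `0`
(`solves_iff`). For fixed `c₁`, strong convexity gives the second one exactly one root `c₀`, and the
intermediate value theorem for the first one gives a solution (`exists_solution`).

*The density.* The logarithmic kernel `Gk` is the imaginary part of a holomorphic function outside
`γ` (`Mo`) and of another one inside (`Mi`). Integrated against `J'` and the logarithms of
`(J - x)/(J - x')` outside and `(e^J - e^x)/(e^J - e^{x'})` inside, they give the mass and the two
logarithmic potentials of `Gk`. The real parts of `Mo` and `Mi` add up to a step function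
(`Mo_add_Mi_re`), so the sum of the potentials is explicit (`integral_Gk_potential`). By Fubini the
average `dens` of `Gk` against `V''` satisfies the Euler–Lagrange equation as soon as the two
equations hold (`psi_euler_lagrange`). The kernel concentrates at an end point like the vertical
coordinate of `γ`, which has square root growth (`tendsto_dens_div_sqrt`). Outside the support, the
effective potential is strictly convex in the sense of second differences and leaves the end point
without a corner, so it is positive (`IsBoundedDensity.lt_of_right`).

*The minimizer.* The energy of `ν` exceeds that of `ψ dx` by the integral of the effective potential
plus half the logarithmic energy of the difference. Writing `-log |x|` as a superposition of tents
`(1 - |x|/ρ)₊` shows that this energy is nonnegative and vanishes only for equal measures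
(`logEnergy_nonneg`, `isEquilibriumMeasure_iff`).

*Uniqueness of the parameters.* Every solution of the equations yields the unique minimizer; its
support determines `c₀`, and also `c₁` because the half length is strictly increasing in `c₁`
(`radius_lt`, `solution_unique`).
-/

namespace EquiSource

noncomputable section

open scoped Real ComplexConjugate
open Real (log exp sinh)
open Complex (I)

variable {c₁ : ℝ}

/-! ### The segment `[-½,½]` and the function `h` -/

/-- `s` does not lie on the slit `[-½,½]`. -/
def Off (s : ℂ) : Prop := ∀ t ∈ Icc (-1 / 2 : ℝ) (1 / 2), (t : ℂ) - s ≠ 0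

/-- `h(s) = ∫ dt / |t - s|²` over the slit. For `Im s ≠ 0` it is the angle under which the slit is
seen from `s`, divided by `|Im s|`. -/
def hfun (s : ℂ) : ℝ := ∫ t in (-1 / 2 : ℝ)..(1 / 2), (‖(t : ℂ) - s‖ ^ 2)⁻¹

/-- The divided difference `∫ dt / ((t - s)(t - s'))` of the logarithm in `J`. -/
def kk (s s' : ℂ) : ℂ := ∫ t in (-1 / 2 : ℝ)..(1 / 2), ((t : ℂ) - s)⁻¹ * ((t : ℂ) - s')⁻¹

/-- The quartic integral which measures the defect in `|kk s s'| ≤ ½ (h s + h s')`. -/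
def quart (s s' : ℂ) : ℝ :=
  ∫ t in (-1 / 2 : ℝ)..(1 / 2), (‖(t : ℂ) - s‖ ^ 2)⁻¹ * (‖(t : ℂ) - s'‖ ^ 2)⁻¹

lemma off_iff {s : ℂ} : Off s ↔ s ∉ realSet (Icc (-1 / 2) (1 / 2)) := by
  unfold Off realSet
  constructor
  · rintro h ⟨t, ht, rfl⟩
    exact h t ht (by simp)
  · intro h t ht h0
    exact h ⟨t, ht, by simpa [sub_eq_zero] using h0⟩

lemma off_ofReal {x : ℝ} (h : 1 / 2 < |x|) : Off (x : ℂ) := by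
  intro t ht h0
  have : t = x := by exact_mod_cast sub_eq_zero.1 h0
  subst this
  have : |t| ≤ 1 / 2 := abs_le.2 ⟨by linarith [ht.1], ht.2⟩
  linarith

lemma Off.conj {s : ℂ} (h : Off s) : Off (conj s) := by
  intro t ht h0
  apply h t ht
  have := congrArg conj h0
  simpa using this

lemma uIcc_half : uIcc (-1 / 2 : ℝ) (1 / 2) = Icc (-1 / 2) (1 / 2) := uIcc_of_le (by norm_num)

lemma Off.continuousOn_inv {s : ℂ} (h : Off s) :
    ContinuousOn (fun t : ℝ => ((t : ℂ) - s)⁻¹) (Icc (-1 / 2 : ℝ) (1 / 2)) :=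
  ContinuousOn.inv₀ (by fun_prop) h

lemma Off.continuousOn_sq {s : ℂ} (h : Off s) :
    ContinuousOn (fun t : ℝ => (‖(t : ℂ) - s‖ ^ 2)⁻¹) (Icc (-1 / 2 : ℝ) (1 / 2)) :=
  ContinuousOn.inv₀ (by fun_prop) fun t ht => by
    have := h t ht
    positivity

lemma Off.integrable_sq {s : ℂ} (h : Off s) :
    IntervalIntegrable (fun t : ℝ => (‖(t : ℂ) - s‖ ^ 2)⁻¹) volume (-1 / 2) (1 / 2) :=
  ContinuousOn.intervalIntegrable (by rw [uIcc_half]; exact h.continuousOn_sq)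

lemma Off.integrable_inv {s : ℂ} (h : Off s) :
    IntervalIntegrable (fun t : ℝ => ((t : ℂ) - s)⁻¹) volume (-1 / 2) (1 / 2) :=
  ContinuousOn.intervalIntegrable (by rw [uIcc_half]; exact h.continuousOn_inv)

lemma Off.integrable_mul {s s' : ℂ} (h : Off s) (h' : Off s') :
    IntervalIntegrable (fun t : ℝ => ((t : ℂ) - s)⁻¹ * ((t : ℂ) - s')⁻¹) volume (-1 / 2) (1 / 2) :=
  ContinuousOn.intervalIntegrable (by
    rw [uIcc_half]; exact h.continuousOn_inv.mul h'.continuousOn_inv)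

lemma Off.integrable_quart {s s' : ℂ} (h : Off s) (h' : Off s') :
    IntervalIntegrable (fun t : ℝ => (‖(t : ℂ) - s‖ ^ 2)⁻¹ * (‖(t : ℂ) - s'‖ ^ 2)⁻¹)
      volume (-1 / 2) (1 / 2) :=
  ContinuousOn.intervalIntegrable (by
    rw [uIcc_half]; exact h.continuousOn_sq.mul h'.continuousOn_sq)

lemma Off.add_half_ne {s : ℂ} (h : Off s) : s + 1 / 2 ≠ 0 := by
  have := h (-1 / 2) ⟨le_rfl, by norm_num⟩
  intro h0
  apply this
  push_cast
  linear_combination -h0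

lemma Off.sub_half_ne {s : ℂ} (h : Off s) : s - 1 / 2 ≠ 0 := by
  have := h (1 / 2) ⟨by norm_num, le_rfl⟩
  intro h0
  apply this
  push_cast
  linear_combination -h0

lemma Off.mem_slitPlane {s : ℂ} (h : Off s) {t : ℝ} (ht : t ∈ Icc (-1 / 2 : ℝ) (1 / 2)) :
    (s - t) / (s + 1 / 2) ∈ Complex.slitPlane := by
  by_contra hc
  rw [Complex.mem_slitPlane_iff, not_or, not_lt, not_not] at hc
  obtain ⟨h1, h2⟩ := hc
  set q := (s - t) / (s + 1 / 2) with hq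
  have hqr : q = (q.re : ℂ) := by apply Complex.ext <;> simp [h2]
  have h3 : s - t = q.re * (s + 1 / 2) := by
    rw [← hqr, hq, div_mul_cancel₀ _ h.add_half_ne]
  have hne : (1 - q.re) ≠ 0 := by linarith
  have h4 : s = (((t + q.re / 2) / (1 - q.re) : ℝ) : ℂ) := by
    have : ((1 - q.re : ℝ) : ℂ) ≠ 0 := by exact_mod_cast hne
    rw [Complex.ofReal_div, eq_div_iff this]
    push_cast
    linear_combination h3
  refine h _ ?_ (sub_eq_zero.2 h4.symm)
  have hp : 0 < 1 - q.re := by linarith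
  constructor
  · rw [le_div_iff₀ hp]; nlinarith [ht.1]
  · rw [div_le_iff₀ hp]; nlinarith [ht.2]

lemma Off.slit {s : ℂ} (h : Off s) : (s - 1 / 2) / (s + 1 / 2) ∈ Complex.slitPlane := by
  have := h.mem_slitPlane (t := 1 / 2) ⟨by norm_num, le_rfl⟩
  simpa using this

lemma Off.log_eq {s : ℂ} (h : Off s) :
    Complex.log ((s - 1 / 2) / (s + 1 / 2)) = ∫ t in (-1 / 2 : ℝ)..(1 / 2), ((t : ℂ) - s)⁻¹ := by
  have hd : ∀ t ∈ uIcc (-1 / 2 : ℝ) (1 / 2),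
      HasDerivAt (fun t : ℝ => Complex.log ((s - t) / (s + 1 / 2))) (((t : ℂ) - s)⁻¹) t := by
    intro t ht
    rw [uIcc_half] at ht
    have h1 : HasDerivAt (fun t : ℝ => (s - (t : ℂ)) / (s + 1 / 2)) (-1 / (s + 1 / 2)) t := by
      have := (Complex.ofRealCLM.hasDerivAt (x := t)).const_sub s
      exact (by simpa using this.div_const (s + 1 / 2))
    have h2 := h1.clog_real (h.mem_slitPlane ht)
    convert h2 using 1
    have e1 := h t ht
    have e2 := h.add_half_ne
    have e3 : s - (t : ℂ) ≠ 0 := fun h0 => e1 (by linear_combination -h0)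
    rw [div_div_div_cancel_right₀ e2, ← neg_sub s (t : ℂ), inv_neg, neg_div, one_div]
  rw [intervalIntegral.integral_eq_sub_of_hasDerivAt hd h.integrable_inv]
  have : (s - ((-1 / 2 : ℝ) : ℂ)) / (s + 1 / 2) = 1 := by
    rw [div_eq_one_iff_eq h.add_half_ne]; push_cast; ring
  rw [this]
  push_cast
  simp

lemma J_eq {c₀ : ℝ} {s : ℂ} (h : Off s) :
    J c₁ c₀ s = c₁ * s + c₀ - ∫ t in (-1 / 2 : ℝ)..(1 / 2), ((t : ℂ) - s)⁻¹ := by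
  rw [J, h.log_eq]

lemma integral_inv_sub {s s' : ℂ} (h : Off s) (h' : Off s') :
    (∫ t in (-1 / 2 : ℝ)..(1 / 2), ((t : ℂ) - s)⁻¹) - ∫ t in (-1 / 2 : ℝ)..(1 / 2), ((t : ℂ) - s')⁻¹
      = (s - s') * kk s s' := by
  rw [← intervalIntegral.integral_sub h.integrable_inv h'.integrable_inv, kk,
    ← intervalIntegral.integral_const_mul]
  apply intervalIntegral.integral_congr
  intro t ht
  rw [uIcc_half] at ht
  have e1 := h t ht
  have e2 := h' t ht
  simp only
  field_simp
  ring

/-- The divided difference of `J`, also between two different values of the parameter. -/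
lemma J_sub_J {c₁ c₀ d₁ d₀ : ℝ} {s s' : ℂ} (h : Off s) (h' : Off s') :
    J c₁ c₀ s - J d₁ d₀ s' =
      (s - s') * (c₁ - kk s s') + (c₁ - d₁) * s' + (c₀ - d₀) := by
  have := integral_inv_sub h h'
  rw [J_eq h, J_eq h']
  linear_combination -this

lemma J_sub {c₀ : ℝ} {s s' : ℂ} (h : Off s) (h' : Off s') :
    J c₁ c₀ s - J c₁ c₀ s' = (s - s') * (c₁ - kk s s') := by
  rw [J_sub_J h h']; ring

lemma J_conj {c₀ : ℝ} {s : ℂ} (h : Off s) :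
    J c₁ c₀ (conj s) = conj (J c₁ c₀ s) := by
  rw [J_eq h, J_eq h.conj]
  simp only [map_sub, map_add, map_mul, Complex.conj_ofReal]
  congr 1
  simp only [intervalIntegral.integral_of_le (show (-1 / 2 : ℝ) ≤ 1 / 2 by norm_num)]
  rw [← integral_conj]
  simp

lemma hfun_conj (s : ℂ) : hfun (conj s) = hfun s := by
  unfold hfun
  congr 1
  ext t
  rw [← Complex.norm_conj]
  simp

lemma im_inv_sub (t : ℝ) (s : ℂ) : ((t : ℂ) - s)⁻¹.im = s.im * (‖(t : ℂ) - s‖ ^ 2)⁻¹ := by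
  rw [Complex.inv_im, Complex.normSq_eq_norm_sq]
  simp [div_eq_mul_inv]

lemma im_intervalIntegral {f : ℝ → ℂ} {a b : ℝ} (hf : IntervalIntegrable f volume a b) :
    (∫ t in a..b, f t).im = ∫ t in a..b, (f t).im :=
  (intervalIntegral.intervalIntegral_im hf).symm

lemma re_intervalIntegral {f : ℝ → ℂ} {a b : ℝ} (hf : IntervalIntegrable f volume a b) :
    (∫ t in a..b, f t).re = ∫ t in a..b, (f t).re :=
  (intervalIntegral.intervalIntegral_re hf).symm

lemma J_im {c₀ : ℝ} {s : ℂ} (h : Off s) :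
    (J c₁ c₀ s).im = s.im * (c₁ - hfun s) := by
  rw [J_eq h]
  simp only [Complex.sub_im, Complex.add_im, Complex.mul_im, Complex.ofReal_im, Complex.ofReal_re]
  rw [im_intervalIntegral h.integrable_inv]
  simp only [im_inv_sub]
  rw [intervalIntegral.integral_const_mul, hfun]
  ring


lemma Off.quart_pos {s s' : ℂ} (h : Off s) (h' : Off s') : 0 < quart s s' := by
  unfold quart
  apply intervalIntegral.intervalIntegral_pos_of_pos_on (h.integrable_quart h') _ (by norm_num)
  intro t ht
  have e1 := norm_pos_iff.2 (h t (Ioo_subset_Icc_self ht))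
  have e2 := norm_pos_iff.2 (h' t (Ioo_subset_Icc_self ht))
  positivity

lemma re_inv_mul_inv {z w : ℂ} (hz : z ≠ 0) (hw : w ≠ 0) :
    (z⁻¹ * w⁻¹).re = 1 / 2 * ((‖z‖ ^ 2)⁻¹ + (‖w‖ ^ 2)⁻¹)
      - 1 / 2 * (‖z - conj w‖ ^ 2 * ((‖z‖ ^ 2)⁻¹ * (‖w‖ ^ 2)⁻¹)) := by
  have e1 : ‖z‖ ^ 2 ≠ 0 := by positivity
  have e2 : ‖w‖ ^ 2 ≠ 0 := by positivity
  rw [← mul_inv, Complex.inv_re, Complex.normSq_mul, Complex.normSq_eq_norm_sq,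
    Complex.normSq_eq_norm_sq]
  field_simp
  simp only [← Complex.normSq_eq_norm_sq, Complex.normSq_apply, Complex.mul_re, Complex.sub_re,
    Complex.sub_im, Complex.conj_re, Complex.conj_im]
  ring

/-- Cauchy–Schwarz for the divided difference, with the exact defect. -/
lemma kk_re {s s' : ℂ} (h : Off s) (h' : Off s') :
    (kk s s').re = 1 / 2 * (hfun s + hfun s')
      - 1 / 2 * (‖s - conj s'‖ ^ 2 * quart s s') := by
  unfold kk hfun quart
  rw [re_intervalIntegral (h.integrable_mul h'),
    ← intervalIntegral.integral_add h.integrable_sq h'.integrable_sq,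
    ← intervalIntegral.integral_const_mul, ← intervalIntegral.integral_const_mul,
    ← intervalIntegral.integral_const_mul, ← intervalIntegral.integral_sub
      ((h.integrable_sq.add h'.integrable_sq).const_mul _)
      (((h.integrable_quart h').const_mul _).const_mul _)]
  apply intervalIntegral.integral_congr
  intro t ht
  rw [uIcc_half] at ht
  simp only
  refine (re_inv_mul_inv (h t ht) (h' t ht)).trans ?_
  have : ((t : ℂ) - s) - conj ((t : ℂ) - s') = -(s - conj s') := by
    simp
  rw [this, norm_neg]

lemma norm_kk_le {s s' : ℂ} (h : Off s) (h' : Off s') :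
    ‖kk s s'‖ ≤ 1 / 2 * (hfun s + hfun s') := by
  unfold kk hfun
  rw [← intervalIntegral.integral_add h.integrable_sq h'.integrable_sq,
    ← intervalIntegral.integral_const_mul]
  apply intervalIntegral.norm_integral_le_of_norm_le (by norm_num)
  · filter_upwards with t ht
    rw [norm_mul, norm_inv, norm_inv, ← inv_pow, ← inv_pow]
    nlinarith [sq_nonneg (‖(t : ℂ) - s‖⁻¹ - ‖(t : ℂ) - s'‖⁻¹)]
  · exact (h.integrable_sq.add h'.integrable_sq).const_mul _

lemma J_lipschitz {c₀ : ℝ} {s s' : ℂ} (hc : 0 < c₁) (h : Off s) (h' : Off s')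
    (hs : hfun s ≤ c₁) (hs' : hfun s' ≤ c₁) :
    ‖J c₁ c₀ s - J c₁ c₀ s'‖ ≤ 2 * c₁ * ‖s - s'‖ := by
  rw [J_sub h h', norm_mul, mul_comm]
  apply mul_le_mul_of_nonneg_right _ (norm_nonneg _)
  calc ‖(c₁ : ℂ) - kk s s'‖ ≤ ‖(c₁ : ℂ)‖ + ‖kk s s'‖ := norm_sub_le _ _
    _ ≤ c₁ + 1 / 2 * (hfun s + hfun s') := by
        gcongr
        · simp [abs_of_pos hc]
        · exact norm_kk_le h h'
    _ ≤ 2 * c₁ := by linarith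

/-- Where `h ≤ c₁`, `J` takes equal values only at equal or complex conjugate points. -/
lemma J_inj {c₀ : ℝ} {s s' : ℂ} (h : Off s) (h' : Off s')
    (hs : hfun s ≤ c₁) (hs' : hfun s' ≤ c₁) (hJ : J c₁ c₀ s = J c₁ c₀ s') :
    s = s' ∨ s = conj s' := by
  by_contra! hne
  have h1 := J_sub (c₁ := c₁) (c₀ := c₀) h h'
  rw [hJ, sub_self, eq_comm, mul_eq_zero, or_iff_right (sub_ne_zero.2 hne.1), sub_eq_zero] at h1
  have h2 := kk_re h h'
  rw [← h1, Complex.ofReal_re] at h2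
  have h3 := h.quart_pos h'
  have h4 : 0 < ‖s - conj s'‖ := norm_pos_iff.2 (sub_ne_zero.2 hne.2)
  have : 0 < ‖s - conj s'‖ ^ 2 * quart s s' := by positivity
  linarith

lemma quart_lower {s s' : ℂ} {M : ℝ} (h : Off s) (h' : Off s') (hs : ‖s‖ ≤ M) (hs' : ‖s'‖ ≤ M) :
    (M + 1) ^ (-4 : ℤ) ≤ quart s s' := by
  have hM : 0 ≤ M := (norm_nonneg _).trans hs
  have : ∫ t in (-1 / 2 : ℝ)..(1 / 2), (M + 1) ^ (-4 : ℤ) = (M + 1) ^ (-4 : ℤ) := by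
    rw [intervalIntegral.integral_const]; norm_num
  rw [← this]
  apply intervalIntegral.integral_mono_on (by norm_num) (by simp) (h.integrable_quart h')
  intro t ht
  have ht1 : ‖(t : ℂ)‖ ≤ 1 := by
    rw [Complex.norm_real, Real.norm_eq_abs]; exact abs_le.2 ⟨by linarith [ht.1], by linarith [ht.2]⟩
  have e1 : ‖(t : ℂ) - s‖ ≤ M + 1 := (norm_sub_le _ _).trans (by linarith)
  have e2 : ‖(t : ℂ) - s'‖ ≤ M + 1 := (norm_sub_le _ _).trans (by linarith)
  have p1 := norm_pos_iff.2 (h t ht)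
  have p2 := norm_pos_iff.2 (h' t ht)
  have : (M + 1) ^ (-4 : ℤ) = ((M + 1) ^ 2)⁻¹ * ((M + 1) ^ 2)⁻¹ := by
    rw [zpow_neg, ← mul_inv]; congr 1; norm_cast; ring
  rw [this]
  gcongr

lemma norm_sub_le_conj {s q : ℂ} (hs : 0 ≤ s.im) (hq : 0 ≤ q.im) :
    ‖s - q‖ ≤ ‖s - conj q‖ := by
  apply le_of_sq_le_sq _ (norm_nonneg _)
  rw [← Complex.normSq_eq_norm_sq, ← Complex.normSq_eq_norm_sq, Complex.normSq_apply,
    Complex.normSq_apply]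
  simp only [Complex.sub_re, Complex.sub_im, Complex.conj_re, Complex.conj_im]
  nlinarith [mul_nonneg hs hq]

/-- Lower bound for the divided difference of `J`. -/
lemma kk_lower {s q : ℂ} (h : Off s) (h' : Off q) :
    1 / 2 * (‖s - conj q‖ ^ 2 * quart s q) + (c₁ - 1 / 2 * (hfun s + hfun q))
      ≤ ‖(c₁ : ℂ) - kk s q‖ := by
  refine le_trans ?_ (Complex.re_le_norm _)
  rw [Complex.sub_re, kk_re h h', Complex.ofReal_re]
  linarith

/-- The inverse of `J` on the closed upper half plane is Hölder continuous, jointly in the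
parameter `c₁`. -/
lemma J_holder {c₁ d₁ M : ℝ} {s q : ℂ} (h : Off s) (h' : Off q) (hs : hfun s ≤ c₁)
    (hq : hfun q ≤ d₁) (his : 0 ≤ s.im) (hiq : 0 ≤ q.im) (hsM : ‖s‖ ≤ M) (hqM : ‖q‖ ≤ M) :
    (M + 1) ^ (-4 : ℤ) * ‖s - q‖ ^ 3 ≤ 2 * ‖J c₁ 0 s - J d₁ 0 q‖ + 4 * M * |c₁ - d₁| := by
  have hM : 0 ≤ M := (norm_nonneg _).trans hsM
  have e := J_sub_J (c₁ := c₁) (c₀ := 0) (d₁ := d₁) (d₀ := 0) h h'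
  have e1 : (s - q) * (c₁ - kk s q) = (J c₁ 0 s - J d₁ 0 q) - (c₁ - d₁) * q := by
    rw [e]; push_cast; ring
  have e2 : ‖s - q‖ * ‖(c₁ : ℂ) - kk s q‖ ≤ ‖J c₁ 0 s - J d₁ 0 q‖ + |c₁ - d₁| * M := by
    rw [← norm_mul, e1]
    refine (norm_sub_le _ _).trans ?_
    rw [norm_mul]
    have : ‖(c₁ : ℂ) - d₁‖ = |c₁ - d₁| := by
      rw [← Complex.ofReal_sub, Complex.norm_real, Real.norm_eq_abs]
    rw [this]
    gcongr
  have e3 := kk_lower (c₁ := c₁) h h'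
  have e4 := quart_lower h h' hsM hqM
  have e5 := norm_sub_le_conj his hiq
  have e6 : ‖s - q‖ ≤ 2 * M := (norm_sub_le _ _).trans (by linarith)
  have e7 : ‖s - q‖ ^ 2 * (M + 1) ^ (-4 : ℤ) ≤ ‖s - conj q‖ ^ 2 * quart s q := by
    gcongr
  have e8 : -(|c₁ - d₁| / 2) ≤ c₁ - 1 / 2 * (hfun s + hfun q) := by
    have := neg_abs_le (c₁ - d₁)
    linarith
  have e9 : 1 / 2 * (‖s - q‖ ^ 2 * (M + 1) ^ (-4 : ℤ)) - |c₁ - d₁| / 2 ≤ ‖(c₁ : ℂ) - kk s q‖ := by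
    linarith
  have e10 := mul_le_mul_of_nonneg_left e9 (norm_nonneg (s - q))
  have e11 : ‖s - q‖ * |c₁ - d₁| ≤ 2 * M * |c₁ - d₁| := by gcongr
  nlinarith [abs_nonneg (c₁ - d₁), norm_nonneg (s - q)]

/-! ### Monotonicity and continuity of `h` -/

lemma norm_sq_sub (t : ℝ) (s : ℂ) : ‖(t : ℂ) - s‖ ^ 2 = (t - s.re) ^ 2 + s.im ^ 2 := by
  rw [← Complex.normSq_eq_norm_sq, Complex.normSq_apply]
  simp
  ring

lemma Off.vert {s s' : ℂ} (h : Off s) (hre : s.re = s'.re) (him : |s.im| ≤ |s'.im|) : Off s' := by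
  intro t ht h0
  have h1 := norm_pos_iff.2 (h t ht)
  have h2 : ‖(t : ℂ) - s‖ ^ 2 ≤ ‖(t : ℂ) - s'‖ ^ 2 := by
    rw [norm_sq_sub, norm_sq_sub, hre]
    gcongr 1
    exact sq_le_sq.2 him
  rw [h0, norm_zero] at h2
  nlinarith

lemma hfun_vert {s s' : ℂ} (h : Off s) (hre : s.re = s'.re) (him : |s.im| ≤ |s'.im|) :
    hfun s' ≤ hfun s := by
  apply intervalIntegral.integral_mono_on (by norm_num) (h.vert hre him).integrable_sq
    h.integrable_sq
  intro t ht
  have := norm_pos_iff.2 (h t ht)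
  apply inv_anti₀ (by positivity)
  rw [norm_sq_sub, norm_sq_sub, hre]
  gcongr 1
  exact sq_le_sq.2 him

lemma Off.scale {s : ℂ} (h : Off s) {R : ℝ} (hR : 1 ≤ R) : Off (R * s) := by
  intro t ht h0
  have hR0 : (R : ℂ) ≠ 0 := by exact_mod_cast (by linarith : R ≠ 0)
  refine h (t / R) ⟨?_, ?_⟩ ?_
  · rw [le_div_iff₀ (by linarith)]; nlinarith [ht.1]
  · rw [div_le_iff₀ (by linarith)]; nlinarith [ht.2]
  · push_cast
    field_simp
    linear_combination h0

/-- `h` decreases along rays from `0`, at least like the inverse distance. -/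
lemma hfun_scale {s : ℂ} (h : Off s) {R : ℝ} (hR : 1 ≤ R) : hfun (R * s) ≤ hfun s / R := by
  have hR0 : 0 < R := by linarith
  have e1 : hfun (R * s) = ∫ t in (-1 / 2 : ℝ)..(1 / 2),
      (fun τ : ℝ => (R ^ 2)⁻¹ * (‖(τ : ℂ) - s‖ ^ 2)⁻¹) (t / R) := by
    unfold hfun
    congr 1
    ext t
    simp only
    rw [← mul_inv, ← mul_pow]
    congr 2
    have : (R : ℂ) ≠ 0 := by exact_mod_cast hR0.ne'
    have e : (t : ℂ) - R * s = (R : ℂ) * (((t / R : ℝ) : ℂ) - s) := by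
      push_cast
      field_simp
    rw [e, norm_mul, Complex.norm_real, Real.norm_eq_abs, abs_of_pos hR0]
  rw [e1, intervalIntegral.integral_comp_div
    (fun τ : ℝ => (R ^ 2)⁻¹ * (‖(τ : ℂ) - s‖ ^ 2)⁻¹) hR0.ne', intervalIntegral.integral_const_mul,
    smul_eq_mul]
  have l1 : -1 / 2 ≤ -1 / 2 / R := by rw [le_div_iff₀ hR0]; nlinarith
  have l2 : (1 : ℝ) / 2 / R ≤ 1 / 2 := by rw [div_le_iff₀ hR0]; nlinarith
  have l3 : -1 / 2 / R ≤ 1 / 2 / R := by gcongr; norm_num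
  have e2 : ∫ t in (-1 / 2 / R)..(1 / 2 / R), (‖(t : ℂ) - s‖ ^ 2)⁻¹ ≤ hfun s :=
    intervalIntegral.integral_mono_interval l1 l3 l2
      (.of_forall fun t => by positivity) h.integrable_sq
  calc R * ((R ^ 2)⁻¹ * _) = (∫ t in (-1 / 2 / R)..(1 / 2 / R), (‖(t : ℂ) - s‖ ^ 2)⁻¹) / R := by
        field_simp
    _ ≤ _ := by gcongr

/-- A point with `h ≤ C` keeps a definite distance from the slit. -/
lemma dist_lower {s : ℂ} {C : ℝ} (hC : 0 < C) (h : Off s) (hs : hfun s ≤ C) {t₀ : ℝ}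
    (ht₀ : t₀ ∈ Icc (-1 / 2 : ℝ) (1 / 2)) : min (1 / 2) (1 / (4 * C)) ≤ ‖(t₀ : ℂ) - s‖ := by
  by_contra! hlt
  obtain ⟨h1, h2⟩ := lt_min_iff.1 hlt
  set ε := ‖(t₀ : ℂ) - s‖ with hε
  have hε0 : 0 < ε := norm_pos_iff.2 (h t₀ ht₀)
  obtain ⟨α, hα1, hα2, hα3⟩ : ∃ α, -1 / 2 ≤ α ∧ α + ε ≤ 1 / 2 ∧
      ∀ t ∈ Icc α (α + ε), |t - t₀| ≤ ε := by
    rcases le_total t₀ 0 with h0 | h0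
    · exact ⟨t₀, ht₀.1, by linarith, fun t ht => abs_le.2 ⟨by linarith [ht.1], by linarith [ht.2]⟩⟩
    · exact ⟨t₀ - ε, by linarith, by linarith [ht₀.2],
        fun t ht => abs_le.2 ⟨by linarith [ht.1], by linarith [ht.2]⟩⟩
  have h3 : ∫ t in α..(α + ε), (‖(t : ℂ) - s‖ ^ 2)⁻¹ ≤ hfun s :=
    intervalIntegral.integral_mono_interval hα1 (by linarith) hα2
      (.of_forall fun t => by positivity) h.integrable_sq
  have h4 : ∫ t in α..(α + ε), ((2 * ε) ^ 2)⁻¹ ≤ ∫ t in α..(α + ε), (‖(t : ℂ) - s‖ ^ 2)⁻¹ := by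
    apply intervalIntegral.integral_mono_on (by linarith) (by simp)
    · apply ContinuousOn.intervalIntegrable
      rw [uIcc_of_le (by linarith)]
      exact h.continuousOn_sq.mono (Icc_subset_Icc hα1 hα2)
    · intro t ht
      have p := norm_pos_iff.2 (h t ⟨hα1.trans ht.1, ht.2.trans hα2⟩)
      have : ‖(t : ℂ) - s‖ ≤ 2 * ε := by
        have e : (t : ℂ) - s = ((t - t₀ : ℝ) : ℂ) + ((t₀ : ℂ) - s) := by push_cast; ring
        rw [e]
        refine (norm_add_le _ _).trans ?_
        rw [Complex.norm_real, Real.norm_eq_abs]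
        linarith [hα3 t ht]
      gcongr
  rw [intervalIntegral.integral_const, smul_eq_mul, add_sub_cancel_left] at h4
  have h5 : ε * ((2 * ε) ^ 2)⁻¹ = 1 / (4 * ε) := by field_simp; norm_num
  rw [h5] at h4
  have h6 : 1 / (4 * ε) ≤ C := by linarith
  rw [div_le_iff₀ (by positivity)] at h6
  rw [lt_div_iff₀ (by positivity)] at h2
  nlinarith

lemma hfun_lipschitz {s s' : ℂ} {d : ℝ} (hd : 0 < d)
    (h : ∀ t ∈ Icc (-1 / 2 : ℝ) (1 / 2), d ≤ ‖(t : ℂ) - s‖)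
    (h' : ∀ t ∈ Icc (-1 / 2 : ℝ) (1 / 2), d ≤ ‖(t : ℂ) - s'‖) :
    |hfun s - hfun s'| ≤ 2 * d⁻¹ ^ 3 * ‖s - s'‖ := by
  have o : Off s := fun t ht => norm_pos_iff.1 (hd.trans_le (h t ht))
  have o' : Off s' := fun t ht => norm_pos_iff.1 (hd.trans_le (h' t ht))
  unfold hfun
  rw [← intervalIntegral.integral_sub o.integrable_sq o'.integrable_sq, ← Real.norm_eq_abs]
  have := intervalIntegral.norm_integral_le_of_norm_le_const
    (C := 2 * d⁻¹ ^ 3 * ‖s - s'‖) (a := (-1 / 2 : ℝ)) (b := 1 / 2)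
    (f := fun t : ℝ => (‖(t : ℂ) - s‖ ^ 2)⁻¹ - (‖(t : ℂ) - s'‖ ^ 2)⁻¹) ?_
  · refine this.trans (le_of_eq ?_)
    norm_num
  · intro t ht
    rw [uIoc_of_le (by norm_num)] at ht
    have ht := Ioc_subset_Icc_self ht
    have e1 := h t ht
    have e2 := h' t ht
    have p1 := hd.trans_le e1
    have p2 := hd.trans_le e2
    set x := ‖(t : ℂ) - s‖
    set y := ‖(t : ℂ) - s'‖
    have e3 : |y - x| ≤ ‖s - s'‖ := by
      have := abs_norm_sub_norm_le ((t : ℂ) - s') ((t : ℂ) - s)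
      simpa using this
    have e4 : (x ^ 2)⁻¹ - (y ^ 2)⁻¹ = (y - x) * (x⁻¹ * (y⁻¹) ^ 2 + (x⁻¹) ^ 2 * y⁻¹) := by
      field_simp
      ring
    have i1 : x⁻¹ ≤ d⁻¹ := inv_anti₀ hd e1
    have i2 : y⁻¹ ≤ d⁻¹ := inv_anti₀ hd e2
    rw [e4, norm_mul, Real.norm_eq_abs, Real.norm_eq_abs, mul_comm]
    have q1 : 0 < x⁻¹ := by positivity
    have q2 : 0 < y⁻¹ := by positivity
    rw [abs_of_pos (a := _ + _) (by positivity)]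
    apply mul_le_mul _ e3 (abs_nonneg _) (by positivity)
    calc x⁻¹ * (y⁻¹) ^ 2 + (x⁻¹) ^ 2 * y⁻¹ ≤ d⁻¹ * (d⁻¹) ^ 2 + (d⁻¹) ^ 2 * d⁻¹ := by gcongr
      _ = _ := by ring

lemma hfun_large {s : ℂ} {M : ℝ} (hM : 0 < M) (hs : 1 / 2 + M < ‖s‖) : Off s ∧ hfun s < 1 / M ^ 2 := by
  have key : ∀ t ∈ Icc (-1 / 2 : ℝ) (1 / 2), ‖s‖ - 1 / 2 ≤ ‖(t : ℂ) - s‖ := by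
    intro t ht
    have h1 : ‖(t : ℂ)‖ ≤ 1 / 2 := by
      rw [Complex.norm_real, Real.norm_eq_abs]; exact abs_le.2 ⟨by linarith [ht.1], ht.2⟩
    have := norm_sub_norm_le s (t : ℂ)
    rw [norm_sub_rev] at this
    linarith
  have o : Off s := fun t ht => norm_pos_iff.1 (by linarith [key t ht])
  refine ⟨o, ?_⟩
  have h1 : hfun s ≤ ∫ t in (-1 / 2 : ℝ)..(1 / 2), ((‖s‖ - 1 / 2) ^ 2)⁻¹ := by
    apply intervalIntegral.integral_mono_on (by norm_num) o.integrable_sq (by simp)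
    intro t ht
    have := key t ht
    have : 0 < ‖s‖ - 1 / 2 := by linarith
    gcongr
  rw [intervalIntegral.integral_const] at h1
  rw [show (1 / 2 - -1 / 2 : ℝ) = 1 by norm_num, one_smul] at h1
  refine h1.trans_lt ?_
  rw [one_div (M ^ 2)]
  apply inv_strictAnti₀ (by positivity)
  gcongr
  linarith


/-! ### The exterior domain, the curve and the interior domain -/

/-- The closed exterior domain `{h ≤ c₁}`. -/
def Clo (c₁ : ℝ) : Set ℂ := {s | Off s ∧ hfun s ≤ c₁}

/-- The open exterior domain `{h < c₁}`, on which `J` is univalent. -/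
def Out (c₁ : ℝ) : Set ℂ := {s | Off s ∧ hfun s < c₁}

lemma Out_subset_Clo (c₁ : ℝ) : Out c₁ ⊆ Clo c₁ := fun _ h => ⟨h.1, h.2.le⟩

lemma Off.exists_dist {s : ℂ} (h : Off s) :
    ∃ d > 0, ∀ t ∈ Icc (-1 / 2 : ℝ) (1 / 2), d ≤ ‖(t : ℂ) - s‖ := by
  obtain ⟨t, ht, hmin⟩ := isCompact_Icc.exists_isMinOn (s := Icc (-1 / 2 : ℝ) (1 / 2))
    (nonempty_Icc.2 (by norm_num)) (f := fun t : ℝ => ‖(t : ℂ) - s‖) (by fun_prop)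
  exact ⟨_, norm_pos_iff.2 (h t ht), fun t' ht' => hmin ht'⟩

lemma Off.eventually_dist {s : ℂ} (h : Off s) :
    ∃ d > 0, ∀ᶠ s' in 𝓝 s, ∀ t ∈ Icc (-1 / 2 : ℝ) (1 / 2), d ≤ ‖(t : ℂ) - s'‖ := by
  obtain ⟨d, hd, h1⟩ := h.exists_dist
  refine ⟨d / 2, by positivity, ?_⟩
  filter_upwards [Metric.ball_mem_nhds s (half_pos hd)] with s' hs' t ht
  have h2 := h1 t ht
  rw [Metric.mem_ball, dist_eq_norm] at hs'
  have : ‖(t : ℂ) - s‖ ≤ ‖(t : ℂ) - s'‖ + ‖s' - s‖ := by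
    have := norm_add_le ((t : ℂ) - s') (s' - s)
    simpa using this
  linarith

lemma isOpen_off : IsOpen {s | Off s} := by
  rw [isOpen_iff_mem_nhds]
  intro s hs
  obtain ⟨d, hd, h⟩ := Off.eventually_dist hs
  filter_upwards [h] with s' h' t ht
  exact norm_pos_iff.1 (hd.trans_le (h' t ht))

lemma Off.continuousAt_hfun {s : ℂ} (h : Off s) : ContinuousAt hfun s := by
  obtain ⟨d, hd, h1⟩ := h.eventually_dist
  have h0 := h1.self_of_nhds
  rw [ContinuousAt, tendsto_iff_dist_tendsto_zero]
  have : Tendsto (fun s' => 2 * d⁻¹ ^ 3 * ‖s' - s‖) (𝓝 s) (𝓝 0) := by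
    have : Continuous fun s' : ℂ => 2 * d⁻¹ ^ 3 * ‖s' - s‖ := by fun_prop
    simpa using this.tendsto s
  refine squeeze_zero' (.of_forall fun _ => dist_nonneg) ?_ this
  filter_upwards [h1] with s' hs'
  exact hfun_lipschitz hd hs' h0

lemma isOpen_Out (c₁ : ℝ) : IsOpen (Out c₁) := by
  rw [isOpen_iff_mem_nhds]
  rintro s ⟨hs, h⟩
  filter_upwards [isOpen_off.mem_nhds hs, hs.continuousAt_hfun.eventually_lt continuousAt_const h]
    with s' h1 h2 using ⟨h1, h2⟩

lemma isClosed_Clo (hc : 0 < c₁) : IsClosed (Clo c₁) := by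
  set d := min (1 / 2) (1 / (4 * c₁))
  have hd : 0 < d := by positivity
  have hK : IsClosed {s : ℂ | ∀ t ∈ Icc (-1 / 2 : ℝ) (1 / 2), d ≤ ‖(t : ℂ) - s‖} := by
    simp only [ofPred_forall]
    refine isClosed_iInter fun t => isClosed_iInter fun _ => isClosed_le ?_ ?_ <;> fun_prop
  have : Clo c₁ = {s : ℂ | ∀ t ∈ Icc (-1 / 2 : ℝ) (1 / 2), d ≤ ‖(t : ℂ) - s‖} ∩
      hfun ⁻¹' Iic c₁ := by
    ext s
    constructor
    · rintro ⟨h1, h2⟩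
      exact ⟨fun t ht => dist_lower hc h1 h2 ht, h2⟩
    · rintro ⟨h1, h2⟩
      exact ⟨fun t ht => norm_pos_iff.1 (hd.trans_le (h1 t ht)), h2⟩
  rw [this]
  refine ContinuousOn.preimage_isClosed_of_isClosed (fun s hs => ?_) hK isClosed_Iic
  have : Off s := fun t ht => norm_pos_iff.1 (hd.trans_le (hs t ht))
  exact this.continuousAt_hfun.continuousWithinAt

lemma Off.hasDerivAt_J {c₀ : ℝ} {s : ℂ} (h : Off s) :
    HasDerivAt (J c₁ c₀) (c₁ - 1 / (s ^ 2 - 1 / 4)) s := by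
  have e1 := h.add_half_ne
  have e2 := h.sub_half_ne
  have h1 : HasDerivAt (fun s : ℂ => (s - 1 / 2) / (s + 1 / 2))
      ((1 * (s + 1 / 2) - (s - 1 / 2) * 1) / (s + 1 / 2) ^ 2) s :=
    ((hasDerivAt_id s).sub_const _).div ((hasDerivAt_id s).add_const _) e1
  have h2 := (((hasDerivAt_id s).const_mul (c₁ : ℂ)).add_const (c₀ : ℂ)).sub (h1.clog h.slit)
  refine h2.congr_deriv ?_
  have e3 : s ^ 2 - 1 / 4 = (s - 1 / 2) * (s + 1 / 2) := by ring
  rw [e3]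
  rw [mul_one, sub_right_inj]
  rw [div_div_eq_mul_div, div_mul_eq_mul_div, div_div, div_eq_div_iff (by positivity) (by positivity)]
  ring

lemma Off.sq_ne {s : ℂ} (h : Off s) : s ^ 2 - 1 / 4 ≠ 0 := by
  have e3 : s ^ 2 - 1 / 4 = (s - 1 / 2) * (s + 1 / 2) := by ring
  rw [e3]
  exact mul_ne_zero h.sub_half_ne h.add_half_ne

lemma Off.kk_self {s : ℂ} (h : Off s) : kk s s = 1 / (s ^ 2 - 1 / 4) := by
  have hd : ∀ t ∈ uIcc (-1 / 2 : ℝ) (1 / 2),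
      HasDerivAt (fun t : ℝ => -((t : ℂ) - s)⁻¹) (((t : ℂ) - s)⁻¹ * ((t : ℂ) - s)⁻¹) t := by
    intro t ht
    rw [uIcc_half] at ht
    have h1 : HasDerivAt (fun t : ℝ => (t : ℂ) - s) 1 t := by
      simpa using (Complex.ofRealCLM.hasDerivAt (x := t)).sub_const s
    refine (h1.fun_inv (h t ht)).neg.congr_deriv ?_
    field_simp
  rw [kk, intervalIntegral.integral_eq_sub_of_hasDerivAt hd (h.integrable_mul h)]
  have e1 := h.add_half_ne
  have e2 := h.sub_half_ne
  have e3 : s ^ 2 - 1 / 4 = (s - 1 / 2) * (s + 1 / 2) := by ring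
  have e4 : ((1 / 2 : ℝ) : ℂ) - s = -(s - 1 / 2) := by push_cast; ring
  have e5 : ((-1 / 2 : ℝ) : ℂ) - s = -(s + 1 / 2) := by push_cast; ring
  rw [e3, e4, e5, inv_neg, inv_neg, neg_neg, neg_neg, inv_sub_inv e2 e1]
  congr 1
  ring

lemma Off.continuousAt_J {c₀ : ℝ} {s : ℂ} (h : Off s) : ContinuousAt (J c₁ c₀) s :=
  h.hasDerivAt_J.continuousAt

lemma J_neg {c₀ : ℝ} {s : ℂ} (h : Off s) : J c₁ c₀ (-s) = 2 * c₀ - J c₁ c₀ s := by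
  unfold J
  have e1 : (-s - 1 / 2) / (-s + 1 / 2) = ((s - 1 / 2) / (s + 1 / 2))⁻¹ := by
    rw [inv_div, ← neg_div_neg_eq]
    congr 1 <;> ring
  rw [e1, Complex.log_inv _ (Complex.slitPlane_arg_ne_pi h.slit)]
  ring

lemma J_eq_add (c₁ c₀ : ℝ) (s : ℂ) : J c₁ c₀ s = J c₁ 0 s + c₀ := by
  simp [J]; ring

/-! ### `J` on the real axis -/

/-- The values of `J_{c₁,0}` on `(½,∞)`. -/
def Jr (c₁ x : ℝ) : ℝ := c₁ * x - log ((x - 1 / 2) / (x + 1 / 2))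

lemma J_ofReal {c₁ c₀ x : ℝ} (hx : 1 / 2 < x) : J c₁ c₀ (x : ℂ) = ((Jr c₁ x + c₀ : ℝ) : ℂ) := by
  unfold J Jr
  have : 0 ≤ (x - 1 / 2) / (x + 1 / 2) := div_nonneg (by linarith) (by linarith)
  push_cast [Complex.ofReal_log this]
  ring

lemma J_ofReal_neg {c₁ c₀ x : ℝ} (hx : x < -(1 / 2)) :
    J c₁ c₀ (x : ℂ) = ((c₀ - Jr c₁ (-x) : ℝ) : ℂ) := by
  have h1 : 1 / 2 < -x := by linarith
  have h2 := J_neg (c₁ := c₁) (c₀ := c₀) (off_ofReal (x := -x) (by rwa [abs_of_pos (by linarith)]))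
  rw [Complex.ofReal_neg, neg_neg, ← Complex.ofReal_neg, J_ofReal h1] at h2
  rw [h2]
  push_cast
  ring

lemma hfun_real {x : ℝ} (hx : 1 / 2 < |x|) : hfun (x : ℂ) = 1 / (x ^ 2 - 1 / 4) := by
  have o := off_ofReal hx
  have h1 := o.kk_self
  have h2 := kk_re o o
  rw [h1] at h2
  simp only [Complex.conj_ofReal, sub_self, norm_zero] at h2
  have h3 : (1 / ((x : ℂ) ^ 2 - 1 / 4)).re = 1 / (x ^ 2 - 1 / 4) := by
    have : (1 / ((x : ℂ) ^ 2 - 1 / 4)) = ((1 / (x ^ 2 - 1 / 4) : ℝ) : ℂ) := by push_cast; ring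
    rw [this, Complex.ofReal_re]
  rw [h3] at h2
  rw [h2]
  ring

lemma sA_eq (c₁ : ℝ) : sA c₁ = -sB c₁ := rfl

lemma sB_sq (hc : 0 < c₁) : sB c₁ ^ 2 = 1 / 4 + 1 / c₁ := Real.sq_sqrt (by positivity)

lemma sB_gt (hc : 0 < c₁) : 1 / 2 < sB c₁ := by
  apply Real.lt_sqrt_of_sq_lt
  have : 0 < 1 / c₁ := by positivity
  linarith

lemma off_sB (hc : 0 < c₁) : Off (sB c₁ : ℂ) :=
  off_ofReal (by rw [abs_of_pos] <;> linarith [sB_gt hc])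

lemma hfun_sB (hc : 0 < c₁) : hfun (sB c₁ : ℂ) = c₁ := by
  rw [hfun_real (by rw [abs_of_pos] <;> linarith [sB_gt hc]), sB_sq hc]
  field_simp
  ring

lemma hfun_real_lt {c₁ x : ℝ} (hc : 0 < c₁) (hx : 1 / 2 < x) : hfun (x : ℂ) < c₁ ↔ sB c₁ < x := by
  have h0 : 0 < x ^ 2 - 1 / 4 := by nlinarith
  have h1 := sB_gt hc
  rw [hfun_real (by rwa [abs_of_pos (by linarith)]), div_lt_iff₀ h0,
    ← sq_lt_sq₀ (a := sB c₁) (by linarith) (by linarith), sB_sq hc, ← div_lt_iff₀' hc]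
  constructor <;> intro h <;> linarith

lemma hasDerivAt_Jr {c₁ x : ℝ} (hx : 1 / 2 < x) :
    HasDerivAt (Jr c₁) (c₁ - 1 / (x ^ 2 - 1 / 4)) x := by
  have o : Off (x : ℂ) := off_ofReal (by rwa [abs_of_pos (by linarith)])
  have h1 : HasDerivAt (fun y : ℝ => (J c₁ 0 (y : ℂ)).re)
      (((c₁ : ℂ) - 1 / ((x : ℂ) ^ 2 - 1 / 4)).re) x :=
    (o.hasDerivAt_J (c₁ := c₁) (c₀ := 0)).real_of_complex
  have h2 : ((c₁ : ℂ) - 1 / ((x : ℂ) ^ 2 - 1 / 4)).re = c₁ - 1 / (x ^ 2 - 1 / 4) := by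
    have : ((c₁ : ℂ) - 1 / ((x : ℂ) ^ 2 - 1 / 4)) = ((c₁ - 1 / (x ^ 2 - 1 / 4) : ℝ) : ℂ) := by
      push_cast; ring
    rw [this, Complex.ofReal_re]
  rw [h2] at h1
  refine h1.congr_of_eventuallyEq ?_
  filter_upwards [lt_mem_nhds hx] with y hy
  rw [J_ofReal hy]
  simp

lemma Jr_min {c₁ x : ℝ} (hc : 0 < c₁) (hx : 1 / 2 < x) (hne : x ≠ sB c₁) :
    Jr c₁ (sB c₁) < Jr c₁ x := by
  have hb := sB_gt hc
  have hq := sB_sq hc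
  rcases lt_or_gt_of_ne hne with h | h
  · have hanti : StrictAntiOn (Jr c₁) (Ioc (1 / 2) (sB c₁)) := by
      apply strictAntiOn_of_deriv_neg (convex_Ioc _ _)
      · intro y hy
        exact (hasDerivAt_Jr hy.1).continuousAt.continuousWithinAt
      · intro y hy
        rw [interior_Ioc] at hy
        rw [(hasDerivAt_Jr hy.1).deriv, sub_neg, lt_div_iff₀ (by nlinarith [hy.1])]
        have : y ^ 2 < 1 / 4 + 1 / c₁ := by rw [← hq]; nlinarith [hy.1, hy.2]
        have h3 : c₁ * (1 / c₁) = 1 := by field_simp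
        nlinarith
    exact hanti ⟨hx, h.le⟩ ⟨hb, le_rfl⟩ h
  · have hmono : StrictMonoOn (Jr c₁) (Ici (sB c₁)) := by
      apply strictMonoOn_of_deriv_pos (convex_Ici _)
      · intro y hy
        exact (hasDerivAt_Jr (hb.trans_le hy)).continuousAt.continuousWithinAt
      · intro y hy
        rw [interior_Ici] at hy
        have hy : sB c₁ < y := hy
        rw [(hasDerivAt_Jr (hb.trans hy)).deriv, sub_pos, div_lt_iff₀ (by nlinarith)]
        have : 1 / 4 + 1 / c₁ < y ^ 2 := by rw [← hq]; nlinarith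
        have h3 : c₁ * (1 / c₁) = 1 := by field_simp
        nlinarith
    exact hmono self_mem_Ici h.le h

/-- The half length `(b - a)/2` of the interval. -/
def radius (c₁ : ℝ) : ℝ := Jr c₁ (sB c₁)

/-- The open interval `(a, b)`, centred at `0`. -/
abbrev cut (c₁ : ℝ) : Set ℝ := Ioo (-radius c₁) (radius c₁)

lemma J_sB (hc : 0 < c₁) (c₀ : ℝ) :
    J c₁ c₀ (sB c₁ : ℂ) = ((c₀ + radius c₁ : ℝ) : ℂ) := by
  rw [J_ofReal (sB_gt hc), radius, add_comm]

lemma J_sA (hc : 0 < c₁) (c₀ : ℝ) :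
    J c₁ c₀ (sA c₁ : ℂ) = ((c₀ - radius c₁ : ℝ) : ℂ) := by
  rw [J_ofReal_neg (by rw [sA_eq]; linarith [sB_gt hc]), radius, sA_eq, neg_neg]

lemma rightEnd_eq (hc : 0 < c₁) (c₀ : ℝ) : rightEnd c₁ c₀ = c₀ + radius c₁ := by
  rw [rightEnd, J_sB hc, Complex.ofReal_re]

lemma leftEnd_eq (hc : 0 < c₁) (c₀ : ℝ) : leftEnd c₁ c₀ = c₀ - radius c₁ := by
  rw [leftEnd, J_sA hc, Complex.ofReal_re]

lemma lt_Jr {c₁ x : ℝ} (hx : 1 / 2 < x) : c₁ * x < Jr c₁ x := by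
  unfold Jr
  have h1 : 0 < (x - 1 / 2) / (x + 1 / 2) := div_pos (by linarith) (by linarith)
  have h2 : (x - 1 / 2) / (x + 1 / 2) < 1 := by rw [div_lt_one (by linarith)]; linarith
  linarith [Real.log_neg h1 h2]

lemma radius_pos (hc : 0 < c₁) : 0 < radius c₁ :=
  lt_trans (by nlinarith [sB_gt hc]) (lt_Jr (sB_gt hc))

lemma radius_lt {c₁ d₁ : ℝ} (hc : 0 < c₁) (h : c₁ < d₁) : radius c₁ < radius d₁ := by
  have hd := hc.trans h
  have h1 := sB_gt hd
  calc radius c₁ ≤ Jr c₁ (sB d₁) := by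
        rcases eq_or_ne (sB d₁) (sB c₁) with h2 | h2
        · rw [h2, radius]
        · exact (Jr_min hc h1 h2).le
    _ < radius d₁ := by
        unfold radius Jr
        nlinarith

/-- `J` maps `[sB,∞)` onto `[b,∞)`. -/
lemma Jr_surj {c₁ z : ℝ} (hc : 0 < c₁) (hz : radius c₁ ≤ z) : ∃ x, sB c₁ ≤ x ∧ Jr c₁ x = z := by
  have hb := sB_gt hc
  set X := max (sB c₁) (z / c₁) with hX
  have h1 : z ≤ Jr c₁ X := by
    refine le_trans ?_ (lt_Jr (hb.trans_le (le_max_left _ _))).le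
    rw [← div_le_iff₀' hc]
    exact le_max_right _ _
  have h2 := intermediate_value_Icc (le_max_left (sB c₁) (z / c₁)) (f := Jr c₁) (fun y hy =>
    (hasDerivAt_Jr (hb.trans_le hy.1)).continuousAt.continuousWithinAt)
  obtain ⟨x, hx, hx'⟩ := h2 ⟨hz, h1⟩
  exact ⟨x, hx.1, hx'⟩


lemma hfun_eq_of_real {c₀ : ℝ} {s : ℂ} (h : Off s) (hi : s.im ≠ 0) (hJ : (J c₁ c₀ s).im = 0) :
    hfun s = c₁ := by
  rw [J_im h] at hJ
  rcases mul_eq_zero.1 hJ with h0 | h0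
  · exact absurd h0 hi
  · linarith

lemma exists_ofReal {s : ℂ} (h : s.im = 0) : s = (s.re : ℂ) := by
  apply Complex.ext <;> simp [h]

lemma Off.re_gt {s : ℂ} (h : Off s) (hi : s.im = 0) : 1 / 2 < |s.re| := by
  by_contra! hc
  have := h s.re ⟨by linarith [(abs_le.1 hc).1], (abs_le.1 hc).2⟩
  rw [← exists_ofReal hi] at this
  simp at this

/-- A non-real point of the closed exterior domain is not sent to `[b,∞)` by `J_{c₁,0}`, as the
points of `[s_b,∞)` are. -/
lemma J_ne_real_right {c₁ z : ℝ} (hc : 0 < c₁) {s : ℂ} (h : s ∈ Clo c₁) (hi : s.im ≠ 0)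
    (hz : radius c₁ ≤ z) : J c₁ 0 s ≠ (z : ℂ) := by
  intro hJ
  obtain ⟨x, hx, hxz⟩ := Jr_surj hc hz
  have hb := sB_gt hc
  have hx2 : 1 / 2 < x := hb.trans_le hx
  have o : Off (x : ℂ) := off_ofReal (by rwa [abs_of_pos (by linarith)])
  have hh : hfun (x : ℂ) ≤ c₁ := by
    rcases hx.eq_or_lt with h1 | h1
    · rw [← h1, hfun_sB hc]
    · exact ((hfun_real_lt hc hx2).2 h1).le
  have e : J c₁ 0 s = J c₁ 0 (x : ℂ) := by rw [hJ, J_ofReal hx2, hxz, add_zero]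
  rcases J_inj h.1 o h.2 hh e with h1 | h1 <;> apply hi <;> rw [h1] <;> simp

lemma hfun_neg (s : ℂ) : hfun (-s) = hfun s := by
  have h1 : hfun (-s) = ∫ t in (-1 / 2 : ℝ)..(1 / 2),
      (fun τ : ℝ => (‖(τ : ℂ) - s‖ ^ 2)⁻¹) (-t) := by
    unfold hfun
    apply intervalIntegral.integral_congr
    intro t _
    simp only
    rw [← norm_neg]
    congr 3
    push_cast
    ring
  rw [h1, intervalIntegral.integral_comp_neg (fun τ : ℝ => (‖(τ : ℂ) - s‖ ^ 2)⁻¹), hfun]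
  norm_num

lemma Off.neg {s : ℂ} (h : Off s) : Off (-s) := by
  intro t ht h0
  refine h (-t) ⟨by linarith [ht.2], by linarith [ht.1]⟩ ?_
  push_cast
  linear_combination -h0

lemma Clo_neg {s : ℂ} (h : s ∈ Clo c₁) : -s ∈ Clo c₁ := ⟨h.1.neg, by rw [hfun_neg]; exact h.2⟩

lemma Clo_conj {s : ℂ} (h : s ∈ Clo c₁) : conj s ∈ Clo c₁ :=
  ⟨h.1.conj, by rw [hfun_conj]; exact h.2⟩

lemma J_ne_real_left {c₁ z : ℝ} (hc : 0 < c₁) {s : ℂ} (h : s ∈ Clo c₁) (hi : s.im ≠ 0)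
    (hz : z ≤ -radius c₁) : J c₁ 0 s ≠ (z : ℂ) := by
  intro hJ
  have h1 := J_ne_real_right hc (Clo_neg h) (by simpa using hi) (z := -z) (by linarith)
  apply h1
  rw [J_neg h.1, hJ]
  push_cast
  ring

lemma abs_re_of_curve (hc : 0 < c₁) {x : ℝ} (hx : 1 / 2 < |x|) :
    radius c₁ ≤ |(J c₁ 0 (x : ℂ)).re| ∧
      (|(J c₁ 0 (x : ℂ)).re| = radius c₁ → x = sB c₁ ∨ x = sA c₁) := by
  have key : ∀ y : ℝ, 1 / 2 < y → radius c₁ ≤ Jr c₁ y ∧ (Jr c₁ y = radius c₁ → y = sB c₁) := by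
    intro y hy
    constructor
    · rcases eq_or_ne y (sB c₁) with h | h
      · rw [h, radius]
      · exact (Jr_min hc hy h).le
    · intro h
      by_contra hne
      exact (Jr_min hc hy hne).ne' h
  rcases lt_abs.1 hx with h | h
  · rw [J_ofReal h, Complex.ofReal_re, add_zero]
    have := key x h
    rw [abs_of_pos ((radius_pos hc).trans_le this.1)]
    exact ⟨this.1, fun h => Or.inl (this.2 h)⟩
  · rw [J_ofReal_neg (by linarith), Complex.ofReal_re, zero_sub, abs_neg]
    have := key (-x) h
    rw [abs_of_pos ((radius_pos hc).trans_le this.1)]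
    exact ⟨this.1, fun h => Or.inr (by rw [sA_eq, ← this.2 h, neg_neg])⟩

lemma mem_realSet_iff {S : Set ℝ} {z : ℂ} : z ∈ realSet S ↔ z.im = 0 ∧ z.re ∈ S := by
  constructor
  · rintro ⟨x, hx, rfl⟩; simpa using hx
  · rintro ⟨h1, h2⟩; exact ⟨z.re, h2, (exists_ofReal h1).symm⟩

lemma mem_J_target {c₀ : ℝ} (hc : 0 < c₁) {s : ℂ} :
    J c₁ c₀ s ∈ realSet (Icc (leftEnd c₁ c₀) (rightEnd c₁ c₀)) ↔
      (J c₁ 0 s).im = 0 ∧ |(J c₁ 0 s).re| ≤ radius c₁ := by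
  rw [mem_realSet_iff, J_eq_add c₁ c₀, leftEnd_eq hc, rightEnd_eq hc, abs_le, mem_Icc]
  simp only [Complex.add_im, Complex.ofReal_im, add_zero, Complex.add_re, Complex.ofReal_re]
  constructor <;> rintro ⟨h1, h2, h3⟩ <;> refine ⟨h1, ?_, ?_⟩ <;> linarith

lemma J_curve_im {c₀ : ℝ} {s : ℂ} (h : Off s) (hh : hfun s = c₁) : (J c₁ c₀ s).im = 0 := by
  rw [J_im h, hh, sub_self, mul_zero]

lemma hfun_sA (hc : 0 < c₁) : hfun (sA c₁ : ℂ) = c₁ := by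
  rw [sA_eq, Complex.ofReal_neg, hfun_neg, hfun_sB hc]

lemma hfun_real_eq {c₁ x : ℝ} (hc : 0 < c₁) (hx : 1 / 2 < |x|) (h : hfun (x : ℂ) = c₁) :
    x = sB c₁ ∨ x = sA c₁ := by
  have h0 : 0 < x ^ 2 - 1 / 4 := by
    have : (1 / 2 : ℝ) ^ 2 < |x| ^ 2 := by gcongr
    rw [sq_abs] at this
    linarith
  rw [hfun_real hx, div_eq_iff h0.ne'] at h
  have h1 : x ^ 2 = sB c₁ ^ 2 := by
    rw [sB_sq hc]
    field_simp
    linarith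
  rcases sq_eq_sq_iff_eq_or_eq_neg.1 h1 with h2 | h2
  · exact Or.inl h2
  · exact Or.inr h2

lemma curve_eq (hc : 0 < c₁) (c₀ : ℝ) : curve c₁ c₀ = {s | Off s ∧ hfun s = c₁} := by
  ext s
  unfold curve
  rw [mem_ofPred_eq, mem_ofPred_eq, ← off_iff, mem_J_target hc]
  constructor
  · rintro ⟨h1, h2, h3⟩
    refine ⟨h1, ?_⟩
    by_cases hi : s.im = 0
    · have hr := h1.re_gt hi
      have h4 := abs_re_of_curve hc hr
      rw [exists_ofReal hi] at h3 ⊢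
      rcases h4.2 (le_antisymm h3 h4.1) with h | h <;> rw [h]
      · exact hfun_sB hc
      · exact hfun_sA hc
    · exact hfun_eq_of_real h1 hi h2
  · rintro ⟨h1, h2⟩
    have h3 := J_curve_im (c₀ := 0) h1 h2
    refine ⟨h1, h3, ?_⟩
    by_cases hi : s.im = 0
    · rw [exists_ofReal hi] at h2 ⊢
      rcases hfun_real_eq hc (h1.re_gt hi) h2 with h | h <;> rw [h]
      · rw [J_sB hc, zero_add, Complex.ofReal_re, abs_of_pos (radius_pos hc)]
      · rw [J_sA hc, zero_sub, Complex.ofReal_re, abs_neg, abs_of_pos (radius_pos hc)]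
    · by_contra! hlt
      have hz := exists_ofReal h3
      rcases lt_abs.1 hlt with h | h
      · exact J_ne_real_right hc ⟨h1, h2.le⟩ hi h.le hz
      · exact J_ne_real_left hc ⟨h1, h2.le⟩ hi (by linarith) hz

/-! ### The region enclosed by the curve -/

lemma compl_curve (hc : 0 < c₁) (c₀ : ℝ) : (curve c₁ c₀)ᶜ = (Clo c₁)ᶜ ∪ Out c₁ := by
  rw [curve_eq hc]
  ext s
  simp only [mem_compl_iff, mem_union, Clo, Out, mem_ofPred_eq]
  by_cases h : Off s
  · simp only [h, true_and]
    constructor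
    · intro hne
      rcases lt_or_gt_of_ne hne with h1 | h1
      · exact Or.inr h1
      · exact Or.inl h1.not_ge
    · rintro (h1 | h1)
      · exact fun h2 => h1 h2.le
      · exact h1.ne
  · simp [h]

lemma norm_le_of_hfun (hc : 0 < c₁) {s : ℂ} (h : Off s → c₁ ≤ hfun s) :
    ‖s‖ ≤ 1 / 2 + 1 / √c₁ := by
  by_contra! hlt
  have hp : 0 < 1 / √c₁ := by positivity
  obtain ⟨h1, h2⟩ := hfun_large hp hlt
  rw [div_pow, one_pow, Real.sq_sqrt hc.le, one_div_one_div] at h2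
  exact h2.not_ge (h h1)

lemma norm_le_of_notMem_Out (hc : 0 < c₁) {s : ℂ} (h : s ∉ Out c₁) :
    ‖s‖ ≤ 1 / 2 + 1 / √c₁ :=
  norm_le_of_hfun hc fun h1 => not_lt.1 fun h2 => h ⟨h1, h2⟩

lemma region_eq (hc : 0 < c₁) (c₀ : ℝ) : region c₁ c₀ = (Clo c₁)ᶜ := by
  have hdisj : Disjoint (Clo c₁)ᶜ (Out c₁) :=
    disjoint_compl_left_iff_subset.2 (Out_subset_Clo c₁)
  have hcc := compl_curve hc c₀
  ext s
  constructor
  · rintro ⟨h1, h2⟩ hs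
    have hsO : s ∈ Out c₁ := by
      have : s ∈ (curve c₁ c₀)ᶜ := h1
      rw [hcc] at this
      exact this.resolve_left (fun h => h hs)
    -- a vertical half line starting at `s` stays in the exterior domain
    obtain ⟨σ, hσ, hσi⟩ : ∃ σ : ℝ, |σ| = 1 ∧ 0 ≤ σ * s.im := by
      rcases le_total 0 s.im with h | h
      · exact ⟨1, by simp, by linarith⟩
      · exact ⟨-1, by simp, by linarith⟩
    set f : ℝ → ℂ := fun τ => s + ((σ * τ : ℝ) : ℂ) * I with hf
    have hfc : Continuous f := by fun_prop
    have hpre : IsPreconnected (f '' Ici 0) := isPreconnected_Ici.image _ hfc.continuousOn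
    have him : ∀ τ, 0 ≤ τ → |s.im| ≤ |s.im + σ * τ| := by
      intro τ hτ
      rw [← sq_le_sq]
      nlinarith [sq_nonneg (σ * τ)]
    have hsub : f '' Ici 0 ⊆ (curve c₁ c₀)ᶜ := by
      rw [hcc]
      rintro _ ⟨τ, hτ, rfl⟩
      right
      have hre : s.re = (f τ).re := by simp [hf]
      have him' : |s.im| ≤ |(f τ).im| := by
        have := him τ hτ
        simpa [hf] using this
      exact ⟨hsO.1.vert hre him', (hfun_vert hsO.1 hre him').trans_lt hsO.2⟩
    have hmem : s ∈ f '' Ici 0 := ⟨0, self_mem_Ici, by simp [hf]⟩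
    have hss := hpre.subset_connectedComponentIn hmem hsub
    obtain ⟨M, hM⟩ := (h2.subset hss).exists_norm_le
    have hM0 : 0 ≤ M := (norm_nonneg _).trans (hM _ hmem)
    have h3 := hM (f (M + ‖s‖ + 1)) ⟨_, show (0 : ℝ) ≤ M + ‖s‖ + 1 by positivity, rfl⟩
    have h4 : ‖((σ * (M + ‖s‖ + 1) : ℝ) : ℂ) * I‖ = M + ‖s‖ + 1 := by
      rw [norm_mul, Complex.norm_I, mul_one, Complex.norm_real, Real.norm_eq_abs, abs_mul, hσ,
        one_mul, abs_of_pos (by positivity)]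
    have h5 : ‖((σ * (M + ‖s‖ + 1) : ℝ) : ℂ) * I‖ ≤ ‖f (M + ‖s‖ + 1)‖ + ‖s‖ := by
      have : ((σ * (M + ‖s‖ + 1) : ℝ) : ℂ) * I = f (M + ‖s‖ + 1) - s := by
        simp only [hf]; ring
      rw [this]
      exact norm_sub_le _ _
    linarith
  · intro hs
    have h1 : s ∈ (curve c₁ c₀)ᶜ := by rw [hcc]; exact Or.inl hs
    refine ⟨h1, ?_⟩
    have hsub : connectedComponentIn (curve c₁ c₀)ᶜ s ⊆ (Clo c₁)ᶜ := by
      apply isPreconnected_connectedComponentIn.subset_left_of_subset_union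
        (isClosed_Clo hc).isOpen_compl (isOpen_Out c₁) hdisj
      · rw [← hcc]; exact connectedComponentIn_subset _ _
      · exact ⟨s, mem_connectedComponentIn h1, hs⟩
    refine Bornology.IsBounded.subset ?_ hsub
    rw [isBounded_iff_forall_norm_le]
    exact ⟨_, fun z hz => norm_le_of_notMem_Out hc fun h => hz (Out_subset_Clo _ h)⟩

lemma closure_region (hc : 0 < c₁) (c₀ : ℝ) :
    closure (region c₁ c₀) = (Out c₁)ᶜ := by
  rw [region_eq hc]
  apply subset_antisymm
  · exact closure_minimal (compl_subset_compl.2 (Out_subset_Clo c₁)) (isOpen_Out c₁).isClosed_compl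
  · intro s hs
    by_cases hsC : s ∈ Clo c₁
    swap
    · exact subset_closure hsC
    have hh : hfun s = c₁ := le_antisymm hsC.2 (not_lt.1 fun h => hs ⟨hsC.1, h⟩)
    -- the curve is approached by `r s`, `r → 1-`
    have hr : ∀ r : ℝ, r ∈ Ioo (0 : ℝ) 1 → (r : ℂ) * s ∈ (Clo c₁)ᶜ := by
      rintro r ⟨h0, h1⟩ ⟨h2, h3⟩
      have h4 := hfun_scale h2 (R := r⁻¹) ((one_le_inv₀ h0).2 h1.le)
      have h5 : ((r⁻¹ : ℝ) : ℂ) * ((r : ℂ) * s) = s := by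
        have : (r : ℂ) ≠ 0 := by exact_mod_cast h0.ne'
        push_cast
        field_simp
      rw [h5, hh, div_inv_eq_mul] at h4
      nlinarith
    have hlim : Tendsto (fun r : ℝ => (r : ℂ) * s) (𝓝[<] 1) (𝓝 s) := by
      have : Continuous fun r : ℝ => (r : ℂ) * s := by fun_prop
      simpa using (this.tendsto 1).mono_left nhdsWithin_le_nhds
    refine mem_closure_of_tendsto hlim ?_
    filter_upwards [Ioo_mem_nhdsLT (show (0 : ℝ) < 1 by norm_num)] with r h using hr r h

/-! ### Univalence of `J` on the exterior domain -/

lemma J_maps_upper {c₀ : ℝ} {s : ℂ} (h : s ∈ Out c₁) : 0 < (J c₁ c₀ s).im ↔ 0 < s.im := by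
  rw [J_im h.1]
  have : 0 < c₁ - hfun s := by linarith [h.2]
  exact mul_pos_iff_of_pos_right this

/-- `|J(s) - c₁ s - c₀|` is bounded on the exterior domain. -/
lemma norm_le_J (hc : 0 < c₁) {s : ℂ} (h : s ∈ Clo c₁) :
    c₁ * ‖s‖ ≤ ‖J c₁ 0 s‖ + 1 / min (1 / 2) (1 / (4 * c₁)) := by
  have hd : 0 < min (1 / 2) (1 / (4 * c₁)) := by positivity
  have h1 := J_eq (c₁ := c₁) (c₀ := 0) h.1
  have h2 : ‖∫ t in (-1 / 2 : ℝ)..(1 / 2), ((t : ℂ) - s)⁻¹‖ ≤ 1 / min (1 / 2) (1 / (4 * c₁)) := by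
    have := intervalIntegral.norm_integral_le_of_norm_le_const
      (C := 1 / min (1 / 2) (1 / (4 * c₁))) (a := (-1 / 2 : ℝ)) (b := 1 / 2)
      (f := fun t : ℝ => ((t : ℂ) - s)⁻¹) ?_
    · refine this.trans (le_of_eq ?_)
      norm_num
    · intro t ht
      rw [uIoc_of_le (by norm_num)] at ht
      rw [norm_inv, ← one_div]
      exact one_div_le_one_div_of_le hd (dist_lower hc h.1 h.2 (Ioc_subset_Icc_self ht))
  have h3 : (c₁ : ℂ) * s = J c₁ 0 s + ∫ t in (-1 / 2 : ℝ)..(1 / 2), ((t : ℂ) - s)⁻¹ := by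
    rw [h1]; push_cast; ring
  have h4 : c₁ * ‖s‖ = ‖(c₁ : ℂ) * s‖ := by
    rw [norm_mul, Complex.norm_real, Real.norm_eq_abs, abs_of_pos hc]
  rw [h4, h3]
  exact (norm_add_le _ _).trans (by gcongr)

lemma deriv_J_ne_zero {s : ℂ} (h : s ∈ Out c₁) :
    (c₁ : ℂ) - 1 / (s ^ 2 - 1 / 4) ≠ 0 := by
  rw [← h.1.kk_self, sub_ne_zero]
  intro h0
  have := norm_kk_le h.1 h.1
  rw [← h0, Complex.norm_real, Real.norm_eq_abs] at this
  linarith [le_abs_self c₁, h.2]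

/-- The image of the upper half of the exterior domain is both open and closed in the upper half
plane. -/
lemma J_surj_upper (hc : 0 < c₁) {z : ℂ} (hz : 0 < z.im) :
    ∃ s ∈ Out c₁, 0 < s.im ∧ J c₁ 0 s = z := by
  set H : Set ℂ := {z | 0 < z.im} with hH
  have hHo : IsOpen H := isOpen_lt continuous_const Complex.continuous_im
  set U : Set ℂ := Out c₁ ∩ H with hU
  have hUo : IsOpen U := (isOpen_Out c₁).inter hHo
  have himg : IsOpen (J c₁ 0 '' U) := by
    rw [isOpen_iff_mem_nhds]
    rintro _ ⟨s, hs, rfl⟩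
    have h1 : HasStrictDerivAt (J c₁ 0) (c₁ - 1 / (s ^ 2 - 1 / 4)) s := by
      have han : AnalyticAt ℂ (J c₁ 0) s := by
        rw [Complex.analyticAt_iff_eventually_differentiableAt]
        filter_upwards [isOpen_off.mem_nhds hs.1.1] with w hw
        exact (Off.hasDerivAt_J hw).differentiableAt
      have := han.hasStrictDerivAt
      rwa [(Off.hasDerivAt_J hs.1.1).deriv] at this
    rw [← h1.map_nhds_eq (deriv_J_ne_zero hs.1)]
    exact image_mem_map (hUo.mem_nhds hs)
  have hpre : IsPreconnected H := by
    have : Convex ℝ H := convex_halfSpace_im_gt 0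
    exact this.isPreconnected
  have hne : (H ∩ J c₁ 0 '' U).Nonempty := by
    obtain ⟨o, hh⟩ := hfun_large (s := ((1 / 2 + (1 / √c₁ + 1) : ℝ) : ℂ) * I)
      (M := 1 / √c₁) (by positivity) (by
        rw [norm_mul, Complex.norm_I, mul_one, Complex.norm_real, Real.norm_eq_abs,
          abs_of_pos (by positivity)]
        linarith)
    rw [div_pow, one_pow, Real.sq_sqrt hc.le, one_div_one_div] at hh
    have hi : 0 < (((1 / 2 + (1 / √c₁ + 1) : ℝ) : ℂ) * I).im := by
      rw [Complex.mul_im, Complex.I_im, Complex.I_re, Complex.ofReal_re, mul_one, mul_zero, add_zero]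
      positivity
    exact ⟨_, (J_maps_upper (c₀ := 0) ⟨o, hh⟩).2 hi, mem_image_of_mem _ ⟨⟨o, hh⟩, hi⟩⟩
  -- a sequence with convergent images is bounded, as `J` is proper, so it has a limit point
  have hclosed : H ∩ closure (J c₁ 0 '' U) ⊆ J c₁ 0 '' U := by
    rintro w ⟨hw, hwc⟩
    obtain ⟨v, hv, hvw⟩ := mem_closure_iff_seq_limit.1 hwc
    choose s hs hsv using hv
    obtain ⟨B, hB⟩ := (Metric.isBounded_range_of_tendsto _ hvw).exists_norm_le
    have hsb : ∀ n, s n ∈ Clo c₁ ∩ Metric.closedBall 0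
        ((B + 1 / min (1 / 2) (1 / (4 * c₁))) / c₁) := by
      intro n
      have h1 := Out_subset_Clo _ (hs n).1
      refine ⟨h1, ?_⟩
      rw [mem_closedBall_zero_iff, le_div_iff₀' hc]
      refine (norm_le_J hc h1).trans ?_
      rw [hsv]
      gcongr
      exact hB _ (mem_range_self n)
    have hK : IsCompact (Clo c₁ ∩ Metric.closedBall 0
        ((B + 1 / min (1 / 2) (1 / (4 * c₁))) / c₁)) :=
      (isCompact_closedBall _ _).inter_left (isClosed_Clo hc)
    obtain ⟨q, hq, φ, hφ, hlim⟩ := hK.tendsto_subseq hsb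
    have hJq : J c₁ 0 q = w := by
      have h1 : Tendsto (fun n => J c₁ 0 (s (φ n))) atTop (𝓝 (J c₁ 0 q)) :=
        (hq.1.1.continuousAt_J.tendsto).comp hlim
      have h2 : Tendsto (fun n => J c₁ 0 (s (φ n))) atTop (𝓝 w) := by
        simp_rw [hsv]
        exact hvw.comp hφ.tendsto_atTop
      exact tendsto_nhds_unique h1 h2
    have hqi : 0 ≤ q.im :=
      ge_of_tendsto ((Complex.continuous_im.tendsto q).comp hlim)
        (.of_forall fun n => (hs (φ n)).2.le)
    have hwi : 0 < q.im * (c₁ - hfun q) := by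
      rw [← J_im (c₀ := 0) hq.1.1, hJq]; exact hw
    have h3 : 0 < q.im := lt_of_le_of_ne hqi fun h => by rw [← h, zero_mul] at hwi; exact lt_irrefl _ hwi
    have h4 : hfun q < c₁ := by
      have := (mul_pos_iff_of_pos_left h3).1 hwi
      linarith
    exact ⟨q, ⟨⟨hq.1.1, h4⟩, h3⟩, hJq⟩
  obtain ⟨s, hs, hsz⟩ := hpre.subset_of_closure_inter_subset himg hne
    (by rwa [inter_comm] at hclosed) hz
  exact ⟨s, hs.1, hs.2, hsz⟩

lemma J_surj (hc : 0 < c₁) {z : ℂ} (hz : ¬ (z.im = 0 ∧ |z.re| ≤ radius c₁)) :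
    ∃ s ∈ Out c₁, J c₁ 0 s = z := by
  rcases lt_trichotomy z.im 0 with h | h | h
  · obtain ⟨s, hs, -, hJ⟩ := J_surj_upper hc (z := conj z) (by simpa using h)
    refine ⟨conj s, ⟨hs.1.conj, by rw [hfun_conj]; exact hs.2⟩, ?_⟩
    rw [J_conj hs.1, hJ, Complex.conj_conj]
  · have h1 : radius c₁ < |z.re| := by
      by_contra! h2; exact hz ⟨h, h2⟩
    obtain ⟨x, hx, hxz⟩ := Jr_surj hc h1.le
    have hx1 : sB c₁ < x := lt_of_le_of_ne hx fun h0 => by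
      rw [← h0] at hxz; exact h1.ne hxz
    have hx2 := (sB_gt hc).trans hx1
    have o : Off (x : ℂ) := off_ofReal (by rwa [abs_of_pos (by linarith)])
    have hh := (hfun_real_lt hc hx2).2 hx1
    rcases le_total 0 z.re with h0 | h0
    · refine ⟨x, ⟨o, hh⟩, ?_⟩
      rw [J_ofReal hx2, hxz, abs_of_nonneg h0, add_zero, ← exists_ofReal h]
    · refine ⟨-x, ⟨o.neg, by rwa [hfun_neg]⟩, ?_⟩
      rw [J_neg o, J_ofReal hx2, hxz, abs_of_nonpos h0, add_zero]
      conv_rhs => rw [exists_ofReal h]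
      push_cast
      ring
  · obtain ⟨s, hs, -, hJ⟩ := J_surj_upper hc h
    exact ⟨s, hs, hJ⟩

lemma Out_J_not_mem (hc : 0 < c₁) {s : ℂ} (hs : s ∈ Out c₁) :
    ¬ ((J c₁ 0 s).im = 0 ∧ |(J c₁ 0 s).re| ≤ radius c₁) := by
  rintro ⟨h1, h2⟩
  have hcur : s ∈ curve c₁ 0 := ⟨off_iff.1 hs.1, (mem_J_target hc).2 ⟨h1, h2⟩⟩
  rw [curve_eq hc] at hcur
  exact hs.2.ne hcur.2

lemma J_injOn (c₀ : ℝ) : InjOn (J c₁ c₀) (Out c₁) := by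
  intro s hs s' hs' h
  rcases J_inj hs.1 hs'.1 hs.2.le hs'.2.le h with h1 | h1
  · exact h1
  · have h2 : (J c₁ c₀ s).im = -(J c₁ c₀ s).im := by
      conv_lhs => rw [h1, J_conj hs'.1, ← h, Complex.conj_im]
    have h3 : (J c₁ c₀ s).im = 0 := by linarith
    rw [J_im hs.1, mul_eq_zero, or_iff_left (by linarith [hs.2])] at h3
    rw [h1, Complex.conj_im] at h3
    rw [h1, exists_ofReal (show s'.im = 0 by linarith), Complex.conj_ofReal]

theorem J_bijOn (hc : 0 < c₁) (c₀ : ℝ) :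
    BijOn (J c₁ c₀) (closure (region c₁ c₀))ᶜ
      (realSet (Icc (leftEnd c₁ c₀) (rightEnd c₁ c₀)))ᶜ := by
  rw [closure_region hc, compl_compl]
  refine ⟨fun s hs => ?_, J_injOn c₀, fun z hz => ?_⟩
  · rw [mem_compl_iff, mem_J_target hc]
    exact Out_J_not_mem hc hs
  · obtain ⟨s, hs, hJ⟩ := J_surj hc (z := z - c₀) (by
      rintro ⟨h1, h2⟩
      apply hz
      rw [mem_realSet_iff, leftEnd_eq hc, rightEnd_eq hc]
      simp only [Complex.sub_im, Complex.ofReal_im, sub_zero, Complex.sub_re,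
        Complex.ofReal_re] at h1 h2
      rw [abs_le] at h2
      exact ⟨h1, by linarith [h2.1], by linarith [h2.2]⟩)
    refine ⟨s, hs, ?_⟩
    rw [J_eq_add, hJ]
    ring


/-! ### The boundary parametrization -/

/-- The point of the closed upper half of the curve with `J_{c₁,0}(s) = τ`, for
`τ ∈ [-radius, radius]`; other values of `τ` are first moved to the nearest end point. -/
def bp (c₁ τ : ℝ) : ℂ :=
  Classical.epsilon fun s => s ∈ Clo c₁ ∧ 0 ≤ s.im ∧
    J c₁ 0 s = ((max (-radius c₁) (min τ (radius c₁)) : ℝ) : ℂ)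

lemma exists_boundary (hc : 0 < c₁) (τ : ℝ) :
    ∃ s ∈ Clo c₁, 0 ≤ s.im ∧ J c₁ 0 s = (τ : ℂ) := by
  have hz : ∀ n : ℕ, 0 < ((τ : ℂ) + ((1 / ((n : ℝ) + 1) : ℝ) : ℂ) * I).im := by
    intro n
    rw [Complex.add_im, Complex.ofReal_im, Complex.mul_im, Complex.I_im, Complex.I_re,
      Complex.ofReal_re, mul_one, mul_zero, add_zero, zero_add]
    positivity
  choose s hs hsi hsJ using fun n => J_surj_upper hc (hz n)
  have hlimz : Tendsto (fun n : ℕ => (τ : ℂ) + ((1 / ((n : ℝ) + 1) : ℝ) : ℂ) * I) atTop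
      (𝓝 (τ : ℂ)) := by
    have h1 := tendsto_one_div_add_atTop_nhds_zero_nat (𝕜 := ℝ)
    have h2 : Continuous fun x : ℝ => (τ : ℂ) + (x : ℂ) * I := by fun_prop
    have h3 : Tendsto (fun x : ℝ => (τ : ℂ) + (x : ℂ) * I) (𝓝 0) (𝓝 (τ : ℂ)) := by
      simpa using h2.tendsto 0
    exact h3.comp h1
  obtain ⟨B, hB⟩ := (Metric.isBounded_range_of_tendsto _ hlimz).exists_norm_le
  have hsb : ∀ n, s n ∈ Clo c₁ ∩ Metric.closedBall 0
      ((B + 1 / min (1 / 2) (1 / (4 * c₁))) / c₁) := by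
    intro n
    have h1 := Out_subset_Clo _ (hs n)
    refine ⟨h1, ?_⟩
    rw [mem_closedBall_zero_iff, le_div_iff₀' hc]
    refine (norm_le_J hc h1).trans ?_
    rw [hsJ]
    gcongr
    exact hB _ (mem_range_self n)
  have hK : IsCompact (Clo c₁ ∩ Metric.closedBall 0
      ((B + 1 / min (1 / 2) (1 / (4 * c₁))) / c₁)) :=
    (isCompact_closedBall _ _).inter_left (isClosed_Clo hc)
  obtain ⟨q, hq, φ, hφ, hlim⟩ := hK.tendsto_subseq hsb
  refine ⟨q, hq.1, ?_, ?_⟩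
  · exact ge_of_tendsto ((Complex.continuous_im.tendsto q).comp hlim)
      (.of_forall fun n => (hsi (φ n)).le)
  · have h1 : Tendsto (fun n => J c₁ 0 (s (φ n))) atTop (𝓝 (J c₁ 0 q)) :=
      (hq.1.1.continuousAt_J.tendsto).comp hlim
    have h2 : Tendsto (fun n => J c₁ 0 (s (φ n))) atTop (𝓝 (τ : ℂ)) := by
      simp_rw [hsJ]
      exact hlimz.comp hφ.tendsto_atTop
    exact tendsto_nhds_unique h1 h2

lemma bp_spec' (hc : 0 < c₁) (τ : ℝ) :
    bp c₁ τ ∈ Clo c₁ ∧ 0 ≤ (bp c₁ τ).im ∧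
    J c₁ 0 (bp c₁ τ) = ((max (-radius c₁) (min τ (radius c₁)) : ℝ) : ℂ) :=
  Classical.epsilon_spec (p := fun s => s ∈ Clo c₁ ∧ 0 ≤ s.im ∧
    J c₁ 0 s = ((max (-radius c₁) (min τ (radius c₁)) : ℝ) : ℂ))
    (by simpa only [and_assoc] using exists_boundary hc _)

lemma bp_mem (hc : 0 < c₁) (τ : ℝ) : bp c₁ τ ∈ Clo c₁ := (bp_spec' hc τ).1

lemma bp_off (hc : 0 < c₁) (τ : ℝ) : Off (bp c₁ τ) := (bp_mem hc τ).1

lemma bp_im_nonneg (hc : 0 < c₁) (τ : ℝ) : 0 ≤ (bp c₁ τ).im := (bp_spec' hc τ).2.1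

lemma clamp_eq {c₁ τ : ℝ} (hτ : τ ∈ Icc (-radius c₁) (radius c₁)) :
    max (-radius c₁) (min τ (radius c₁)) = τ := by
  rw [min_eq_left hτ.2, max_eq_right hτ.1]

lemma J_bp (hc : 0 < c₁) {τ : ℝ} (hτ : τ ∈ Icc (-radius c₁) (radius c₁)) :
    J c₁ 0 (bp c₁ τ) = (τ : ℂ) := by
  rw [(bp_spec' hc τ).2.2, clamp_eq hτ]

lemma clamp_mem (hc : 0 < c₁) (τ : ℝ) :
    max (-radius c₁) (min τ (radius c₁)) ∈ Icc (-radius c₁) (radius c₁) :=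
  ⟨le_max_left _ _, max_le (by linarith [radius_pos hc]) (min_le_right _ _)⟩

lemma hfun_bp (hc : 0 < c₁) (τ : ℝ) : hfun (bp c₁ τ) = c₁ := by
  have h : bp c₁ τ ∈ curve c₁ 0 := by
    refine ⟨off_iff.1 (bp_off hc τ), ?_⟩
    rw [mem_J_target hc, (bp_spec' hc τ).2.2, Complex.ofReal_im, Complex.ofReal_re]
    exact ⟨rfl, abs_le.2 (clamp_mem hc τ)⟩
  rw [curve_eq hc] at h
  exact h.2

lemma norm_bp_le (hc : 0 < c₁) (τ : ℝ) : ‖bp c₁ τ‖ ≤ 1 / 2 + 1 / √c₁ :=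
  norm_le_of_hfun hc fun _ => (hfun_bp hc τ).ge

lemma bp_unique (hc : 0 < c₁) {τ : ℝ} (hτ : τ ∈ Icc (-radius c₁) (radius c₁))
    {s : ℂ} (hs : s ∈ Clo c₁) (hi : 0 ≤ s.im) (hJ : J c₁ 0 s = (τ : ℂ)) : s = bp c₁ τ := by
  rcases J_inj hs.1 (bp_off hc τ) hs.2 (bp_mem hc τ).2 (hJ.trans (J_bp hc hτ).symm) with h | h
  · exact h
  · have h1 := congrArg Complex.im h
    rw [Complex.conj_im] at h1
    have h2 := bp_im_nonneg hc τ
    rw [h, exists_ofReal (show (bp c₁ τ).im = 0 by linarith), Complex.conj_ofReal]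

lemma bp_right (hc : 0 < c₁) : bp c₁ (radius c₁) = (sB c₁ : ℂ) := by
  have := radius_pos hc
  refine (bp_unique hc ⟨by linarith, le_rfl⟩ ⟨off_sB hc, (hfun_sB hc).le⟩ (by simp) ?_).symm
  rw [J_sB hc, zero_add]

lemma off_sA (hc : 0 < c₁) : Off (sA c₁ : ℂ) := by
  rw [sA_eq, Complex.ofReal_neg]; exact (off_sB hc).neg

lemma bp_left (hc : 0 < c₁) : bp c₁ (-radius c₁) = (sA c₁ : ℂ) := by
  have := radius_pos hc
  refine (bp_unique hc ⟨le_rfl, by linarith⟩ ⟨off_sA hc, (hfun_sA hc).le⟩ (by simp) ?_).symm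
  rw [J_sA hc, zero_sub]

lemma bp_im_pos (hc : 0 < c₁) {τ : ℝ} (hτ : τ ∈ cut c₁) :
    0 < (bp c₁ τ).im := by
  refine lt_of_le_of_ne (bp_im_nonneg hc τ) fun h => ?_
  have h1 := exists_ofReal h.symm
  have h2 := (bp_off hc τ).re_gt h.symm
  have h3 := J_bp hc (Ioo_subset_Icc_self hτ)
  have h4 := (abs_re_of_curve hc h2).1
  rw [← h1, h3, Complex.ofReal_re] at h4
  exact absurd (abs_lt.2 hτ) h4.not_gt

lemma bp_neg (hc : 0 < c₁) {τ : ℝ} (hτ : τ ∈ Icc (-radius c₁) (radius c₁)) :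
    bp c₁ (-τ) = -conj (bp c₁ τ) := by
  symm
  refine bp_unique hc ⟨by linarith [hτ.2], by linarith [hτ.1]⟩ (Clo_neg (Clo_conj (bp_mem hc τ)))
    (by simpa using bp_im_nonneg hc τ) ?_
  rw [J_neg (bp_off hc τ).conj, J_conj (bp_off hc τ), J_bp hc hτ, Complex.conj_ofReal]
  push_cast
  ring

/-- Joint Hölder continuity of the boundary parametrization. -/
lemma bp_holder {c₁ d₁ M : ℝ} (hc : 0 < c₁) (hd : 0 < d₁) (hM : 1 / 2 + 1 / √c₁ ≤ M)
    (hM' : 1 / 2 + 1 / √d₁ ≤ M) {τ σ : ℝ} (hτ : τ ∈ Icc (-radius c₁) (radius c₁))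
    (hσ : σ ∈ Icc (-radius d₁) (radius d₁)) :
    (M + 1) ^ (-4 : ℤ) * ‖bp c₁ τ - bp d₁ σ‖ ^ 3 ≤ 2 * |τ - σ| + 4 * M * |c₁ - d₁| := by
  have h := J_holder (bp_off hc τ) (bp_off hd σ) (bp_mem hc τ).2 (bp_mem hd σ).2
    (bp_im_nonneg hc τ) (bp_im_nonneg hd σ) ((norm_bp_le hc τ).trans hM)
    ((norm_bp_le hd σ).trans hM')
  rwa [J_bp hc hτ, J_bp hd hσ, ← Complex.ofReal_sub, Complex.norm_real, Real.norm_eq_abs] at h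

lemma tendsto_of_holder {α : Type*} {l : Filter α} {f : α → ℂ} {y : ℂ} {K : ℝ} (hK : 0 < K)
    {g : α → ℝ} (h : ∀ᶠ x in l, K * ‖f x - y‖ ^ 3 ≤ g x) (hg : Tendsto g l (𝓝 0)) :
    Tendsto f l (𝓝 y) := by
  rw [tendsto_iff_norm_sub_tendsto_zero]
  have h1 : Tendsto (fun x => ‖f x - y‖ ^ 3) l (𝓝 0) := by
    have h2 : Tendsto (fun x => g x / K) l (𝓝 0) := by simpa using hg.div_const K
    refine squeeze_zero' (.of_forall fun _ => by positivity) ?_ h2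
    filter_upwards [h] with x hx
    rw [le_div_iff₀ hK]
    linarith
  rw [Metric.tendsto_nhds] at h1 ⊢
  intro ε hε
  filter_upwards [h1 (ε ^ 3) (by positivity)] with x hx
  rw [dist_zero_right, Real.norm_of_nonneg (by positivity)] at hx ⊢
  exact lt_of_pow_lt_pow_left₀ 3 hε.le hx

lemma bp_clamp (hc : 0 < c₁) (τ : ℝ) :
    bp c₁ (max (-radius c₁) (min τ (radius c₁))) = bp c₁ τ := by
  unfold bp
  rw [clamp_eq (clamp_mem hc τ)]

lemma continuous_bp (hc : 0 < c₁) : Continuous (bp c₁) := by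
  rw [continuous_iff_continuousAt]
  intro τ
  set cl : ℝ → ℝ := fun τ => max (-radius c₁) (min τ (radius c₁)) with hcl
  have hclc : Continuous cl := by fun_prop
  refine tendsto_of_holder (K := (1 / 2 + 1 / √c₁ + 1) ^ (-4 : ℤ)) (by positivity)
    (g := fun σ => 2 * |cl σ - cl τ|) (.of_forall fun σ => ?_) ?_
  · have h := bp_holder hc hc le_rfl le_rfl (clamp_mem hc σ) (clamp_mem hc τ)
    rw [bp_clamp hc, bp_clamp hc, sub_self, abs_zero, mul_zero, add_zero] at h
    exact h
  · have : Continuous fun σ => 2 * |cl σ - cl τ| := by fun_prop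
    simpa using this.tendsto τ

lemma continuousOn_sB : ContinuousOn sB (Ioi 0) := by
  unfold sB
  exact (continuousOn_const.add (continuousOn_const.div continuousOn_id fun x hx => ne_of_gt hx)).sqrt

lemma continuousOn_radius : ContinuousOn radius (Ioi 0) := by
  unfold radius Jr
  have h1 : ContinuousOn sB (Ioi 0) := continuousOn_sB
  refine (continuousOn_id.mul h1).sub (ContinuousOn.log ((h1.sub continuousOn_const).div
    (h1.add continuousOn_const) fun x hx => ?_) fun x hx => ?_)
  · linarith [sB_gt hx]
  · have := sB_gt hx
    exact (div_pos (by linarith) (by linarith)).ne'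

/-- Continuity of the boundary point with a fixed relative position as a function of `c₁`. -/
lemma continuousAt_bp_param {c₁ σ : ℝ} (hc : 0 < c₁) (hσ : σ ∈ Icc (-1 : ℝ) 1) :
    ContinuousAt (fun c => bp c (radius c * σ)) c₁ := by
  have hmem : ∀ c, 0 < c → radius c * σ ∈ Icc (-radius c) (radius c) := by
    intro c hc
    have := radius_pos hc
    constructor <;> nlinarith [hσ.1, hσ.2]
  set M := 1 / 2 + 1 / √(c₁ / 2)
  have hw : ContinuousAt radius c₁ := continuousOn_radius.continuousAt (Ioi_mem_nhds hc)
  have hM : ∀ c, c₁ / 2 ≤ c → 1 / 2 + 1 / √c ≤ M := by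
    intro c h
    have : 0 < c₁ / 2 := by positivity
    change 1 / 2 + 1 / √c ≤ 1 / 2 + 1 / √(c₁ / 2)
    gcongr
  refine tendsto_of_holder (K := (M + 1) ^ (-4 : ℤ)) (by positivity)
    (g := fun c => 2 * |radius c * σ - radius c₁ * σ| + 4 * M * |c - c₁|) ?_ ?_
  · filter_upwards [Ioi_mem_nhds (half_lt_self hc)] with c hcc
    have hcc : c₁ / 2 < c := hcc
    exact bp_holder (by linarith) hc (hM c hcc.le) (hM c₁ (half_lt_self hc).le)
      (hmem c (by linarith)) (hmem c₁ hc)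
  · have : ContinuousAt (fun c => 2 * |radius c * σ - radius c₁ * σ| + 4 * M * |c - c₁|) c₁ := by
      fun_prop
    simpa [ContinuousAt] using this

/-! ### Identification of `I₊` and `I₋` -/

lemma I₁_spec {c₀ : ℝ} (hc : 0 < c₁) {z : ℂ} (hz : z.im ≠ 0) :
    I₁ c₁ c₀ z ∈ Out c₁ ∧ J c₁ c₀ (I₁ c₁ c₀ z) = z := by
  have hb := J_bijOn hc c₀
  have h1 : z ∈ J c₁ c₀ '' (closure (region c₁ c₀))ᶜ := by
    rw [hb.image_eq]
    intro h
    exact hz (mem_realSet_iff.1 h).1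
  have h2 := Function.invFunOn_mem h1
  have h3 := Function.invFunOn_eq h1
  rw [closure_region hc, compl_compl] at h2 h3
  rw [I₁, closure_region hc, compl_compl]
  exact ⟨h2, h3⟩

lemma I₁_conj {c₀ : ℝ} (hc : 0 < c₁) {z : ℂ} (hz : z.im ≠ 0) :
    I₁ c₁ c₀ (conj z) = conj (I₁ c₁ c₀ z) := by
  have h1 := I₁_spec (c₀ := c₀) hc hz
  have h2 := I₁_spec (c₀ := c₀) hc (z := conj z) (by simpa using hz)
  apply J_injOn c₀ h2.1 ⟨h1.1.1.conj, by rw [hfun_conj]; exact h1.1.2⟩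
  rw [h2.2, J_conj h1.1.1, h1.2]

/-- `I₁ = I₊` in the limit: the inverse of `J` is Hölder continuous up to the boundary. -/
lemma tendsto_I₁ {c₁ c₀ x : ℝ} (hc : 0 < c₁)
    (hx : x ∈ Icc (leftEnd c₁ c₀) (rightEnd c₁ c₀)) :
    Tendsto (fun ε : ℝ => I₁ c₁ c₀ ((x : ℂ) + I * (ε : ℂ))) (𝓝[>] 0)
      (𝓝 (bp c₁ (x - c₀))) := by
  rw [leftEnd_eq hc, rightEnd_eq hc] at hx
  have hx' : x - c₀ ∈ Icc (-radius c₁) (radius c₁) :=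
    ⟨by linarith [hx.1], by linarith [hx.2]⟩
  have hJ : ∀ s, J c₁ 0 s = J c₁ c₀ s - c₀ := fun s => by rw [J_eq_add c₁ c₀]; ring
  set B := (|x - c₀| + 1 + 1 / min (1 / 2) (1 / (4 * c₁))) / c₁ with hB
  set M := max B (1 / 2 + 1 / √c₁) with hM
  have hM0 : 0 < M := lt_of_lt_of_le (by positivity) (le_max_right _ _)
  refine tendsto_of_holder (K := (M + 1) ^ (-4 : ℤ)) (by positivity)
    (g := fun ε : ℝ => 2 * ε) ?_ ?_
  · filter_upwards [Ioo_mem_nhdsGT (show (0 : ℝ) < 1 by norm_num)] with ε hε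
    have hzi : ((x : ℂ) + I * (ε : ℂ)).im = ε := by simp
    obtain ⟨h1, h2⟩ := I₁_spec (c₀ := c₀) hc (z := (x : ℂ) + I * (ε : ℂ))
      (by rw [hzi]; exact hε.1.ne')
    set s := I₁ c₁ c₀ ((x : ℂ) + I * (ε : ℂ))
    have hsi : 0 < s.im := by
      rw [← J_maps_upper (c₀ := c₀) h1, h2, hzi]; exact hε.1
    have h3 : J c₁ 0 s = ((x - c₀ : ℝ) : ℂ) + I * (ε : ℂ) := by
      rw [hJ, h2]; push_cast; ring
    have hε1 : ‖I * (ε : ℂ)‖ = ε := by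
      rw [norm_mul, Complex.norm_I, one_mul, Complex.norm_real, Real.norm_of_nonneg hε.1.le]
    have hsM : ‖s‖ ≤ M := by
      refine le_trans ?_ (le_max_left _ _)
      rw [hB, le_div_iff₀' hc]
      refine (norm_le_J hc (Out_subset_Clo _ h1)).trans ?_
      gcongr
      rw [h3]
      refine (norm_add_le _ _).trans ?_
      rw [hε1, Complex.norm_real, Real.norm_eq_abs]
      linarith [hε.2]
    have h4 := J_holder h1.1 (bp_off hc (x - c₀)) h1.2.le (bp_mem hc _).2 hsi.le
      (bp_im_nonneg hc _) hsM ((norm_bp_le hc _).trans (le_max_right _ _))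
    rw [J_bp hc hx', h3, add_sub_cancel_left, hε1, sub_self, abs_zero, mul_zero, add_zero] at h4
    exact h4
  · have : Continuous fun ε : ℝ => 2 * ε := by fun_prop
    simpa using (this.tendsto 0).mono_left nhdsWithin_le_nhds

lemma tendsto_I₁' {c₁ c₀ x : ℝ} (hc : 0 < c₁)
    (hx : x ∈ Icc (leftEnd c₁ c₀) (rightEnd c₁ c₀)) :
    Tendsto (fun ε : ℝ => I₁ c₁ c₀ ((x : ℂ) - I * (ε : ℂ))) (𝓝[>] 0)
      (𝓝 (conj (bp c₁ (x - c₀)))) := by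
  refine ((Complex.continuous_conj.tendsto _).comp (tendsto_I₁ hc hx)).congr' ?_
  filter_upwards [self_mem_nhdsWithin] with ε hε
  have hε : 0 < ε := hε
  rw [Function.comp, ← I₁_conj hc (by simpa using hε.ne')]
  congr 1
  simp
  ring

lemma Iplus_eq {c₁ c₀ x : ℝ} (hc : 0 < c₁)
    (hx : x ∈ Icc (leftEnd c₁ c₀) (rightEnd c₁ c₀)) : Iplus c₁ c₀ x = bp c₁ (x - c₀) :=
  (tendsto_I₁ hc hx).limUnder_eq

lemma Iminus_eq {c₁ c₀ x : ℝ} (hc : 0 < c₁)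
    (hx : x ∈ Icc (leftEnd c₁ c₀) (rightEnd c₁ c₀)) :
    Iminus c₁ c₀ x = conj (bp c₁ (x - c₀)) :=
  (tendsto_I₁' hc hx).limUnder_eq


/-! ### The derivative of the boundary parametrization -/

lemma re_deriv_J_pos (hc : 0 < c₁) {τ : ℝ}
    (hτ : τ ∈ cut c₁) :
    0 < ((c₁ : ℂ) - 1 / (bp c₁ τ ^ 2 - 1 / 4)).re := by
  have o := bp_off hc τ
  rw [← o.kk_self, Complex.sub_re, Complex.ofReal_re, kk_re o o, hfun_bp hc]
  have h1 := bp_im_pos hc hτ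
  have h2 : bp c₁ τ - conj (bp c₁ τ) ≠ 0 := by
    intro h0
    have := congrArg Complex.im h0
    simp at this
    linarith
  have h3 := norm_pos_iff.2 h2
  have h4 := o.quart_pos o
  have : 0 < ‖bp c₁ τ - conj (bp c₁ τ)‖ ^ 2 * quart (bp c₁ τ) (bp c₁ τ) := by positivity
  linarith

/-- The derivative `1 / J'` of the boundary parametrization. -/
def dbp (c₁ τ : ℝ) : ℂ := ((c₁ : ℂ) - 1 / (bp c₁ τ ^ 2 - 1 / 4))⁻¹

lemma deriv_J_bp_ne (hc : 0 < c₁) {τ : ℝ}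
    (hτ : τ ∈ cut c₁) :
    (c₁ : ℂ) - 1 / (bp c₁ τ ^ 2 - 1 / 4) ≠ 0 := by
  intro h0
  have := re_deriv_J_pos hc hτ
  rw [h0] at this
  simp at this

lemma dbp_re_pos (hc : 0 < c₁) {τ : ℝ}
    (hτ : τ ∈ cut c₁) : 0 < (dbp c₁ τ).re := by
  rw [dbp, Complex.inv_re]
  exact div_pos (re_deriv_J_pos hc hτ) (Complex.normSq_pos.2 (deriv_J_bp_ne hc hτ))

lemma hasDerivAt_bp (hc : 0 < c₁) {τ : ℝ}
    (hτ : τ ∈ cut c₁) : HasDerivAt (bp c₁) (dbp c₁ τ) τ := by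
  have o := bp_off hc τ
  have h1 := (o.hasDerivAt_J (c₁ := c₁) (c₀ := 0))
  rw [hasDerivAt_iff_tendsto_slope] at h1 ⊢
  have hJ : ∀ σ ∈ cut c₁, J c₁ 0 (bp c₁ σ) = σ := fun σ hσ =>
    J_bp hc (Ioo_subset_Icc_self hσ)
  have hne : ∀ᶠ σ in 𝓝[≠] τ, σ ∈ cut c₁ ∧ σ ≠ τ :=
    (eventually_nhdsWithin_of_eventually_nhds (Ioo_mem_nhds hτ.1 hτ.2)).and self_mem_nhdsWithin
  have h2 : Tendsto (bp c₁) (𝓝[≠] τ) (𝓝[≠] (bp c₁ τ)) := by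
    rw [tendsto_nhdsWithin_iff]
    refine ⟨((continuous_bp hc).tendsto τ).mono_left nhdsWithin_le_nhds, ?_⟩
    filter_upwards [hne] with σ hσ h0
    apply hσ.2
    have h0 : bp c₁ σ = bp c₁ τ := h0
    have := congrArg (J c₁ 0) h0
    rw [hJ σ hσ.1, hJ τ hτ] at this
    exact_mod_cast this
  have h3 := (h1.comp h2).inv₀ (deriv_J_bp_ne hc hτ)
  refine h3.congr' ?_
  filter_upwards [hne] with σ hσ
  rw [Function.comp, slope_def_field, slope_def_module, hJ σ hσ.1, hJ τ hτ, inv_div,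
    ← Complex.ofReal_sub, div_eq_inv_mul, Complex.real_smul, Complex.ofReal_inv]

lemma strictMonoOn_bp_re (hc : 0 < c₁) :
    StrictMonoOn (fun τ => (bp c₁ τ).re) (Icc (-radius c₁) (radius c₁)) := by
  apply strictMonoOn_of_deriv_pos (convex_Icc _ _)
  · exact (Complex.continuous_re.comp (continuous_bp hc)).continuousOn
  · intro τ hτ
    rw [interior_Icc] at hτ
    have h1 : HasDerivAt (fun τ => (bp c₁ τ).re) (dbp c₁ τ).re τ :=
      (Complex.reCLM.hasFDerivAt.comp_hasDerivAt τ (hasDerivAt_bp hc hτ))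
    rw [h1.deriv]
    exact dbp_re_pos hc hτ

/-! ### Behaviour at the end points -/

/-- The second divided difference of the logarithm in `J`, with a double node at `e`. -/
def qq (s e : ℂ) : ℂ :=
  ∫ t in (-1 / 2 : ℝ)..(1 / 2), ((t : ℂ) - s)⁻¹ * (((t : ℂ) - e)⁻¹ * ((t : ℂ) - e)⁻¹)

lemma Off.integrable_qq {s e : ℂ} (h : Off s) (h' : Off e) :
    IntervalIntegrable (fun t : ℝ => ((t : ℂ) - s)⁻¹ * (((t : ℂ) - e)⁻¹ * ((t : ℂ) - e)⁻¹))
      volume (-1 / 2) (1 / 2) :=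
  ContinuousOn.intervalIntegrable (by
    rw [uIcc_half]
    exact h.continuousOn_inv.mul (h'.continuousOn_inv.mul h'.continuousOn_inv))

lemma kk_sub_kk {s e : ℂ} (h : Off s) (h' : Off e) : kk s e - kk e e = (s - e) * qq s e := by
  unfold kk qq
  rw [← intervalIntegral.integral_sub (h.integrable_mul h') (h'.integrable_mul h'),
    ← intervalIntegral.integral_const_mul]
  apply intervalIntegral.integral_congr
  intro t ht
  rw [uIcc_half] at ht
  have e1 := h t ht
  have e2 := h' t ht
  simp only
  field_simp
  ring

lemma J_sub_sB (hc : 0 < c₁) {s : ℂ} (h : Off s) :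
    J c₁ 0 s - (radius c₁ : ℂ) = -((s - sB c₁) ^ 2 * qq s (sB c₁)) := by
  have hk : kk (sB c₁ : ℂ) (sB c₁) = c₁ := by
    rw [(off_sB hc).kk_self]
    have h1 : ((sB c₁ : ℂ) ^ 2 - 1 / 4) = ((1 / c₁ : ℝ) : ℂ) := by
      have := sB_sq hc
      rw [← Complex.ofReal_pow, this]
      push_cast
      ring
    rw [h1]
    push_cast
    rw [one_div_one_div]
  have h2 := J_sub (c₁ := c₁) (c₀ := 0) h (off_sB hc)
  rw [J_sB hc, zero_add] at h2
  have h3 := kk_sub_kk h (off_sB hc)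
  rw [hk] at h3
  rw [h2]
  linear_combination -(s - sB c₁) * h3

/-- A lower bound, uniform over the closed exterior domain, for the distance to the slit. -/
def dd (c₁ : ℝ) : ℝ := min (1 / 2) (1 / (4 * c₁))

lemma dd_pos (hc : 0 < c₁) : 0 < dd c₁ := by unfold dd; positivity

lemma dd_le (hc : 0 < c₁) {s : ℂ} (hs : s ∈ Clo c₁) {t : ℝ}
    (ht : t ∈ Icc (-1 / 2 : ℝ) (1 / 2)) : dd c₁ ≤ ‖(t : ℂ) - s‖ := dist_lower hc hs.1 hs.2 ht

lemma norm_inv_le (hc : 0 < c₁) {s : ℂ} (hs : s ∈ Clo c₁) {t : ℝ}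
    (ht : t ∈ Icc (-1 / 2 : ℝ) (1 / 2)) : ‖((t : ℂ) - s)⁻¹‖ ≤ (dd c₁)⁻¹ := by
  rw [norm_inv]
  exact inv_anti₀ (dd_pos hc) (dd_le hc hs ht)

lemma norm_integral_slit_le {f : ℝ → ℂ} {C : ℝ}
    (h : ∀ t ∈ Icc (-1 / 2 : ℝ) (1 / 2), ‖f t‖ ≤ C) :
    ‖∫ t in (-1 / 2 : ℝ)..(1 / 2), f t‖ ≤ C := by
  have := intervalIntegral.norm_integral_le_of_norm_le_const
      (C := C) (a := (-1 / 2 : ℝ)) (b := 1 / 2) (f := f) ?_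
  · refine this.trans (le_of_eq ?_)
    norm_num
  · intro t ht
    rw [uIoc_of_le (by norm_num)] at ht
    exact h t (Ioc_subset_Icc_self ht)

lemma norm_qq_le (hc : 0 < c₁) {s e : ℂ} (hs : s ∈ Clo c₁) (he : e ∈ Clo c₁) :
    ‖qq s e‖ ≤ (dd c₁)⁻¹ ^ 3 := by
  have := dd_pos hc
  apply norm_integral_slit_le
  intro t ht
  rw [norm_mul, norm_mul, show (dd c₁)⁻¹ ^ 3 = (dd c₁)⁻¹ * ((dd c₁)⁻¹ * (dd c₁)⁻¹) by ring]
  gcongr <;> apply norm_inv_le hc <;> assumption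

lemma qq_sub_qq_le (hc : 0 < c₁) {s e : ℂ} (hs : s ∈ Clo c₁) (he : e ∈ Clo c₁) :
    ‖qq s e - qq e e‖ ≤ (dd c₁)⁻¹ ^ 4 * ‖s - e‖ := by
  have hd := dd_pos hc
  unfold qq
  rw [← intervalIntegral.integral_sub (hs.1.integrable_qq he.1) (he.1.integrable_qq he.1)]
  apply norm_integral_slit_le
  intro t ht
  have e1 := hs.1 t ht
  have e2 := he.1 t ht
  have : ((t : ℂ) - s)⁻¹ * (((t : ℂ) - e)⁻¹ * ((t : ℂ) - e)⁻¹) -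
      ((t : ℂ) - e)⁻¹ * (((t : ℂ) - e)⁻¹ * ((t : ℂ) - e)⁻¹)
      = ((t : ℂ) - s)⁻¹ * ((t : ℂ) - e)⁻¹ * ((t : ℂ) - e)⁻¹ * ((t : ℂ) - e)⁻¹ * (s - e) := by
    field_simp
    ring
  rw [this, norm_mul, norm_mul, norm_mul, norm_mul,
    show (dd c₁)⁻¹ ^ 4 = (dd c₁)⁻¹ * (dd c₁)⁻¹ * (dd c₁)⁻¹ * (dd c₁)⁻¹ by ring]
  gcongr <;> apply norm_inv_le hc <;> assumption

lemma sB_mem (hc : 0 < c₁) : (sB c₁ : ℂ) ∈ Clo c₁ := ⟨off_sB hc, (hfun_sB hc).le⟩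

lemma bp_sub_sB (hc : 0 < c₁) {τ : ℝ} (hτ : τ ∈ Icc (-radius c₁) (radius c₁)) :
    (bp c₁ τ - sB c₁) ^ 2 * qq (bp c₁ τ) (sB c₁) = ((radius c₁ - τ : ℝ) : ℂ) := by
  have := J_sub_sB hc (bp_off hc τ)
  rw [J_bp hc hτ] at this
  push_cast
  linear_combination this

lemma sqrt_le_norm_sub_sB (hc : 0 < c₁) {τ : ℝ}
    (hτ : τ ∈ Icc (-radius c₁) (radius c₁)) :
    (dd c₁) ^ 3 * (radius c₁ - τ) ≤ ‖bp c₁ τ - sB c₁‖ ^ 2 := by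
  have h1 := congrArg norm (bp_sub_sB hc hτ)
  rw [norm_mul, norm_pow, Complex.norm_real, Real.norm_of_nonneg (by linarith [hτ.2])] at h1
  have h2 := norm_qq_le hc (bp_mem hc τ) (sB_mem hc)
  have hd := dd_pos hc
  rw [inv_pow] at h2
  rw [← h1]
  calc dd c₁ ^ 3 * (‖bp c₁ τ - sB c₁‖ ^ 2 * ‖qq (bp c₁ τ) (sB c₁)‖)
      ≤ dd c₁ ^ 3 * (‖bp c₁ τ - sB c₁‖ ^ 2 * (dd c₁ ^ 3)⁻¹) := by gcongr
    _ = _ := by field_simp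

lemma sqrt_le_norm_sub_sA (hc : 0 < c₁) {τ : ℝ}
    (hτ : τ ∈ Icc (-radius c₁) (radius c₁)) :
    (dd c₁) ^ 3 * (radius c₁ + τ) ≤ ‖bp c₁ τ - sA c₁‖ ^ 2 := by
  have h := sqrt_le_norm_sub_sB hc (τ := -τ) ⟨by linarith [hτ.2], by linarith [hτ.1]⟩
  rw [bp_neg hc hτ, sub_neg_eq_add] at h
  have : ‖-conj (bp c₁ τ) - (sB c₁ : ℂ)‖ = ‖bp c₁ τ - sA c₁‖ := by
    rw [← Complex.norm_conj, ← norm_neg]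
    congr 1
    rw [sA_eq]
    simp
    ring
  rwa [this] at h

lemma dbp_eq (hc : 0 < c₁) {τ : ℝ} :
    dbp c₁ τ = (bp c₁ τ ^ 2 - 1 / 4) / (c₁ * ((bp c₁ τ - sB c₁) * (bp c₁ τ - sA c₁))) := by
  have h1 := (bp_off hc τ).sq_ne
  have h2 : (c₁ : ℂ) ≠ 0 := by exact_mod_cast hc.ne'
  have h3 : (c₁ : ℂ) - 1 / (bp c₁ τ ^ 2 - 1 / 4)
      = (c₁ * ((bp c₁ τ - sB c₁) * (bp c₁ τ - sA c₁))) / (bp c₁ τ ^ 2 - 1 / 4) := by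
    have h4 : ((sB c₁ : ℂ)) ^ 2 = 1 / 4 + 1 / c₁ := by
      have := sB_sq hc
      rw [← Complex.ofReal_pow, this]
      push_cast
      ring
    rw [sA_eq, eq_div_iff h1, sub_mul, div_mul_cancel₀ _ h1]
    have h5 : (c₁ : ℂ) * (1 / c₁) = 1 := by field_simp
    push_cast
    linear_combination (c₁ : ℂ) * h4 + h5
  rw [dbp, h3, inv_div]

/-- Constant in the square root bound for the derivative of the boundary parametrization. -/
def dbpConst (c₁ : ℝ) : ℝ := ((1 / 2 + 1 / √c₁) ^ 2 + 1 / 4) / (c₁ * dd c₁ ^ 3)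

lemma norm_dbp_le (hc : 0 < c₁) {τ : ℝ}
    (hτ : τ ∈ cut c₁) :
    ‖dbp c₁ τ‖ ≤ dbpConst c₁ * ((radius c₁ - τ) ^ (-1 / 2 : ℝ) *
      (radius c₁ + τ) ^ (-1 / 2 : ℝ)) := by
  have hd := dd_pos hc
  have p1 : 0 < radius c₁ - τ := by linarith [hτ.2]
  have p2 : 0 < radius c₁ + τ := by linarith [hτ.1]
  have key : ∀ x y : ℝ, 0 < x → 0 ≤ y → dd c₁ ^ 3 * x ≤ y ^ 2 →
      √(dd c₁ ^ 3) * x ^ (1 / 2 : ℝ) ≤ y := by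
    intro x y hx hy h
    rw [← Real.sqrt_eq_rpow, ← Real.sqrt_mul (by positivity)]
    exact Real.sqrt_le_iff.2 ⟨hy, h⟩
  have k1 := key _ _ p1 (norm_nonneg _) (sqrt_le_norm_sub_sB hc (Ioo_subset_Icc_self hτ))
  have k2 := key _ _ p2 (norm_nonneg _) (sqrt_le_norm_sub_sA hc (Ioo_subset_Icc_self hτ))
  have hq : √(dd c₁ ^ 3) * √(dd c₁ ^ 3) = dd c₁ ^ 3 :=
    Real.mul_self_sqrt (by positivity)
  have q0 : 0 < √(dd c₁ ^ 3) := by positivity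
  rw [dbp_eq hc, norm_div, norm_mul, norm_mul, Complex.norm_real, Real.norm_of_nonneg hc.le]
  have n1 : ‖bp c₁ τ ^ 2 - 1 / 4‖ ≤ (1 / 2 + 1 / √c₁) ^ 2 + 1 / 4 := by
    refine (norm_sub_le _ _).trans ?_
    rw [norm_pow]
    have := norm_bp_le hc τ
    have h4 : ‖(1 / 4 : ℂ)‖ = 1 / 4 := by norm_num
    rw [h4]
    gcongr
  have x1 : 0 < (radius c₁ - τ) ^ (1 / 2 : ℝ) := by positivity
  have x2 : 0 < (radius c₁ + τ) ^ (1 / 2 : ℝ) := by positivity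
  calc ‖bp c₁ τ ^ 2 - 1 / 4‖ / (c₁ * (‖bp c₁ τ - sB c₁‖ * ‖bp c₁ τ - sA c₁‖))
      ≤ ((1 / 2 + 1 / √c₁) ^ 2 + 1 / 4) /
        (c₁ * ((√(dd c₁ ^ 3) * (radius c₁ - τ) ^ (1 / 2 : ℝ)) *
          (√(dd c₁ ^ 3) * (radius c₁ + τ) ^ (1 / 2 : ℝ)))) := by gcongr
    _ = _ := by
      rw [dbpConst, neg_div, Real.rpow_neg p1.le, Real.rpow_neg p2.le, mul_mul_mul_comm, hq]
      field_simp

/-! ### Distances along dilated copies of the curve -/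

lemma bp_dist_lower (hc : 0 < c₁) {τ σ : ℝ}
    (hτ : τ ∈ Icc (-radius c₁) (radius c₁)) (hσ : σ ∈ Icc (-radius c₁) (radius c₁)) :
    |τ - σ| ≤ 2 * c₁ * ‖bp c₁ τ - bp c₁ σ‖ := by
  have h := J_lipschitz (c₀ := 0) hc (bp_off hc τ) (bp_off hc σ) (bp_mem hc τ).2 (bp_mem hc σ).2
  rwa [J_bp hc hτ, J_bp hc hσ, ← Complex.ofReal_sub, Complex.norm_real, Real.norm_eq_abs] at h

lemma mul_bp_mem_Out (hc : 0 < c₁) {s : ℂ} (hs : s ∈ Clo c₁) {r : ℝ} (hr : 1 < r) :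
    (r : ℂ) * s ∈ Out c₁ := by
  refine ⟨hs.1.scale hr.le, (hfun_scale hs.1 hr.le).trans_lt ?_⟩
  rw [div_lt_iff₀ (by linarith)]
  nlinarith [hs.2]

/-- The interior domain is strictly star-shaped about `0`. -/
lemma mul_mem_In {s : ℂ} (hs : s ∉ Out c₁) {r : ℝ} (hr0 : 0 ≤ r) (hr : r < 1)
    (hc : 0 < c₁) : (r : ℂ) * s ∈ (Clo c₁)ᶜ := by
  rintro ⟨h1, h2⟩
  rcases hr0.eq_or_lt with h0 | h0
  · have := h1 0 (by norm_num)
    rw [← h0] at this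
    simp at this
  · have h3 : ((r⁻¹ : ℝ) : ℂ) * ((r : ℂ) * s) = s := by
      have : (r : ℂ) ≠ 0 := by exact_mod_cast h0.ne'
      push_cast
      field_simp
    have := mul_bp_mem_Out hc ⟨h1, h2⟩ (r := r⁻¹) ((one_lt_inv₀ h0).2 hr)
    rw [h3] at this
    exact hs this

lemma bp_notMem_Out (hc : 0 < c₁) (τ : ℝ) : bp c₁ τ ∉ Out c₁ :=
  fun h => h.2.ne (hfun_bp hc τ)

lemma exists_dilation (hc : 0 < c₁) :
    ∃ δ > 0, ∃ d > 0, δ ≤ 1 / 2 ∧ ∀ r : ℝ, |r - 1| ≤ δ → ∀ τ, ∀ t ∈ Icc (-1 / 2 : ℝ) (1 / 2),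
      d ≤ ‖(t : ℂ) - r * bp c₁ τ‖ := by
  set R := 1 / 2 + 1 / √c₁ with hR
  have hR0 : 0 < R := by positivity
  have hd := dd_pos hc
  refine ⟨min (1 / 2) (dd c₁ / (2 * R)), by positivity, dd c₁ / 2, by positivity, min_le_left _ _,
    fun r hr τ t ht => ?_⟩
  have h1 := dd_le hc (bp_mem hc τ) ht
  have h2 : ‖((r - 1 : ℝ) : ℂ) * bp c₁ τ‖ ≤ dd c₁ / 2 := by
    rw [norm_mul, Complex.norm_real, Real.norm_eq_abs]
    calc |r - 1| * ‖bp c₁ τ‖ ≤ dd c₁ / (2 * R) * R := by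
          gcongr
          · exact hr.trans (min_le_right _ _)
          · exact norm_bp_le hc τ
      _ = dd c₁ / 2 := by field_simp
  have h3 : (t : ℂ) - bp c₁ τ = ((t : ℂ) - r * bp c₁ τ) + ((r - 1 : ℝ) : ℂ) * bp c₁ τ := by
    push_cast; ring
  rw [h3] at h1
  linarith [norm_add_le ((t : ℂ) - r * bp c₁ τ) (((r - 1 : ℝ) : ℂ) * bp c₁ τ)]

lemma off_of_dist {d : ℝ} (hd : 0 < d) {s : ℂ}
    (h : ∀ t ∈ Icc (-1 / 2 : ℝ) (1 / 2), d ≤ ‖(t : ℂ) - s‖) : Off s :=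
  fun t ht => norm_pos_iff.1 (hd.trans_le (h t ht))

/-- Distances from a dilated copy of the curve to the curve. -/
lemma exists_dist_dilated (hc : 0 < c₁) :
    ∃ κ > 0, ∃ δ > 0, ∀ r : ℝ, |r - 1| ≤ δ → ∀ τ ∈ Icc (-radius c₁) (radius c₁),
      ∀ σ ∈ Icc (-radius c₁) (radius c₁), κ * |τ - σ| ≤ ‖(r : ℂ) * bp c₁ τ - bp c₁ σ‖ := by
  obtain ⟨δ, hδ, d, hd, hδ2, hdist⟩ := exists_dilation hc
  set R := 1 / 2 + 1 / √c₁ with hR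
  have hR0 : 0 < R := by positivity
  set L := 2 * d⁻¹ ^ 3 with hL
  have hL0 : 0 < L := by positivity
  set K := 1 + 2 * L / c₁ * R with hK
  have hK0 : 0 < K := by positivity
  refine ⟨(2 * c₁ * K)⁻¹, by positivity, δ, hδ, fun r hr τ hτ σ hσ => ?_⟩
  have hrr := abs_le.1 hr
  have h1 := hfun_lipschitz hd (hdist r hr τ) (by simpa using hdist 1 (by simpa using hδ.le) σ)
  rw [hfun_bp hc σ] at h1
  have o := off_of_dist hd (hdist r hr τ)
  -- `h` decreases at least like `1/r` along rays, so a dilated point is off the level set `h = c₁`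
  have h2 : c₁ * |r - 1| ≤ 2 * |hfun (r * bp c₁ τ) - c₁| := by
    rcases le_total 1 r with h | h
    · have h3 := hfun_scale (bp_off hc τ) h
      rw [hfun_bp hc τ, le_div_iff₀ (by linarith)] at h3
      rw [abs_of_nonneg (by linarith : 0 ≤ r - 1)]
      have h4 := neg_abs_le (hfun (r * bp c₁ τ) - c₁)
      have h6 : r * |hfun (r * bp c₁ τ) - c₁| ≤ 2 * |hfun (r * bp c₁ τ) - c₁| := by
        gcongr
        linarith
      have h7 := mul_le_mul_of_nonneg_left h4 (show (0 : ℝ) ≤ r by linarith)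
      linarith
    · have hr0 : 0 < r := by linarith
      have h3 := hfun_scale o (R := r⁻¹) ((one_le_inv₀ hr0).2 h)
      have h5 : ((r⁻¹ : ℝ) : ℂ) * ((r : ℂ) * bp c₁ τ) = bp c₁ τ := by
        have : (r : ℂ) ≠ 0 := by exact_mod_cast hr0.ne'
        push_cast
        field_simp
      rw [h5, hfun_bp hc τ, div_inv_eq_mul] at h3
      rw [abs_of_nonpos (by linarith : r - 1 ≤ 0)]
      have h4 := le_abs_self (hfun (r * bp c₁ τ) - c₁)
      have h6 : r * |hfun (r * bp c₁ τ) - c₁| ≤ 2 * |hfun (r * bp c₁ τ) - c₁| := by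
        gcongr
        linarith
      have h7 := mul_le_mul_of_nonneg_left h4 (show (0 : ℝ) ≤ r by linarith)
      linarith
  have h3 : |r - 1| ≤ 2 * L / c₁ * ‖(r : ℂ) * bp c₁ τ - bp c₁ σ‖ := by
    rw [div_mul_eq_mul_div, le_div_iff₀ hc]
    linarith
  have h4 : ‖bp c₁ τ - bp c₁ σ‖ ≤ K * ‖(r : ℂ) * bp c₁ τ - bp c₁ σ‖ := by
    have e : bp c₁ τ - bp c₁ σ = ((r : ℂ) * bp c₁ τ - bp c₁ σ) - ((r - 1 : ℝ) : ℂ) * bp c₁ τ := by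
      push_cast; ring
    rw [e]
    refine (norm_sub_le _ _).trans ?_
    rw [norm_mul, Complex.norm_real, Real.norm_eq_abs, hK, add_mul, one_mul]
    apply add_le_add_right
    calc |r - 1| * ‖bp c₁ τ‖ ≤ (2 * L / c₁ * ‖(r : ℂ) * bp c₁ τ - bp c₁ σ‖) * R := by
          gcongr
          exact norm_bp_le hc τ
      _ = _ := by ring
  have h5 := bp_dist_lower hc hτ hσ
  rw [inv_mul_le_iff₀ (by positivity)]
  calc |τ - σ| ≤ 2 * c₁ * ‖bp c₁ τ - bp c₁ σ‖ := h5
    _ ≤ 2 * c₁ * (K * ‖(r : ℂ) * bp c₁ τ - bp c₁ σ‖) := by gcongr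
    _ = _ := by ring

lemma norm_kk_le_of_dist {d : ℝ} (hd : 0 < d) {s s' : ℂ}
    (h : ∀ t ∈ Icc (-1 / 2 : ℝ) (1 / 2), d ≤ ‖(t : ℂ) - s‖)
    (h' : ∀ t ∈ Icc (-1 / 2 : ℝ) (1 / 2), d ≤ ‖(t : ℂ) - s'‖) : ‖kk s s'‖ ≤ d⁻¹ ^ 2 := by
  apply norm_integral_slit_le
  intro t ht
  rw [norm_mul, norm_inv, norm_inv, sq]
  have := h t ht
  have := h' t ht
  gcongr

/-- `J` is close to its boundary values on dilated copies of the curve. -/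
lemma exists_J_dilated (hc : 0 < c₁) :
    ∃ C > 0, ∃ δ > 0, ∀ r : ℝ, |r - 1| ≤ δ → ∀ τ ∈ Icc (-radius c₁) (radius c₁),
      Off (r * bp c₁ τ) ∧ ‖J c₁ 0 (r * bp c₁ τ) - τ‖ ≤ C * |r - 1| := by
  obtain ⟨δ, hδ, d, hd, hδ2, hdist⟩ := exists_dilation hc
  set R := 1 / 2 + 1 / √c₁ with hR
  refine ⟨R * (c₁ + d⁻¹ ^ 2), by positivity, δ, hδ, fun r hr τ hτ => ?_⟩
  have o := off_of_dist hd (hdist r hr τ)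
  refine ⟨o, ?_⟩
  have h1 := J_sub (c₁ := c₁) (c₀ := 0) o (bp_off hc τ)
  rw [J_bp hc hτ] at h1
  rw [h1, norm_mul]
  have h2 := norm_kk_le_of_dist hd (hdist r hr τ) (by simpa using hdist 1 (by simpa using hδ.le) τ)
  have h3 : ‖(r : ℂ) * bp c₁ τ - bp c₁ τ‖ ≤ |r - 1| * R := by
    have e : (r : ℂ) * bp c₁ τ - bp c₁ τ = ((r - 1 : ℝ) : ℂ) * bp c₁ τ := by push_cast; ring
    rw [e, norm_mul, Complex.norm_real, Real.norm_eq_abs]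
    gcongr
    exact norm_bp_le hc τ
  have h4 : ‖(c₁ : ℂ) - kk (r * bp c₁ τ) (bp c₁ τ)‖ ≤ c₁ + d⁻¹ ^ 2 := by
    refine (norm_sub_le _ _).trans ?_
    rw [Complex.norm_real, Real.norm_of_nonneg hc.le]
    gcongr
  calc _ ≤ |r - 1| * R * (c₁ + d⁻¹ ^ 2) := by gcongr
    _ = _ := by ring

/-- On dilated copies of the curve, `J` stays away from an interior point `σ` of the interval
except near the corresponding boundary point. -/
lemma exists_J_lower (hc : 0 < c₁) {σ : ℝ}
    (hσ : σ ∈ cut c₁) :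
    ∃ κ > 0, ∃ δ > 0, ∀ r : ℝ, |r - 1| ≤ δ → ∀ τ ∈ Icc (-radius c₁) (radius c₁),
      κ * ‖(r : ℂ) * bp c₁ τ - bp c₁ σ‖ ≤ ‖J c₁ 0 (r * bp c₁ τ) - σ‖ := by
  obtain ⟨δ, hδ, d, hd, hδ2, hdist⟩ := exists_dilation hc
  set R := 1 / 2 + 1 / √c₁ with hR
  have hR0 : 0 < R := by positivity
  set y := (bp c₁ σ).im with hy
  have hy0 : 0 < y := bp_im_pos hc hσ
  set m := y ^ 2 * (2 * R + 1) ^ (-4 : ℤ) with hm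
  have hm0 : 0 < m := by positivity
  set L := 2 * d⁻¹ ^ 3 * R with hL
  have hL0 : 0 < L := by positivity
  refine ⟨m / 4, by positivity, min δ (m / (2 * L)), by positivity, fun r hr τ hτ => ?_⟩
  have hr1 := hr.trans (min_le_left _ _)
  have hr2 := hr.trans (min_le_right _ _)
  have hrr := abs_le.1 hr1
  have o := off_of_dist hd (hdist r hr1 τ)
  have h1 := J_sub (c₁ := c₁) (c₀ := 0) o (bp_off hc σ)
  rw [J_bp hc (Ioo_subset_Icc_self hσ)] at h1
  rw [h1, norm_mul, mul_comm]
  gcongr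
  refine le_trans ?_ (kk_lower o (bp_off hc σ))
  rw [hfun_bp hc σ]
  have n1 : ‖(r : ℂ) * bp c₁ τ‖ ≤ 2 * R := by
    rw [norm_mul, Complex.norm_real, Real.norm_of_nonneg (by linarith)]
    have := norm_bp_le hc τ
    gcongr
    linarith
  have n2 : ‖bp c₁ σ‖ ≤ 2 * R := (norm_bp_le hc σ).trans (by linarith)
  have h2 := quart_lower o (bp_off hc σ) n1 n2
  have h3 : y ≤ ‖(r : ℂ) * bp c₁ τ - conj (bp c₁ σ)‖ := by
    refine le_trans ?_ (Complex.abs_im_le_norm _)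
    refine le_trans ?_ (le_abs_self _)
    have e : ((r : ℂ) * bp c₁ τ).im = r * (bp c₁ τ).im := by simp
    rw [Complex.sub_im, Complex.conj_im, sub_neg_eq_add, e, ← hy]
    have : 0 ≤ r * (bp c₁ τ).im := mul_nonneg (by linarith) (bp_im_nonneg hc τ)
    linarith
  have h4 : m ≤ ‖(r : ℂ) * bp c₁ τ - conj (bp c₁ σ)‖ ^ 2 *
      quart (r * bp c₁ τ) (bp c₁ σ) := by
    rw [hm]
    gcongr
  have h5 := hfun_lipschitz hd (hdist r hr1 τ) (by simpa using hdist 1 (by simpa using hδ.le) τ)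
  rw [hfun_bp hc τ] at h5
  have h6 : ‖(r : ℂ) * bp c₁ τ - bp c₁ τ‖ ≤ |r - 1| * R := by
    have e : (r : ℂ) * bp c₁ τ - bp c₁ τ = ((r - 1 : ℝ) : ℂ) * bp c₁ τ := by push_cast; ring
    rw [e, norm_mul, Complex.norm_real, Real.norm_eq_abs]
    gcongr
    exact norm_bp_le hc τ
  have h7 : |hfun (r * bp c₁ τ) - c₁| ≤ m / 2 := by
    calc _ ≤ 2 * d⁻¹ ^ 3 * (|r - 1| * R) := h5.trans (by gcongr)
      _ = L * |r - 1| := by rw [hL]; ring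
      _ ≤ L * (m / (2 * L)) := by gcongr
      _ = m / 2 := by field_simp
  have h8 := (abs_le.1 h7).2
  linarith


/-! ### Integrable singular weights -/

lemma intervalIntegrable_abs_sub_rpow {α : ℝ} (hα : -1 < α) (c a b : ℝ) :
    IntervalIntegrable (fun t : ℝ => |t - c| ^ α) volume a b := by
  have h1 : ∀ b : ℝ, 0 ≤ b → IntervalIntegrable (fun t : ℝ => |t| ^ α) volume 0 b := by
    intro b hb
    refine (intervalIntegral.intervalIntegrable_rpow' hα (a := 0) (b := b)).congr ?_
    intro t ht
    rw [uIoc_of_le hb] at ht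
    simp only
    rw [abs_of_pos ht.1]
  have h2 : ∀ b : ℝ, IntervalIntegrable (fun t : ℝ => |t| ^ α) volume 0 b := by
    intro b
    rcases le_total 0 b with hb | hb
    · exact h1 b hb
    · have := (h1 (-b) (by linarith)).comp_mul_left (c := -1)
      simpa using this
  have h3 : ∀ a b : ℝ, IntervalIntegrable (fun t : ℝ => |t| ^ α) volume a b :=
    fun a b => (h2 a).symm.trans (h2 b)
  have := (h3 (a - c) (b - c)).comp_sub_right c
  simpa using this

/-- A weight which is at least `1` and has integrable singularities at the points of `F`; the sixth
power of the weight is still integrable. -/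
def sing (F : Finset ℝ) (t : ℝ) : ℝ := 1 + ∑ c ∈ F, |t - c| ^ (-1 / 8 : ℝ)

lemma one_le_sing (F : Finset ℝ) (t : ℝ) : 1 ≤ sing F t := by
  unfold sing
  have : 0 ≤ ∑ c ∈ F, |t - c| ^ (-1 / 8 : ℝ) := Finset.sum_nonneg fun c _ => by positivity
  linarith

lemma sing_mono {F G : Finset ℝ} (h : F ⊆ G) (t : ℝ) : sing F t ≤ sing G t := by
  unfold sing
  gcongr

lemma le_sing {F : Finset ℝ} {c : ℝ} (hc : c ∈ F) (t : ℝ) : |t - c| ^ (-1 / 8 : ℝ) ≤ sing F t := by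
  unfold sing
  have : |t - c| ^ (-1 / 8 : ℝ) ≤ ∑ c ∈ F, |t - c| ^ (-1 / 8 : ℝ) :=
    Finset.single_le_sum (f := fun c => |t - c| ^ (-1 / 8 : ℝ)) (fun c _ => by positivity) hc
  linarith

lemma measurable_sing (F : Finset ℝ) : Measurable (sing F) := by
  unfold sing
  fun_prop

lemma intervalIntegrable_sing_pow (F : Finset ℝ) (a b : ℝ) :
    IntervalIntegrable (fun t => sing F t ^ 6) volume a b := by
  set f : Option F → ℝ → ℝ := fun o t => match o with
    | none => 1
    | some c => |t - c| ^ (-1 / 8 : ℝ) with hf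
  have hs : ∀ t, sing F t = ∑ o : Option F, f o t := by
    intro t
    rw [Fintype.sum_option, sing]
    congr 1
    rw [← Finset.sum_coe_sort]
  have hf0 : ∀ o t, 0 ≤ f o t := by
    rintro (_ | c) t
    · exact zero_le_one
    · change 0 ≤ |t - c| ^ (-1 / 8 : ℝ); positivity
  have hint : ∀ o, IntervalIntegrable (fun t => f o t ^ 6) volume a b := by
    rintro (_ | c)
    · simp [hf]
    · have : (fun t : ℝ => f (some c) t ^ 6) = fun t : ℝ => |t - c| ^ (-3 / 4 : ℝ) := by
        ext t
        change (|t - c| ^ (-1 / 8 : ℝ)) ^ 6 = _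
        rw [← Real.rpow_natCast, ← Real.rpow_mul (abs_nonneg _)]
        norm_num
      rw [this]
      exact intervalIntegrable_abs_sub_rpow (by norm_num) _ _ _
  have hb : IntervalIntegrable (fun t => (Fintype.card (Option F) : ℝ) ^ 5 *
      ∑ o : Option F, f o t ^ 6) volume a b := by
    refine IntervalIntegrable.const_mul ?_ _
    have := IntervalIntegrable.sum (μ := volume) (a := a) (b := b)
      (Finset.univ : Finset (Option F)) (f := fun o t => f o t ^ 6) (fun o _ => hint o)
    refine this.congr fun t _ => ?_
    simp
  refine hb.mono_fun ((measurable_sing F).pow_const 6).aestronglyMeasurable ?_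
  refine .of_forall fun t => ?_
  have h1 := one_le_sing F t
  change ‖sing F t ^ 6‖ ≤ _
  rw [Real.norm_of_nonneg (by positivity)]
  refine le_trans ?_ (le_abs_self _)
  rw [hs]
  have := pow_sum_div_card_le_sum_pow (s := (Finset.univ : Finset (Option F))) (f := fun o => f o t)
    (fun o _ => hf0 o t) 5
  rw [div_le_iff₀ (by
    have : 0 < Fintype.card (Option F) := Fintype.card_pos
    rw [Finset.card_univ]
    positivity)] at this
  rw [Finset.card_univ] at this
  rw [mul_comm]
  exact this

/-- A power singularity dominates the logarithm. -/
lemma abs_log_le_sing {F : Finset ℝ} {c : ℝ} (hc : c ∈ F) {κ M : ℝ} (hκ : 0 < κ) :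
    ∀ t y : ℝ, t ≠ c → κ * |t - c| ≤ y → y ≤ M →
      |log y| ≤ (|log κ| + |log M| + 8) * sing F t := by
  intro t y htc h1 h2
  have h0 : 0 < |t - c| := abs_pos.2 (sub_ne_zero.2 htc)
  have hy : 0 < y := lt_of_lt_of_le (by positivity) h1
  have hs := one_le_sing F t
  have hs2 := le_sing hc t
  have e1 : log y ≤ |log M| := (Real.log_le_log hy h2).trans (le_abs_self _)
  have e2 : -log y ≤ |log κ| + 8 * |t - c| ^ (-1 / 8 : ℝ) := by
    have e3 := Real.log_le_log (by positivity) h1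
    rw [Real.log_mul hκ.ne' h0.ne'] at e3
    have e4 := Real.log_le_rpow_div (x := |t - c|⁻¹) (ε := 1 / 8) (by positivity) (by norm_num)
    rw [Real.log_inv, Real.inv_rpow h0.le, ← Real.rpow_neg h0.le] at e4
    have e5 : (-(1 / 8) : ℝ) = -1 / 8 := by norm_num
    rw [e5] at e4
    have := neg_abs_le (log κ)
    linarith
  have p1 := abs_nonneg (log κ)
  have p2 := abs_nonneg (log M)
  rw [abs_le]
  constructor <;> nlinarith

lemma norm_clog_le (z : ℂ) : ‖Complex.log z‖ ≤ |log ‖z‖| + π := by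
  refine (Complex.norm_le_abs_re_add_abs_im _).trans ?_
  rw [Complex.log_re, Complex.log_im]
  gcongr
  exact Complex.abs_arg_le_pi z

lemma continuous_dbp_aux (hc : 0 < c₁) :
    Continuous fun τ => (c₁ : ℂ) - 1 / (bp c₁ τ ^ 2 - 1 / 4) := by
  have := continuous_bp hc
  exact continuous_const.sub (continuous_const.div (by fun_prop) fun τ => (bp_off hc τ).sq_ne)

lemma measurable_dbp (hc : 0 < c₁) : Measurable (dbp c₁) :=
  (continuous_dbp_aux hc).measurable.inv

/-- The end points of the interval. -/
def ends (c₁ : ℝ) : Finset ℝ := {-radius c₁, radius c₁}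

lemma norm_dbp_le_sing (hc : 0 < c₁) :
    ∃ C > 0, ∀ τ ∈ cut c₁, ‖dbp c₁ τ‖ ≤ C * sing (ends c₁) τ ^ 4 := by
  set w := radius c₁ with hw
  have hw0 : 0 < w := radius_pos hc
  have hC : 0 < dbpConst c₁ := by
    have := dd_pos hc
    unfold dbpConst
    positivity
  have key : ∀ τ c : ℝ, |τ - c| ^ (-1 / 2 : ℝ) = (|τ - c| ^ (-1 / 8 : ℝ)) ^ 4 := by
    intro τ c
    rw [← Real.rpow_natCast, ← Real.rpow_mul (abs_nonneg _)]
    norm_num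
  refine ⟨dbpConst c₁ * w ^ (-1 / 2 : ℝ), by positivity, fun τ hτ => ?_⟩
  refine (norm_dbp_le hc hτ).trans ?_
  rw [mul_assoc]
  apply mul_le_mul_of_nonneg_left _ hC.le
  have p1 : 0 < w - τ := by linarith [hτ.2]
  have p2 : 0 < w + τ := by linarith [hτ.1]
  have s1 := one_le_sing (ends c₁) τ
  rcases le_total 0 τ with h | h
  · have e1 : (w + τ) ^ (-1 / 2 : ℝ) ≤ w ^ (-1 / 2 : ℝ) :=
      Real.rpow_le_rpow_of_nonpos hw0 (by linarith) (by norm_num)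
    have e2 : (w - τ) ^ (-1 / 2 : ℝ) ≤ sing (ends c₁) τ ^ 4 := by
      rw [← abs_of_pos p1, abs_sub_comm, key]
      gcongr
      exact le_sing (by simp [ends, hw]) τ
    calc _ ≤ sing (ends c₁) τ ^ 4 * w ^ (-1 / 2 : ℝ) := by gcongr
      _ = _ := mul_comm _ _
  · have e1 : (w - τ) ^ (-1 / 2 : ℝ) ≤ w ^ (-1 / 2 : ℝ) :=
      Real.rpow_le_rpow_of_nonpos hw0 (by linarith) (by norm_num)
    have e2 : (w + τ) ^ (-1 / 2 : ℝ) ≤ sing (ends c₁) τ ^ 4 := by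
      have : w + τ = |τ - -w| := by rw [sub_neg_eq_add, abs_of_pos (by linarith), add_comm]
      rw [this, key]
      gcongr
      exact le_sing (by simp [ends, hw]) τ
    gcongr

lemma intervalIntegrable_of_le_sing {f : ℝ → ℂ} {F : Finset ℝ} {a b C : ℝ} (hab : a ≤ b)
    (hf : AEStronglyMeasurable f (volume.restrict (uIoc a b)))
    (h : ∀ᵐ t, t ∈ Ioo a b → ‖f t‖ ≤ C * sing F t ^ 6) : IntervalIntegrable f volume a b := by
  refine ((intervalIntegrable_sing_pow F a b).const_mul C).mono_fun hf ?_
  rw [uIoc_of_le hab, EventuallyLE, ae_restrict_iff' measurableSet_Ioc]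
  have hb : ∀ᵐ t : ℝ, t ≠ b := by simp [ae_iff, measure_singleton]
  filter_upwards [h, hb] with t ht htb ht2
  exact (ht ⟨ht2.1, lt_of_le_of_ne ht2.2 htb⟩).trans (le_abs_self _)

lemma intervalIntegrable_dbp (hc : 0 < c₁) :
    IntervalIntegrable (dbp c₁) volume (-radius c₁) (radius c₁) := by
  obtain ⟨C, hC, h⟩ := norm_dbp_le_sing hc
  refine intervalIntegrable_of_le_sing (F := ends c₁) (C := C) (by linarith [radius_pos hc])
    (measurable_dbp hc).aestronglyMeasurable (.of_forall fun τ hτ => ?_)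
  refine (h τ hτ).trans ?_
  gcongr
  · exact one_le_sing _ _
  · norm_num

/-! ### Cauchy's theorem along dilated curves -/

/-- The primitive `s ↦ ∫_1^R s g(ρ s) dρ` of `R g(R s) - g(s)`. -/
lemma hasDerivAt_radial {U : Set ℂ} (hU : IsOpen U) {g : ℂ → ℂ} (hg : DifferentiableOn ℂ g U)
    {R : ℝ} {s₀ : ℂ} (h : ∀ ρ ∈ uIcc 1 R, (ρ : ℂ) * s₀ ∈ U) :
    HasDerivAt (fun s => ∫ ρ in (1 : ℝ)..R, s * g (ρ * s)) (R * g (R * s₀) - g s₀) s₀ := by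
  have hK : IsCompact ((fun ρ : ℝ => (ρ : ℂ) * s₀) '' uIcc 1 R) :=
    isCompact_uIcc.image (by fun_prop)
  obtain ⟨ε, hε, hth⟩ := hK.exists_thickening_subset_open hU (by
    rintro _ ⟨ρ, hρ, rfl⟩; exact h ρ hρ)
  have hM : ∀ ρ ∈ uIcc 1 R, |ρ| ≤ 1 + |R| := by
    intro ρ hρ
    rw [mem_uIcc] at hρ
    have := neg_abs_le R
    have := le_abs_self R
    rw [abs_le]
    rcases hρ with h | h <;> constructor <;> linarith [h.1, h.2]
  set η := ε / (2 * (1 + |R|)) with hη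
  have hη0 : 0 < η := by positivity
  have hball : ∀ s ∈ Metric.closedBall s₀ η, ∀ ρ ∈ uIcc 1 R, (ρ : ℂ) * s ∈ U := by
    intro s hs ρ hρ
    apply hth
    rw [Metric.mem_thickening_iff]
    refine ⟨_, mem_image_of_mem _ hρ, ?_⟩
    rw [dist_eq_norm, ← mul_sub, norm_mul, Complex.norm_real, Real.norm_eq_abs]
    rw [Metric.mem_closedBall, dist_eq_norm] at hs
    calc |ρ| * ‖s - s₀‖ ≤ (1 + |R|) * η := by gcongr; exact hM ρ hρ
      _ = ε / 2 := by rw [hη]; field_simp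
      _ < ε := by linarith
  have hgc : ContinuousOn g U := hg.continuousOn
  have hg' : ContinuousOn (deriv g) U := (hg.deriv hU).continuousOn
  have hs0 : s₀ ∈ Metric.closedBall s₀ η := Metric.mem_closedBall_self hη0.le
  set F' : ℂ → ℝ → ℂ := fun s ρ => g (ρ * s) + s * (deriv g (ρ * s) * ρ) with hF'
  have hcont : ContinuousOn (fun q : ℂ × ℝ => F' q.1 q.2) (Metric.closedBall s₀ η ×ˢ uIcc 1 R) := by
    have hm : ContinuousOn (fun q : ℂ × ℝ => (q.2 : ℂ) * q.1)
      (Metric.closedBall s₀ η ×ˢ uIcc 1 R) := by fun_prop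
    have hmt : MapsTo (fun q : ℂ × ℝ => (q.2 : ℂ) * q.1) (Metric.closedBall s₀ η ×ˢ uIcc 1 R) U :=
      fun q hq => hball q.1 hq.1 q.2 hq.2
    have c1 := hgc.comp hm hmt
    have c2 := hg'.comp hm hmt
    have c3 : ContinuousOn (fun q : ℂ × ℝ => (q.2 : ℂ)) (Metric.closedBall s₀ η ×ˢ uIcc 1 R) := by
      fun_prop
    exact c1.add (continuousOn_fst.mul (c2.mul c3))
  obtain ⟨B, hB⟩ := ((isCompact_closedBall s₀ η).prod isCompact_uIcc).exists_bound_of_continuousOn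
    hcont
  have hcs : ∀ s ∈ Metric.closedBall s₀ η, ContinuousOn (fun ρ : ℝ => s * g (ρ * s)) (uIcc 1 R) := by
    intro s hs
    refine continuousOn_const.mul (hgc.comp (f := fun ρ : ℝ => (ρ : ℂ) * s) (by fun_prop)
      fun ρ hρ => hball s hs ρ hρ)
  have hcs' : ContinuousOn (F' s₀) (uIcc 1 R) :=
    hcont.comp (f := fun ρ : ℝ => (s₀, ρ)) (by fun_prop) fun ρ hρ => ⟨hs0, hρ⟩
  have main := intervalIntegral.hasDerivAt_integral_of_dominated_loc_of_deriv_le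
    (μ := volume) (a := 1) (b := R) (F := fun s (ρ : ℝ) => s * g (ρ * s)) (F' := F') (x₀ := s₀)
    (s := Metric.closedBall s₀ η) (bound := fun _ => B) (Metric.closedBall_mem_nhds s₀ hη0)
    (by
      filter_upwards [Metric.closedBall_mem_nhds s₀ hη0] with s hs
      exact ((hcs s hs).mono uIoc_subset_uIcc).aestronglyMeasurable measurableSet_uIoc)
    ((hcs s₀ hs0).intervalIntegrable)
    ((hcs'.mono uIoc_subset_uIcc).aestronglyMeasurable measurableSet_uIoc)
    (.of_forall fun ρ hρ s hs => hB (s, ρ) ⟨hs, uIoc_subset_uIcc hρ⟩)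
    (by simp)
    (.of_forall fun ρ hρ s hs => by
      have hgd := (hg.differentiableAt (hU.mem_nhds (hball s hs ρ (uIoc_subset_uIcc hρ)))).hasDerivAt
      have h1 : HasDerivAt (fun s : ℂ => (ρ : ℂ) * s) ρ s := by
        simpa using (hasDerivAt_id s).const_mul (ρ : ℂ)
      have h2 := (hasDerivAt_id s).mul (hgd.comp s h1)
      refine h2.congr_deriv ?_
      simp [hF'])
  refine main.2.congr_deriv ?_
  have hFTC : ∀ ρ ∈ uIcc 1 R, HasDerivAt (fun ρ : ℝ => (ρ : ℂ) * g (ρ * s₀)) (F' s₀ ρ) ρ := by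
    intro ρ hρ
    have hgd := (hg.differentiableAt (hU.mem_nhds (h ρ hρ))).hasDerivAt
    have h0 : HasDerivAt (fun ρ : ℝ => (ρ : ℂ)) 1 ρ := Complex.ofRealCLM.hasDerivAt
    have h1 : HasDerivAt (fun ρ : ℝ => (ρ : ℂ) * s₀) s₀ ρ := by simpa using h0.mul_const s₀
    have h2 := h0.mul (hgd.comp ρ h1)
    refine h2.congr_deriv ?_
    simp [hF']
    ring
  rw [intervalIntegral.integral_eq_sub_of_hasDerivAt hFTC hcs'.intervalIntegrable]
  simp

/-- Cauchy's theorem for the upper half of the dilated curves: if `g` is holomorphic on an open set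
that contains all dilates between `r γ` and `R r γ`, and real on the real axis, then the imaginary
parts of the integrals along both curves agree. -/
theorem im_integral_dilate (hc : 0 < c₁) {U : Set ℂ} (hU : IsOpen U) {g : ℂ → ℂ}
    (hg : DifferentiableOn ℂ g U) {R r : ℝ}
    (h : ∀ τ, ∀ ρ ∈ uIcc 1 R, (ρ : ℂ) * (r * bp c₁ τ) ∈ U)
    (hreal : ∀ x : ℝ, (x : ℂ) ∈ U → (g x).im = 0) :
    (∫ τ in (-radius c₁)..(radius c₁), g (r * bp c₁ τ) * (r * dbp c₁ τ)).im =
    (∫ τ in (-radius c₁)..(radius c₁),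
      (R * g (R * (r * bp c₁ τ))) * (r * dbp c₁ τ)).im := by
  set w := radius c₁ with hw
  have hw0 : 0 < w := radius_pos hc
  have hbc : Continuous fun τ => (r : ℂ) * bp c₁ τ := continuous_const.mul (continuous_bp hc)
  have hd := intervalIntegrable_dbp hc
  have hgc := hg.continuousOn
  have c1 : Continuous fun τ => g (r * bp c₁ τ) := by
    rw [← continuousOn_univ]
    refine hgc.comp hbc.continuousOn fun τ _ => ?_
    simpa using h τ 1 left_mem_uIcc
  have c2 : Continuous fun τ => (R : ℂ) * g (R * (r * bp c₁ τ)) := by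
    rw [← continuousOn_univ]
    exact continuousOn_const.mul (hgc.comp (continuous_const.mul hbc).continuousOn
      fun τ _ => h τ R right_mem_uIcc)
  have i1 := (hd.const_mul (r : ℂ)).continuousOn_mul c1.continuousOn
  have i2 := (hd.const_mul (r : ℂ)).continuousOn_mul c2.continuousOn
  set P : ℂ → ℂ := fun s => ∫ ρ in (1 : ℝ)..R, s * g (ρ * s) with hP
  have hPd : ∀ τ, HasDerivAt P (R * g (R * (r * bp c₁ τ)) - g (r * bp c₁ τ)) (r * bp c₁ τ) :=
    fun τ => hasDerivAt_radial hU hg (h τ)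
  have hFTC := intervalIntegral.integral_eq_sub_of_hasDerivAt_of_le (a := -w) (b := w)
    (f := fun τ => P (r * bp c₁ τ))
    (f' := fun τ => (R * g (R * (r * bp c₁ τ)) - g (r * bp c₁ τ)) * (r * dbp c₁ τ))
    (by linarith)
    (continuous_iff_continuousAt.2 fun τ =>
      ContinuousAt.comp (f := fun τ => (r : ℂ) * bp c₁ τ) (hPd τ).continuousAt
        hbc.continuousAt).continuousOn
    (fun τ hτ => by
      have h1 : HasDerivAt (fun τ => (r : ℂ) * bp c₁ τ) (r * dbp c₁ τ) τ :=
        (hasDerivAt_bp hc hτ).const_mul (r : ℂ)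
      exact (hPd τ).comp τ h1)
    (by
      have := i2.sub i1
      refine this.congr fun τ _ => ?_
      rw [← sub_mul])
  -- the end points of the arc are real, and so are the values of the primitive there
  have hreal' : ∀ x : ℝ, (∀ ρ ∈ uIcc 1 R, (ρ : ℂ) * ((r : ℂ) * x) ∈ U) → (P (r * x)).im = 0 := by
    intro x hx
    have : P (r * x) = ∫ ρ in (1 : ℝ)..R, (((r * x) * (g (ρ * (r * x))).re : ℝ) : ℂ) := by
      rw [hP]
      apply intervalIntegral.integral_congr
      intro ρ hρ
      have h1 := hreal (ρ * (r * x)) (by push_cast; exact hx ρ hρ)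
      have h2 := exists_ofReal h1
      push_cast at h2 ⊢
      rw [← h2]
    rw [this, intervalIntegral.integral_ofReal, Complex.ofReal_im]
  have e1 : (P (r * bp c₁ w)).im = 0 := by
    rw [bp_right hc]
    exact hreal' _ fun ρ hρ => by rw [← bp_right hc]; exact h _ ρ hρ
  have e2 : (P (r * bp c₁ (-w))).im = 0 := by
    rw [bp_left hc]
    exact hreal' _ fun ρ hρ => by rw [← bp_left hc]; exact h _ ρ hρ
  have e3 := congrArg Complex.im hFTC
  rw [Complex.sub_im, e1, e2, sub_zero] at e3
  have e4 : ∫ τ in (-w)..w, (R * g (R * (r * bp c₁ τ)) - g (r * bp c₁ τ)) * (r * dbp c₁ τ)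
      = (∫ τ in (-w)..w, (R * g (R * (r * bp c₁ τ))) * (r * dbp c₁ τ)) -
        ∫ τ in (-w)..w, g (r * bp c₁ τ) * (r * dbp c₁ τ) := by
    rw [← intervalIntegral.integral_sub i2 i1]
    congr 1
    ext τ
    ring
  rw [e4, Complex.sub_im] at e3
  linarith


/-! ### Limits of contour integrals -/

lemma ae_notMem_finset (F : Finset ℝ) : ∀ᵐ t : ℝ, t ∉ F := by
  have : volume (F : Set ℝ) = 0 := F.finite_toSet.measure_zero _
  exact measure_eq_zero_iff_ae_notMem.1 this

/-- Dominated convergence for the dilated curves, as the factor tends to `1` along `l`: the values of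
the integrals pass to the boundary function `f`. -/
lemma im_integral_limit (hc : 0 < c₁) {l : Filter ℝ} [l.IsCountablyGenerated] [l.NeBot]
    {g : ℂ → ℂ} {f : ℝ → ℂ} {F : Finset ℝ} {C κ : ℝ} (hF : ends c₁ ⊆ F) (hl : l ≤ 𝓝 1)
    (hf : Measurable f)
    (hcont : ∀ᶠ r : ℝ in l, Continuous fun τ => g (r * bp c₁ τ))
    (hval : ∀ᶠ r : ℝ in l, (∫ τ in (-radius c₁)..(radius c₁),
      g (r * bp c₁ τ) * (r * dbp c₁ τ)).im = κ)
    (hbd : ∀ᶠ r : ℝ in l, ∀ τ ∈ cut c₁, τ ∉ F →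
      ‖g (r * bp c₁ τ)‖ ≤ C * sing F τ ^ 2)
    (hlim : ∀ τ ∈ cut c₁, τ ∉ F →
      Tendsto (fun r : ℝ => g (r * bp c₁ τ) * dbp c₁ τ) l (𝓝 (f τ))) :
    IntervalIntegrable f volume (-radius c₁) (radius c₁) ∧
      ∫ τ in (-radius c₁)..(radius c₁), (f τ).im = κ := by
  set w := radius c₁ with hw
  have hw0 : 0 < w := radius_pos hc
  obtain ⟨D, hD, hdb⟩ := norm_dbp_le_sing hc
  have hmem : ∀ τ, τ ∈ uIoc (-w) w → τ ∉ F → τ ∈ Ioo (-w) w := by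
    intro τ h h2
    rw [uIoc_of_le (by linarith)] at h
    refine ⟨h.1, lt_of_le_of_ne h.2 fun h3 => h2 (hF ?_)⟩
    simp [ends, h3, hw]
  have hr2 : ∀ᶠ r : ℝ in l, ‖(r : ℂ)‖ ≤ 2 := by
    have : ∀ᶠ r : ℝ in 𝓝 1, |r| < 2 :=
      (continuous_abs.tendsto (1 : ℝ)).eventually_lt_const (by norm_num)
    filter_upwards [hl this] with r hr
    rw [Complex.norm_real, Real.norm_eq_abs]
    exact hr.le
  have h1 : Tendsto (fun r : ℝ => ∫ τ in (-w)..w, g (r * bp c₁ τ) * (r * dbp c₁ τ)) l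
      (𝓝 (∫ τ in (-w)..w, f τ)) := by
    apply intervalIntegral.tendsto_integral_filter_of_dominated_convergence
      (bound := fun τ => (2 * |C| * D) * sing F τ ^ 6)
    · filter_upwards [hcont] with r hr
      exact (hr.measurable.mul ((measurable_dbp hc).const_mul _)).aestronglyMeasurable
    · filter_upwards [hbd, hr2] with r h1 h2
      filter_upwards [ae_notMem_finset F] with τ h3 h4
      have hτ := hmem τ h4 h3
      rw [norm_mul, norm_mul]
      have e1 := h1 τ hτ h3
      have e2 := hdb τ hτ
      have e3 := one_le_sing F τ
      have e4 := one_le_sing (ends c₁) τ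
      have e5 := sing_mono hF τ
      have e6 : C * sing F τ ^ 2 ≤ |C| * sing F τ ^ 2 := by gcongr; exact le_abs_self C
      calc _ ≤ (|C| * sing F τ ^ 2) * (2 * (D * sing F τ ^ 4)) := by
            gcongr
            · exact e1.trans e6
            · exact e2.trans (by gcongr)
        _ = _ := by ring
    · exact (intervalIntegrable_sing_pow F _ _).const_mul _
    · filter_upwards [ae_notMem_finset F] with τ h3 h4
      have e1 := hlim τ (hmem τ h4 h3) h3
      have e2 : Tendsto (fun r : ℝ => (r : ℂ)) l (𝓝 1) := by
        have := (Complex.continuous_ofReal.tendsto 1).mono_left hl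
        simpa using this
      have e3 := e2.mul e1
      rw [one_mul] at e3
      refine e3.congr fun r => ?_
      ring
  have h2 := (Complex.continuous_im.tendsto _).comp h1
  have h3 : Tendsto (Complex.im ∘ fun r : ℝ => ∫ τ in (-w)..w, g (r * bp c₁ τ) * (r * dbp c₁ τ)) l
      (𝓝 κ) := by
    refine tendsto_const_nhds.congr' ?_
    filter_upwards [hval] with r hr using hr.symm
  have h4 : IntervalIntegrable f volume (-w) w := by
    refine intervalIntegrable_of_le_sing (F := F) (C := |C| * D) (by linarith)
      hf.aestronglyMeasurable ?_
    filter_upwards [ae_notMem_finset F] with τ h3 h4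
    refine le_of_tendsto (hlim τ h4 h3).norm ?_
    filter_upwards [hbd] with r h1
    rw [norm_mul]
    have e1 := h1 τ h4 h3
    have e2 := hdb τ h4
    have e3 := one_le_sing F τ
    have e4 := one_le_sing (ends c₁) τ
    have e5 := sing_mono hF τ
    have e6 : C * sing F τ ^ 2 ≤ |C| * sing F τ ^ 2 := by gcongr; exact le_abs_self C
    calc _ ≤ (|C| * sing F τ ^ 2) * (D * sing F τ ^ 4) := by
          gcongr
          · exact e1.trans e6
          · exact e2.trans (by gcongr)
      _ = _ := by ring
  refine ⟨h4, ?_⟩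
  rw [← im_intervalIntegral h4]
  exact tendsto_nhds_unique h2 h3

lemma dd_le_norm_bp (hc : 0 < c₁) (τ : ℝ) : dd c₁ ≤ ‖bp c₁ τ‖ := by
  have := dd_le hc (bp_mem hc τ) (t := 0) (by norm_num)
  simpa using this

/-! ### Cauchy's theorem outside and inside the curve -/

/-- A point of the closed upper half plane, rotated by `-i`, lies in the slit plane unless it is
`0`. -/
lemma neg_I_mul_mem_slitPlane {z : ℂ} (h0 : z ≠ 0) (h : 0 ≤ z.im) :
    -I * z ∈ Complex.slitPlane := by
  rw [Complex.mem_slitPlane_iff]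
  have e1 : (-I * z).re = z.im := by simp
  have e2 : (-I * z).im = -z.re := by simp
  rw [e1, e2]
  rcases h.eq_or_lt with h1 | h1
  · right
    intro h2
    apply h0
    apply Complex.ext
    · simpa using h2
    · exact h1.symm
  · left; exact h1

lemma log_neg_I_mul_pos {x : ℝ} (hx : 0 < x) :
    (Complex.log (-I * x)).im = -(π / 2) := by
  rw [Complex.log_im, mul_comm, Complex.arg_real_mul _ hx]
  exact Complex.arg_neg_I

lemma log_neg_I_mul_neg {x : ℝ} (hx : x < 0) :
    (Complex.log (-I * x)).im = π / 2 := by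
  rw [Complex.log_im]
  have : -I * (x : ℂ) = ((-x : ℝ) : ℂ) * I := by push_cast; ring
  rw [this, Complex.arg_real_mul _ (by linarith)]
  exact Complex.arg_I

/-- `dt`-integral of a logarithmic derivative along the upper half of the curve. -/
lemma integral_dbp_div (hc : 0 < c₁) {x : ℝ} (hx : x ∈ Icc (-1 / 2 : ℝ) (1 / 2)) :
    (∫ τ in (-radius c₁)..(radius c₁), dbp c₁ τ / (bp c₁ τ - x)).im = -π := by
  set w := radius c₁ with hw
  have hw0 : 0 < w := radius_pos hc
  have hne : ∀ τ, bp c₁ τ - x ≠ 0 := fun τ h => bp_off hc τ x hx (by linear_combination -h)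
  have hsl : ∀ τ, -I * (bp c₁ τ - x) ∈ Complex.slitPlane := fun τ =>
    neg_I_mul_mem_slitPlane (hne τ) (by simpa using bp_im_nonneg hc τ)
  have hbc : Continuous fun τ => -I * (bp c₁ τ - x) :=
    continuous_const.mul ((continuous_bp hc).sub continuous_const)
  have hFTC := intervalIntegral.integral_eq_sub_of_hasDerivAt_of_le (a := -w) (b := w)
    (f := fun τ => Complex.log (-I * (bp c₁ τ - x)))
    (f' := fun τ => dbp c₁ τ / (bp c₁ τ - x))
    (by linarith) (hbc.clog hsl).continuousOn
    (fun τ hτ => by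
      have h1 : HasDerivAt (fun τ => -I * (bp c₁ τ - x)) (-I * dbp c₁ τ) τ :=
        ((hasDerivAt_bp hc hτ).sub_const _).const_mul _
      refine (h1.clog_real (hsl τ)).congr_deriv ?_
      rw [mul_div_mul_left _ _ (neg_ne_zero.2 Complex.I_ne_zero)])
    (by
      have : Continuous fun τ => (bp c₁ τ - x)⁻¹ :=
        ((continuous_bp hc).sub continuous_const).inv₀ hne
      exact (intervalIntegrable_dbp hc).mul_continuousOn this.continuousOn)
  rw [hFTC, Complex.sub_im, hw, bp_right hc, bp_left hc, ← Complex.ofReal_sub, ← Complex.ofReal_sub,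
    log_neg_I_mul_pos (by linarith [sB_gt hc, hx.2]),
    log_neg_I_mul_neg (by rw [sA_eq]; linarith [sB_gt hc, hx.1])]
  ring

/-- Residue at infinity, for functions in the exterior domain. -/
theorem im_integral_outer (hc : 0 < c₁) {g : ℂ → ℂ} (hg : DifferentiableOn ℂ g (Out c₁))
    (hreal : ∀ x : ℝ, (x : ℂ) ∈ Out c₁ → (g x).im = 0) {κ : ℝ}
    (hκ : Tendsto (fun s => s * g s) (Bornology.cobounded ℂ) (𝓝 (κ : ℂ))) {r : ℝ} (hr : 1 < r) :
    (∫ τ in (-radius c₁)..(radius c₁), g (r * bp c₁ τ) * (r * dbp c₁ τ)).im =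
      -π * κ := by
  set w := radius c₁ with hw
  have hw0 : 0 < w := radius_pos hc
  have hd := dd_pos hc
  have hmem : ∀ R : ℝ, 1 ≤ R → ∀ τ, (R : ℂ) * (r * bp c₁ τ) ∈ Out c₁ := by
    intro R hR τ
    rw [← mul_assoc, ← Complex.ofReal_mul]
    exact mul_bp_mem_Out hc (bp_mem hc τ) (by nlinarith)
  -- `s g(s)` times the logarithmic differential, on the curve dilated by `R`; then `R → ∞`
  have h1 : ∀ R : ℝ, 1 ≤ R →
      (∫ τ in (-w)..w, g (r * bp c₁ τ) * (r * dbp c₁ τ)).im =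
      (∫ τ in (-w)..w, ((R * (r * bp c₁ τ)) * g (R * (r * bp c₁ τ))) *
        (dbp c₁ τ / (bp c₁ τ - (0 : ℝ)))).im := by
    intro R hR
    rw [hw, im_integral_dilate hc (isOpen_Out c₁) hg (R := R) ?_ hreal]
    · congr 2
      ext τ
      have : bp c₁ τ ≠ 0 := norm_pos_iff.1 (hd.trans_le (dd_le_norm_bp hc τ))
      rw [Complex.ofReal_zero, sub_zero]
      field_simp
    · intro τ ρ hρ
      rw [uIcc_of_le hR] at hρ
      exact hmem ρ hρ.1 τ
  have hint : IntervalIntegrable (fun τ => dbp c₁ τ / (bp c₁ τ - (0 : ℝ))) volume (-w) w := by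
    have hne : ∀ τ, bp c₁ τ - (0 : ℝ) ≠ 0 := fun τ h =>
      bp_off hc τ 0 (by norm_num) (by linear_combination -h)
    have : Continuous fun τ => (bp c₁ τ - (0 : ℝ))⁻¹ :=
        ((continuous_bp hc).sub continuous_const).inv₀ hne
    exact (intervalIntegrable_dbp hc).mul_continuousOn this.continuousOn
  have hcob : ∀ τ, Tendsto (fun R : ℝ => (R : ℂ) * (r * bp c₁ τ)) atTop (Bornology.cobounded ℂ) := by
    intro τ
    rw [← tendsto_norm_atTop_iff_cobounded]
    have h2 : 0 < ‖(r : ℂ) * bp c₁ τ‖ := by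
      rw [norm_mul, Complex.norm_real, Real.norm_of_nonneg (by linarith)]
      have := dd_le_norm_bp hc τ
      exact mul_pos (by linarith) (by linarith)
    have h3 : Tendsto (fun R : ℝ => |R| * ‖(r : ℂ) * bp c₁ τ‖) atTop atTop :=
      tendsto_abs_atTop_atTop.atTop_mul_const h2
    exact h3.congr fun R => by rw [norm_mul (R : ℂ) _, Complex.norm_real, Real.norm_eq_abs]
  have h2 : Tendsto (fun R : ℝ => ∫ τ in (-w)..w, ((R * (r * bp c₁ τ)) * g (R * (r * bp c₁ τ))) *
        (dbp c₁ τ / (bp c₁ τ - (0 : ℝ)))) atTop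
      (𝓝 (∫ τ in (-w)..w, (κ : ℂ) * (dbp c₁ τ / (bp c₁ τ - (0 : ℝ))))) := by
    apply intervalIntegral.tendsto_integral_filter_of_dominated_convergence
      (bound := fun τ => (|κ| + 1) * ‖dbp c₁ τ / (bp c₁ τ - (0 : ℝ))‖)
    · filter_upwards [eventually_ge_atTop 1] with R hR
      have hcg : Continuous fun τ => g (R * (r * bp c₁ τ)) := by
        rw [← continuousOn_univ]
        have := continuous_bp hc
        exact hg.continuousOn.comp (by fun_prop) fun τ _ => hmem R hR τ
      have := continuous_bp hc
      have hm : Continuous fun τ => ((R : ℂ) * (r * bp c₁ τ)) * g (R * (r * bp c₁ τ)) :=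
        (continuous_const.mul (continuous_const.mul (continuous_bp hc))).mul hcg
      have h5 := hint.continuousOn_mul hm.continuousOn
      exact (intervalIntegrable_iff.1 h5).aestronglyMeasurable
    · have h3 : ∀ᶠ s in Bornology.cobounded ℂ, ‖s * g s‖ < |κ| + 1 := by
        have := (continuous_norm.tendsto _).comp hκ
        refine this.eventually_lt_const ?_
        rw [Complex.norm_real, Real.norm_eq_abs]
        linarith
      rw [← comap_norm_atTop, Filter.eventually_comap] at h3
      obtain ⟨S, hS⟩ := eventually_atTop.1 h3
      filter_upwards [eventually_ge_atTop (max 1 (S / dd c₁))] with R hR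
      refine .of_forall fun τ _ => ?_
      rw [norm_mul]
      gcongr
      refine (hS _ ?_ _ rfl).le
      rw [norm_mul, norm_mul, Complex.norm_real, Complex.norm_real,
        Real.norm_of_nonneg (by linarith [le_max_left 1 (S / dd c₁)]),
        Real.norm_of_nonneg (by linarith)]
      have e1 := dd_le_norm_bp hc τ
      have e2 : S ≤ R * dd c₁ := by
        rw [← div_le_iff₀ hd]; exact (le_max_right _ _).trans hR
      have e3 : 0 ≤ R := by linarith [le_max_left 1 (S / dd c₁)]
      calc S ≤ R * dd c₁ := e2
        _ ≤ R * (r * ‖bp c₁ τ‖) := by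
          gcongr
          nlinarith
    · exact hint.norm.const_mul _
    · refine .of_forall fun τ _ => ?_
      exact (hκ.comp (hcob τ)).mul_const _
  have h3 := (Complex.continuous_im.tendsto _).comp h2
  have h4 : Tendsto (Complex.im ∘ fun R : ℝ => ∫ τ in (-w)..w,
      ((R * (r * bp c₁ τ)) * g (R * (r * bp c₁ τ))) * (dbp c₁ τ / (bp c₁ τ - (0 : ℝ)))) atTop
      (𝓝 (∫ τ in (-w)..w, g (r * bp c₁ τ) * (r * dbp c₁ τ)).im) := by
    refine tendsto_const_nhds.congr' ?_
    filter_upwards [eventually_ge_atTop 1] with R hR using h1 R hR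
  rw [tendsto_nhds_unique h4 h3, intervalIntegral.integral_const_mul, Complex.im_ofReal_mul,
    integral_dbp_div hc (x := 0) (by norm_num)]
  ring

/-- Cauchy's theorem for the interior domain. -/
theorem im_integral_inner (hc : 0 < c₁) {g : ℂ → ℂ}
    (hg : DifferentiableOn ℂ g (Clo c₁)ᶜ)
    (hreal : ∀ x : ℝ, (x : ℂ) ∈ (Clo c₁)ᶜ → (g x).im = 0) {r : ℝ} (hr0 : 0 ≤ r) (hr : r < 1) :
    (∫ τ in (-radius c₁)..(radius c₁), g (r * bp c₁ τ) * (r * dbp c₁ τ)).im = 0 := by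
  rw [im_integral_dilate hc (isClosed_Clo hc).isOpen_compl hg (R := 0) ?_ hreal]
  · simp
  · intro τ ρ hρ
    rw [uIcc_of_ge zero_le_one] at hρ
    rw [← mul_assoc, ← Complex.ofReal_mul]
    exact mul_mem_In (bp_notMem_Out hc τ) (mul_nonneg hρ.1 hr0)
      (lt_of_le_of_lt (mul_le_of_le_one_left hr0 hρ.2) hr) hc


/-! ### The logarithmic kernel and its holomorphic extensions -/

/-- The kernel `log |(I₊(u) - I₋(x)) / (I₊(u) - I₊(x))|`, in the centred variables. -/
def Gk (c₁ u x : ℝ) : ℝ :=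
  log ‖(bp c₁ u - conj (bp c₁ x)) / (bp c₁ u - bp c₁ x)‖

/-- The holomorphic function of `s` in the exterior domain whose imaginary part is minus the
logarithmic kernel with pole `p`. -/
def Mo (p s : ℂ) : ℂ := I * Complex.log ((s - p) / (s - conj p))

/-- The holomorphic function of `s` in the interior domain whose imaginary part is the logarithmic
kernel with pole `p`; the branch is cut along the vertical rays from `p` and `conj p`. -/
def Mi (p s : ℂ) : ℂ :=
  π - I * (Complex.log (-I * (p - s)) - Complex.log (I * (conj p - s)))

lemma Mo_im (p s : ℂ) : (Mo p s).im = log ‖(s - p) / (s - conj p)‖ := by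
  simp [Mo, Complex.log_re]

lemma Mi_im (p s : ℂ) : (Mi p s).im = log ‖s - conj p‖ - log ‖s - p‖ := by
  rw [norm_sub_rev s, norm_sub_rev s p]
  simp [Mi, Complex.log_re]

lemma Mo_bp_im (c₁ u x : ℝ) : (Mo (bp c₁ x) (bp c₁ u)).im = -Gk c₁ u x := by
  rw [Mo_im, Gk, ← Real.log_inv, ← norm_inv, inv_div]

lemma Mi_bp_im (u x : ℝ) (h : bp c₁ u ≠ bp c₁ x) (h' : bp c₁ u ≠ conj (bp c₁ x)) :
    (Mi (bp c₁ x) (bp c₁ u)).im = Gk c₁ u x := by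
  rw [Mi_im, Gk, norm_div, Real.log_div (norm_ne_zero_iff.2 (sub_ne_zero.2 h'))
    (norm_ne_zero_iff.2 (sub_ne_zero.2 h))]

/-- A quotient lies in the slit plane if `0` is not on the segment between numerator and
denominator. -/
lemma div_mem_slitPlane {A B : ℂ} (hB : B ≠ 0) (h : ∀ k : ℝ, 0 ≤ k → A + k * B ≠ 0) :
    A / B ∈ Complex.slitPlane := by
  rw [Complex.mem_slitPlane_iff]
  by_contra! hle
  apply h (-(A / B).re) (by linarith [hle.1])
  have h1 : A / B = ((A / B).re : ℂ) := Complex.ext rfl (by simpa using hle.2)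
  have h2 : A = ((A / B).re : ℂ) * B := by rw [← h1]; field_simp
  push_cast
  linear_combination h2

lemma re_eq_of_segment {p s : ℂ} {k : ℝ} (hk : 0 ≤ k) (h : s - p + k * (s - conj p) = 0) :
    s.re = p.re ∧ |s.im| ≤ |p.im| := by
  have h1 := congrArg Complex.re h
  have h2 := congrArg Complex.im h
  simp at h1 h2
  have e1 : (1 + k) * (s.re - p.re) = 0 := by linarith
  have e2 : (1 + k) * s.im = (1 - k) * p.im := by linarith
  refine ⟨by rcases mul_eq_zero.1 e1 with h | h <;> linarith, ?_⟩
  have e3 : (1 + k) * |s.im| = |1 - k| * |p.im| := by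
    rw [← abs_mul, ← e2, abs_mul, abs_of_pos (by linarith : 0 < 1 + k)]
  have e4 : |1 - k| ≤ 1 + k := abs_le.2 ⟨by linarith, by linarith⟩
  have e5 : (1 + k) * |s.im| ≤ (1 + k) * |p.im| := by
    rw [e3]; gcongr
  exact le_of_mul_le_mul_left e5 (by linarith)

lemma slit_of_re_ne {p s : ℂ} (h : s.re ≠ p.re) :
    (s - p) / (s - conj p) ∈ Complex.slitPlane ∧ -I * (p - s) ∈ Complex.slitPlane ∧
      I * (conj p - s) ∈ Complex.slitPlane := by
  refine ⟨div_mem_slitPlane ?_ fun k hk h2 => h (re_eq_of_segment hk h2).1, ?_, ?_⟩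
  · intro h2
    have := congrArg Complex.re h2
    simp at this
    exact h (by linarith)
  · rw [Complex.mem_slitPlane_iff]
    right
    simp
    intro h2
    exact h (by linarith)
  · rw [Complex.mem_slitPlane_iff]
    right
    simp
    intro h2
    exact h (by linarith)

lemma slit_out (hc : 0 < c₁) (σ : ℝ) {s : ℂ} (hs : s ∈ Out c₁) :
    (s - bp c₁ σ) / (s - conj (bp c₁ σ)) ∈ Complex.slitPlane := by
  refine div_mem_slitPlane ?_ fun k hk h2 => ?_
  · intro h
    rw [sub_eq_zero.1 h] at hs
    have := hs.2
    rw [hfun_conj, hfun_bp hc] at this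
    exact this.false
  · obtain ⟨h3, h4⟩ := re_eq_of_segment hk h2
    have := hfun_vert hs.1 h3 h4
    rw [hfun_bp hc] at this
    linarith [hs.2]

lemma slit_in (hc : 0 < c₁) (σ : ℝ) {s : ℂ} (hs : s ∈ (Clo c₁)ᶜ) :
    -I * (bp c₁ σ - s) ∈ Complex.slitPlane ∧
      I * (conj (bp c₁ σ) - s) ∈ Complex.slitPlane := by
  have key : ¬ ((bp c₁ σ).re = s.re ∧ |(bp c₁ σ).im| ≤ |s.im|) := by
    rintro ⟨h1, h2⟩
    refine hs ⟨(bp_off hc σ).vert h1 h2, ?_⟩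
    rw [← hfun_bp hc σ]
    exact hfun_vert (bp_off hc σ) h1 h2
  have h0 := bp_im_nonneg hc σ
  constructor
  · rw [Complex.mem_slitPlane_iff]
    by_contra! h
    simp at h
    refine key ⟨by linarith [h.2], ?_⟩
    rw [abs_of_nonneg h0]
    exact (by linarith [h.1] : _ ≤ s.im).trans (le_abs_self _)
  · rw [Complex.mem_slitPlane_iff]
    by_contra! h
    simp at h
    refine key ⟨by linarith [h.2], ?_⟩
    rw [abs_of_nonneg h0]
    exact (by linarith [h.1] : _ ≤ -s.im).trans (neg_le_abs _)

lemma differentiableAt_Mo {p s : ℂ} (h : (s - p) / (s - conj p) ∈ Complex.slitPlane) :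
    DifferentiableAt ℂ (Mo p) s := by
  have hne : s - conj p ≠ 0 := by
    intro h2
    rw [h2, div_zero] at h
    exact Complex.slitPlane_ne_zero h rfl
  have h1 : DifferentiableAt ℂ (fun s => (s - p) / (s - conj p)) s :=
    (differentiableAt_id.sub_const _).div (differentiableAt_id.sub_const _) hne
  exact (h1.clog h).const_mul _

lemma differentiableAt_Mi {p s : ℂ} (h : -I * (p - s) ∈ Complex.slitPlane)
    (h' : I * (conj p - s) ∈ Complex.slitPlane) :
    DifferentiableAt ℂ (Mi p) s := by
  unfold Mi
  refine DifferentiableAt.const_sub (DifferentiableAt.const_mul (DifferentiableAt.sub ?_ ?_) _) _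
  · exact DifferentiableAt.clog (by fun_prop) h
  · exact DifferentiableAt.clog (by fun_prop) h'

lemma Mo_im_real {p : ℂ} (x : ℝ) : (Mo p x).im = 0 := by
  rw [Mo_im, norm_div]
  have : ‖(x : ℂ) - conj p‖ = ‖(x : ℂ) - p‖ := by
    rw [← Complex.norm_conj ((x : ℂ) - p)]; simp
  rw [this]
  by_cases h : ‖(x : ℂ) - p‖ = 0
  · simp [h]
  · rw [div_self h, Real.log_one]

lemma Mi_im_real {p : ℂ} (x : ℝ) : (Mi p x).im = 0 := by
  rw [Mi_im]
  have : ‖(x : ℂ) - conj p‖ = ‖(x : ℂ) - p‖ := by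
    rw [← Complex.norm_conj ((x : ℂ) - p)]; simp
  rw [this, sub_self]

/-- The jump relation between the two holomorphic functions, for points of the upper half plane at
different horizontal positions. -/
lemma Mo_add_Mi_re {p s : ℂ} (hp : 0 < p.im) (hs : 0 ≤ s.im) (h : s.re ≠ p.re) :
    (Mo p s).re + (Mi p s).re = if p.re < s.re then 2 * π else 0 := by
  obtain ⟨h1, h2, h3⟩ := slit_of_re_ne h
  set A := -I * (p - s) with hA
  set B := I * (conj p - s) with hB
  have hA0 := Complex.slitPlane_ne_zero h2
  have hB0 := Complex.slitPlane_ne_zero h3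
  have hBre : 0 < B.re := by simp [hB]; linarith
  have hBim : B.im = p.re - s.re := by simp [hB]
  have hAim : A.im = s.re - p.re := by simp [hA]
  have hq : (s - p) / (s - conj p) = -(A / B) := by
    have e1 : s - p = -I * A := by
      rw [hA]; linear_combination (s - p) * Complex.I_sq
    have e2 : s - conj p = I * B := by
      rw [hB]; linear_combination (s - conj p) * Complex.I_sq
    rw [e1, e2]
    field_simp
  have hBb := Complex.abs_arg_lt_pi_div_two_iff.2 (Or.inl hBre)
  rw [abs_lt] at hBb
  -- `log (-(A/B))` differs from `log A - log B` by `± iπ`, the sign depending on the side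
  have hlog : ∀ ε : ℝ, (ε = 1 ∨ ε = -1) → -π < Complex.arg A - Complex.arg B - ε * π →
      Complex.arg A - Complex.arg B - ε * π ≤ π →
      (Complex.log ((s - p) / (s - conj p))).im = Complex.arg A - Complex.arg B - ε * π := by
    intro ε hε g1 g2
    have e1 : Complex.exp (Complex.log A - Complex.log B - ε * π * I) =
        (s - p) / (s - conj p) := by
      rw [hq, Complex.exp_sub, Complex.exp_sub, Complex.exp_log hA0, Complex.exp_log hB0]
      have : Complex.exp (ε * π * I) = -1 := by
        rcases hε with rfl | rfl
        · simp
        · have : ((-1 : ℝ) : ℂ) * π * I = -(π * I) := by push_cast; ring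
          rw [this, Complex.exp_neg, Complex.exp_pi_mul_I]; norm_num
      rw [this, div_neg, div_one]
    have e2 : (Complex.log A - Complex.log B - ε * π * I).im =
        Complex.arg A - Complex.arg B - ε * π := by
      simp [Complex.log_im]
    rw [← e1, Complex.log_exp (by rw [e2]; exact g1) (by rw [e2]; exact g2), e2]
  have eMo : (Mo p s).re = -(Complex.log ((s - p) / (s - conj p))).im := by simp [Mo]
  have eMi : (Mi p s).re = π + Complex.arg A - Complex.arg B := by
    simp only [Mi, ← hA, ← hB]
    simp [Complex.log_im]
    ring
  have hpi := Real.pi_pos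
  split_ifs with hlt
  · have a1 : 0 ≤ Complex.arg A := Complex.arg_nonneg_iff.2 (by linarith)
    have a2 := Complex.arg_le_pi A
    have b1 : Complex.arg B < 0 := Complex.arg_neg_iff.2 (by linarith)
    rw [eMo, eMi, hlog 1 (Or.inl rfl) (by linarith) (by linarith)]
    ring
  · have hgt : s.re < p.re := lt_of_le_of_ne (not_lt.1 hlt) h
    have a1 : Complex.arg A < 0 := Complex.arg_neg_iff.2 (by linarith)
    have a2 := Complex.neg_pi_lt_arg A
    have b1 : 0 ≤ Complex.arg B := Complex.arg_nonneg_iff.2 (by linarith)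
    rw [eMo, eMi, hlog (-1) (Or.inr rfl) (by linarith) (by linarith)]
    ring

lemma bp_re_ne (hc : 0 < c₁) {τ σ : ℝ} (hτ : τ ∈ Icc (-radius c₁) (radius c₁))
    (hσ : σ ∈ Icc (-radius c₁) (radius c₁)) (h : τ ≠ σ) : (bp c₁ τ).re ≠ (bp c₁ σ).re :=
  fun h2 => h ((strictMonoOn_bp_re hc).injOn hτ hσ h2)

lemma exp_sub_one_lower {z : ℂ} (hz : |z.im| ≤ 1) :
    2 / π * exp (-|z.re|) * ‖z‖ ≤ ‖Complex.exp z - 1‖ := by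
  have hpi := Real.pi_gt_three
  have e0 : ‖Complex.exp z - 1‖ ^ 2 =
      (exp z.re - 1) ^ 2 + 2 * exp z.re * (1 - Real.cos z.im) := by
    rw [← Complex.normSq_eq_norm_sq, Complex.normSq_apply]
    simp only [Complex.sub_re, Complex.sub_im, Complex.exp_re, Complex.exp_im, Complex.one_re,
      Complex.one_im]
    linear_combination exp z.re ^ 2 * Real.sin_sq_add_cos_sq z.im
  have e1 : z.re ^ 2 * exp (-|z.re|) ^ 2 ≤ (exp z.re - 1) ^ 2 := by
    rw [← mul_pow, sq_le_sq, abs_mul, abs_of_pos (Real.exp_pos _)]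
    rcases le_total 0 z.re with h | h
    · rw [abs_of_nonneg h]
      have h1 := Real.add_one_le_exp z.re
      have h2 : exp (-z.re) ≤ 1 := Real.exp_le_one_iff.2 (by linarith)
      rw [abs_of_nonneg (by linarith)]
      nlinarith [Real.exp_pos (-z.re)]
    · rw [abs_of_nonpos h, neg_neg]
      have h1 := Real.add_one_le_exp (-z.re)
      have h2 : exp z.re ≤ 1 := Real.exp_le_one_iff.2 h
      rw [abs_of_nonpos (by linarith)]
      have h3 : exp z.re * exp (-z.re) = 1 := by rw [← Real.exp_add]; simp
      nlinarith [Real.exp_pos (z.re)]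
  have e2 : exp (-|z.re|) ^ 2 ≤ exp z.re := by
    rw [← Real.exp_nat_mul]
    apply Real.exp_le_exp.2
    push_cast
    have := neg_abs_le z.re
    have := abs_nonneg z.re
    linarith
  have e3 : 2 / π ^ 2 * z.im ^ 2 ≤ 1 - Real.cos z.im := by
    have := Real.cos_le_one_sub_mul_cos_sq (x := z.im) (by linarith)
    linarith
  have e4 : 2 * (exp (-|z.re|) ^ 2) * (2 / π ^ 2 * z.im ^ 2) ≤
      2 * exp z.re * (1 - Real.cos z.im) := by gcongr
  have e5 : 4 / π ^ 2 ≤ 1 := by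
    rw [div_le_one (by positivity)]; nlinarith
  have hn : ‖z‖ ^ 2 = z.re ^ 2 + z.im ^ 2 := by
    rw [← Complex.normSq_eq_norm_sq, Complex.normSq_apply]; ring
  refine le_of_sq_le_sq ?_ (norm_nonneg _)
  rw [mul_pow, mul_pow, hn, e0, div_pow]
  have e6 : 4 / π ^ 2 * (z.re ^ 2 * exp (-|z.re|) ^ 2) ≤
      1 * (z.re ^ 2 * exp (-|z.re|) ^ 2) := by gcongr
  calc _ = 4 / π ^ 2 * (z.re ^ 2 * exp (-|z.re|) ^ 2) +
        2 * (exp (-|z.re|) ^ 2) * (2 / π ^ 2 * z.im ^ 2) := by ring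
    _ ≤ _ := by linarith

/-- Boundary values of the logarithm from above. -/
lemma tendsto_log_of_im_nonneg {α : Type*} {l : Filter α} {f : α → ℂ} {y : ℝ} (hy : y ≠ 0)
    (hf : Tendsto f l (𝓝 (y : ℂ))) (him : ∀ᶠ a in l, 0 ≤ (f a).im) :
    Tendsto (fun a => Complex.log (f a)) l
      (𝓝 (log |y| + (if y < 0 then π else 0 : ℝ) * I)) := by
  rcases lt_or_gt_of_ne hy with h | h
  · rw [if_pos h]
    have := Complex.continuousWithinAt_log_of_re_neg_of_im_zero (z := (y : ℂ)) (by simpa using h)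
      (by simp)
    have h2 := this.tendsto.comp (tendsto_nhdsWithin_iff.2 ⟨hf, him⟩)
    convert h2 using 1
    congr 1
    rw [Complex.log, Complex.arg_ofReal_of_neg h, Complex.norm_real, Real.norm_eq_abs]
  · rw [if_neg (not_lt.2 h.le)]
    have := (continuousAt_clog (x := (y : ℂ)) (by simp [h])).tendsto.comp hf
    convert this using 1
    congr 1
    rw [← Complex.ofReal_log h.le, abs_of_pos h]
    simp

/-- Boundary values of the logarithm from below. -/
lemma tendsto_log_of_im_neg {α : Type*} {l : Filter α} {f : α → ℂ} {y : ℝ} (hy : y ≠ 0)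
    (hf : Tendsto f l (𝓝 (y : ℂ))) (him : ∀ᶠ a in l, (f a).im < 0) :
    Tendsto (fun a => Complex.log (f a)) l
      (𝓝 (log |y| + (if y < 0 then -π else 0 : ℝ) * I)) := by
  rcases lt_or_gt_of_ne hy with h | h
  · rw [if_pos h]
    have := Complex.tendsto_log_nhdsWithin_im_neg_of_re_neg_of_im_zero (z := (y : ℂ))
      (by simpa using h) (by simp)
    have h2 := this.comp (tendsto_nhdsWithin_iff.2 ⟨hf, him⟩)
    convert h2 using 1
    congr 1
    rw [Complex.norm_real, Real.norm_eq_abs]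
    push_cast
    ring_nf
  · rw [if_neg (not_lt.2 h.le)]
    have := (continuousAt_clog (x := (y : ℂ)) (by simp [h])).tendsto.comp hf
    convert this using 1
    congr 1
    rw [← Complex.ofReal_log h.le, abs_of_pos h]
    simp

lemma im_div_sub {z : ℂ} (a b : ℝ) :
    ((z - a) / (z - b)).im = z.im * (a - b) / Complex.normSq (z - b) := by
  rw [Complex.div_im]
  simp
  ring


/-- The derivative of `J`. -/
def dJ (c₁ : ℝ) (s : ℂ) : ℂ := c₁ - 1 / (s ^ 2 - 1 / 4)

lemma Off.differentiableAt_dJ {s : ℂ} (h : Off s) : DifferentiableAt ℂ (dJ c₁) s := by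
  have h1 : DifferentiableAt ℂ (fun s : ℂ => 1 / (s ^ 2 - 1 / 4)) s :=
    (differentiableAt_const _).div (by fun_prop) h.sq_ne
  exact h1.const_sub _

lemma dJ_mul_dbp (hc : 0 < c₁) {τ : ℝ} (hτ : τ ∈ cut c₁) :
    dJ c₁ (bp c₁ τ) * dbp c₁ τ = 1 := by
  unfold dJ dbp
  exact mul_inv_cancel₀ (deriv_J_bp_ne hc hτ)

lemma dJ_im_real (c₁ x : ℝ) : (dJ c₁ x).im = 0 := by
  have : dJ c₁ x = ((c₁ - 1 / (x ^ 2 - 1 / 4) : ℝ) : ℂ) := by unfold dJ; push_cast; ring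
  rw [this, Complex.ofReal_im]

lemma dilate_im_nonneg (hc : 0 < c₁) {r : ℝ} (hr : 0 ≤ r) (τ : ℝ) :
    0 ≤ ((r : ℂ) * bp c₁ τ).im := by
  rw [Complex.im_ofReal_mul]
  exact mul_nonneg hr (bp_im_nonneg hc τ)

/-- Uniform logarithmic bounds on the dilated curves. -/
lemma exists_log_bounds (hc : 0 < c₁) {σ : ℝ}
    (hσ : σ ∈ cut c₁) {F : Finset ℝ} (hF : σ ∈ F) :
    ∃ C > 0, ∃ δ > 0, δ ≤ 1 / 2 ∧ ∀ r : ℝ, |r - 1| ≤ δ →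
      ∀ τ ∈ cut c₁, τ ∉ F →
      |log ‖r * bp c₁ τ - bp c₁ σ‖| ≤ C * sing F τ ∧
      |log ‖r * bp c₁ τ - conj (bp c₁ σ)‖| ≤ C * sing F τ ∧
      |log ‖J c₁ 0 (r * bp c₁ τ) - σ‖| ≤ C * sing F τ ∧
      |log ‖Complex.exp (J c₁ 0 (r * bp c₁ τ)) - Complex.exp σ‖| ≤ C * sing F τ := by
  set w := radius c₁ with hw
  obtain ⟨κ, hκ, δ₁, hδ₁, h1⟩ := exists_dist_dilated hc
  obtain ⟨κ', hκ', δ₂, hδ₂, h2⟩ := exists_J_lower hc hσ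
  obtain ⟨D, hD, δ₃, hδ₃, h3⟩ := exists_J_dilated hc
  set R := 1 / 2 + 1 / √c₁ with hR
  have hR0 : 0 < R := by positivity
  have hw0 : 0 < w := radius_pos hc
  -- `m` comes from the lower bound for `|e^z - 1|` with `|Im z| ≤ 1`
  set m := 2 / π * exp (-(2 * w + 1)) * exp (-w) with hm
  have hm0 : 0 < m := by have := Real.pi_pos; positivity
  set C₁ := |log κ| + |log (3 * R)| + 8 with hC₁
  set C₂ := |log (κ' * κ)| + |log (2 * w + 1)| + 8 with hC₂
  set C₃ := |log (m * (κ' * κ))| + |log (2 * exp (w + 1))| + 8 with hC₃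
  have hC₁0 : 0 < C₁ := by positivity
  have hC₂0 : 0 < C₂ := by positivity
  have hC₃0 : 0 < C₃ := by positivity
  refine ⟨C₁ + C₂ + C₃, by positivity, min (min δ₁ δ₂) (min (min δ₃ (1 / D)) (1 / 2)),
    by positivity, (min_le_right _ _).trans (min_le_right _ _), fun r hr τ hτ hτF => ?_⟩
  have r1 : |r - 1| ≤ δ₁ := hr.trans ((min_le_left _ _).trans (min_le_left _ _))
  have r2 : |r - 1| ≤ δ₂ := hr.trans ((min_le_left _ _).trans (min_le_right _ _))
  have r3 : |r - 1| ≤ δ₃ :=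
    hr.trans ((min_le_right _ _).trans ((min_le_left _ _).trans (min_le_left _ _)))
  have r4 : D * |r - 1| ≤ 1 := by
    have : |r - 1| ≤ 1 / D :=
      hr.trans ((min_le_right _ _).trans ((min_le_left _ _).trans (min_le_right _ _)))
    rw [le_div_iff₀ hD] at this
    linarith
  have r5 : |r - 1| ≤ 1 / 2 := hr.trans ((min_le_right _ _).trans (min_le_right _ _))
  have hr0 : 0 ≤ r := by linarith [(abs_le.1 r5).1]
  have hr2 : r ≤ 2 := by linarith [(abs_le.1 r5).2]
  have hne : τ ≠ σ := fun h => hτF (h ▸ hF)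
  have hτ' := Ioo_subset_Icc_self hτ
  have hσ' := Ioo_subset_Icc_self hσ
  have hs := one_le_sing F τ
  have nb : ‖(r : ℂ) * bp c₁ τ‖ ≤ 2 * R := by
    rw [norm_mul, Complex.norm_real, Real.norm_of_nonneg hr0]
    have := norm_bp_le hc τ
    gcongr
  have d1 := h1 r r1 τ hτ' σ hσ'
  have him := dilate_im_nonneg hc hr0 τ
  have d2 := norm_sub_le_conj him (bp_im_nonneg hc σ)
  have u1 : ‖(r : ℂ) * bp c₁ τ - bp c₁ σ‖ ≤ 3 * R :=
    (norm_sub_le _ _).trans (by linarith [norm_bp_le hc σ])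
  have u2 : ‖(r : ℂ) * bp c₁ τ - conj (bp c₁ σ)‖ ≤ 3 * R :=
    (norm_sub_le _ _).trans (by rw [Complex.norm_conj]; linarith [norm_bp_le hc σ])
  have g1 := h2 r r2 τ hτ'
  have d3 : κ' * κ * |τ - σ| ≤ ‖J c₁ 0 (r * bp c₁ τ) - σ‖ := by
    refine le_trans ?_ g1
    rw [mul_assoc]
    gcongr
  have g2 := (h3 r r3 τ hτ').2
  have g3 : ‖J c₁ 0 (r * bp c₁ τ) - τ‖ ≤ 1 := g2.trans r4
  have g4 : ‖J c₁ 0 (r * bp c₁ τ) - σ‖ ≤ 2 * w + 1 := by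
    have e : J c₁ 0 (r * bp c₁ τ) - σ = (J c₁ 0 (r * bp c₁ τ) - τ) + ((τ - σ : ℝ) : ℂ) := by
      push_cast; ring
    rw [e]
    refine (norm_add_le _ _).trans ?_
    rw [Complex.norm_real, Real.norm_eq_abs]
    have : |τ - σ| ≤ 2 * w := abs_le.2 ⟨by linarith [hτ.1, hσ.2], by linarith [hτ.2, hσ.1]⟩
    linarith
  set z := J c₁ 0 (r * bp c₁ τ) with hz
  have zim : |(z - σ).im| ≤ 1 := by
    have := Complex.abs_im_le_norm (z - τ)
    have e : (z - (σ : ℂ)).im = (z - (τ : ℂ)).im := by simp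
    rw [e]
    linarith
  have zre : z.re ≤ w + 1 := by
    have := (Complex.re_le_norm (z - τ)).trans g3
    simp at this
    linarith [hτ.2]
  have ez : Complex.exp z - Complex.exp σ = Complex.exp σ * (Complex.exp (z - σ) - 1) := by
    rw [mul_sub, ← Complex.exp_add]
    congr 2 <;> ring
  have d4 : m * (κ' * κ) * |τ - σ| ≤ ‖Complex.exp z - Complex.exp σ‖ := by
    rw [ez, norm_mul, Complex.norm_exp, Complex.ofReal_re]
    have e1 := exp_sub_one_lower zim
    have e2 : exp (-w) ≤ exp σ := Real.exp_le_exp.2 (by linarith [hσ.1])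
    have e3 : exp (-(2 * w + 1)) ≤ exp (-|(z - σ).re|) :=
      Real.exp_le_exp.2 (by linarith [(Complex.abs_re_le_norm (z - σ))])
    have hpi := Real.pi_pos
    calc m * (κ' * κ) * |τ - σ| =
        exp (-w) * (2 / π * exp (-(2 * w + 1)) * (κ' * κ * |τ - σ|)) := by
          rw [hm]; ring
      _ ≤ exp σ * (2 / π * exp (-|(z - σ).re|) * ‖z - σ‖) := by gcongr
      _ ≤ _ := by gcongr
  have u4 : ‖Complex.exp z - Complex.exp σ‖ ≤ 2 * exp (w + 1) := by
    refine (norm_sub_le _ _).trans ?_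
    rw [Complex.norm_exp, Complex.norm_exp, Complex.ofReal_re]
    have e1 : exp z.re ≤ exp (w + 1) := Real.exp_le_exp.2 zre
    have e2 : exp σ ≤ exp (w + 1) := Real.exp_le_exp.2 (by linarith [hσ.2])
    linarith
  have b1 := abs_log_le_sing hF hκ τ _ hne d1 u1
  have b2 := abs_log_le_sing hF hκ τ _ hne (d1.trans d2) u2
  have b3 := abs_log_le_sing hF (by positivity : 0 < κ' * κ) τ _ hne d3 g4
  have b4 := abs_log_le_sing hF (by positivity : 0 < m * (κ' * κ)) τ _ hne d4 u4
  refine ⟨b1.trans ?_, b2.trans ?_, b3.trans ?_, b4.trans ?_⟩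
  all_goals
    exact mul_le_mul_of_nonneg_right (by linarith) (by linarith)

lemma exists_dJ_bound (hc : 0 < c₁) :
    ∃ C > 0, ∃ δ > 0, ∀ r : ℝ, |r - 1| ≤ δ → ∀ τ, Off (r * bp c₁ τ) ∧
      ‖dJ c₁ (r * bp c₁ τ)‖ ≤ C := by
  obtain ⟨δ, hδ, d, hd, hδ2, hdist⟩ := exists_dilation hc
  refine ⟨c₁ + d⁻¹ ^ 2, by positivity, δ, hδ, fun r hr τ => ?_⟩
  have o := off_of_dist hd (hdist r hr τ)
  refine ⟨o, ?_⟩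
  rw [dJ, ← o.kk_self]
  refine (norm_sub_le _ _).trans ?_
  rw [Complex.norm_real, Real.norm_of_nonneg hc.le]
  gcongr
  exact norm_kk_le_of_dist hd (hdist r hr τ) (hdist r hr τ)

lemma tendsto_dilate (c₁ τ : ℝ) {l : Filter ℝ} (hl : l ≤ 𝓝 1) :
    Tendsto (fun r : ℝ => (r : ℂ) * bp c₁ τ) l (𝓝 (bp c₁ τ)) := by
  have h1 : Tendsto (fun r : ℝ => (r : ℂ) * bp c₁ τ) (𝓝 1) (𝓝 (((1 : ℝ) : ℂ) * bp c₁ τ)) :=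
    ((Complex.continuous_ofReal.mul continuous_const).tendsto 1)
  rw [Complex.ofReal_one, one_mul] at h1
  exact h1.mono_left hl

lemma tendsto_dJ_dilate (hc : 0 < c₁) {τ : ℝ}
    (hτ : τ ∈ cut c₁) {l : Filter ℝ} (hl : l ≤ 𝓝 1) :
    Tendsto (fun r : ℝ => dJ c₁ (r * bp c₁ τ) * dbp c₁ τ) l (𝓝 1) := by
  rw [← dJ_mul_dbp hc hτ]
  exact ((bp_off hc τ).differentiableAt_dJ.continuousAt.tendsto.comp
    (tendsto_dilate c₁ τ hl)).mul_const _

lemma tendsto_J_dilate (hc : 0 < c₁) {τ : ℝ}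
    (hτ : τ ∈ cut c₁) {l : Filter ℝ} (hl : l ≤ 𝓝 1) :
    Tendsto (fun r : ℝ => J c₁ 0 (r * bp c₁ τ)) l (𝓝 (τ : ℂ)) := by
  rw [← J_bp hc (Ioo_subset_Icc_self hτ)]
  exact (bp_off hc τ).continuousAt_J.tendsto.comp (tendsto_dilate c₁ τ hl)

lemma norm_clog_div_le {A B : ℂ} {M : ℝ} (hA : A ≠ 0) (hB : B ≠ 0) (h : |log ‖A‖| ≤ M)
    (h' : |log ‖B‖| ≤ M) : ‖Complex.log (A / B)‖ ≤ 2 * M + π := by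
  refine (norm_clog_le _).trans ?_
  rw [norm_div, Real.log_div (norm_ne_zero_iff.2 hA) (norm_ne_zero_iff.2 hB)]
  have := abs_sub (log ‖A‖) (log ‖B‖)
  linarith

lemma norm_clog_div_le' {A B : ℂ} {M : ℝ} (hM : 0 ≤ M) (h : |log ‖A‖| ≤ M)
    (h' : |log ‖B‖| ≤ M) : ‖Complex.log (A / B)‖ ≤ 2 * M + π := by
  by_cases hA : A = 0
  · simp [hA]; positivity
  by_cases hB : B = 0
  · simp [hB]; positivity
  exact norm_clog_div_le hA hB h h'

lemma norm_Mo_le {p s : ℂ} {M : ℝ} (hM : 0 ≤ M) (h : |log ‖s - p‖| ≤ M)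
    (h' : |log ‖s - conj p‖| ≤ M) : ‖Mo p s‖ ≤ 2 * M + π := by
  rw [Mo, norm_mul, Complex.norm_I, one_mul]
  exact norm_clog_div_le' hM h h'

lemma norm_Mi_le {p s : ℂ} {M : ℝ} (h : |log ‖s - p‖| ≤ M)
    (h' : |log ‖s - conj p‖| ≤ M) : ‖Mi p s‖ ≤ 2 * M + 3 * π := by
  rw [Mi]
  refine (norm_sub_le _ _).trans ?_
  rw [norm_mul, Complex.norm_I, one_mul, Complex.norm_real, Real.norm_of_nonneg Real.pi_pos.le]
  have h1 := norm_clog_le (-I * (p - s))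
  have h2 := norm_clog_le (I * (conj p - s))
  have e1 : ‖-I * (p - s)‖ = ‖s - p‖ := by
    rw [norm_mul, norm_neg, Complex.norm_I, one_mul, norm_sub_rev]
  have e2 : ‖I * (conj p - s)‖ = ‖s - conj p‖ := by
    rw [norm_mul, Complex.norm_I, one_mul, norm_sub_rev]
  rw [e1] at h1
  rw [e2] at h2
  have := norm_sub_le (Complex.log (-I * (p - s))) (Complex.log (I * (conj p - s)))
  linarith

lemma differentiableOn_Mo (hc : 0 < c₁) (σ : ℝ) :
    DifferentiableOn ℂ (Mo (bp c₁ σ)) (Out c₁) := fun _ hs =>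
  (differentiableAt_Mo (slit_out hc σ hs)).differentiableWithinAt

lemma differentiableOn_Mi (hc : 0 < c₁) (σ : ℝ) :
    DifferentiableOn ℂ (Mi (bp c₁ σ)) (Clo c₁)ᶜ := fun _ hs =>
  (differentiableAt_Mi (slit_in hc σ hs).1 (slit_in hc σ hs).2).differentiableWithinAt

lemma tendsto_log_one_add_mul {f : ℂ → ℂ} {κ : ℂ} {l : Filter ℂ} (hf : Tendsto f l (𝓝 0))
    (h : Tendsto (fun s => s * f s) l (𝓝 κ)) (hne : ∀ᶠ s in l, f s ≠ 0) :
    Tendsto (fun s => s * Complex.log (1 + f s)) l (𝓝 κ) := by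
  have h1 : HasDerivAt Complex.log 1 1 := by
    simpa using Complex.hasDerivAt_log (z := 1) (by simp)
  have h2 := (hasDerivAt_iff_tendsto_slope_zero.1 h1).comp
    (tendsto_nhdsWithin_iff.2 ⟨hf, hne⟩)
  have h3 := h.mul h2
  rw [mul_one] at h3
  refine h3.congr' ?_
  filter_upwards [hne] with s hs
  simp
  field_simp

lemma tendsto_mul_Mo {p : ℂ} (hp : 0 < p.im) :
    Tendsto (fun s => s * Mo p s) (Bornology.cobounded ℂ) (𝓝 ((2 * p.im : ℝ) : ℂ)) := by
  have hq : conj p - p = -(2 * p.im : ℝ) * I := by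
    apply Complex.ext <;> simp; ring
  have hq0 : conj p - p ≠ 0 := by
    intro h
    have := congrArg Complex.im h
    simp at this
    linarith
  have hinv : Tendsto (fun s => (s - conj p)⁻¹) (Bornology.cobounded ℂ) (𝓝 0) :=
    tendsto_inv₀_cobounded.comp (tendsto_sub_const_cobounded (conj p))
  have hz : Tendsto (fun s => (conj p - p) * (s - conj p)⁻¹) (Bornology.cobounded ℂ) (𝓝 0) := by
    simpa using hinv.const_mul (conj p - p)
  have hev : ∀ᶠ s in Bornology.cobounded ℂ, s - conj p ≠ 0 :=
    (tendsto_sub_const_cobounded (conj p)).eventually_ne_cobounded 0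
  have hs : Tendsto (fun s => s * ((conj p - p) * (s - conj p)⁻¹)) (Bornology.cobounded ℂ)
      (𝓝 (conj p - p)) := by
    have h1 : Tendsto (fun s => (conj p - p) * (1 + conj p * (s - conj p)⁻¹))
        (Bornology.cobounded ℂ) (𝓝 ((conj p - p) * (1 + conj p * 0))) :=
      (tendsto_const_nhds.add (hinv.const_mul _)).const_mul _
    rw [mul_zero, add_zero, mul_one] at h1
    refine h1.congr' ?_
    filter_upwards [hev] with s hs
    field_simp
    ring
  have h3 := tendsto_log_one_add_mul hz hs (by
    filter_upwards [hev] with s hs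
    exact mul_ne_zero hq0 (inv_ne_zero hs))
  have h4 := h3.const_mul I
  have e : I * (conj p - p) = ((2 * p.im : ℝ) : ℂ) := by
    rw [hq]; linear_combination (-(2 * p.im : ℝ) : ℂ) * Complex.I_sq
  rw [e] at h4
  refine h4.congr' ?_
  filter_upwards [hev] with s hs
  rw [Mo]
  have : 1 + (conj p - p) * (s - conj p)⁻¹ = (s - p) / (s - conj p) := by
    field_simp
    ring
  rw [this]
  ring

lemma tendsto_dJ (c₁ : ℝ) : Tendsto (dJ c₁) (Bornology.cobounded ℂ) (𝓝 (c₁ : ℂ)) := by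
  have h1 : Tendsto (fun s : ℂ => (s - 1 / 2)⁻¹) (Bornology.cobounded ℂ) (𝓝 0) :=
    tendsto_inv₀_cobounded.comp (tendsto_sub_const_cobounded _)
  have h2 : Tendsto (fun s : ℂ => (s + 1 / 2)⁻¹) (Bornology.cobounded ℂ) (𝓝 0) :=
    tendsto_inv₀_cobounded.comp (tendsto_add_const_cobounded _)
  have h3 := (h1.mul h2).const_sub (c₁ : ℂ)
  rw [mul_zero, sub_zero] at h3
  refine h3.congr fun s => ?_
  rw [dJ, ← mul_inv, one_div]
  congr 2
  ring


lemma ends_subset_insert (c₁ : ℝ) (F : Finset ℝ) : ends c₁ ⊆ ends c₁ ∪ F := Finset.subset_union_left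

lemma measurable_Mo (p : ℂ) : Measurable (Mo p) := by
  unfold Mo
  exact (Complex.measurable_log.comp (by fun_prop)).const_mul _

lemma measurable_Mi (p : ℂ) : Measurable (Mi p) := by
  unfold Mi
  exact (((Complex.measurable_log.comp (by fun_prop)).sub
    (Complex.measurable_log.comp (by fun_prop))).const_mul _).const_sub _

lemma tendsto_Mo_dilate (hc : 0 < c₁) {τ σ : ℝ}
    (hτ : τ ∈ cut c₁) (hσ : σ ∈ cut c₁)
    (h : τ ≠ σ) {l : Filter ℝ} (hl : l ≤ 𝓝 1) :
    Tendsto (fun r : ℝ => Mo (bp c₁ σ) (r * bp c₁ τ)) l (𝓝 (Mo (bp c₁ σ) (bp c₁ τ))) := by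
  have h1 := slit_of_re_ne (bp_re_ne hc (Ioo_subset_Icc_self hτ) (Ioo_subset_Icc_self hσ) h)
  exact (differentiableAt_Mo h1.1).continuousAt.tendsto.comp (tendsto_dilate c₁ τ hl)

lemma tendsto_Mi_dilate (hc : 0 < c₁) {τ σ : ℝ}
    (hτ : τ ∈ cut c₁) (hσ : σ ∈ cut c₁)
    (h : τ ≠ σ) {l : Filter ℝ} (hl : l ≤ 𝓝 1) :
    Tendsto (fun r : ℝ => Mi (bp c₁ σ) (r * bp c₁ τ)) l (𝓝 (Mi (bp c₁ σ) (bp c₁ τ))) := by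
  have h1 := slit_of_re_ne (bp_re_ne hc (Ioo_subset_Icc_self hτ) (Ioo_subset_Icc_self hσ) h)
  exact (differentiableAt_Mi h1.2.1 h1.2.2).continuousAt.tendsto.comp (tendsto_dilate c₁ τ hl)

lemma continuous_dilate_outer (hc : 0 < c₁) {g : ℂ → ℂ}
    (hg : DifferentiableOn ℂ g (Out c₁)) :
    ∀ᶠ r : ℝ in 𝓝[>] 1, Continuous fun τ => g (r * bp c₁ τ) := by
  filter_upwards [self_mem_nhdsWithin] with r hr
  rw [← continuousOn_univ]
  exact hg.continuousOn.comp (continuous_const.mul (continuous_bp hc)).continuousOn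
    fun τ _ => mul_bp_mem_Out hc (bp_mem hc τ) hr

lemma continuous_dilate_inner (hc : 0 < c₁) {g : ℂ → ℂ}
    (hg : DifferentiableOn ℂ g (Clo c₁)ᶜ) :
    ∀ᶠ r : ℝ in 𝓝[<] 1, Continuous fun τ => g (r * bp c₁ τ) := by
  have h0 : ∀ᶠ r : ℝ in 𝓝[<] 1, 0 < r :=
    nhdsWithin_le_nhds (eventually_gt_nhds (by norm_num))
  filter_upwards [self_mem_nhdsWithin, h0] with r hr hr0
  rw [← continuousOn_univ]
  exact hg.continuousOn.comp (continuous_const.mul (continuous_bp hc)).continuousOn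
    fun τ _ => mul_mem_In (bp_notMem_Out hc τ) hr0.le hr hc

lemma eventually_abs_sub_one {l : Filter ℝ} (hl : l ≤ 𝓝 1) {δ : ℝ} (hδ : 0 < δ) :
    ∀ᶠ r : ℝ in l, |r - 1| ≤ δ := by
  have : ∀ᶠ r : ℝ in 𝓝 1, dist r 1 < δ := Metric.ball_mem_nhds _ hδ
  filter_upwards [hl this] with r hr
  exact hr.le

lemma differentiableOn_dJ_Out (c₁ : ℝ) : DifferentiableOn ℂ (dJ c₁) (Out c₁) := fun _ hs =>
  hs.1.differentiableAt_dJ.differentiableWithinAt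

/-! ### Mass and potentials of the kernel -/

/-- The total mass of the logarithmic kernel. -/
theorem integral_Gk (hc : 0 < c₁) {σ : ℝ}
    (hσ : σ ∈ cut c₁) :
    IntervalIntegrable (fun τ => Gk c₁ τ σ) volume (-radius c₁) (radius c₁) ∧
    ∫ τ in (-radius c₁)..(radius c₁), Gk c₁ τ σ = 2 * π * c₁ * (bp c₁ σ).im := by
  set p := bp c₁ σ with hp
  have hl : 𝓝[>] (1 : ℝ) ≤ 𝓝 1 := nhdsWithin_le_nhds
  have hgd : DifferentiableOn ℂ (fun s => Mo p s * dJ c₁ s) (Out c₁) :=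
    (differentiableOn_Mo hc σ).mul (differentiableOn_dJ_Out c₁)
  set F : Finset ℝ := ends c₁ ∪ {σ} with hF
  obtain ⟨C, hC, δ, hδ, -, hb⟩ := exists_log_bounds hc hσ (F := F) (by simp [hF])
  obtain ⟨D, hD, δ', hδ', hb'⟩ := exists_dJ_bound hc
  have hπ := Real.pi_pos
  obtain ⟨h1, h2⟩ := im_integral_limit hc (l := 𝓝[>] 1) (g := fun s => Mo p s * dJ c₁ s)
    (f := fun τ => Mo p (bp c₁ τ)) (F := F) (C := (2 * C + π) * D)
    (κ := -π * (2 * c₁ * p.im)) (ends_subset_insert _ _) hl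
    ((measurable_Mo p).comp (continuous_bp hc).measurable)
    (continuous_dilate_outer hc hgd)
    (by
      filter_upwards [self_mem_nhdsWithin] with r hr
      refine im_integral_outer hc hgd ?_ ?_ hr
      · intro x _
        rw [Complex.mul_im, Mo_im_real, dJ_im_real]
        ring
      · have := (tendsto_mul_Mo (bp_im_pos hc hσ)).mul (tendsto_dJ c₁)
        rw [← Complex.ofReal_mul] at this
        refine (this.congr fun s => by ring).trans (le_of_eq ?_)
        congr 2
        ring)
    (by
      filter_upwards [eventually_abs_sub_one hl hδ, eventually_abs_sub_one hl hδ'] with r h1 h2 τ hτ hτF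
      obtain ⟨b1, b2, -, -⟩ := hb r h1 τ hτ hτF
      have hs := one_le_sing F τ
      rw [norm_mul]
      have e1 := norm_Mo_le (by positivity) b1 b2
      have e2 := (hb' r h2 τ).2
      calc _ ≤ (2 * (C * sing F τ) + π) * D := by gcongr
        _ ≤ ((2 * C + π) * sing F τ ^ 2) * D := by gcongr; nlinarith [mul_nonneg (by positivity : 0 ≤ 2 * C + π) (mul_nonneg (by linarith : 0 ≤ sing F τ) (by linarith : 0 ≤ sing F τ - 1))]
        _ = _ := by ring)
    (by
      intro τ hτ hτF
      have hne : τ ≠ σ := fun h => hτF (by simp [hF, h])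
      have := (tendsto_Mo_dilate hc hτ hσ hne hl).mul (tendsto_dJ_dilate hc hτ hl)
      rw [mul_one] at this
      exact this.congr fun r => by ring)
  have e : ∀ τ, (Mo p (bp c₁ τ)).im = -Gk c₁ τ σ := fun τ => Mo_bp_im c₁ τ σ
  simp only [e, intervalIntegral.integral_neg] at h2
  refine ⟨?_, by linarith⟩
  have h3 : IntervalIntegrable (fun τ => -(Mo p (bp c₁ τ)).im) volume (-radius c₁) (radius c₁) := by
    have : IntervalIntegrable (fun τ => (Mo p (bp c₁ τ)).im) volume (-radius c₁) (radius c₁) :=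
      ⟨h1.1.im, h1.2.im⟩
    exact this.neg
  simpa only [e, neg_neg] using h3

lemma integral_mul_ite {w x x' c : ℝ} (hx : x ∈ Ioo (-w) w) (hx' : x' ∈ Ioo (-w) w) (h : x' < x)
    (φ : ℝ → ℝ) :
    ∫ τ in (-w)..w, φ τ * (if (τ - x) / (τ - x') < 0 then c else 0) = c * ∫ τ in x'..x, φ τ := by
  have hcond : ∀ τ, (τ - x) / (τ - x') < 0 ↔ τ ∈ Ioo x' x := by
    intro τ
    rw [div_neg_iff, mem_Ioo]
    constructor
    · rintro (h1 | h1) <;> constructor <;> linarith [h1.1, h1.2]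
    · intro h1; right; constructor <;> linarith [h1.1, h1.2]
  have e : (fun τ => φ τ * (if (τ - x) / (τ - x') < 0 then c else 0)) =
      (Ioo x' x).indicator (fun τ => c * φ τ) := by
    ext τ
    by_cases hτ : τ ∈ Ioo x' x
    · rw [indicator_of_mem hτ, if_pos ((hcond τ).2 hτ), mul_comm]
    · rw [indicator_of_notMem hτ, if_neg (fun h => hτ ((hcond τ).1 h)), mul_zero]
  rw [e, intervalIntegral.integral_of_le (by linarith [hx.1, hx.2]),
    setIntegral_indicator measurableSet_Ioo,
    inter_eq_self_of_subset_right (s := Ioc (-w) w) (t := Ioo x' x)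
      (fun y hy => ⟨by linarith [hy.1, hx'.1], by linarith [hy.2, hx.2]⟩),
    ← integral_Ioc_eq_integral_Ioo, ← intervalIntegral.integral_of_le h.le,
    intervalIntegral.integral_const_mul]

/-- Splitting the imaginary part of a product with a boundary value of the logarithm. -/
lemma integral_im_mul {w x x' c K : ℝ} (hx : x ∈ Ioo (-w) w) (hx' : x' ∈ Ioo (-w) w) (h : x' < x)
    {M : ℝ → ℂ} {L : ℝ → ℝ} (hM : Measurable M) (hK : ∀ τ, |(M τ).re| ≤ K)
    (hi : IntervalIntegrable (fun τ => M τ * ((L τ : ℂ) +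
      (if (τ - x) / (τ - x') < 0 then c else 0 : ℝ) * I)) volume (-w) w)
    (h0 : ∫ τ in (-w)..w, (M τ * ((L τ : ℂ) +
      (if (τ - x) / (τ - x') < 0 then c else 0 : ℝ) * I)).im = 0) :
    IntervalIntegrable (fun τ => (M τ).im * L τ) volume (-w) w ∧
      ∫ τ in (-w)..w, (M τ).im * L τ = -(c * ∫ τ in x'..x, (M τ).re) := by
  have hmr : Measurable fun τ => (M τ).re := Complex.measurable_re.comp hM
  have i1 : IntervalIntegrable (fun τ => (M τ).re * (if (τ - x) / (τ - x') < 0 then c else 0))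
      volume (-w) w := by
    refine (intervalIntegrable_const (c := K * |c|)).mono_fun ?_ ?_
    · refine (hmr.mul (Measurable.ite ?_ measurable_const measurable_const)).aestronglyMeasurable
      exact measurableSet_lt (by fun_prop) measurable_const
    · refine .of_forall fun τ => ?_
      simp only [norm_mul, Real.norm_eq_abs]
      have hk : 0 ≤ K := (abs_nonneg _).trans (hK τ)
      rw [abs_of_nonneg hk, abs_abs]
      refine mul_le_mul (hK τ) ?_ (abs_nonneg _) hk
      split_ifs <;> simp
  have i2 : IntervalIntegrable (fun τ => (M τ * ((L τ : ℂ) +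
      (if (τ - x) / (τ - x') < 0 then c else 0 : ℝ) * I)).im) volume (-w) w :=
    ⟨hi.1.im, hi.2.im⟩
  have e : ∀ τ, (M τ * ((L τ : ℂ) +
      (if (τ - x) / (τ - x') < 0 then c else 0 : ℝ) * I)).im =
      (M τ).im * L τ + (M τ).re * (if (τ - x) / (τ - x') < 0 then c else 0) := by
    intro τ
    rw [Complex.mul_im]
    simp only [Complex.add_re, Complex.add_im, Complex.ofReal_re, Complex.ofReal_im,
      Complex.re_ofReal_mul, Complex.im_ofReal_mul, Complex.I_re, Complex.I_im]
    ring
  simp only [e] at i2 h0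
  have i3 : IntervalIntegrable (fun τ => (M τ).im * L τ) volume (-w) w := by
    have := i2.sub i1
    refine this.congr fun τ _ => ?_
    simp
  refine ⟨i3, ?_⟩
  rw [intervalIntegral.integral_add i3 i1, integral_mul_ite hx hx' h] at h0
  linarith

lemma abs_Mo_re_le (p s : ℂ) : |(Mo p s).re| ≤ π := by
  have : (Mo p s).re = -(Complex.log ((s - p) / (s - conj p))).im := by simp [Mo]
  rw [this, abs_neg, Complex.log_im]
  exact Complex.abs_arg_le_pi _

lemma Mi_re (p s : ℂ) : (Mi p s).re = π + Complex.arg (-I * (p - s)) -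
    Complex.arg (I * (conj p - s)) := by
  simp [Mi, Complex.log_im]
  ring

lemma abs_Mi_re_le (p s : ℂ) : |(Mi p s).re| ≤ 3 * π := by
  rw [Mi_re]
  have h1 := abs_le.1 (Complex.abs_arg_le_pi (-I * (p - s)))
  have h2 := abs_le.1 (Complex.abs_arg_le_pi (I * (conj p - s)))
  exact abs_le.2 ⟨by linarith [h1.1, h2.2, Real.pi_pos], by linarith [h1.2, h2.1]⟩

/-- The logarithm of the quotient of `J - x` and `J - x'`. -/
def Lo (c₁ x x' : ℝ) (s : ℂ) : ℂ := Complex.log ((J c₁ 0 s - x) / (J c₁ 0 s - x'))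

lemma segment_mem {w x x' k : ℝ} (hx : x ∈ Ioo (-w) w) (hx' : x' ∈ Ioo (-w) w) (hk : 0 ≤ k) :
    (x + k * x') / (1 + k) ∈ Ioo (-w) w := by
  have h1 : 0 < 1 + k := by linarith
  constructor
  · rw [lt_div_iff₀ h1]; nlinarith [hx.1, hx'.1]
  · rw [div_lt_iff₀ h1]; nlinarith [hx.2, hx'.2]

lemma J_sub_ne_of_Out (hc : 0 < c₁) {t : ℝ} (ht : t ∈ cut c₁)
    {s : ℂ} (hs : s ∈ Out c₁) : J c₁ 0 s ≠ t := by
  intro h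
  apply Out_J_not_mem hc hs
  rw [h]
  exact ⟨by simp, by simpa using abs_le.2 ⟨ht.1.le, ht.2.le⟩⟩

lemma Lo_slit (hc : 0 < c₁) {x x' : ℝ} (hx : x ∈ cut c₁)
    (hx' : x' ∈ cut c₁) {s : ℂ} (hs : s ∈ Out c₁) :
    (J c₁ 0 s - x) / (J c₁ 0 s - x') ∈ Complex.slitPlane := by
  refine div_mem_slitPlane (sub_ne_zero.2 (J_sub_ne_of_Out hc hx' hs)) fun k hk h => ?_
  refine J_sub_ne_of_Out hc (segment_mem hx hx' hk) hs ?_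
  have h1 : (1 + k : ℂ) ≠ 0 := by exact_mod_cast (by linarith : (1 + k : ℝ) ≠ 0)
  push_cast
  rw [eq_div_iff h1]
  linear_combination h

lemma differentiableOn_Lo (hc : 0 < c₁) {x x' : ℝ}
    (hx : x ∈ cut c₁)
    (hx' : x' ∈ cut c₁) : DifferentiableOn ℂ (Lo c₁ x x') (Out c₁) := by
  intro s hs
  have hJ : DifferentiableAt ℂ (J c₁ 0) s := hs.1.hasDerivAt_J.differentiableAt
  have h1 : DifferentiableAt ℂ (fun s => (J c₁ 0 s - x) / (J c₁ 0 s - x')) s :=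
    (hJ.sub_const _).div (hJ.sub_const _) (sub_ne_zero.2 (J_sub_ne_of_Out hc hx' hs))
  exact (h1.clog (Lo_slit hc hx hx' hs)).differentiableWithinAt

lemma clog_im_eq_zero {z : ℂ} (h : z ∈ Complex.slitPlane) (hi : z.im = 0) :
    (Complex.log z).im = 0 := by
  rw [Complex.log_im]
  rcases Complex.mem_slitPlane_iff.1 h with h1 | h1
  · exact Complex.arg_eq_zero_iff.2 ⟨h1.le, hi⟩
  · exact absurd hi h1

lemma tendsto_Lo_cobounded (hc : 0 < c₁) (x x' : ℝ) :
    Tendsto (Lo c₁ x x') (Bornology.cobounded ℂ) (𝓝 0) := by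
  have h1 : Tendsto (fun s : ℂ => J c₁ 0 s) (Bornology.cobounded ℂ) (Bornology.cobounded ℂ) := by
    rw [← tendsto_norm_atTop_iff_cobounded]
    have h2 : Tendsto (fun s : ℂ => c₁ * ‖s‖ - 1 / min (1 / 2) (1 / (4 * c₁)))
        (Bornology.cobounded ℂ) atTop :=
      tendsto_atTop_add_const_right _ _ (tendsto_norm_cobounded_atTop.const_mul_atTop hc)
    refine tendsto_atTop_mono' _ ?_ h2
    have h3 : ∀ᶠ s : ℂ in Bornology.cobounded ℂ, 1 / 2 + 1 / √c₁ < ‖s‖ :=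
      tendsto_norm_cobounded_atTop.eventually_gt_atTop _
    filter_upwards [h3] with s hs
    have h4 : s ∈ Clo c₁ := by
      by_contra h5
      exact absurd (norm_le_of_notMem_Out hc fun h6 => h5 (Out_subset_Clo _ h6)) (not_le.2 hs)
    linarith [norm_le_J hc h4]
  have h5 : Tendsto (fun s => (J c₁ 0 s - x')⁻¹) (Bornology.cobounded ℂ) (𝓝 0) :=
    tendsto_inv₀_cobounded.comp ((tendsto_sub_const_cobounded (x' : ℂ)).comp h1)
  have h6 : ∀ᶠ s in Bornology.cobounded ℂ, J c₁ 0 s - x' ≠ 0 :=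
    ((tendsto_sub_const_cobounded (x' : ℂ)).comp h1).eventually_ne_cobounded 0
  have h7 : Tendsto (fun s => (J c₁ 0 s - x) / (J c₁ 0 s - x')) (Bornology.cobounded ℂ) (𝓝 1) := by
    have := (h5.const_mul ((x' : ℂ) - x)).const_add 1
    rw [mul_zero, add_zero] at this
    refine this.congr' ?_
    filter_upwards [h6] with s hs
    field_simp
    ring
  have h8 := (continuousAt_clog (x := 1) (by simp)).tendsto.comp h7
  rwa [Complex.log_one] at h8

lemma measurable_boundary_log {c x x' : ℝ} {L : ℝ → ℝ} (hL : Measurable L) :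
    Measurable fun τ : ℝ => ((L τ : ℂ) +
      (if (τ - x) / (τ - x') < 0 then c else 0 : ℝ) * I) := by
  refine (Complex.measurable_ofReal.comp hL).add
    ((Complex.measurable_ofReal.comp (Measurable.ite ?_ measurable_const measurable_const)).mul_const _)
  exact measurableSet_lt (by fun_prop) measurable_const

/-- The logarithmic potential of the kernel, from the exterior domain. -/
theorem integral_Gk_mul_log (hc : 0 < c₁) {σ x x' : ℝ}
    (hσ : σ ∈ cut c₁) (hx : x ∈ cut c₁)
    (hx' : x' ∈ cut c₁) (hlt : x' < x) :
    IntervalIntegrable (fun τ => Gk c₁ τ σ * log |(τ - x) / (τ - x')|) volume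
      (-radius c₁) (radius c₁) ∧
    ∫ τ in (-radius c₁)..(radius c₁), Gk c₁ τ σ * log |(τ - x) / (τ - x')| =
      π * ∫ τ in x'..x, (Mo (bp c₁ σ) (bp c₁ τ)).re := by
  set p := bp c₁ σ with hp
  have hl : 𝓝[>] (1 : ℝ) ≤ 𝓝 1 := nhdsWithin_le_nhds
  have hgd : DifferentiableOn ℂ (fun s => Mo p s * dJ c₁ s * Lo c₁ x x' s) (Out c₁) :=
    ((differentiableOn_Mo hc σ).mul (differentiableOn_dJ_Out c₁)).mul (differentiableOn_Lo hc hx hx')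
  set F : Finset ℝ := ends c₁ ∪ {σ, x, x'} with hF
  obtain ⟨C, hC, δ, hδ, -, hb⟩ := exists_log_bounds hc hσ (F := F) (by simp [hF])
  obtain ⟨C₁, hC₁, δ₁, hδ₁, -, hb₁⟩ := exists_log_bounds hc hx (F := F) (by simp [hF])
  obtain ⟨C₂, hC₂, δ₂, hδ₂, -, hb₂⟩ := exists_log_bounds hc hx' (F := F) (by simp [hF])
  obtain ⟨D, hD, δ', hδ', hb'⟩ := exists_dJ_bound hc
  have hπ := Real.pi_pos
  have hMm : Measurable fun τ => Mo p (bp c₁ τ) :=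
    (measurable_Mo p).comp (continuous_bp hc).measurable
  have hLm : Measurable fun τ : ℝ => log |(τ - x) / (τ - x')| := by
    simp only [Real.log_abs]
    exact Real.measurable_log.comp (by fun_prop)
  obtain ⟨h1, h2⟩ := im_integral_limit hc (l := 𝓝[>] 1)
    (g := fun s => Mo p s * dJ c₁ s * Lo c₁ x x' s)
    (f := fun τ => Mo p (bp c₁ τ) * (((log |(τ - x) / (τ - x')| : ℝ) : ℂ) +
      (if (τ - x) / (τ - x') < 0 then π else 0 : ℝ) * I))
    (F := F) (C := (2 * C + π) * D * (2 * (C₁ + C₂) + π))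
    (κ := 0) (ends_subset_insert _ _) hl
    (hMm.mul (measurable_boundary_log hLm))
    (continuous_dilate_outer hc hgd)
    (by
      filter_upwards [self_mem_nhdsWithin] with r hr
      rw [im_integral_outer hc hgd (κ := 0) ?_ ?_ hr, mul_zero]
      · intro y hy
        have e1 : (Lo c₁ x x' y).im = 0 := by
          refine clog_im_eq_zero (Lo_slit hc hx hx' hy) ?_
          rw [im_div_sub]
          have : (J c₁ 0 (y : ℂ)).im = 0 := by rw [J_im hy.1]; simp
          rw [this]; simp
        rw [Complex.mul_im, Complex.mul_im, Mo_im_real, dJ_im_real, e1]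
        ring
      · have := ((tendsto_mul_Mo (bp_im_pos hc hσ)).mul (tendsto_dJ c₁)).mul
          (tendsto_Lo_cobounded hc x x')
        rw [mul_zero] at this
        rw [Complex.ofReal_zero]
        exact this.congr fun s => by ring)
    (by
      filter_upwards [eventually_abs_sub_one hl hδ, eventually_abs_sub_one hl hδ',
        eventually_abs_sub_one hl hδ₁, eventually_abs_sub_one hl hδ₂] with r h1 h2 h3 h4 τ hτ hτF
      obtain ⟨b1, b2, -, -⟩ := hb r h1 τ hτ hτF
      obtain ⟨-, -, b3, -⟩ := hb₁ r h3 τ hτ hτF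
      obtain ⟨-, -, b4, -⟩ := hb₂ r h4 τ hτ hτF
      have hs := one_le_sing F τ
      rw [norm_mul, norm_mul]
      have e1 := norm_Mo_le (by positivity) b1 b2
      have e2 := (hb' r h2 τ).2
      have e3 : ‖Lo c₁ x x' (r * bp c₁ τ)‖ ≤ 2 * ((C₁ + C₂) * sing F τ) + π :=
        norm_clog_div_le' (by positivity) (b3.trans (by gcongr; linarith))
          (b4.trans (by gcongr; linarith))
      have e4 : 2 * (C * sing F τ) + π ≤ (2 * C + π) * sing F τ := by nlinarith
      have e5 : 2 * ((C₁ + C₂) * sing F τ) + π ≤ (2 * (C₁ + C₂) + π) * sing F τ := by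
        nlinarith
      calc _ ≤ ((2 * C + π) * sing F τ) * D * ((2 * (C₁ + C₂) + π) * sing F τ) := by
            gcongr
            · exact e1.trans e4
            · exact e3.trans e5
        _ = _ := by ring)
    (by
      intro τ hτ hτF
      have hne : τ ≠ σ := fun h => hτF (by simp [hF, h])
      have hne1 : τ ≠ x := fun h => hτF (by simp [hF, h])
      have hne2 : τ ≠ x' := fun h => hτF (by simp [hF, h])
      have hJ := tendsto_J_dilate hc hτ hl
      have hq : Tendsto (fun r : ℝ => (J c₁ 0 (r * bp c₁ τ) - x) / (J c₁ 0 (r * bp c₁ τ) - x'))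
          (𝓝[>] 1) (𝓝 (((τ - x) / (τ - x') : ℝ) : ℂ)) := by
        push_cast
        refine (hJ.sub_const _).div (hJ.sub_const _) ?_
        rw [← Complex.ofReal_sub]
        exact_mod_cast sub_ne_zero.2 hne2
      have hlog : Tendsto (fun r : ℝ => Lo c₁ x x' (r * bp c₁ τ)) (𝓝[>] 1)
          (𝓝 (((log |(τ - x) / (τ - x')| : ℝ) : ℂ) +
            (if (τ - x) / (τ - x') < 0 then π else 0 : ℝ) * I)) := by
        refine tendsto_log_of_im_nonneg (div_ne_zero (sub_ne_zero.2 hne1) (sub_ne_zero.2 hne2)) hq ?_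
        filter_upwards [self_mem_nhdsWithin] with r hr
        have hO := mul_bp_mem_Out hc (bp_mem hc τ) hr
        have hr' : (1 : ℝ) < r := hr
        have him : 0 < ((r : ℂ) * bp c₁ τ).im := by
          rw [Complex.im_ofReal_mul]
          exact mul_pos (by linarith) (bp_im_pos hc hτ)
        have := (J_maps_upper (c₀ := 0) hO).2 him
        rw [im_div_sub]
        exact div_nonneg (mul_nonneg this.le (by linarith)) (Complex.normSq_nonneg _)
      have := ((tendsto_Mo_dilate hc hτ hσ hne hl).mul (tendsto_dJ_dilate hc hτ hl)).mul hlog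
      rw [mul_one] at this
      exact this.congr fun r => by ring)
  obtain ⟨h3, h4⟩ := integral_im_mul hx hx' hlt hMm (fun τ => abs_Mo_re_le _ _) h1 h2
  have e : ∀ τ, (Mo p (bp c₁ τ)).im = -Gk c₁ τ σ := fun τ => Mo_bp_im c₁ τ σ
  simp only [e, neg_mul, intervalIntegral.integral_neg] at h3 h4
  exact ⟨by simpa only [Pi.neg_def, neg_neg] using h3.neg, by linarith⟩


/-! ### The potential in the exponential variable -/

/-- `(s - ½)(e^{J(s)} - e^x)`, an entire function. -/
def Nn (c₁ x : ℝ) (s : ℂ) : ℂ :=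
  Complex.exp (c₁ * s) * (s + 1 / 2) - Complex.exp x * (s - 1 / 2)

/-- The logarithm of the quotient of `e^J - e^x` and `e^J - e^{x'}`, which extends holomorphically
to the interior domain. -/
def Li (c₁ x x' : ℝ) (s : ℂ) : ℂ := Complex.log (Nn c₁ x s / Nn c₁ x' s)

lemma exp_J {s : ℂ} (h : Off s) :
    Complex.exp (J c₁ 0 s) * (s - 1 / 2) = Complex.exp (c₁ * s) * (s + 1 / 2) := by
  have h1 : (s - 1 / 2) / (s + 1 / 2) ≠ 0 := div_ne_zero h.sub_half_ne h.add_half_ne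
  have h2 := h.sub_half_ne
  rw [J, Complex.exp_sub, Complex.exp_log h1, Complex.ofReal_zero, add_zero,
    div_div_eq_mul_div, div_mul_cancel₀ _ h2]

lemma Nn_eq {c₁ x : ℝ} {s : ℂ} (h : Off s) :
    Nn c₁ x s = (s - 1 / 2) * (Complex.exp (J c₁ 0 s) - Complex.exp x) := by
  rw [Nn, ← exp_J h]; ring

lemma Nn_div {c₁ x x' : ℝ} {s : ℂ} (h : Off s) :
    Nn c₁ x s / Nn c₁ x' s = (Complex.exp (J c₁ 0 s) - Complex.exp x) /
      (Complex.exp (J c₁ 0 s) - Complex.exp x') := by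
  rw [Nn_eq h, Nn_eq h, mul_div_mul_left _ _ h.sub_half_ne]

lemma J_im_mem {s : ℂ} (hc : 0 < c₁) (h : Off s) (hs : c₁ < hfun s) (hi : 0 < s.im) :
    (J c₁ 0 s).im ∈ Ioo (-π) 0 := by
  have h1 : (J c₁ 0 s).im = s.im * (c₁ - hfun s) := J_im h
  have h2 : (J c₁ 0 s).im = c₁ * s.im - Complex.arg ((s - 1 / 2) / (s + 1 / 2)) := by
    simp [J, Complex.log_im]
  have h3 := Complex.arg_le_pi ((s - 1 / 2) / (s + 1 / 2))
  constructor
  · rw [h2]; nlinarith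
  · rw [h1]; nlinarith

lemma exp_J_im_neg {s : ℂ} (hc : 0 < c₁) (h : Off s) (hs : c₁ < hfun s) (hi : 0 < s.im) :
    (Complex.exp (J c₁ 0 s)).im < 0 := by
  have h1 := J_im_mem hc h hs hi
  rw [Complex.exp_im]
  exact mul_neg_of_pos_of_neg (Real.exp_pos _) (Real.sin_neg_of_neg_of_neg_pi_lt h1.2 h1.1)

lemma Nn_ne (hc : 0 < c₁) {t : ℝ} (ht : t ∈ cut c₁)
    {s : ℂ} (hs : s ∈ (Clo c₁)ᶜ) : Nn c₁ t s ≠ 0 := by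
  -- off the slit, `-π < Im J < 0` above the real axis, so `e^J` is not real; on it, both terms of
  -- the entire function have one sign
  by_cases hoff : Off s
  · have hh : c₁ < hfun s := by
      by_contra h
      exact hs ⟨hoff, not_lt.1 h⟩
    rw [Nn_eq hoff]
    refine mul_ne_zero hoff.sub_half_ne fun h => ?_
    have h1 : Complex.exp (J c₁ 0 s) = ((exp t : ℝ) : ℂ) := by
      rw [Complex.ofReal_exp]; linear_combination h
    rcases lt_trichotomy s.im 0 with hi | hi | hi
    · have h2 := exp_J_im_neg (s := conj s) hc hoff.conj (by rwa [hfun_conj]) (by simpa using hi)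
      rw [J_conj hoff, Complex.exp_conj, h1] at h2
      simp at h2
    · have hgt := hoff.re_gt hi
      rw [exists_ofReal hi] at h1 hh
      rcases lt_abs.1 hgt with h2 | h2
      · rw [J_ofReal h2, ← Complex.ofReal_exp] at h1
        have h3 := Real.exp_injective (Complex.ofReal_injective h1)
        have hne : s.re ≠ sB c₁ := by
          intro h4; rw [h4, hfun_sB hc] at hh; exact hh.false
        have h5 := Jr_min hc h2 hne
        have h6 := ht.2
        unfold radius at h6
        linarith
      · have h2' : s.re < -(1 / 2) := by linarith
        rw [J_ofReal_neg h2', ← Complex.ofReal_exp] at h1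
        have h3 := Real.exp_injective (Complex.ofReal_injective h1)
        have hne : -s.re ≠ sB c₁ := by
          intro h4
          have : ((s.re : ℝ) : ℂ) = -(sB c₁ : ℂ) := by rw [← h4]; push_cast; ring
          rw [this, hfun_neg, hfun_sB hc] at hh; exact hh.false
        have h5 := Jr_min hc h2 hne
        have h6 := ht.1
        unfold radius at h6
        linarith
    · have h2 := exp_J_im_neg hc hoff hh hi
      rw [h1] at h2
      simp at h2
  · unfold Off at hoff
    push Not at hoff
    obtain ⟨y, hy, hys⟩ := hoff
    have hs' : s = (y : ℂ) := by linear_combination -hys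
    intro h
    have e : Nn c₁ t s = ((exp (c₁ * y) * (y + 1 / 2) - exp t * (y - 1 / 2) : ℝ) : ℂ) := by
      rw [Nn, hs']; push_cast; ring
    rw [e] at h
    have h1 : exp (c₁ * y) * (y + 1 / 2) - exp t * (y - 1 / 2) = 0 := by exact_mod_cast h
    have e1 := mul_nonneg (Real.exp_pos (c₁ * y)).le (by linarith [hy.1] : 0 ≤ y + 1 / 2)
    have e2 := mul_nonneg (Real.exp_pos t).le (by linarith [hy.2] : 0 ≤ 1 / 2 - y)
    have e3 : exp (c₁ * y) * (y + 1 / 2) = 0 := by nlinarith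
    have e4 : exp t * (1 / 2 - y) = 0 := by nlinarith
    have e5 := (mul_eq_zero.1 e3).resolve_left (Real.exp_pos _).ne'
    have e6 := (mul_eq_zero.1 e4).resolve_left (Real.exp_pos _).ne'
    linarith

lemma Li_slit (hc : 0 < c₁) {x x' : ℝ} (hx : x ∈ cut c₁)
    (hx' : x' ∈ cut c₁) {s : ℂ} (hs : s ∈ (Clo c₁)ᶜ) :
    Nn c₁ x s / Nn c₁ x' s ∈ Complex.slitPlane := by
  refine div_mem_slitPlane (Nn_ne hc hx' hs) fun k hk h => ?_
  set y := (exp x + k * exp x') / (1 + k) with hy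
  have h1 : 0 < 1 + k := by linarith
  have hy0 : 0 < y := by positivity
  have hmem : log y ∈ cut c₁ := by
    constructor
    · rw [Real.lt_log_iff_exp_lt hy0, hy, lt_div_iff₀ h1]
      have e1 := Real.exp_lt_exp.2 hx.1
      have e2 := Real.exp_lt_exp.2 hx'.1
      nlinarith
    · rw [Real.log_lt_iff_lt_exp hy0, hy, div_lt_iff₀ h1]
      have e1 := Real.exp_lt_exp.2 hx.2
      have e2 := Real.exp_lt_exp.2 hx'.2
      nlinarith
  refine Nn_ne hc hmem hs ?_
  have h2 : (1 + k : ℂ) ≠ 0 := by exact_mod_cast h1.ne'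
  have e : Complex.exp ((log y : ℝ) : ℂ) = (Complex.exp x + k * Complex.exp x') / (1 + k) := by
    rw [← Complex.ofReal_exp, Real.exp_log hy0, hy]; push_cast; rfl
  rw [Nn, e]
  unfold Nn at h
  field_simp
  linear_combination 2 * h

lemma differentiable_Nn (c₁ x : ℝ) : Differentiable ℂ (Nn c₁ x) := by
  unfold Nn; fun_prop

lemma differentiableOn_Li (hc : 0 < c₁) {x x' : ℝ}
    (hx : x ∈ cut c₁)
    (hx' : x' ∈ cut c₁) :
    DifferentiableOn ℂ (Li c₁ x x') (Clo c₁)ᶜ := by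
  intro s hs
  have h1 : DifferentiableAt ℂ (fun s => Nn c₁ x s / Nn c₁ x' s) s :=
    (differentiable_Nn c₁ x s).div (differentiable_Nn c₁ x' s) (Nn_ne hc hx' hs)
  exact (h1.clog (Li_slit hc hx hx' hs)).differentiableWithinAt

lemma Li_im_real (hc : 0 < c₁) {x x' : ℝ} (hx : x ∈ cut c₁)
    (hx' : x' ∈ cut c₁) {y : ℝ} (hs : (y : ℂ) ∈ (Clo c₁)ᶜ) :
    (Li c₁ x x' y).im = 0 := by
  refine clog_im_eq_zero (Li_slit hc hx hx' hs) ?_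
  have e : ∀ x, Nn c₁ x y = ((exp (c₁ * y) * (y + 1 / 2) - exp x * (y - 1 / 2) : ℝ) : ℂ) := by
    intro x; rw [Nn]; push_cast; ring
  rw [e, e, ← Complex.ofReal_div, Complex.ofReal_im]

/-- Divided differences at a real point of a function which is real on the reals. -/
lemma dslope_im_real {f : ℂ → ℂ} {a : ℝ} (hf : DifferentiableAt ℂ f a) {U : Set ℂ} (hU : IsOpen U)
    (ha : (a : ℂ) ∈ U) (h : ∀ x : ℝ, (x : ℂ) ∈ U → (f x).im = 0) {x : ℝ} (hx : (x : ℂ) ∈ U) :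
    (dslope f a x).im = 0 := by
  by_cases hxa : x = a
  · rw [hxa, dslope_same]
    have h1 : HasDerivAt (fun y : ℝ => f y) (deriv f a) a := hf.hasDerivAt.comp_ofReal
    have h2 : HasDerivAt (fun y : ℝ => (f y).im) (deriv f a).im a := by
      have := (Complex.imCLM.hasFDerivAt (x := f a)).comp_hasDerivAt a h1
      exact this
    have h3 : (fun y : ℝ => (f y).im) =ᶠ[𝓝 a] fun _ => (0 : ℝ) := by
      have : ∀ᶠ y : ℝ in 𝓝 a, (y : ℂ) ∈ U :=
        Complex.continuous_ofReal.continuousAt.eventually (hU.mem_nhds ha)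
      filter_upwards [this] with y hy using h y hy
    exact (h2.unique ((hasDerivAt_const a (0 : ℝ)).congr_of_eventuallyEq h3))
  · rw [dslope_of_ne _ (by exact_mod_cast hxa), slope_def_field, ← Complex.ofReal_sub,
      Complex.div_ofReal_im, Complex.sub_im, h x hx, h a ha]
    simp

lemma neg_half_mem (c₁ : ℝ) : ((-(1 / 2) : ℝ) : ℂ) ∈ (Clo c₁)ᶜ := fun h =>
  h.1 (-(1 / 2)) (by norm_num) (by simp)

lemma half_mem (c₁ : ℝ) : ((1 / 2 : ℝ) : ℂ) ∈ (Clo c₁)ᶜ := fun h =>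
  h.1 (1 / 2) (by norm_num) (by simp)

/-- Twice the angle at `-½`: the value of the interior function at the point where the first
derivative of `J` has the pole not cancelled by the logarithm. -/
def angle (c₁ σ : ℝ) : ℝ := (Mi (bp c₁ σ) ((-(1 / 2) : ℝ) : ℂ)).re

lemma Mi_neg_half (c₁ σ : ℝ) : Mi (bp c₁ σ) ((-(1 / 2) : ℝ) : ℂ) = (angle c₁ σ : ℂ) :=
  exists_ofReal (Mi_im_real _)

lemma Li_half (c₁ x x' : ℝ) : Li c₁ x x' ((1 / 2 : ℝ) : ℂ) = 0 := by
  have e : ∀ x, Nn c₁ x ((1 / 2 : ℝ) : ℂ) = Complex.exp (c₁ * ((1 / 2 : ℝ) : ℂ)) := by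
    intro x; rw [Nn]; push_cast; ring
  rw [Li, e, e, div_self (Complex.exp_ne_zero _), Complex.log_one]

/-- The logarithmic potential, in the exponential variable, of the kernel. -/
theorem integral_Gk_mul_log_exp (hc : 0 < c₁) {σ x x' : ℝ}
    (hσ : σ ∈ cut c₁) (hx : x ∈ cut c₁)
    (hx' : x' ∈ cut c₁) (hlt : x' < x) :
    IntervalIntegrable (fun τ => Gk c₁ τ σ *
      log |(exp τ - exp x) / (exp τ - exp x')|) volume
      (-radius c₁) (radius c₁) ∧
    ∫ τ in (-radius c₁)..(radius c₁), Gk c₁ τ σ *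
      log |(exp τ - exp x) / (exp τ - exp x')| =
      π * ∫ τ in x'..x, ((Mi (bp c₁ σ) (bp c₁ τ)).re - angle c₁ σ) := by
  set p := bp c₁ σ with hp
  set B := angle c₁ σ with hB
  set U := (Clo c₁)ᶜ with hU
  have hUo : IsOpen U := (isClosed_Clo hc).isOpen_compl
  have hl : 𝓝[<] (1 : ℝ) ≤ 𝓝 1 := nhdsWithin_le_nhds
  have hMi : DifferentiableOn ℂ (Mi p) U := differentiableOn_Mi hc σ
  have hLi : DifferentiableOn ℂ (Li c₁ x x') U := differentiableOn_Li hc hx hx'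
  have hd1 : DifferentiableOn ℂ (dslope (Li c₁ x x') ((1 / 2 : ℝ) : ℂ)) U :=
    (Complex.differentiableOn_dslope (hUo.mem_nhds (half_mem c₁))).2 hLi
  have hd2 : DifferentiableOn ℂ (dslope (Mi p) ((-(1 / 2) : ℝ) : ℂ)) U :=
    (Complex.differentiableOn_dslope (hUo.mem_nhds (neg_half_mem c₁))).2 hMi
  -- the product `(Mi - B) Λ J'`, with the removable singularities at `±½` removed
  set g : ℂ → ℂ := fun s => c₁ * (Mi p s - B) * Li c₁ x x' s
    - (Mi p s - B) * dslope (Li c₁ x x') ((1 / 2 : ℝ) : ℂ) s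
    + dslope (Mi p) ((-(1 / 2) : ℝ) : ℂ) s * Li c₁ x x' s with hg
  have hgd : DifferentiableOn ℂ g U :=
    ((((hMi.sub_const _).const_mul _).mul hLi).sub ((hMi.sub_const _).mul hd1)).add (hd2.mul hLi)
  have hgoff : ∀ s, Off s → g s = (Mi p s - B) * Li c₁ x x' s * dJ c₁ s := by
    intro s hs
    have n1 := hs.sub_half_ne
    have n2 := hs.add_half_ne
    have n1' : s ≠ ((1 / 2 : ℝ) : ℂ) := fun h => n1 (by rw [h]; push_cast; ring)
    have n2' : s ≠ ((-(1 / 2) : ℝ) : ℂ) := fun h => n2 (by rw [h]; push_cast; ring)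
    have e1 : dslope (Li c₁ x x') ((1 / 2 : ℝ) : ℂ) s = Li c₁ x x' s / (s - 1 / 2) := by
      rw [dslope_of_ne _ n1', slope_def_field, Li_half, sub_zero]
      push_cast; rfl
    have e2 : dslope (Mi p) ((-(1 / 2) : ℝ) : ℂ) s = (Mi p s - B) / (s + 1 / 2) := by
      rw [dslope_of_ne _ n2', slope_def_field, hp, Mi_neg_half]
      push_cast
      rw [sub_neg_eq_add]
    have e3 : s ^ 2 - 1 / 4 = (s - 1 / 2) * (s + 1 / 2) := by ring
    simp only [hg]
    have key : ∀ a b M L c : ℂ, a ≠ 0 → b ≠ 0 → b = a + 1 →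
        c * M * L - M * (L / a) + M / b * L = M * L * (c - 1 / (a * b)) := by
      intro a b M L c ha hb h
      field_simp
      rw [h]
      ring
    rw [e1, e2, dJ, e3]
    exact key _ _ _ _ _ n1 n2 (by ring)
  set F : Finset ℝ := ends c₁ ∪ {σ, x, x'} with hF
  obtain ⟨C, hC, δ, hδ, hδ2, hb⟩ := exists_log_bounds hc hσ (F := F) (by simp [hF])
  obtain ⟨C₁, hC₁, δ₁, hδ₁, -, hb₁⟩ := exists_log_bounds hc hx (F := F) (by simp [hF])
  obtain ⟨C₂, hC₂, δ₂, hδ₂, -, hb₂⟩ := exists_log_bounds hc hx' (F := F) (by simp [hF])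
  obtain ⟨D, hD, δ', hδ', hb'⟩ := exists_dJ_bound hc
  have hπ := Real.pi_pos
  have hMm : Measurable fun τ => Mi p (bp c₁ τ) - B :=
    ((measurable_Mi p).comp (continuous_bp hc).measurable).sub_const _
  have hLm : Measurable fun τ : ℝ => log |(exp τ - exp x) / (exp τ - exp x')| := by
    simp only [Real.log_abs]
    exact Real.measurable_log.comp (by fun_prop)
  have hr0 : ∀ᶠ r : ℝ in 𝓝[<] 1, 0 < r := hl (eventually_gt_nhds (by norm_num))
  obtain ⟨h1, h2⟩ := im_integral_limit hc (l := 𝓝[<] 1) (g := g)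
    (f := fun τ => (Mi p (bp c₁ τ) - B) *
      (((log |(exp τ - exp x) / (exp τ - exp x')| : ℝ) : ℂ) +
      (if (τ - x) / (τ - x') < 0 then -π else 0 : ℝ) * I))
    (F := F) (C := (2 * C + 3 * π + |B|) * D * (2 * (C₁ + C₂) + π))
    (κ := 0) (ends_subset_insert _ _) hl
    (hMm.mul (measurable_boundary_log hLm))
    (continuous_dilate_inner hc hgd)
    (by
      filter_upwards [self_mem_nhdsWithin, hr0] with r hr hr0
      refine im_integral_inner hc hgd ?_ hr0.le hr
      intro y hy
      have a1 : (Mi p y).im = 0 := Mi_im_real y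
      have a2 := Li_im_real hc hx hx' hy
      have a3 := dslope_im_real (hLi.differentiableAt (hUo.mem_nhds (half_mem c₁))) hUo (half_mem c₁)
        (fun y hy => Li_im_real hc hx hx' hy) hy
      have a4 := dslope_im_real (hMi.differentiableAt (hUo.mem_nhds (neg_half_mem c₁))) hUo
        (neg_half_mem c₁) (fun y _ => Mi_im_real y) hy
      simp only [hg, Complex.add_im, Complex.sub_im, Complex.mul_im, Complex.ofReal_im, a1, a2, a3, a4]
      simp)
    (by
      filter_upwards [eventually_abs_sub_one hl hδ, eventually_abs_sub_one hl hδ',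
        eventually_abs_sub_one hl hδ₁, eventually_abs_sub_one hl hδ₂] with r h1 h2 h3 h4 τ hτ hτF
      obtain ⟨b1, b2, -, -⟩ := hb r h1 τ hτ hτF
      obtain ⟨-, -, -, b3⟩ := hb₁ r h3 τ hτ hτF
      obtain ⟨-, -, -, b4⟩ := hb₂ r h4 τ hτ hτF
      have hs := one_le_sing F τ
      obtain ⟨o, e2⟩ := hb' r h2 τ
      rw [hgoff _ o, norm_mul, norm_mul]
      have e1 := norm_Mi_le b1 b2
      have e3 : ‖Li c₁ x x' (r * bp c₁ τ)‖ ≤ 2 * ((C₁ + C₂) * sing F τ) + π := by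
        rw [Li, Nn_div o]
        exact norm_clog_div_le' (by positivity) (b3.trans (by gcongr; linarith))
          (b4.trans (by gcongr; linarith))
      have hB0 := abs_nonneg B
      have e6 : ‖Mi p (r * bp c₁ τ) - B‖ ≤ 2 * (C * sing F τ) + 3 * π + |B| := by
        refine (norm_sub_le _ _).trans ?_
        rw [Complex.norm_real, Real.norm_eq_abs]
        gcongr
      have e4 : 2 * (C * sing F τ) + 3 * π + |B| ≤ (2 * C + 3 * π + |B|) * sing F τ := by
        nlinarith
      have e5 : 2 * ((C₁ + C₂) * sing F τ) + π ≤ (2 * (C₁ + C₂) + π) * sing F τ := by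
        nlinarith
      calc _ ≤ ((2 * C + 3 * π + |B|) * sing F τ) *
            ((2 * (C₁ + C₂) + π) * sing F τ) * D := by
            gcongr
            · exact e6.trans e4
            · exact e3.trans e5
        _ = _ := by ring)
    (by
      intro τ hτ hτF
      have hne : τ ≠ σ := fun h => hτF (by simp [hF, h])
      have hne1 : τ ≠ x := fun h => hτF (by simp [hF, h])
      have hne2 : τ ≠ x' := fun h => hτF (by simp [hF, h])
      have hJ := (Complex.continuous_exp.tendsto _).comp (tendsto_J_dilate hc hτ hl)
      have m1 : exp τ - exp x ≠ 0 :=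
        sub_ne_zero.2 fun h => hne1 (Real.exp_injective h)
      have m2 : exp τ - exp x' ≠ 0 :=
        sub_ne_zero.2 fun h => hne2 (Real.exp_injective h)
      have hq : Tendsto (fun r : ℝ => (Complex.exp (J c₁ 0 (r * bp c₁ τ)) - Complex.exp x) /
          (Complex.exp (J c₁ 0 (r * bp c₁ τ)) - Complex.exp x'))
          (𝓝[<] 1) (𝓝 (((exp τ - exp x) / (exp τ - exp x') : ℝ) : ℂ)) := by
        push_cast
        refine (hJ.sub_const _).div (hJ.sub_const _) ?_
        rw [← Complex.ofReal_exp, ← Complex.ofReal_exp, ← Complex.ofReal_sub]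
        exact_mod_cast m2
      have hoff : ∀ᶠ r : ℝ in 𝓝[<] 1, Off (r * bp c₁ τ) := by
        filter_upwards [eventually_abs_sub_one hl hδ'] with r hr using (hb' r hr τ).1
      have hsgn : (exp τ - exp x) / (exp τ - exp x') < 0 ↔
          (τ - x) / (τ - x') < 0 := by
        rw [div_neg_iff, div_neg_iff]
        simp [sub_pos, sub_neg, Real.exp_lt_exp]
      have hlog : Tendsto (fun r : ℝ => Li c₁ x x' (r * bp c₁ τ)) (𝓝[<] 1)
          (𝓝 (((log |(exp τ - exp x) / (exp τ - exp x')| : ℝ) : ℂ) +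
            (if (τ - x) / (τ - x') < 0 then -π else 0 : ℝ) * I)) := by
        have := tendsto_log_of_im_neg (div_ne_zero m1 m2) hq (by
          filter_upwards [self_mem_nhdsWithin, hr0, hoff] with r hr hr0 o
          have hI := mul_mem_In (bp_notMem_Out hc τ) hr0.le hr hc
          have hr' : r < 1 := hr
          have him : 0 < ((r : ℂ) * bp c₁ τ).im := by
            rw [Complex.im_ofReal_mul]
            exact mul_pos hr0 (bp_im_pos hc hτ)
          have hh : c₁ < hfun (r * bp c₁ τ) := by
            by_contra h
            exact hI ⟨o, not_lt.1 h⟩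
          have e1 := exp_J_im_neg hc o hh him
          have e2 := Nn_ne hc hx' hI
          rw [Nn_eq o] at e2
          have e3 := right_ne_zero_of_mul e2
          rw [← Complex.ofReal_exp] at e3 ⊢
          rw [← Complex.ofReal_exp, im_div_sub]
          refine div_neg_of_neg_of_pos (mul_neg_of_neg_of_pos e1 ?_) (Complex.normSq_pos.2 e3)
          exact sub_pos.2 (Real.exp_lt_exp.2 hlt))
        simp only [hsgn] at this
        refine this.congr' ?_
        filter_upwards [hoff] with r o
        rw [Li, Nn_div o]
      have h5 := (((tendsto_Mi_dilate hc hτ hσ hne hl).sub_const (B : ℂ)).mul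
        (tendsto_dJ_dilate hc hτ hl)).mul hlog
      rw [mul_one] at h5
      refine h5.congr' ?_
      filter_upwards [hoff] with r o
      rw [hgoff _ o]
      ring)
  have hK : ∀ τ, |(Mi p (bp c₁ τ) - B).re| ≤ 3 * π + |B| := fun τ => by
    rw [Complex.sub_re, Complex.ofReal_re]
    exact (abs_sub _ _).trans (add_le_add (abs_Mi_re_le _ _) le_rfl)
  obtain ⟨h3, h4⟩ := integral_im_mul hx hx' hlt hMm hK h1 h2
  have e : ∀ τ, τ ∈ cut c₁ → τ ≠ σ →
      (Mi p (bp c₁ τ) - B).im = Gk c₁ τ σ := by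
    intro τ hτ hne
    have hre := bp_re_ne hc (Ioo_subset_Icc_self hτ) (Ioo_subset_Icc_self hσ) hne
    rw [Complex.sub_im, Complex.ofReal_im, sub_zero]
    refine Mi_bp_im τ σ (fun h => hre (by rw [h])) (fun h => hre (by rw [h]; simp))
  have hae : ∀ᵐ τ : ℝ, τ ∈ uIoc (-radius c₁) (radius c₁) →
      (Mi p (bp c₁ τ) - B).im * log |(exp τ - exp x) / (exp τ - exp x')| =
      Gk c₁ τ σ * log |(exp τ - exp x) / (exp τ - exp x')| := by
    filter_upwards [ae_notMem_finset F] with τ hτF hτ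
    have hw := radius_pos hc
    rw [uIoc_of_le (by linarith)] at hτ
    rw [e τ ⟨hτ.1, lt_of_le_of_ne hτ.2 fun h => hτF (by simp [hF, ends, h])⟩
      fun h => hτF (by simp [hF, h])]
  rw [intervalIntegral.integral_congr_ae hae] at h4
  refine ⟨h3.congr_ae ?_, ?_⟩
  · rw [Filter.EventuallyEq, ae_restrict_iff' measurableSet_uIoc]
    exact hae
  · rw [h4]
    simp only [Complex.sub_re, Complex.ofReal_re]
    ring


variable {V : ℝ → ℝ} {c : ℝ}

lemma norm_conj_sub_conj (a b : ℂ) : ‖conj a - b‖ = ‖a - conj b‖ := by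
  rw [← Complex.norm_conj (a - conj b)]; simp

lemma Gk_symm (c₁ u x : ℝ) : Gk c₁ u x = Gk c₁ x u := by
  rw [Gk, Gk, norm_div, norm_div, norm_sub_rev (bp c₁ u) (bp c₁ x),
    norm_sub_rev (bp c₁ u) (conj (bp c₁ x)), norm_conj_sub_conj]

lemma Gk_nonneg (hc : 0 < c₁) (u x : ℝ) : 0 ≤ Gk c₁ u x := by
  rw [Gk, norm_div]
  by_cases h : bp c₁ u = bp c₁ x
  · rw [h, sub_self]; simp
  · refine Real.log_nonneg ?_
    rw [one_le_div (norm_pos_iff.2 (sub_ne_zero.2 h))]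
    exact norm_sub_le_conj (bp_im_nonneg hc u) (bp_im_nonneg hc x)

/-- The increment of the two logarithmic kernels between `x'` and `x`. -/
def lamQ (x x' τ : ℝ) : ℝ :=
  log |(τ - x) / (τ - x')| + log |(exp τ - exp x) / (exp τ - exp x')|

lemma integral_step {x x' σ c : ℝ} (h : x' < x) :
    ∫ τ in x'..x, (if σ < τ then c else 0) = c * (max x σ - max x' σ) := by
  have e : (fun τ : ℝ => if σ < τ then c else 0) = (Ioi σ).indicator fun _ => c := by
    ext τ
    by_cases hτ : σ < τ
    · rw [if_pos hτ, indicator_of_mem (mem_Ioi.2 hτ)]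
    · rw [if_neg hτ, indicator_of_notMem (by simpa using hτ)]
  rw [e, intervalIntegral.integral_of_le h.le, setIntegral_indicator measurableSet_Ioi,
    setIntegral_const, smul_eq_mul, Ioc_inter_Ioi, Real.volume_real_Ioc, mul_comm]
  congr 1
  rcases le_total σ x with h1 | h1
  · rw [max_eq_left h1, max_eq_left]
    linarith [max_le h.le h1]
  · rw [max_eq_right h1, max_eq_right (h.le.trans h1), max_eq_right (by linarith)]
    ring

/-- The increments of the logarithmic potential of the kernel `G(·, σ)`. -/
theorem integral_Gk_potential (hc : 0 < c₁) {σ x x' : ℝ}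
    (hσ : σ ∈ cut c₁) (hx : x ∈ cut c₁)
    (hx' : x' ∈ cut c₁) (hlt : x' < x) :
    IntervalIntegrable (fun τ => Gk c₁ τ σ * lamQ x x' τ) volume
      (-radius c₁) (radius c₁) ∧
    ∫ τ in (-radius c₁)..(radius c₁), Gk c₁ τ σ * lamQ x x' τ =
      2 * π ^ 2 * (max x σ - max x' σ) - π * angle c₁ σ * (x - x') := by
  obtain ⟨i1, e1⟩ := integral_Gk_mul_log hc hσ hx hx' hlt
  obtain ⟨i2, e2⟩ := integral_Gk_mul_log_exp hc hσ hx hx' hlt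
  simp only [lamQ, mul_add]
  refine ⟨i1.add i2, ?_⟩
  rw [intervalIntegral.integral_add i1 i2, e1, e2]
  have m1 : IntervalIntegrable (fun τ => (Mo (bp c₁ σ) (bp c₁ τ)).re) volume x' x := by
    refine (intervalIntegrable_const (c := π)).mono_fun ?_ ?_
    · exact (Complex.measurable_re.comp ((measurable_Mo _).comp
        (continuous_bp hc).measurable)).aestronglyMeasurable
    · refine .of_forall fun τ => ?_
      simp only [Real.norm_eq_abs]
      rw [abs_of_pos Real.pi_pos]
      exact abs_Mo_re_le _ _
  have m2 : IntervalIntegrable (fun τ => (Mi (bp c₁ σ) (bp c₁ τ)).re - angle c₁ σ) volume x' x := by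
    refine (intervalIntegrable_const (c := 3 * π + |angle c₁ σ|)).mono_fun ?_ ?_
    · exact ((Complex.measurable_re.comp ((measurable_Mi _).comp
        (continuous_bp hc).measurable)).sub_const _).aestronglyMeasurable
    · refine .of_forall fun τ => ?_
      simp only [Real.norm_eq_abs]
      rw [abs_of_nonneg (by have := Real.pi_pos; positivity : 0 ≤ 3 * π + |angle c₁ σ|)]
      exact (abs_sub _ _).trans (add_le_add (abs_Mi_re_le _ _) le_rfl)
  rw [← mul_add, ← intervalIntegral.integral_add m1 m2]
  have hae : ∀ᵐ τ : ℝ, τ ∈ uIoc x' x →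
      (Mo (bp c₁ σ) (bp c₁ τ)).re + ((Mi (bp c₁ σ) (bp c₁ τ)).re - angle c₁ σ) =
      (if σ < τ then 2 * π else 0) - angle c₁ σ := by
    have hne : ∀ᵐ τ : ℝ, τ ≠ σ := by simp [ae_iff, measure_singleton]
    filter_upwards [hne] with τ hτ hm
    rw [uIoc_of_le hlt.le] at hm
    have hτm : τ ∈ Icc (-radius c₁) (radius c₁) := ⟨by linarith [hx'.1, hm.1], by linarith [hx.2, hm.2]⟩
    have h1 := Mo_add_Mi_re (bp_im_pos hc hσ) (bp_im_nonneg hc τ)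
      (bp_re_ne hc hτm (Ioo_subset_Icc_self hσ) hτ)
    have h2 : (bp c₁ σ).re < (bp c₁ τ).re ↔ σ < τ :=
      (strictMonoOn_bp_re hc).lt_iff_lt (Ioo_subset_Icc_self hσ) hτm
    simp only [h2] at h1
    rw [← h1]; ring
  rw [intervalIntegral.integral_congr_ae hae, intervalIntegral.integral_sub,
    integral_step hlt, intervalIntegral.integral_const, smul_eq_mul]
  · ring
  · refine (intervalIntegrable_const (c := 2 * π)).mono_fun ?_ ?_
    · exact (Measurable.ite measurableSet_Ioi measurable_const measurable_const).aestronglyMeasurable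
    · refine .of_forall fun τ => ?_
      dsimp only
      split_ifs
      · rfl
      · simp
  · exact intervalIntegrable_const

/-! ### The two real equations -/

/-- The density of the probability measure `-β'(τ) dτ`, `πβ` being the argument of
`I₊ + ½`. -/
def mdens (c₁ τ : ℝ) : ℝ := -(1 / π) * (dbp c₁ τ / (bp c₁ τ + 1 / 2)).im

lemma mdens_nonneg (hc : 0 < c₁) (τ : ℝ) : 0 ≤ mdens c₁ τ := by
  have h2 := (bp_off hc τ).add_half_ne
  have e : dbp c₁ τ / (bp c₁ τ + 1 / 2) =
      (bp c₁ τ - 1 / 2) / (c₁ * ((bp c₁ τ - sB c₁) * (bp c₁ τ - sA c₁))) := by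
    rw [dbp_eq hc, show bp c₁ τ ^ 2 - 1 / 4 = (bp c₁ τ - 1 / 2) * (bp c₁ τ + 1 / 2) by ring]
    rw [div_right_comm, mul_div_cancel_right₀ _ h2]
  have e2 : (c₁ : ℂ) * ((bp c₁ τ - sB c₁) * (bp c₁ τ - sA c₁)) =
      c₁ * (bp c₁ τ ^ 2 - ((1 / 4 + 1 / c₁ : ℝ) : ℂ)) := by
    rw [← sB_sq hc, sA_eq]; push_cast; ring
  rw [mdens, e, e2, Complex.div_im, ← sub_div]
  have hπ := Real.pi_pos
  rw [neg_mul, ← mul_neg, ← neg_div]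
  refine mul_nonneg (by positivity) (div_nonneg ?_ (Complex.normSq_nonneg _))
  have him := bp_im_nonneg hc τ
  set x := (bp c₁ τ).re
  set y := (bp c₁ τ).im
  have a1 : (bp c₁ τ - 1 / 2).re = x - 1 / 2 := by simp [x]
  have a2 : (bp c₁ τ - 1 / 2).im = y := by simp [y]
  have a3 : (bp c₁ τ ^ 2).re = x ^ 2 - y ^ 2 := by rw [pow_two, Complex.mul_re]; ring
  have a4 : (bp c₁ τ ^ 2).im = 2 * x * y := by rw [pow_two, Complex.mul_im]; ring
  have a5 : (bp c₁ τ ^ 2 - ((1 / 4 + 1 / c₁ : ℝ) : ℂ)).re = x ^ 2 - y ^ 2 - (1 / 4 + 1 / c₁) := by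
    rw [Complex.sub_re, Complex.ofReal_re, a3]
  have a6 : (bp c₁ τ ^ 2 - ((1 / 4 + 1 / c₁ : ℝ) : ℂ)).im = 2 * x * y - 0 := by
    rw [Complex.sub_im, Complex.ofReal_im, a4]
  rw [Complex.re_ofReal_mul, Complex.im_ofReal_mul, a1, a2, a5, a6]
  have : -(y * (c₁ * (x ^ 2 - y ^ 2 - (1 / 4 + 1 / c₁))) - (x - 1 / 2) * (c₁ * (2 * x * y - 0))) =
      c₁ * y * ((x - 1 / 2) ^ 2 + y ^ 2 + 1 / c₁) := by ring
  rw [this]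
  positivity

lemma intervalIntegrable_dbp_div (hc : 0 < c₁) {x : ℝ} (hx : x ∈ Icc (-1 / 2 : ℝ) (1 / 2)) :
    IntervalIntegrable (fun τ => dbp c₁ τ / (bp c₁ τ - x)) volume (-radius c₁) (radius c₁) := by
  have hne : ∀ τ, bp c₁ τ - x ≠ 0 := fun τ h => bp_off hc τ x hx (by linear_combination -h)
  have : Continuous fun τ => (bp c₁ τ - x)⁻¹ :=
    ((continuous_bp hc).sub continuous_const).inv₀ hne
  exact (intervalIntegrable_dbp hc).mul_continuousOn this.continuousOn

lemma intervalIntegrable_im {f : ℝ → ℂ} {a b : ℝ} (h : IntervalIntegrable f volume a b) :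
    IntervalIntegrable (fun t => (f t).im) volume a b := ⟨h.1.im, h.2.im⟩

lemma intervalIntegrable_mdens (hc : 0 < c₁) :
    IntervalIntegrable (mdens c₁) volume (-radius c₁) (radius c₁) := by
  have h := (intervalIntegrable_im (intervalIntegrable_dbp_div hc (x := -(1 / 2)) (by norm_num))).const_mul
    (-(1 / π))
  refine h.congr fun τ _ => ?_
  simp [mdens]

lemma integral_mdens (hc : 0 < c₁) :
    ∫ τ in (-radius c₁)..(radius c₁), mdens c₁ τ = 1 := by
  have h1 := integral_dbp_div hc (x := -(1 / 2)) (by norm_num)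
  rw [im_intervalIntegral (intervalIntegrable_dbp_div hc (by norm_num))] at h1
  have e : ∀ τ, mdens c₁ τ = -(1 / π) * (dbp c₁ τ / (bp c₁ τ - ((-(1 / 2) : ℝ) : ℂ))).im := by
    intro τ; rw [mdens]; push_cast; rw [sub_neg_eq_add]
  simp only [e]
  rw [intervalIntegral.integral_const_mul, h1]
  have := Real.pi_pos
  field_simp

lemma angle_eq (hc : 0 < c₁) (σ : ℝ) :
    angle c₁ σ = π + 2 * (Complex.log (-I * (bp c₁ σ + 1 / 2))).im := by
  have hsl : -I * (bp c₁ σ + 1 / 2) ∈ Complex.slitPlane :=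
    neg_I_mul_mem_slitPlane (bp_off hc σ).add_half_ne (by simpa using bp_im_nonneg hc σ)
  rw [angle, Mi_re, Complex.log_im]
  have e1 : -I * (bp c₁ σ - ((-(1 / 2) : ℝ) : ℂ)) = -I * (bp c₁ σ + 1 / 2) := by
    push_cast; ring
  have e2 : I * (conj (bp c₁ σ) - ((-(1 / 2) : ℝ) : ℂ)) =
      conj (-I * (bp c₁ σ + 1 / 2)) := by
    apply Complex.ext <;> simp
  rw [e1, e2, Complex.arg_conj, if_neg (Complex.slitPlane_arg_ne_pi hsl)]
  ring

lemma continuous_angle (hc : 0 < c₁) : Continuous (angle c₁) := by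
  have : angle c₁ = fun σ => π + 2 * (Complex.log (-I * (bp c₁ σ + 1 / 2))).im :=
    funext (angle_eq hc)
  rw [this]
  have h1 : Continuous fun σ => -I * (bp c₁ σ + 1 / 2) :=
    continuous_const.mul ((continuous_bp hc).add continuous_const)
  have h2 := h1.clog fun σ => neg_I_mul_mem_slitPlane (bp_off hc σ).add_half_ne
    (by simpa using bp_im_nonneg hc σ)
  exact continuous_const.add (continuous_const.mul (Complex.continuous_im.comp h2))

lemma hasDerivAt_im {f : ℝ → ℂ} {f' : ℂ} {x : ℝ} (h : HasDerivAt f f' x) :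
    HasDerivAt (fun t => (f t).im) f'.im x :=
  (Complex.imCLM.hasFDerivAt (x := f x)).comp_hasDerivAt x h

lemma hasDerivAt_angle (hc : 0 < c₁) {τ : ℝ}
    (hτ : τ ∈ cut c₁) :
    HasDerivAt (angle c₁) (-(2 * π) * mdens c₁ τ) τ := by
  have : angle c₁ = fun σ => π + 2 * (Complex.log (-I * (bp c₁ σ + 1 / 2))).im :=
    funext (angle_eq hc)
  rw [this]
  have h1 : HasDerivAt (fun τ => -I * (bp c₁ τ + 1 / 2)) (-I * dbp c₁ τ) τ :=
    ((hasDerivAt_bp hc hτ).add_const _).const_mul _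
  have h2 := h1.clog_real (neg_I_mul_mem_slitPlane (bp_off hc τ).add_half_ne
    (by simpa using bp_im_nonneg hc τ))
  rw [mul_div_mul_left _ _ (neg_ne_zero.2 Complex.I_ne_zero)] at h2
  refine (((hasDerivAt_im h2).const_mul 2).const_add π).congr_deriv ?_
  rw [mdens]
  have := Real.pi_pos
  field_simp

lemma angle_left (hc : 0 < c₁) : angle c₁ (-radius c₁) = 2 * π := by
  have e : -I * (bp c₁ (-radius c₁) + 1 / 2) = -I * ((sA c₁ + 1 / 2 : ℝ) : ℂ) := by
    rw [bp_left hc]; push_cast; ring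
  rw [angle_eq hc, e, log_neg_I_mul_neg (by rw [sA_eq]; linarith [sB_gt hc])]
  ring

lemma angle_right (hc : 0 < c₁) : angle c₁ (radius c₁) = 0 := by
  have e : -I * (bp c₁ (radius c₁) + 1 / 2) = -I * ((sB c₁ + 1 / 2 : ℝ) : ℂ) := by
    rw [bp_right hc]; push_cast; ring
  rw [angle_eq hc, e, log_neg_I_mul_pos (by linarith [sB_gt hc])]
  ring

/-- Integration by parts against the angle. -/
lemma integral_deriv_mul_angle (hc : 0 < c₁) {f f' : ℝ → ℝ}
    (hf : ∀ x, HasDerivAt f (f' x) x) (hf' : Continuous f') :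
    ∫ τ in (-radius c₁)..(radius c₁), f' τ * angle c₁ τ =
      2 * π * ((∫ τ in (-radius c₁)..(radius c₁), f τ * mdens c₁ τ)
        - f (-radius c₁)) := by
  have hw := radius_pos hc
  have hfc : Continuous f := continuous_iff_continuousAt.2 fun x => (hf x).continuousAt
  have h := intervalIntegral.integral_mul_deriv_eq_deriv_mul_of_hasDerivAt
    (a := -radius c₁) (b := radius c₁) (u := f) (u' := f') (v := angle c₁)
    (v' := fun τ => -(2 * π) * mdens c₁ τ) hfc.continuousOn (continuous_angle hc).continuousOn
    (fun x _ => hf x)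
    (fun x hx => hasDerivAt_angle hc (by
      rwa [min_eq_left (by linarith), max_eq_right (by linarith)] at hx))
    (hf'.intervalIntegrable _ _) ((intervalIntegrable_mdens hc).const_mul _)
  rw [angle_left hc, angle_right hc] at h
  have e : (fun τ => f τ * (-(2 * π) * mdens c₁ τ)) =
      fun τ => -(2 * π) * (f τ * mdens c₁ τ) := by ext; ring
  rw [e, intervalIntegral.integral_const_mul] at h
  linarith

/-- Integration by parts against the imaginary part of the boundary curve. -/
lemma integral_deriv_mul_im (hc : 0 < c₁) {f f' : ℝ → ℝ}
    (hf : ∀ x, HasDerivAt f (f' x) x) (hf' : Continuous f') :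
    ∫ τ in (-radius c₁)..(radius c₁), f' τ * (bp c₁ τ).im =
      -∫ τ in (-radius c₁)..(radius c₁), f τ * (dbp c₁ τ).im := by
  have hw := radius_pos hc
  have hfc : Continuous f := continuous_iff_continuousAt.2 fun x => (hf x).continuousAt
  have h := intervalIntegral.integral_mul_deriv_eq_deriv_mul_of_hasDerivAt
    (a := -radius c₁) (b := radius c₁) (u := f) (u' := f') (v := fun τ => (bp c₁ τ).im)
    (v' := fun τ => (dbp c₁ τ).im) hfc.continuousOn
    (Complex.continuous_im.comp (continuous_bp hc)).continuousOn
    (fun x _ => hf x)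
    (fun x hx => hasDerivAt_im (hasDerivAt_bp hc (by
      rwa [min_eq_left (by linarith), max_eq_right (by linarith)] at hx)))
    (hf'.intervalIntegrable _ _) (intervalIntegrable_im (intervalIntegrable_dbp hc))
  rw [bp_right hc, bp_left hc, Complex.ofReal_im, Complex.ofReal_im] at h
  linarith

/-- The area under the boundary curve, in the variable of the interval. -/
lemma integral_bp_im (hc : 0 < c₁) :
    ∫ τ in (-radius c₁)..(radius c₁), (bp c₁ τ).im = π := by
  set w := radius c₁ with hw
  have hw0 : 0 < w := radius_pos hc
  have i1 := intervalIntegrable_dbp_div hc (x := 1 / 2) (by norm_num)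
  have i2 := intervalIntegrable_dbp_div hc (x := -(1 / 2)) (by norm_num)
  have i0 : IntervalIntegrable (fun τ => c₁ * (bp c₁ τ * dbp c₁ τ)) volume (-w) w :=
    ((intervalIntegrable_dbp hc).continuousOn_mul (continuous_bp hc).continuousOn).const_mul _
  have e0 : ∫ τ in (-w)..w, c₁ * (bp c₁ τ * dbp c₁ τ) = (c₁ / 2 * (bp c₁ w) ^ 2 - c₁ / 2 * (bp c₁ (-w)) ^ 2) := by
    refine intervalIntegral.integral_eq_sub_of_hasDerivAt_of_le (f := fun τ => c₁ / 2 * (bp c₁ τ) ^ 2)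
      (by linarith) ?_ ?_ i0
    · exact (continuous_const.mul ((continuous_bp hc).pow 2)).continuousOn
    · intro τ hτ
      refine (((hasDerivAt_bp hc hτ).fun_pow 2).const_mul _).congr_deriv ?_
      ring
  -- multiply `J'(p) p' = 1` by `p` and expand into partial fractions
  have key : ∀ τ ∈ Ioo (-w) w, bp c₁ τ = c₁ * (bp c₁ τ * dbp c₁ τ) -
      1 / 2 * (dbp c₁ τ / (bp c₁ τ - ((1 / 2 : ℝ) : ℂ))) -
      1 / 2 * (dbp c₁ τ / (bp c₁ τ - ((-(1 / 2) : ℝ) : ℂ))) := by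
    intro τ hτ
    have h1 := dJ_mul_dbp hc hτ
    have n1 := (bp_off hc τ).sub_half_ne
    have n2 := (bp_off hc τ).add_half_ne
    have e3 : bp c₁ τ ^ 2 - 1 / 4 = (bp c₁ τ - 1 / 2) * (bp c₁ τ + 1 / 2) := by ring
    have e4 : 1 / (bp c₁ τ ^ 2 - 1 / 4) = 1 / (bp c₁ τ - 1 / 2) - 1 / (bp c₁ τ + 1 / 2) := by
      rw [e3, div_sub_div _ _ n1 n2]
      congr 1
      ring
    have e5 : bp c₁ τ = bp c₁ τ * (dJ c₁ (bp c₁ τ) * dbp c₁ τ) := by rw [h1, mul_one]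
    have f1 : bp c₁ τ * (1 / (bp c₁ τ - 1 / 2)) = 1 + 1 / 2 * (1 / (bp c₁ τ - 1 / 2)) := by
      have : bp c₁ τ * (1 / (bp c₁ τ - 1 / 2)) = (bp c₁ τ - 1 / 2) * (1 / (bp c₁ τ - 1 / 2)) +
        1 / 2 * (1 / (bp c₁ τ - 1 / 2)) := by ring
      rw [this, mul_one_div_cancel n1]
    have f2 : bp c₁ τ * (1 / (bp c₁ τ + 1 / 2)) = 1 - 1 / 2 * (1 / (bp c₁ τ + 1 / 2)) := by
      have : bp c₁ τ * (1 / (bp c₁ τ + 1 / 2)) = (bp c₁ τ + 1 / 2) * (1 / (bp c₁ τ + 1 / 2)) -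
        1 / 2 * (1 / (bp c₁ τ + 1 / 2)) := by ring
      rw [this, mul_one_div_cancel n2]
    push_cast
    rw [sub_neg_eq_add]
    rw [dJ, e4] at e5
    refine e5.trans ?_
    linear_combination (-dbp c₁ τ) * f1 + dbp c₁ τ * f2
  have hae : ∀ᵐ τ : ℝ, τ ∈ uIoc (-w) w → (bp c₁ τ).im = (c₁ * (bp c₁ τ * dbp c₁ τ)).im -
      1 / 2 * (dbp c₁ τ / (bp c₁ τ - ((1 / 2 : ℝ) : ℂ))).im -
      1 / 2 * (dbp c₁ τ / (bp c₁ τ - ((-(1 / 2) : ℝ) : ℂ))).im := by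
    have hne : ∀ᵐ τ : ℝ, τ ≠ w := by simp [ae_iff, measure_singleton]
    filter_upwards [hne] with τ h1 h2
    rw [uIoc_of_le (by linarith)] at h2
    conv_lhs => rw [key τ ⟨h2.1, lt_of_le_of_ne h2.2 h1⟩]
    have eh : (1 / 2 : ℂ) = ((1 / 2 : ℝ) : ℂ) := by push_cast; rfl
    rw [Complex.sub_im, Complex.sub_im, eh, Complex.im_ofReal_mul (1 / 2), Complex.im_ofReal_mul (1 / 2)]
  rw [intervalIntegral.integral_congr_ae hae, intervalIntegral.integral_sub
    ((intervalIntegrable_im i0).sub ((intervalIntegrable_im i1).const_mul _))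
    ((intervalIntegrable_im i2).const_mul _),
    intervalIntegral.integral_sub (intervalIntegrable_im i0) ((intervalIntegrable_im i1).const_mul _),
    intervalIntegral.integral_const_mul, intervalIntegral.integral_const_mul,
    ← im_intervalIntegral i0, ← im_intervalIntegral i1, ← im_intervalIntegral i2, e0,
    integral_dbp_div hc (by norm_num), integral_dbp_div hc (by norm_num), hw, bp_right hc, bp_left hc]
  have : ((c₁ : ℂ) / 2 * (sB c₁ : ℂ) ^ 2 - (c₁ : ℂ) / 2 * (sA c₁ : ℂ) ^ 2) =
      ((c₁ / 2 * sB c₁ ^ 2 - c₁ / 2 * sA c₁ ^ 2 : ℝ) : ℂ) := by push_cast; ring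
  rw [this, Complex.ofReal_im]
  ring

lemma curveInt_Iplus {c₀ : ℝ} (hc : 0 < c₁) (F : ℂ → ℂ) :
    curveInt (Iplus c₁ c₀) (leftEnd c₁ c₀) (rightEnd c₁ c₀) F =
      ∫ τ in (-radius c₁)..(radius c₁), F (bp c₁ τ) * dbp c₁ τ := by
  have hw := radius_pos hc
  have hL := leftEnd_eq hc c₀
  have hR := rightEnd_eq hc c₀
  rw [curveInt]
  have hae : ∀ᵐ x : ℝ, x ∈ uIoc (leftEnd c₁ c₀) (rightEnd c₁ c₀) →
      F (Iplus c₁ c₀ x) * deriv (Iplus c₁ c₀) x = F (bp c₁ (x - c₀)) * dbp c₁ (x - c₀) := by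
    have hne : ∀ᵐ τ : ℝ, τ ≠ rightEnd c₁ c₀ := by simp [ae_iff, measure_singleton]
    filter_upwards [hne] with x h1 h2
    rw [uIoc_of_le (by linarith)] at h2
    have hx : x ∈ Ioo (leftEnd c₁ c₀) (rightEnd c₁ c₀) := ⟨h2.1, lt_of_le_of_ne h2.2 h1⟩
    have hx' : x - c₀ ∈ cut c₁ := ⟨by linarith [hx.1], by linarith [hx.2]⟩
    have e : Iplus c₁ c₀ =ᶠ[𝓝 x] fun x => bp c₁ (x - c₀) := by
      filter_upwards [isOpen_Ioo.mem_nhds hx] with y hy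
      exact Iplus_eq hc (Ioo_subset_Icc_self hy)
    have hd : HasDerivAt (fun x => bp c₁ (x - c₀)) (dbp c₁ (x - c₀)) x := by
      simpa using (hasDerivAt_bp hc hx').comp_sub_const x c₀
    rw [e.deriv_eq, hd.deriv, e.eq_of_nhds]
  rw [intervalIntegral.integral_congr_ae hae,
    intervalIntegral.integral_comp_sub_right (fun τ => F (bp c₁ τ) * dbp c₁ τ), hL, hR]
  congr 1 <;> ring

lemma curveInt_Iminus {c₀ : ℝ} (hc : 0 < c₁) {F : ℂ → ℂ}
    (hF : ∀ s, F (conj s) = conj (F s) ∨ ¬ Off s) :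
    curveInt (Iminus c₁ c₀) (leftEnd c₁ c₀) (rightEnd c₁ c₀) F =
      conj (∫ τ in (-radius c₁)..(radius c₁), F (bp c₁ τ) * dbp c₁ τ) := by
  have hw := radius_pos hc
  have hL := leftEnd_eq hc c₀
  have hR := rightEnd_eq hc c₀
  rw [curveInt]
  have hae : ∀ᵐ x : ℝ, x ∈ uIoc (leftEnd c₁ c₀) (rightEnd c₁ c₀) →
      F (Iminus c₁ c₀ x) * deriv (Iminus c₁ c₀) x =
        conj (F (bp c₁ (x - c₀)) * dbp c₁ (x - c₀)) := by
    have hne : ∀ᵐ τ : ℝ, τ ≠ rightEnd c₁ c₀ := by simp [ae_iff, measure_singleton]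
    filter_upwards [hne] with x h1 h2
    rw [uIoc_of_le (by linarith)] at h2
    have hx : x ∈ Ioo (leftEnd c₁ c₀) (rightEnd c₁ c₀) := ⟨h2.1, lt_of_le_of_ne h2.2 h1⟩
    have hx' : x - c₀ ∈ cut c₁ := ⟨by linarith [hx.1], by linarith [hx.2]⟩
    have e : Iminus c₁ c₀ =ᶠ[𝓝 x] fun x => conj (bp c₁ (x - c₀)) := by
      filter_upwards [isOpen_Ioo.mem_nhds hx] with y hy
      exact Iminus_eq hc (Ioo_subset_Icc_self hy)
    have hd : HasDerivAt (fun x => bp c₁ (x - c₀)) (dbp c₁ (x - c₀)) x := by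
      simpa using (hasDerivAt_bp hc hx').comp_sub_const x c₀
    have hd' : HasDerivAt (fun x => conj (bp c₁ (x - c₀))) (conj (dbp c₁ (x - c₀))) x :=
      (Complex.conjCLE.toContinuousLinearMap.hasFDerivAt).comp_hasDerivAt x hd
    rw [e.deriv_eq, hd'.deriv, e.eq_of_nhds, map_mul,
      (hF _).resolve_right (not_not.2 (bp_off hc _))]
  rw [intervalIntegral.integral_congr_ae hae, intervalIntegral.intervalIntegral_conj,
    intervalIntegral.integral_comp_sub_right (fun τ => F (bp c₁ τ) * dbp c₁ τ), hL, hR]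
  congr 2 <;> ring

lemma contourInt_eq {c₀ : ℝ} (hc : 0 < c₁) {F : ℂ → ℂ}
    (hF : ∀ s, F (conj s) = conj (F s) ∨ ¬ Off s) :
    1 / (2 * (π : ℂ) * I) * contourInt c₁ c₀ F =
      ((-(1 / π) * (∫ τ in (-radius c₁)..(radius c₁), F (bp c₁ τ) * dbp c₁ τ).im : ℝ) : ℂ) := by
  rw [contourInt, curveInt_Iminus hc hF, curveInt_Iplus hc]
  set Z := ∫ τ in (-radius c₁)..(radius c₁), F (bp c₁ τ) * dbp c₁ τ
  have e : conj Z - Z = -(2 * Z.im : ℝ) * I := by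
    apply Complex.ext <;> simp; ring
  have hπ : (π : ℂ) ≠ 0 := by exact_mod_cast Real.pi_ne_zero
  rw [e]
  push_cast
  field_simp [Complex.I_ne_zero]

/-- The pair of contour integral equations in real form. -/
theorem solves_iff (hV : ContDiff ℝ 2 V) {c₀ : ℝ} (hc : 0 < c₁) :
    SolvesEndpointEquations V c₁ c₀ ↔
      (∫ τ in (-radius c₁)..(radius c₁), deriv (deriv V) (c₀ + τ) * (bp c₁ τ).im
        = π / c₁) ∧
      ∫ τ in (-radius c₁)..(radius c₁), deriv V (c₀ + τ) * mdens c₁ τ = 0 := by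
  have hw := radius_pos hc
  have hV1 : ∀ x, HasDerivAt (deriv V) (deriv (deriv V) x) x := fun x =>
    (hV.differentiable_deriv_two x).hasDerivAt
  have hV2 : Continuous (deriv (deriv V)) := by
    have := (hV.iterate_deriv' 0 2).continuous
    simpa using this
  have hf : ∀ τ, HasDerivAt (fun τ => deriv V (c₀ + τ)) (deriv (deriv V) (c₀ + τ)) τ := fun τ =>
    (hV1 (c₀ + τ)).comp_const_add c₀ τ
  have hVc : Continuous (deriv V) := continuous_iff_continuousAt.2 fun x => (hV1 x).continuousAt
  have hfc : Continuous fun τ => deriv V (c₀ + τ) := hVc.comp (by fun_prop)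
  have hfc' : Continuous fun τ => deriv (deriv V) (c₀ + τ) := hV2.comp (by fun_prop)
  -- the upper and lower arcs are conjugate, so only imaginary parts along the upper one remain
  have hparts := integral_deriv_mul_im hc hf hfc'
  have hconj : ∀ s, derivAlong V c₁ c₀ (conj s) = conj (derivAlong V c₁ c₀ s) ∨ ¬ Off s := by
    intro s
    by_cases h : Off s
    · left
      rw [derivAlong, derivAlong, J_conj h, Complex.conj_re, Complex.conj_ofReal]
    · right; exact h
  have hconj2 : ∀ s, derivAlong V c₁ c₀ (conj s) / (conj s - 1 / 2) =
      conj (derivAlong V c₁ c₀ s / (s - 1 / 2)) ∨ ¬ Off s := by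
    intro s
    refine (hconj s).imp_left fun h => ?_
    rw [h, map_div₀, map_sub]
    congr 2
    apply Complex.ext <;> simp
  have hval : ∀ τ ∈ Icc (-radius c₁) (radius c₁),
      derivAlong V c₁ c₀ (bp c₁ τ) = ((deriv V (c₀ + τ) : ℝ) : ℂ) := by
    intro τ hτ
    rw [derivAlong, J_eq_add, J_bp hc hτ, ← Complex.ofReal_add, Complex.ofReal_re, add_comm]
  have hint : ∀ {g : ℝ → ℂ}, IntervalIntegrable g volume (-radius c₁) (radius c₁) →
      (∫ τ in (-radius c₁)..(radius c₁), ((deriv V (c₀ + τ) : ℝ) : ℂ) * g τ).im =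
        ∫ τ in (-radius c₁)..(radius c₁), deriv V (c₀ + τ) * (g τ).im := by
    intro g hg
    have hi : IntervalIntegrable (fun τ => ((deriv V (c₀ + τ) : ℝ) : ℂ) * g τ) volume
        (-radius c₁) (radius c₁) :=
      hg.continuousOn_mul (Complex.continuous_ofReal.comp hfc).continuousOn
    rw [im_intervalIntegral hi]
    congr 1
    ext τ
    rw [Complex.im_ofReal_mul]
  have hsub : ∀ τ, τ ∈ uIcc (-radius c₁) (radius c₁) →
      τ ∈ Icc (-radius c₁) (radius c₁) := fun τ h => by
    rwa [uIcc_of_le (by linarith)] at h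
  have i1 := intervalIntegrable_dbp_div hc (x := 1 / 2) (by norm_num)
  have E1 : (∫ τ in (-radius c₁)..(radius c₁), derivAlong V c₁ c₀ (bp c₁ τ) * dbp c₁ τ).im =
      -∫ τ in (-radius c₁)..(radius c₁), deriv (deriv V) (c₀ + τ) * (bp c₁ τ).im := by
    rw [hparts, neg_neg, ← hint (intervalIntegrable_dbp hc)]
    congr 1
    exact intervalIntegral.integral_congr fun τ hτ => by
      simp only [hval τ (hsub τ hτ)]
  have E2 : (∫ τ in (-radius c₁)..(radius c₁),
      derivAlong V c₁ c₀ (bp c₁ τ) / (bp c₁ τ - 1 / 2) * dbp c₁ τ).im =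
      -(c₁ * ∫ τ in (-radius c₁)..(radius c₁), deriv (deriv V) (c₀ + τ) * (bp c₁ τ).im) -
      π * ∫ τ in (-radius c₁)..(radius c₁), deriv V (c₀ + τ) * mdens c₁ τ := by
    have e1 : (∫ τ in (-radius c₁)..(radius c₁),
      derivAlong V c₁ c₀ (bp c₁ τ) / (bp c₁ τ - 1 / 2) * dbp c₁ τ).im =
      ∫ τ in (-radius c₁)..(radius c₁), deriv V (c₀ + τ) *
        (dbp c₁ τ / (bp c₁ τ - ((1 / 2 : ℝ) : ℂ))).im := by
      rw [← hint i1]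
      congr 1
      refine intervalIntegral.integral_congr fun τ hτ => ?_
      simp only [hval τ (hsub τ hτ)]
      push_cast
      ring
    rw [e1, hparts, mul_neg, neg_neg, ← intervalIntegral.integral_const_mul,
      ← intervalIntegral.integral_const_mul, ← intervalIntegral.integral_sub]
    · refine intervalIntegral.integral_congr_ae ?_
      have hne : ∀ᵐ τ : ℝ, τ ≠ radius c₁ := by simp [ae_iff, measure_singleton]
      filter_upwards [hne] with τ h1 h2
      rw [uIoc_of_le (by linarith)] at h2
      have h3 := dJ_mul_dbp hc (τ := τ) ⟨h2.1, lt_of_le_of_ne h2.2 h1⟩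
      have n1 := (bp_off hc τ).sub_half_ne
      have n2 := (bp_off hc τ).add_half_ne
      have e4 : 1 / (bp c₁ τ ^ 2 - 1 / 4) = 1 / (bp c₁ τ - 1 / 2) - 1 / (bp c₁ τ + 1 / 2) := by
        rw [show bp c₁ τ ^ 2 - 1 / 4 = (bp c₁ τ - 1 / 2) * (bp c₁ τ + 1 / 2) by ring,
          div_sub_div _ _ n1 n2]
        congr 1
        ring
      rw [dJ, e4] at h3
      have e5 : dbp c₁ τ / (bp c₁ τ - ((1 / 2 : ℝ) : ℂ)) =
          c₁ * dbp c₁ τ + dbp c₁ τ / (bp c₁ τ + 1 / 2) - 1 := by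
        push_cast
        linear_combination -h3
      have e6 : (dbp c₁ τ / (bp c₁ τ - ((1 / 2 : ℝ) : ℂ))).im =
          c₁ * (dbp c₁ τ).im + (dbp c₁ τ / (bp c₁ τ + 1 / 2)).im := by
        rw [e5, Complex.sub_im, Complex.add_im, Complex.im_ofReal_mul, Complex.one_im, sub_zero]
      rw [e6, mdens]
      have := Real.pi_pos
      field_simp
      ring
    · exact ((intervalIntegrable_im (intervalIntegrable_dbp hc)).continuousOn_mul
        hfc.continuousOn).const_mul _
    · exact ((intervalIntegrable_mdens hc).continuousOn_mul hfc.continuousOn).const_mul _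
  rw [SolvesEndpointEquations, contourInt_eq hc hconj, contourInt_eq hc hconj2, E1, E2]
  set A := ∫ τ in (-radius c₁)..(radius c₁), deriv (deriv V) (c₀ + τ) * (bp c₁ τ).im
  set M := ∫ τ in (-radius c₁)..(radius c₁), deriv V (c₀ + τ) * mdens c₁ τ
  have hπ := Real.pi_pos
  have l1 : (((c₁⁻¹ : ℝ) : ℂ) = ((-(1 / π) * -A : ℝ) : ℂ)) ↔ A = π / c₁ := by
    rw [Complex.ofReal_inj]
    constructor <;> intro h
    · field_simp at h ⊢; linarith
    · rw [h]; field_simp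
  have l2 : ((1 : ℂ) = ((-(1 / π) * (-(c₁ * A) - π * M) : ℝ) : ℂ)) ↔
      c₁ * A + π * M = π := by
    rw [← Complex.ofReal_one, Complex.ofReal_inj]
    constructor <;> intro h
    · field_simp at h; linarith
    · field_simp; linarith
  rw [l1, l2]
  refine and_congr_right fun h => ?_
  rw [h, mul_div_cancel₀ _ hc.ne']
  constructor <;> intro h2
  · have : π * M = 0 := by linarith
    exact (mul_eq_zero.1 this).resolve_left hπ.ne'
  · rw [h2]; ring


/-! ### Existence of a solution of the equations -/

/-- The smooth, strongly convex external fields. -/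
structure IsField (V : ℝ → ℝ) (c : ℝ) : Prop where
  contDiff : ContDiff ℝ 2 V
  pos : 0 < c
  le : ∀ x, c ≤ deriv (deriv V) x

namespace IsField

lemma hasDerivAt (h : IsField V c) (x : ℝ) : HasDerivAt V (deriv V x) x :=
  (h.contDiff.differentiable (by norm_num) x).hasDerivAt

lemma hasDerivAt_deriv (h : IsField V c) (x : ℝ) : HasDerivAt (deriv V) (deriv (deriv V) x) x :=
  (h.contDiff.differentiable_deriv_two x).hasDerivAt

lemma continuous_deriv (h : IsField V c) : Continuous (deriv V) :=
  continuous_iff_continuousAt.2 fun x => (h.hasDerivAt_deriv x).continuousAt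

lemma continuous (h : IsField V c) : Continuous V :=
  continuous_iff_continuousAt.2 fun x => (h.hasDerivAt x).continuousAt

lemma continuous_deriv2 (h : IsField V c) : Continuous (deriv (deriv V)) := by
  simpa using (h.contDiff.iterate_deriv' 0 2).continuous

lemma deriv_sub_ge (h : IsField V c) {x y : ℝ} (hxy : x ≤ y) :
    c * (y - x) ≤ deriv V y - deriv V x := by
  have h1 : ∀ x, HasDerivAt (fun x => deriv V x - c * x) (deriv (deriv V) x - c) x := fun x => by
    simpa using (h.hasDerivAt_deriv x).fun_sub ((hasDerivAt_id x).const_mul c)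
  have h2 := monotone_of_deriv_nonneg (fun x => (h1 x).differentiableAt)
    (fun x => by rw [(h1 x).deriv]; linarith [h.le x]) hxy
  simp only at h2
  linarith

lemma exists_deriv_zero (h : IsField V c) : ∃ v, deriv V v = 0 := by
  have h1 : 0 ≤ deriv V (|deriv V 0| / c) := by
    have := h.deriv_sub_ge (x := 0) (y := |deriv V 0| / c) (div_nonneg (abs_nonneg _) h.pos.le)
    rw [sub_zero, mul_div_cancel₀ _ h.pos.ne'] at this
    linarith [neg_abs_le (deriv V 0)]
  have h2 : deriv V (-(|deriv V 0| / c)) ≤ 0 := by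
    have := h.deriv_sub_ge (x := -(|deriv V 0| / c)) (y := 0)
      (neg_nonpos.2 (div_nonneg (abs_nonneg _) h.pos.le))
    rw [zero_sub, neg_neg, mul_div_cancel₀ _ h.pos.ne'] at this
    linarith [le_abs_self (deriv V 0)]
  exact mem_range_of_exists_le_of_exists_ge h.continuous_deriv ⟨_, h2⟩ ⟨_, h1⟩

end IsField

/-- The average of `V'` which the second equation requires to vanish. -/
def meanForce (V : ℝ → ℝ) (c₁ x : ℝ) : ℝ :=
  ∫ τ in (-radius c₁)..(radius c₁), deriv V (x + τ) * mdens c₁ τ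

/-- The average of `V''` in the first equation. -/
def meanStiffness (V : ℝ → ℝ) (c₁ x : ℝ) : ℝ :=
  ∫ τ in (-radius c₁)..(radius c₁), deriv (deriv V) (x + τ) * (bp c₁ τ).im

lemma integral_rescale (f : ℝ → ℝ) :
    ∫ τ in (-radius c₁)..(radius c₁), f τ =
      radius c₁ * ∫ σ in (-1 : ℝ)..1, f (radius c₁ * σ) := by
  rw [intervalIntegral.mul_integral_comp_mul_left]
  congr 1 <;> ring

lemma IsField.comp_add (h : IsField V c) (x : ℝ) :
    (∀ τ, HasDerivAt (fun τ => deriv V (x + τ)) (deriv (deriv V) (x + τ)) τ) ∧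
      Continuous (fun τ => deriv V (x + τ)) ∧ Continuous (fun τ => deriv (deriv V) (x + τ)) :=
  ⟨fun τ => (h.hasDerivAt_deriv (x + τ)).comp_const_add x τ,
    h.continuous_deriv.comp (by fun_prop), h.continuous_deriv2.comp (by fun_prop)⟩

lemma meanForce_eq (h : IsField V c) (hc : 0 < c₁) (x : ℝ) :
    meanForce V c₁ x = deriv V (x - radius c₁) + 1 / (2 * π) *
      ∫ τ in (-radius c₁)..(radius c₁), deriv (deriv V) (x + τ) * angle c₁ τ := by
  obtain ⟨h1, -, h3⟩ := h.comp_add x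
  have := integral_deriv_mul_angle hc h1 h3
  rw [this, meanForce, ← sub_eq_add_neg]
  have := Real.pi_pos
  field_simp
  ring

lemma intervalIntegrable_meanForce (h : IsField V c) (hc : 0 < c₁)
    (x : ℝ) : IntervalIntegrable (fun τ => deriv V (x + τ) * mdens c₁ τ) volume
      (-radius c₁) (radius c₁) :=
  (intervalIntegrable_mdens hc).continuousOn_mul (h.comp_add x).2.1.continuousOn

lemma meanForce_sub_ge (h : IsField V c) (hc : 0 < c₁) {x y : ℝ}
    (hxy : x ≤ y) : c * (y - x) ≤ meanForce V c₁ y - meanForce V c₁ x := by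
  have hw := radius_pos hc
  rw [meanForce, meanForce, ← intervalIntegral.integral_sub (intervalIntegrable_meanForce h hc y)
    (intervalIntegrable_meanForce h hc x)]
  have e : c * (y - x) = ∫ τ in (-radius c₁)..(radius c₁), c * (y - x) * mdens c₁ τ := by
    rw [intervalIntegral.integral_const_mul, integral_mdens hc, mul_one]
  rw [e]
  refine intervalIntegral.integral_mono_on (by linarith) ((intervalIntegrable_mdens hc).const_mul _)
    ((intervalIntegrable_meanForce h hc y).sub (intervalIntegrable_meanForce h hc x)) fun τ _ => ?_
  rw [← sub_mul]
  refine mul_le_mul_of_nonneg_right ?_ (mdens_nonneg hc τ)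
  have := h.deriv_sub_ge (x := x + τ) (y := y + τ) (by linarith)
  linarith

lemma meanForce_sign (h : IsField V c) (hc : 0 < c₁) {v : ℝ}
    (hv : deriv V v = 0) : meanForce V c₁ (v - radius c₁) ≤ 0 ∧
      0 ≤ meanForce V c₁ (v + radius c₁) := by
  have hw := radius_pos hc
  constructor
  · rw [meanForce, ← neg_nonneg, ← intervalIntegral.integral_neg]
    refine intervalIntegral.integral_nonneg (by linarith) fun τ hτ => ?_
    rw [← neg_mul]
    refine mul_nonneg ?_ (mdens_nonneg hc τ)
    have := h.deriv_sub_ge (x := v - radius c₁ + τ) (y := v) (by linarith [hτ.2])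
    have := mul_nonneg h.pos.le (by linarith [hτ.2] : 0 ≤ v - (v - radius c₁ + τ))
    linarith
  · refine intervalIntegral.integral_nonneg (by linarith) fun τ hτ => ?_
    refine mul_nonneg ?_ (mdens_nonneg hc τ)
    have := h.deriv_sub_ge (x := v) (y := v + radius c₁ + τ) (by linarith [hτ.1])
    have := mul_nonneg h.pos.le (by linarith [hτ.1] : 0 ≤ v + radius c₁ + τ - v)
    linarith

/-- Continuity in the parameters of the averages of `V''` against a kernel. -/
lemma continuousAt_average (h : IsField V c) (hc : 0 < c₁) {X : ℝ → ℝ}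
    (hX : ContinuousAt X c₁) {k : ℝ → ℝ → ℝ} (hk : ∀ d, 0 < d → Continuous (k d)) {K : ℝ}
    (hK : ∀ᶠ d in 𝓝 c₁, ∀ τ, |k d τ| ≤ K)
    (hkc : ∀ σ ∈ Icc (-1 : ℝ) 1, ContinuousAt (fun d => k d (radius d * σ)) c₁) :
    ContinuousAt (fun d => ∫ τ in (-radius d)..(radius d),
      deriv (deriv V) (X d + τ) * k d τ) c₁ := by
  have hwc : ContinuousAt radius c₁ := continuousOn_radius.continuousAt (Ioi_mem_nhds hc)
  have e : ∀ d, (∫ τ in (-radius d)..(radius d), deriv (deriv V) (X d + τ) * k d τ) =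
      radius d * ∫ σ in (-1 : ℝ)..1,
        deriv (deriv V) (X d + radius d * σ) * k d (radius d * σ) := fun d =>
    integral_rescale (fun τ => deriv (deriv V) (X d + τ) * k d τ)
  simp only [e]
  refine hwc.mul ?_
  set R := |X c₁| + radius c₁ + 1 with hR
  have hb : ∀ᶠ d in 𝓝 c₁, |X d| + radius d < R :=
    ((hX.abs).add hwc).eventually_lt_const (by simp [hR])
  obtain ⟨M, hM⟩ := (isCompact_Icc (a := -R) (b := R)).exists_bound_of_continuousOn
    h.continuous_deriv2.continuousOn
  have hpos : ∀ᶠ d in 𝓝 c₁, 0 < d := lt_mem_nhds hc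
  refine intervalIntegral.continuousAt_of_dominated_interval (bound := fun _ => |M| * |K|) ?_ ?_ ?_ ?_
  · filter_upwards [hpos] with d hd
    have h1 := hk d hd
    have h2 := h.continuous_deriv2
    exact (Continuous.mul (h2.comp (by fun_prop)) (h1.comp (by fun_prop))).aestronglyMeasurable
  · filter_upwards [hb, hK, hpos] with d h1 h2 h3
    refine .of_forall fun σ hσ => ?_
    rw [uIoc_of_le (by norm_num)] at hσ
    rw [norm_mul]
    have hw := radius_pos h3
    have e1 : |X d + radius d * σ| ≤ R := by
      have : |radius d * σ| ≤ radius d := by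
        rw [abs_mul, abs_of_pos hw]
        exact mul_le_of_le_one_right hw.le (abs_le.2 ⟨hσ.1.le, hσ.2⟩)
      exact (abs_add_le _ _).trans (by linarith)
    refine mul_le_mul ((hM _ (abs_le.1 e1)).trans (le_abs_self _))
      ((h2 _).trans (le_abs_self _)) (norm_nonneg _) (abs_nonneg _)
  · exact intervalIntegrable_const
  · refine .of_forall fun σ hσ => ?_
    rw [uIoc_of_le (by norm_num)] at hσ
    refine ContinuousAt.mul ?_ (hkc σ ⟨hσ.1.le, hσ.2⟩)
    exact h.continuous_deriv2.continuousAt.comp (hX.add (hwc.mul continuousAt_const))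

lemma abs_angle_le (c₁ τ : ℝ) : |angle c₁ τ| ≤ 3 * π := abs_Mi_re_le _ _

lemma continuousAt_meanForce (h : IsField V c) (hc : 0 < c₁) (x : ℝ) :
    ContinuousAt (fun d => meanForce V d x) c₁ := by
  have hwc : ContinuousAt radius c₁ := continuousOn_radius.continuousAt (Ioi_mem_nhds hc)
  have hpos : ∀ᶠ d in 𝓝 c₁, 0 < d := lt_mem_nhds hc
  have h1 := continuousAt_average h hc (X := fun _ => x) continuousAt_const (k := angle)
    (fun d hd => continuous_angle hd) (K := 3 * π)
    (.of_forall fun d τ => abs_angle_le d τ) (fun σ hσ => by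
      have e : (fun d => angle d (radius d * σ)) =ᶠ[𝓝 c₁] fun d =>
          π + 2 * (Complex.log (-I * (bp d (radius d * σ) + 1 / 2))).im := by
        filter_upwards [hpos] with d hd using angle_eq hd _
      refine ContinuousAt.congr ?_ e.symm
      have h2 := continuousAt_bp_param hc hσ
      have h3 : ContinuousAt (fun d => -I * (bp d (radius d * σ) + 1 / 2)) c₁ :=
        continuousAt_const.mul (h2.add continuousAt_const)
      have h4 := h3.clog (neg_I_mul_mem_slitPlane (bp_off hc _).add_half_ne
        (by simpa using bp_im_nonneg hc _))
      exact continuousAt_const.add (continuousAt_const.mul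
        (Complex.continuous_im.continuousAt.comp h4)))
  have h2 : ContinuousAt (fun d => deriv V (x - radius d) + 1 / (2 * π) *
      ∫ τ in (-radius d)..(radius d), deriv (deriv V) (x + τ) * angle d τ) c₁ :=
    (h.continuous_deriv.continuousAt.comp (continuousAt_const.sub hwc)).add
      (continuousAt_const.mul h1)
  refine h2.congr ?_
  filter_upwards [hpos] with d hd using (meanForce_eq h hd x).symm

lemma continuousAt_meanStiffness (h : IsField V c) (hc : 0 < c₁)
    {X : ℝ → ℝ} (hX : ContinuousAt X c₁) : ContinuousAt (fun d => meanStiffness V d (X d)) c₁ := by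
  have hs : ContinuousAt (fun d => 1 / 2 + 1 / √d) c₁ :=
    continuousAt_const.add (continuousAt_const.div Real.continuous_sqrt.continuousAt
      (Real.sqrt_pos.2 hc).ne')
  refine continuousAt_average h hc hX (k := fun d τ => (bp d τ).im)
    (fun d hd => Complex.continuous_im.comp (continuous_bp hd))
    (K := 1 / 2 + 1 / √c₁ + 1) ?_ fun σ hσ =>
      Complex.continuous_im.continuousAt.comp (continuousAt_bp_param hc hσ)
  filter_upwards [lt_mem_nhds hc, hs.eventually_lt_const (lt_add_one _)] with d hd h1 τ
  exact (Complex.abs_im_le_norm _).trans ((norm_bp_le hd τ).trans h1.le)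

lemma continuous_meanForce (h : IsField V c) (hc : 0 < c₁) :
    Continuous (meanForce V c₁) := by
  have e : meanForce V c₁ = fun x => deriv V (x - radius c₁) + 1 / (2 * π) *
      ∫ τ in (-radius c₁)..(radius c₁), deriv (deriv V) (x + τ) * angle c₁ τ :=
    funext (meanForce_eq h hc)
  rw [e]
  refine (h.continuous_deriv.comp (by fun_prop)).add (continuous_const.mul ?_)
  refine intervalIntegral.continuous_parametric_intervalIntegral_of_continuous' ?_ _ _
  exact (h.continuous_deriv2.comp (by fun_prop)).mul ((continuous_angle hc).comp continuous_snd)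

/-- There are parameters solving the two equations. For given `c₁`, the second equation has exactly
one root `x`, which depends continuously on `c₁`; then the intermediate value theorem applies to the
first equation. -/
theorem exists_solution (h : IsField V c) :
    ∃ c₁ c₀ : ℝ, 0 < c₁ ∧ meanStiffness V c₁ c₀ = π / c₁ ∧ meanForce V c₁ c₀ = 0 := by
  obtain ⟨v, hv⟩ := h.exists_deriv_zero
  have hex : ∀ d, 0 < d → ∃ x ∈ Icc (v - radius d) (v + radius d), meanForce V d x = 0 := by
    intro d hd
    have hw := radius_pos hd
    have := intermediate_value_Icc (by linarith : v - radius d ≤ v + radius d)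
      (continuous_meanForce h hd).continuousOn (meanForce_sign h hd hv)
    exact this
  choose! X hX hX0 using hex
  -- strong monotonicity in the second variable turns continuity of the force into that of the root
  have hXc : ∀ d, 0 < d → ContinuousAt X d := by
    intro d hd
    have h1 := continuousAt_meanForce h hd (X d)
    have h2 : ∀ᶠ y in 𝓝 d, dist (X y) (X d) ≤ c⁻¹ * dist (meanForce V y (X d)) (meanForce V d (X d)) := by
      filter_upwards [lt_mem_nhds hd] with y hy
      rw [hX0 d hd, Real.dist_eq, Real.dist_eq, sub_zero, le_inv_mul_iff₀ h.pos]
      rcases le_total (X y) (X d) with h3 | h3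
      · have := meanForce_sub_ge h hy h3
        rw [hX0 y hy] at this
        rw [abs_of_nonpos (by linarith)]
        linarith [le_abs_self (meanForce V y (X d))]
      · have := meanForce_sub_ge h hy h3
        rw [hX0 y hy] at this
        rw [abs_of_nonneg (by linarith)]
        linarith [neg_abs_le (meanForce V y (X d))]
    have h3 : Tendsto (fun y => c⁻¹ * dist (meanForce V y (X d)) (meanForce V d (X d))) (𝓝 d) (𝓝 0) := by
      simpa using (tendsto_iff_dist_tendsto_zero.1 h1).const_mul c⁻¹
    exact tendsto_iff_dist_tendsto_zero.2 (squeeze_zero' (.of_forall fun _ => dist_nonneg) h2 h3)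
  have hHc : ContinuousOn (fun d => d * meanStiffness V d (X d)) (Ioi 0) := fun d hd =>
    (continuousAt_id.mul (continuousAt_meanStiffness h hd (hXc d hd))).continuousWithinAt
  have hint : ∀ d, 0 < d → ∀ x, IntervalIntegrable (fun τ => deriv (deriv V) (x + τ) * (bp d τ).im)
      volume (-radius d) (radius d) := fun d hd x =>
    ((h.comp_add x).2.2.mul (Complex.continuous_im.comp (continuous_bp hd))).intervalIntegrable _ _
  have hint' : ∀ (M : ℝ) d, 0 < d → IntervalIntegrable (fun τ => M * (bp d τ).im)
      volume (-radius d) (radius d) := fun M d hd =>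
    (continuous_const.mul (Complex.continuous_im.comp (continuous_bp hd))).intervalIntegrable _ _
  -- the mean stiffness lies between `c π` and `π` times the maximum of `V''` near `v`
  have hlow : ∀ d, 0 < d → c * π ≤ meanStiffness V d (X d) := by
    intro d hd
    have hw := radius_pos hd
    rw [← integral_bp_im hd, ← intervalIntegral.integral_const_mul]
    exact intervalIntegral.integral_mono_on (by linarith) (hint' c d hd) (hint d hd _) fun τ _ =>
      mul_le_mul_of_nonneg_right (h.le _) (bp_im_nonneg hd τ)
  obtain ⟨M, hM⟩ := (isCompact_Icc (a := v - 2 * radius 1) (b := v + 2 * radius 1)).exists_bound_of_continuousOn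
    h.continuous_deriv2.continuousOn
  have hup : ∀ d, 0 < d → d ≤ 1 → meanStiffness V d (X d) ≤ |M| * π := by
    intro d hd hd1
    have hw := radius_pos hd
    have hw1 : radius d ≤ radius 1 := by
      rcases hd1.eq_or_lt with h1 | h1
      · rw [h1]
      · exact (radius_lt hd h1).le
    rw [← integral_bp_im hd, ← intervalIntegral.integral_const_mul]
    refine intervalIntegral.integral_mono_on (by linarith) (hint d hd _) (hint' |M| d hd) fun τ hτ =>
      mul_le_mul_of_nonneg_right ?_ (bp_im_nonneg hd τ)
    have := hM (X d + τ) ⟨by linarith [(hX d hd).1, hτ.1], by linarith [(hX d hd).2, hτ.2]⟩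
    exact (le_abs_self _).trans (this.trans (le_abs_self _))
  have hπ := Real.pi_pos
  have hc := h.pos
  set d₀ := min 1 (1 / (|M| + 1)) with hd₀
  have hd₀0 : 0 < d₀ := by positivity
  have a1 : d₀ * meanStiffness V d₀ (X d₀) ≤ π := by
    have h1 := hup d₀ hd₀0 (min_le_left _ _)
    have h2 : d₀ * (|M| + 1) ≤ 1 := by
      rw [← le_div_iff₀ (by positivity)]; exact min_le_right _ _
    nlinarith [abs_nonneg M]
  have a2 : π ≤ 1 / c * meanStiffness V (1 / c) (X (1 / c)) := by
    have h1 := hlow (1 / c) (by positivity)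
    rw [one_div, le_inv_mul_iff₀ hc]
    simpa using h1
  obtain ⟨d, hd, hd2⟩ := intermediate_value_uIcc (a := d₀) (b := 1 / c)
    (hHc.mono fun x hx => lt_of_lt_of_le (lt_min hd₀0 (by positivity)) hx.1)
    (mem_uIcc_of_le a1 a2)
  have hd0 : 0 < d := lt_of_lt_of_le (lt_min hd₀0 (by positivity)) hd.1
  refine ⟨d, X d, hd0, ?_, hX0 d hd0⟩
  rw [eq_div_iff hd0.ne', mul_comm]
  exact hd2


/-! ### The density -/

/-- The density in the centred variable, for the weight `q` (which is `V''`, centred). -/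
def dens (c₁ : ℝ) (q : ℝ → ℝ) (σ : ℝ) : ℝ :=
  1 / (2 * π ^ 2) * ∫ τ in (-radius c₁)..(radius c₁), q τ * Gk c₁ τ σ

lemma measurable_Gk (hc : 0 < c₁) : Measurable fun p : ℝ × ℝ => Gk c₁ p.1 p.2 := by
  have hb := (continuous_bp hc).measurable
  have h1 : Measurable fun p : ℝ × ℝ => bp c₁ p.1 := hb.comp measurable_fst
  have h2 : Measurable fun p : ℝ × ℝ => bp c₁ p.2 := hb.comp measurable_snd
  have h3 : Measurable fun p : ℝ × ℝ => conj (bp c₁ p.2) :=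
    Complex.continuous_conj.measurable.comp h2
  exact Real.measurable_log.comp ((h1.sub h3).div (h1.sub h2)).norm

lemma measurable_dens (hc : 0 < c₁) {q : ℝ → ℝ} (hq : Continuous q) :
    Measurable (dens c₁ q) := by
  have hw := radius_pos hc
  have h0 := (measurable_Gk hc).comp (measurable_snd.prodMk measurable_fst)
  have h1 : Measurable fun p : ℝ × ℝ => q p.2 * Gk c₁ p.2 p.1 :=
    (hq.measurable.comp measurable_snd).mul h0
  have h2 : Measurable fun σ => ∫ τ in Ioc (-radius c₁) (radius c₁), q τ * Gk c₁ τ σ :=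
    (StronglyMeasurable.integral_prod_right' (f := fun p : ℝ × ℝ => q p.2 * Gk c₁ p.2 p.1)
      h1.stronglyMeasurable).measurable
  have e : dens c₁ q = fun σ => 1 / (2 * π ^ 2) *
      ∫ τ in Ioc (-radius c₁) (radius c₁), q τ * Gk c₁ τ σ := by
    ext σ
    rw [dens, intervalIntegral.integral_of_le (by linarith)]
  rw [e]
  exact h2.const_mul _

lemma intervalIntegrable_mul_Gk (hc : 0 < c₁) {q : ℝ → ℝ} (hq : Continuous q) {σ : ℝ}
    (hσ : σ ∈ cut c₁) :
    IntervalIntegrable (fun τ => q τ * Gk c₁ τ σ) volume (-radius c₁) (radius c₁) :=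
  (integral_Gk hc hσ).1.continuousOn_mul hq.continuousOn

lemma dens_ge (hc : 0 < c₁) {q : ℝ → ℝ} (hq : Continuous q) (hqc : ∀ τ, c ≤ q τ)
    {σ : ℝ} (hσ : σ ∈ cut c₁) :
    c * (2 * π * c₁ * (bp c₁ σ).im) ≤ ∫ τ in (-radius c₁)..(radius c₁), q τ * Gk c₁ τ σ := by
  have hw := radius_pos hc
  rw [← (integral_Gk hc hσ).2, ← intervalIntegral.integral_const_mul]
  exact intervalIntegral.integral_mono_on (by linarith) ((integral_Gk hc hσ).1.const_mul _)
    (intervalIntegrable_mul_Gk hc hq hσ) fun τ _ =>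
      mul_le_mul_of_nonneg_right (hqc τ) (Gk_nonneg hc τ σ)

lemma dens_pos (hc : 0 < c₁) {q : ℝ → ℝ} (hq : Continuous q) (hc0 : 0 < c)
    (hqc : ∀ τ, c ≤ q τ) {σ : ℝ} (hσ : σ ∈ cut c₁) :
    0 < dens c₁ q σ := by
  have := bp_im_pos hc hσ
  have hπ := Real.pi_pos
  exact mul_pos (by positivity) (lt_of_lt_of_le (by positivity) (dens_ge hc hq hqc hσ))

lemma exists_dens_le (hc : 0 < c₁) {q : ℝ → ℝ} (hq : Continuous q) :
    ∃ M > 0, ∀ σ ∈ cut c₁, dens c₁ q σ ≤ M * (bp c₁ σ).im := by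
  have hw := radius_pos hc
  obtain ⟨M, hM⟩ := (isCompact_Icc (a := -radius c₁) (b := radius c₁)).exists_bound_of_continuousOn
    hq.continuousOn
  have hπ := Real.pi_pos
  have hM1 : ∀ τ ∈ Icc (-radius c₁) (radius c₁), q τ ≤ |M| + 1 := fun τ hτ => by
    have := hM τ hτ
    rw [Real.norm_eq_abs] at this
    linarith [le_abs_self (q τ), le_abs_self M]
  refine ⟨1 / (2 * π ^ 2) * ((|M| + 1) * (2 * π * c₁)), by positivity, fun σ hσ => ?_⟩
  rw [dens, mul_assoc]
  refine mul_le_mul_of_nonneg_left ?_ (by positivity)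
  rw [mul_assoc, ← (integral_Gk hc hσ).2, ← intervalIntegral.integral_const_mul]
  exact intervalIntegral.integral_mono_on (by linarith) (intervalIntegrable_mul_Gk hc hq hσ)
    ((integral_Gk hc hσ).1.const_mul _) fun τ hτ =>
      mul_le_mul_of_nonneg_right (hM1 τ hτ) (Gk_nonneg hc τ σ)

/-- The kernel is integrable on the square against a function of one variable. -/
lemma integrable_prod_Gk (hc : 0 < c₁) {q g : ℝ → ℝ} (hq : Continuous q)
    (hg : IntervalIntegrable g volume (-radius c₁) (radius c₁)) (hgm : Measurable g) :
    Integrable (fun p : ℝ × ℝ => q p.1 * Gk c₁ p.1 p.2 * g p.2)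
      ((volume.restrict (cut c₁)).prod
        (volume.restrict (cut c₁))) := by
  set w := radius c₁ with hwd
  have hw : 0 < w := radius_pos hc
  have hm : Measurable fun p : ℝ × ℝ => q p.1 * Gk c₁ p.1 p.2 * g p.2 :=
    ((hq.measurable.comp measurable_fst).mul (measurable_Gk hc)).mul (hgm.comp measurable_snd)
  rw [integrable_prod_iff' hm.aestronglyMeasurable]
  have hii : ∀ σ ∈ Ioo (-w) w, IntegrableOn (fun τ => q τ * Gk c₁ τ σ * g σ) (Ioo (-w) w) := by
    intro σ hσ
    have := (intervalIntegrable_mul_Gk hc hq hσ).mul_const (g σ)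
    rw [intervalIntegrable_iff_integrableOn_Ioo_of_le (by linarith)] at this
    exact this
  refine ⟨(ae_restrict_iff' measurableSet_Ioo).2 (.of_forall hii), ?_⟩
  obtain ⟨M, hM⟩ := (isCompact_Icc (a := -w) (b := w)).exists_bound_of_continuousOn hq.continuousOn
  have hgi : IntegrableOn g (Ioo (-w) w) :=
    (intervalIntegrable_iff_integrableOn_Ioo_of_le (by linarith)).1 hg
  have hπ := Real.pi_pos
  refine (hgi.norm.const_mul (|M| * (2 * π * c₁ * (1 / 2 + 1 / √c₁)))).mono'
    hm.norm.stronglyMeasurable.integral_prod_left.aestronglyMeasurable ?_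
  rw [ae_restrict_iff' measurableSet_Ioo]
  refine .of_forall fun σ hσ => ?_
  obtain ⟨i1, i2⟩ := integral_Gk hc hσ
  rw [intervalIntegrable_iff_integrableOn_Ioo_of_le (by linarith)] at i1
  rw [Real.norm_of_nonneg (integral_nonneg fun _ => norm_nonneg _)]
  have e : ∫ τ in Ioo (-w) w, Gk c₁ τ σ = 2 * π * c₁ * (bp c₁ σ).im := by
    rw [← i2, intervalIntegral.integral_of_le (by linarith), integral_Ioc_eq_integral_Ioo]
  have h4 : (bp c₁ σ).im ≤ 1 / 2 + 1 / √c₁ :=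
    (Complex.im_le_norm _).trans (norm_bp_le hc σ)
  calc ∫ τ in Ioo (-w) w, ‖q τ * Gk c₁ τ σ * g σ‖ ≤ ∫ τ in Ioo (-w) w, |M| * ‖g σ‖ * Gk c₁ τ σ := by
        refine setIntegral_mono_on (hii σ hσ).norm (i1.const_mul _) measurableSet_Ioo fun τ hτ => ?_
        rw [norm_mul, norm_mul, Real.norm_of_nonneg (Gk_nonneg hc τ σ)]
        have h2 : ‖q τ‖ ≤ |M| := (hM τ (Ioo_subset_Icc_self hτ)).trans (le_abs_self _)
        have h3 := Gk_nonneg hc τ σ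
        calc ‖q τ‖ * Gk c₁ τ σ * ‖g σ‖ ≤ |M| * Gk c₁ τ σ * ‖g σ‖ := by gcongr
          _ = _ := by ring
    _ = |M| * ‖g σ‖ * (2 * π * c₁ * (bp c₁ σ).im) := by
        rw [integral_const_mul, e]
    _ ≤ |M| * ‖g σ‖ * (2 * π * c₁ * (1 / 2 + 1 / √c₁)) := by gcongr
    _ = _ := by ring

/-- Fubini's theorem for integrals against the density. -/
lemma integral_dens_mul (hc : 0 < c₁) {q g : ℝ → ℝ} (hq : Continuous q)
    (hg : IntervalIntegrable g volume (-radius c₁) (radius c₁)) (hgm : Measurable g) :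
    ∫ σ in (-radius c₁)..(radius c₁), dens c₁ q σ * g σ =
      1 / (2 * π ^ 2) * ∫ τ in (-radius c₁)..(radius c₁), q τ *
        ∫ σ in (-radius c₁)..(radius c₁), Gk c₁ σ τ * g σ := by
  set w := radius c₁ with hwd
  have hw : 0 < w := radius_pos hc
  have h1 := integral_integral_swap (f := fun τ σ => q τ * Gk c₁ τ σ * g σ)
    (integrable_prod_Gk hc hq hg hgm)
  have hio : ∀ f : ℝ → ℝ, ∫ σ in (-w)..w, f σ = ∫ σ in Ioo (-w) w, f σ := fun f => by
    rw [intervalIntegral.integral_of_le (by linarith), integral_Ioc_eq_integral_Ioo]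
  simp only [hio, dens, ← hwd]
  have e1 : ∀ σ, 1 / (2 * π ^ 2) * (∫ τ in Ioo (-w) w, q τ * Gk c₁ τ σ) * g σ =
      1 / (2 * π ^ 2) * ∫ τ in Ioo (-w) w, q τ * Gk c₁ τ σ * g σ := by
    intro σ
    rw [mul_assoc, ← integral_mul_const]
  simp only [e1]
  rw [integral_const_mul]
  have h2 : ∫ σ in Ioo (-w) w, ∫ τ in Ioo (-w) w, q τ * Gk c₁ τ σ * g σ =
      ∫ τ in Ioo (-w) w, ∫ σ in Ioo (-w) w, q τ * Gk c₁ τ σ * g σ := h1.symm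
  rw [h2]
  congr 2
  ext τ
  rw [← integral_const_mul]
  congr 1
  ext σ
  rw [Gk_symm c₁ σ τ, mul_assoc]

lemma integral_dens (hc : 0 < c₁) {q : ℝ → ℝ} (hq : Continuous q) :
    ∫ σ in (-radius c₁)..(radius c₁), dens c₁ q σ =
      c₁ / π * ∫ τ in (-radius c₁)..(radius c₁), q τ * (bp c₁ τ).im := by
  have hw := radius_pos hc
  have h1 := integral_dens_mul hc hq (g := fun _ => 1) intervalIntegrable_const measurable_const
  simp only [mul_one] at h1
  rw [h1]
  have e : ∫ τ in (-radius c₁)..(radius c₁), q τ *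
      ∫ σ in (-radius c₁)..(radius c₁), Gk c₁ σ τ =
      ∫ τ in (-radius c₁)..(radius c₁), (2 * π * c₁) * (q τ * (bp c₁ τ).im) := by
    refine intervalIntegral.integral_congr_ae ?_
    have hne : ∀ᵐ τ : ℝ, τ ≠ radius c₁ := by simp [ae_iff, measure_singleton]
    filter_upwards [hne] with τ h1 h2
    rw [uIoc_of_le (by linarith)] at h2
    rw [(integral_Gk hc ⟨h2.1, lt_of_le_of_ne h2.2 h1⟩).2]
    ring
  rw [e, intervalIntegral.integral_const_mul]
  have := Real.pi_pos
  field_simp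

/-- The reflection `s ↦ -conj s` of the curve reflects the density. -/
lemma dens_neg (hc : 0 < c₁) (q : ℝ → ℝ) {σ : ℝ}
    (hσ : σ ∈ Icc (-radius c₁) (radius c₁)) :
    dens c₁ q (-σ) = dens c₁ (fun τ => q (-τ)) σ := by
  have hw := radius_pos hc
  rw [dens, dens]
  congr 1
  have h := intervalIntegral.integral_comp_neg (a := -radius c₁) (b := radius c₁)
    (fun τ => q τ * Gk c₁ τ (-σ))
  rw [neg_neg] at h
  rw [← h]
  refine intervalIntegral.integral_congr fun τ hτ => ?_
  rw [uIcc_of_le (by linarith)] at hτ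
  have e : Gk c₁ (-τ) (-σ) = Gk c₁ τ σ := by
    rw [Gk, Gk, bp_neg hc hτ, bp_neg hc hσ, norm_div, norm_div, map_neg, Complex.conj_conj]
    have e1 : ‖-conj (bp c₁ τ) - -bp c₁ σ‖ = ‖bp c₁ τ - conj (bp c₁ σ)‖ := by
      rw [← norm_conj_sub_conj, ← norm_neg]
      congr 1
      ring
    have e2 : ‖-conj (bp c₁ τ) - -conj (bp c₁ σ)‖ = ‖bp c₁ τ - bp c₁ σ‖ := by
      rw [← Complex.norm_conj (bp c₁ τ - bp c₁ σ), ← norm_neg]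
      congr 1
      rw [map_sub]
      ring
    rw [e1, e2]
  simp only [e]

/-- The kernel in terms of the imaginary parts. -/
lemma Gk_eq {τ σ : ℝ} (h : bp c₁ τ ≠ bp c₁ σ) :
    Gk c₁ τ σ = 1 / 2 * log (1 + 4 * (bp c₁ τ).im * (bp c₁ σ).im / ‖bp c₁ τ - bp c₁ σ‖ ^ 2) := by
  have hn : 0 < ‖bp c₁ τ - bp c₁ σ‖ := norm_pos_iff.2 (sub_ne_zero.2 h)
  have e : 1 + 4 * (bp c₁ τ).im * (bp c₁ σ).im / ‖bp c₁ τ - bp c₁ σ‖ ^ 2 =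
      (‖bp c₁ τ - conj (bp c₁ σ)‖ / ‖bp c₁ τ - bp c₁ σ‖) ^ 2 := by
    rw [div_pow, eq_div_iff (by positivity), add_mul, div_mul_cancel₀ _ (by positivity),
      ← Complex.normSq_eq_norm_sq, ← Complex.normSq_eq_norm_sq, Complex.normSq_apply,
      Complex.normSq_apply]
    simp
    ring
  rw [e, Real.log_pow, Gk, norm_div]
  push_cast
  ring

lemma tendsto_nhdsLT_bp (hc : 0 < c₁) :
    Tendsto (bp c₁) (𝓝[<] (radius c₁)) (𝓝 (sB c₁ : ℂ)) := by
  rw [← bp_right hc]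
  exact ((continuous_bp hc).tendsto _).mono_left nhdsWithin_le_nhds

lemma eventually_Ioo {w : ℝ} (hw : 0 < w) {δ : ℝ} (hδ : 0 < δ) :
    ∀ᶠ σ in 𝓝[<] w, σ ∈ Ioo (-w) w ∧ w - δ < σ := by
  have h1 : Ioo (max (-w) (w - δ)) w ∈ 𝓝[<] w :=
    Ioo_mem_nhdsLT (max_lt (by linarith) (by linarith))
  filter_upwards [h1] with σ hσ
  exact ⟨⟨(le_max_left _ _).trans_lt hσ.1, hσ.2⟩, (le_max_right _ _).trans_lt hσ.1⟩

/-- The vertical growth of the boundary curve at the end point. -/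
lemma tendsto_im_div_sqrt (hc : 0 < c₁) :
    ∃ L > 0, Tendsto (fun σ => (bp c₁ σ).im / √(radius c₁ - σ))
      (𝓝[<] (radius c₁)) (𝓝 L) := by
  set w := radius c₁ with hwd
  have hw : 0 < w := radius_pos hc
  have hb := tendsto_nhdsLT_bp hc
  -- the value of `qq` at the end point is a negative real number
  obtain ⟨κ, hκ, hqv⟩ : ∃ κ > 0, qq (sB c₁) (sB c₁) = ((-κ : ℝ) : ℂ) := by
    have hs := sB_gt hc
    have e : qq (sB c₁) (sB c₁) = ((∫ t in (-1 / 2 : ℝ)..(1 / 2), -((sB c₁ - t)⁻¹ ^ 3) : ℝ) : ℂ) := by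
      rw [qq, ← intervalIntegral.integral_ofReal]
      congr 1
      ext t
      rw [← Complex.ofReal_sub, ← neg_sub (sB c₁) t]
      push_cast
      rw [inv_neg]
      ring
    refine ⟨∫ t in (-1 / 2 : ℝ)..(1 / 2), (sB c₁ - t)⁻¹ ^ 3, ?_, by
      rw [e, intervalIntegral.integral_neg]⟩
    have hcont : ContinuousOn (fun t => (sB c₁ - t)⁻¹ ^ 3) (uIcc (-1 / 2 : ℝ) (1 / 2)) := by
      rw [uIcc_half]
      exact ((continuousOn_const.sub continuousOn_id).inv₀ fun t ht => by
        have := ht.2; intro h; simp only [Pi.sub_apply, id] at h; linarith).pow 3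
    refine intervalIntegral.intervalIntegral_pos_of_pos_on hcont.intervalIntegrable ?_ (by norm_num)
    intro t ht
    have : 0 < sB c₁ - t := by linarith [ht.2]
    positivity
  have hq : Tendsto (fun σ => qq (bp c₁ σ) (sB c₁)) (𝓝[<] w) (𝓝 ((-κ : ℝ) : ℂ)) := by
    rw [← hqv, tendsto_iff_norm_sub_tendsto_zero]
    have h1 : Tendsto (fun σ => (dd c₁)⁻¹ ^ 4 * ‖bp c₁ σ - sB c₁‖) (𝓝[<] w) (𝓝 0) := by
      have := (tendsto_iff_norm_sub_tendsto_zero.1 hb).const_mul ((dd c₁)⁻¹ ^ 4)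
      rwa [mul_zero] at this
    exact squeeze_zero (fun _ => norm_nonneg _) (fun σ => qq_sub_qq_le hc (bp_mem hc σ) (sB_mem hc)) h1
  set z : ℝ → ℂ := fun σ => (bp c₁ σ - sB c₁) / (√(w - σ) : ℂ) with hz
  have hzsq : Tendsto (fun σ => z σ ^ 2) (𝓝[<] w) (𝓝 ((-κ : ℝ) : ℂ)⁻¹) := by
    have hk : ((-κ : ℝ) : ℂ) ≠ 0 := by exact_mod_cast (neg_ne_zero.2 hκ.ne')
    refine (hq.inv₀ hk).congr' ?_
    filter_upwards [eventually_Ioo hw hw, hq.eventually_ne hk] with σ hσ hne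
    have h1 := bp_sub_sB hc (Ioo_subset_Icc_self hσ.1)
    have h2 : 0 < w - σ := by linarith [hσ.1.2]
    have h3 : ((√(w - σ) : ℝ) : ℂ) ^ 2 = ((w - σ : ℝ) : ℂ) := by
      rw [← Complex.ofReal_pow, Real.sq_sqrt h2.le]
    have h4 : ((w - σ : ℝ) : ℂ) ≠ 0 := by exact_mod_cast h2.ne'
    simp only [hz]
    rw [div_pow, h3, eq_div_iff h4, ← h1]
    field_simp
  have him : ∀ σ, (z σ).im = (bp c₁ σ).im / √(w - σ) := by
    intro σ
    simp only [hz]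
    rw [Complex.div_ofReal_im, Complex.sub_im, Complex.ofReal_im, sub_zero]
  have hre := (Complex.continuous_re.tendsto _).comp hzsq
  have hno := hzsq.norm
  have h5 : Tendsto (fun σ => √((‖z σ ^ 2‖ - (z σ ^ 2).re) / 2)) (𝓝[<] w)
      (𝓝 (√((‖((-κ : ℝ) : ℂ)⁻¹‖ - (((-κ : ℝ) : ℂ)⁻¹).re) / 2))) :=
    (Real.continuous_sqrt.tendsto _).comp ((hno.sub hre).div_const 2)
  refine ⟨_, ?_, h5.congr fun σ => ?_⟩
  · rw [← Complex.ofReal_inv, Complex.norm_real, Complex.ofReal_re, inv_neg, norm_neg,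
      Real.norm_of_nonneg (by positivity)]
    have : 0 < κ⁻¹ := by positivity
    exact Real.sqrt_pos.2 (by linarith)
  · have e : (‖z σ ^ 2‖ - (z σ ^ 2).re) / 2 = (z σ).im ^ 2 := by
      rw [norm_pow, ← Complex.normSq_eq_norm_sq, Complex.normSq_apply, pow_two (z σ), Complex.mul_re]
      ring
    rw [e, Real.sqrt_sq, him]
    rw [him]
    exact div_nonneg (bp_im_nonneg hc σ) (Real.sqrt_nonneg _)

/-- Away from the end point, the normalized kernel converges. -/
lemma tendsto_integral_Gk_div (hc : 0 < c₁) {h : ℝ → ℝ} (hh : Continuous h) {δ : ℝ}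
    (hδ : 0 < δ) (hδw : δ ≤ 2 * radius c₁) :
    ∃ L, Tendsto (fun σ => ∫ τ in (-radius c₁)..(radius c₁ - δ),
      h τ * (Gk c₁ τ σ / (bp c₁ σ).im)) (𝓝[<] (radius c₁)) (𝓝 L) := by
  set w := radius c₁ with hwd
  have hw : 0 < w := radius_pos hc
  set K := 1 / 2 + 1 / √c₁ with hK
  have hK0 : 0 < K := by positivity
  obtain ⟨M, hM⟩ := (isCompact_Icc (a := -w) (b := w)).exists_bound_of_continuousOn hh.continuousOn
  have hsub : ∀ τ ∈ uIoc (-w) (w - δ), τ ∈ Ioc (-w) (w - δ) := fun τ hτ => by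
    rwa [uIoc_of_le (by linarith)] at hτ
  refine ⟨∫ τ in (-w)..(w - δ), h τ * (2 * (bp c₁ τ).im / ‖bp c₁ τ - sB c₁‖ ^ 2), ?_⟩
  apply intervalIntegral.tendsto_integral_filter_of_dominated_convergence
    (bound := fun _ => |M| * (2 * K * (4 * c₁ / δ) ^ 2))
  · refine .of_forall fun σ => ?_
    have := (measurable_Gk hc).comp (measurable_prodMk_right (y := σ))
    exact (hh.measurable.mul (this.div_const _)).aestronglyMeasurable
  · filter_upwards [eventually_Ioo hw (half_pos hδ)] with σ hσ
    refine .of_forall fun τ hτ => ?_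
    have hτ' := hsub τ hτ
    have hτI : τ ∈ Icc (-w) w := ⟨hτ'.1.le, by linarith [hτ'.2]⟩
    have hσI := Ioo_subset_Icc_self hσ.1
    have hne : τ ≠ σ := by intro h; linarith [hτ'.2, hσ.2]
    have hre := bp_re_ne hc hτI hσI hne
    have hbne : bp c₁ τ ≠ bp c₁ σ := fun h => hre (by rw [h])
    have hd := bp_dist_lower hc hτI hσI
    have hdist : δ / 2 ≤ |τ - σ| := by
      rw [abs_of_nonpos (by linarith [hτ'.2, hσ.2])]; linarith [hτ'.2, hσ.2]
    have hn : 0 < ‖bp c₁ τ - bp c₁ σ‖ := norm_pos_iff.2 (sub_ne_zero.2 hbne)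
    have hlow : δ / (4 * c₁) ≤ ‖bp c₁ τ - bp c₁ σ‖ := by
      rw [div_le_iff₀ (by positivity)]; linarith
    have hσp := bp_im_pos hc hσ.1
    have hτp := bp_im_nonneg hc τ
    have hu : 0 ≤ 4 * (bp c₁ τ).im * (bp c₁ σ).im / ‖bp c₁ τ - bp c₁ σ‖ ^ 2 := by positivity
    have hG : Gk c₁ τ σ / (bp c₁ σ).im ≤ 2 * K * (4 * c₁ / δ) ^ 2 := by
      rw [div_le_iff₀ hσp, Gk_eq hbne]
      have h1 := Real.log_le_sub_one_of_pos (by linarith :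
        0 < 1 + 4 * (bp c₁ τ).im * (bp c₁ σ).im / ‖bp c₁ τ - bp c₁ σ‖ ^ 2)
      have h2 : (‖bp c₁ τ - bp c₁ σ‖ ^ 2)⁻¹ ≤ (4 * c₁ / δ) ^ 2 := by
        rw [← inv_pow]
        refine pow_le_pow_left₀ (by positivity) ?_ 2
        rw [show 4 * c₁ / δ = (δ / (4 * c₁))⁻¹ by rw [inv_div]]
        exact inv_anti₀ (by positivity) hlow
      have h3 : (bp c₁ τ).im ≤ K := (Complex.im_le_norm _).trans (norm_bp_le hc τ)
      calc _ ≤ 1 / 2 * (4 * (bp c₁ τ).im * (bp c₁ σ).im / ‖bp c₁ τ - bp c₁ σ‖ ^ 2) := by linarith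
        _ = 2 * (bp c₁ τ).im * (‖bp c₁ τ - bp c₁ σ‖ ^ 2)⁻¹ * (bp c₁ σ).im := by
          rw [div_eq_mul_inv]; ring
        _ ≤ _ := by gcongr
    rw [norm_mul, Real.norm_of_nonneg (div_nonneg (Gk_nonneg hc τ σ) hσp.le)]
    exact mul_le_mul ((hM τ hτI).trans (le_abs_self _)) hG
      (div_nonneg (Gk_nonneg hc τ σ) hσp.le) (abs_nonneg _)
  · exact intervalIntegrable_const
  · have hne : ∀ᵐ τ : ℝ, τ ∈ uIoc (-w) (w - δ) → τ ∈ Ioo (-w) w :=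
      .of_forall fun τ hτ => ⟨(hsub τ hτ).1, by linarith [(hsub τ hτ).2]⟩
    filter_upwards [hne] with τ hτ hτ2
    have hτI := hτ hτ2
    refine Tendsto.const_mul _ ?_
    have hb := tendsto_nhdsLT_bp hc
    have hre : (bp c₁ τ).re ≠ (bp c₁ w).re :=
      bp_re_ne hc (Ioo_subset_Icc_self hτI) (right_mem_Icc.2 (by linarith)) hτI.2.ne
    have hne : bp c₁ τ - sB c₁ ≠ 0 := by
      rw [← bp_right hc]; exact sub_ne_zero.2 fun h => hre (by rw [h])
    have hn : ‖bp c₁ τ - sB c₁‖ ^ 2 ≠ 0 := pow_ne_zero 2 (norm_ne_zero_iff.2 hne)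
    have hd2 : Tendsto (fun σ => ‖bp c₁ τ - bp c₁ σ‖ ^ 2) (𝓝[<] w) (𝓝 (‖bp c₁ τ - sB c₁‖ ^ 2)) :=
      ((tendsto_const_nhds.sub hb).norm).pow 2
    have him : Tendsto (fun σ => (bp c₁ σ).im) (𝓝[<] w) (𝓝 0) := by
      have := (Complex.continuous_im.tendsto _).comp hb
      rwa [Complex.ofReal_im] at this
    have hu : Tendsto (fun σ => 4 * (bp c₁ τ).im * (bp c₁ σ).im / ‖bp c₁ τ - bp c₁ σ‖ ^ 2)
        (𝓝[<] w) (𝓝 0) := by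
      have := (him.const_mul (4 * (bp c₁ τ).im)).div hd2 hn
      rwa [mul_zero, zero_div] at this
    have hτp := bp_im_pos hc hτI
    have hune : ∀ᶠ σ in 𝓝[<] w, bp c₁ τ ≠ bp c₁ σ ∧
        4 * (bp c₁ τ).im * (bp c₁ σ).im / ‖bp c₁ τ - bp c₁ σ‖ ^ 2 ≠ 0 ∧ (bp c₁ σ).im ≠ 0 := by
      filter_upwards [eventually_Ioo hw hw, hd2.eventually_ne hn] with σ hσ h1
      have hσp := bp_im_pos hc hσ.1
      refine ⟨fun h => h1 (by rw [h, sub_self]; simp), ?_, hσp.ne'⟩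
      have : 0 < ‖bp c₁ τ - bp c₁ σ‖ ^ 2 := lt_of_le_of_ne (by positivity) h1.symm
      positivity
    have h1 : HasDerivAt log 1 1 := by simpa using Real.hasDerivAt_log (x := 1) one_ne_zero
    have h2 := (hasDerivAt_iff_tendsto_slope_zero.1 h1).comp
      (tendsto_nhdsWithin_iff.2 ⟨hu, hune.mono fun σ h => h.2.1⟩)
    have h3 := h2.mul ((tendsto_const_nhds (x := 2 * (bp c₁ τ).im)).div hd2 hn)
    rw [one_mul] at h3
    refine h3.congr' ?_
    filter_upwards [hune] with σ hσ
    rw [Gk_eq hσ.1]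
    have n1 := hσ.2.1
    have n2 := hσ.2.2
    have n3 : ‖bp c₁ τ - bp c₁ σ‖ ≠ 0 := norm_ne_zero_iff.2 (sub_ne_zero.2 hσ.1)
    simp only [Function.comp_apply, Real.log_one, sub_zero, smul_eq_mul,
      Pi.div_apply]
    generalize log _ = ℓ
    field_simp
    norm_num
    ring

/-- Square root behaviour of the density at the right end point. The weighted integral of the
normalized kernel converges because the kernel has constant mass and the weight is nearly constant
where the kernel concentrates. -/
theorem tendsto_dens_div_sqrt (hc : 0 < c₁) {q : ℝ → ℝ} (hq : Continuous q)
    (hc0 : 0 < c) (hqc : ∀ τ, c ≤ q τ) :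
    ∃ L, L ≠ 0 ∧ Tendsto (fun σ => dens c₁ q σ / √(radius c₁ - σ))
      (𝓝[<] (radius c₁)) (𝓝 L) := by
  set w := radius c₁ with hwd
  have hw : 0 < w := radius_pos hc
  have hπ := Real.pi_pos
  set f : ℝ → ℝ → ℝ := fun σ τ => Gk c₁ τ σ / (bp c₁ σ).im with hf
  set Z := 2 * π * c₁ with hZ
  have hZ0 : 0 < Z := by positivity
  have hfi : ∀ σ ∈ Ioo (-w) w, IntervalIntegrable (f σ) volume (-w) w := fun σ hσ =>
    (integral_Gk hc hσ).1.div_const _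
  have hfm : ∀ σ ∈ Ioo (-w) w, ∫ τ in (-w)..w, f σ τ = Z := fun σ hσ => by
    simp only [hf]
    rw [intervalIntegral.integral_div, (integral_Gk hc hσ).2,
      mul_div_cancel_right₀ _ (bp_im_pos hc hσ).ne']
  have hf0 : ∀ σ τ, 0 ≤ f σ τ := fun σ τ => div_nonneg (Gk_nonneg hc τ σ) (bp_im_nonneg hc σ)
  set h : ℝ → ℝ := fun τ => q τ - q w with hh
  have hhc : Continuous h := hq.sub continuous_const
  -- the Cauchy property of the oscillating part
  obtain ⟨g, hg⟩ : ∃ g, Tendsto (fun σ => ∫ τ in (-w)..w, h τ * f σ τ) (𝓝[<] w) (𝓝 g) := by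
    refine cauchy_map_iff_exists_tendsto.1 (Metric.cauchy_iff.2 ⟨inferInstance, fun ε hε => ?_⟩)
    have hη : 0 < ε / (4 * Z) := by positivity
    obtain ⟨δ₀, hδ₀, hδ⟩ := Metric.continuousAt_iff.1 (hhc.continuousAt (x := w)) _ hη
    set δ := min (δ₀ / 2) w with hδd
    have hδ0 : 0 < δ := by positivity
    obtain ⟨L, hL⟩ := tendsto_integral_Gk_div hc hhc hδ0 ((min_le_right _ _).trans (by linarith))
    have hev : ∀ᶠ σ in 𝓝[<] w, dist (∫ τ in (-w)..w, h τ * f σ τ) L < ε / 2 := by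
      filter_upwards [Metric.tendsto_nhds.1 hL (ε / 4) (by positivity), eventually_Ioo hw hw]
        with σ h1 h2
      have i0 := (hfi σ h2.1).continuousOn_mul hhc.continuousOn
      have hδw : δ ≤ w := min_le_right _ _
      have hsub1 : uIcc (-w) (w - δ) ⊆ uIcc (-w) w := by
        rw [uIcc_of_le (by linarith), uIcc_of_le (by linarith)]
        exact Icc_subset_Icc_right (by linarith)
      have hsub2 : uIcc (w - δ) w ⊆ uIcc (-w) w := by
        rw [uIcc_of_le (by linarith), uIcc_of_le (by linarith)]
        exact Icc_subset_Icc_left (by linarith)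
      have i1 := i0.mono_set hsub1
      have i2 := i0.mono_set hsub2
      have j1 := (hfi σ h2.1).mono_set hsub1
      have j2 := (hfi σ h2.1).mono_set hsub2
      rw [← intervalIntegral.integral_add_adjacent_intervals i1 i2]
      have hle : |∫ τ in (w - δ)..w, h τ * f σ τ| ≤ ε / (4 * Z) * Z := by
        calc |∫ τ in (w - δ)..w, h τ * f σ τ| ≤ ∫ τ in (w - δ)..w, |h τ * f σ τ| :=
              intervalIntegral.abs_integral_le_integral_abs (by linarith)
          _ ≤ ∫ τ in (w - δ)..w, ε / (4 * Z) * f σ τ := by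
              refine intervalIntegral.integral_mono_on (by linarith) i2.abs (j2.const_mul _)
                fun τ hτ => ?_
              rw [abs_mul, abs_of_nonneg (hf0 σ τ)]
              refine mul_le_mul_of_nonneg_right ?_ (hf0 σ τ)
              have : dist τ w < δ₀ := by
                rw [Real.dist_eq, abs_of_nonpos (by linarith [hτ.2])]
                linarith [hτ.1, min_le_left (δ₀ / 2) w]
              have h3 := hδ this
              rw [Real.dist_eq] at h3
              have e : h w = 0 := by simp [hh]
              rw [e, sub_zero] at h3
              exact h3.le
          _ ≤ ε / (4 * Z) * Z := by
              rw [intervalIntegral.integral_const_mul]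
              refine mul_le_mul_of_nonneg_left ?_ hη.le
              rw [← hfm σ h2.1, ← intervalIntegral.integral_add_adjacent_intervals j1 j2]
              have := intervalIntegral.integral_nonneg (μ := volume) (a := -w) (b := w - δ)
                (by linarith) (fun τ _ => hf0 σ τ)
              linarith
      rw [show ε / (4 * Z) * Z = ε / 4 by field_simp] at hle
      rw [Real.dist_eq] at h1 ⊢
      rw [add_sub_right_comm]
      refine (abs_add_le _ _).trans_lt ?_
      linarith
    refine ⟨_, image_mem_map hev, ?_⟩
    rintro _ ⟨σ, hσ, rfl⟩ _ ⟨σ', hσ', rfl⟩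
    have := dist_triangle_right (∫ τ in (-w)..w, h τ * f σ τ) (∫ τ in (-w)..w, h τ * f σ' τ) L
    have h1 : dist (∫ τ in (-w)..w, h τ * f σ τ) L < ε / 2 := hσ
    have h2 : dist (∫ τ in (-w)..w, h τ * f σ' τ) L < ε / 2 := hσ'
    linarith
  have hlim : Tendsto (fun σ => ∫ τ in (-w)..w, q τ * f σ τ) (𝓝[<] w) (𝓝 (g + q w * Z)) := by
    refine (hg.add_const (q w * Z)).congr' ?_
    filter_upwards [eventually_Ioo hw hw] with σ hσ
    rw [← hfm σ hσ.1, ← intervalIntegral.integral_const_mul, ← intervalIntegral.integral_add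
      ((hfi σ hσ.1).continuousOn_mul hhc.continuousOn) ((hfi σ hσ.1).const_mul _)]
    congr 1
    ext τ
    simp only [hh]
    ring
  have hpos : c * Z ≤ g + q w * Z := by
    refine ge_of_tendsto hlim ?_
    filter_upwards [eventually_Ioo hw hw] with σ hσ
    rw [← hfm σ hσ.1, ← intervalIntegral.integral_const_mul]
    exact intervalIntegral.integral_mono_on (by linarith) ((hfi σ hσ.1).const_mul _)
      ((hfi σ hσ.1).continuousOn_mul hq.continuousOn) fun τ _ =>
        mul_le_mul_of_nonneg_right (hqc τ) (hf0 σ τ)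
  obtain ⟨l, hl, hlt⟩ := tendsto_im_div_sqrt hc
  refine ⟨1 / (2 * π ^ 2) * (g + q w * Z) * l, ?_, ?_⟩
  · have : 0 < g + q w * Z := lt_of_lt_of_le (by positivity) hpos
    positivity
  · refine ((hlim.const_mul (1 / (2 * π ^ 2))).mul hlt).congr' ?_
    filter_upwards [eventually_Ioo hw hw] with σ hσ
    have e : ∫ τ in (-w)..w, q τ * f σ τ = (∫ τ in (-w)..w, q τ * Gk c₁ τ σ) / (bp c₁ σ).im := by
      rw [← intervalIntegral.integral_div]
      congr 1
      ext τ
      simp only [hf]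
      ring
    have n := (bp_im_pos hc hσ.1).ne'
    rw [e, dens, ← hwd]
    field_simp


/-! ### The symmetrized logarithmic kernel -/

/-- The symmetrized kernel: `log|t-x| + log|e^t-e^x| = ell (t - x) + (t + x) / 2`. -/
def ell (y : ℝ) : ℝ := log |y| + log |2 * sinh (y / 2)|

/-- The local singularity that dominates the logarithm. -/
def invSqrt : ℝ → ℝ := (Icc (-1) 1).indicator fun y => |y| ^ (-(1 / 2) : ℝ)

lemma integrable_invSqrt : Integrable invSqrt := by
  rw [invSqrt, integrable_indicator_iff measurableSet_Icc, integrableOn_Icc_iff_integrableOn_Ioc,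
    ← intervalIntegrable_iff_integrableOn_Ioc_of_le (by norm_num)]
  simpa using intervalIntegrable_abs_sub_rpow (α := -(1 / 2)) (by norm_num) 0 (-1) 1

lemma invSqrt_nonneg (y : ℝ) : 0 ≤ invSqrt y :=
  indicator_nonneg (fun _ _ => Real.rpow_nonneg (abs_nonneg _) _) y

lemma inv_sqrt_le {y : ℝ} : (√|y|)⁻¹ ≤ 1 + invSqrt y := by
  have e : (√|y|)⁻¹ = |y| ^ (-(1 / 2) : ℝ) := by
    rw [Real.rpow_neg (abs_nonneg _), Real.sqrt_eq_rpow]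
  by_cases h : y ∈ Icc (-1 : ℝ) 1
  · rw [invSqrt, indicator_of_mem h, e]
    linarith
  · rw [invSqrt, indicator_of_notMem h, add_zero]
    refine inv_le_one_of_one_le₀ (Real.one_le_sqrt.2 ?_)
    rw [mem_Icc, ← abs_le, not_le] at h
    exact h.le

lemma log_le_two_sqrt {v : ℝ} (hv : 0 ≤ v) : log v ≤ 2 * √v := by
  rcases hv.eq_or_lt with rfl | hv
  · simp
  have h1 := Real.log_le_sub_one_of_pos (Real.sqrt_pos.2 hv)
  rw [Real.log_sqrt hv.le] at h1
  linarith

lemma neg_log_abs_le (y : ℝ) : -log |y| ≤ 2 * invSqrt y := by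
  rcases eq_or_ne y 0 with rfl | hy
  · simpa using invSqrt_nonneg 0
  by_cases h : y ∈ Icc (-1 : ℝ) 1
  · have h1 := log_le_two_sqrt (v := |y|⁻¹) (by positivity)
    have e : √|y|⁻¹ = |y| ^ (-(1 / 2) : ℝ) := by
      rw [Real.rpow_neg (abs_nonneg _), Real.sqrt_inv, Real.sqrt_eq_rpow]
    rw [Real.log_inv, e] at h1
    rwa [invSqrt, indicator_of_mem h]
  · rw [invSqrt, indicator_of_notMem h]
    rw [mem_Icc, ← abs_le, not_le] at h
    have := Real.log_nonneg h.le
    linarith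

lemma log_abs_le (y : ℝ) : log |y| ≤ |y| := by
  rcases eq_or_ne y 0 with rfl | hy
  · simp
  linarith [Real.log_le_sub_one_of_pos (abs_pos.2 hy)]

lemma abs_log_abs_le (y : ℝ) : |(log |y|)| ≤ |y| + 2 * invSqrt y :=
  abs_le.2 ⟨by linarith [neg_log_abs_le y, abs_nonneg y],
    by linarith [log_abs_le y, invSqrt_nonneg y]⟩

lemma abs_le_two_sinh (y : ℝ) : |y| ≤ |2 * sinh (y / 2)| := by
  rcases le_total 0 y with h | h
  · have := Real.self_le_sinh_iff.2 (show 0 ≤ y / 2 by linarith)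
    rw [abs_of_nonneg h, abs_of_nonneg (by linarith)]
    linarith
  · have := Real.sinh_le_self_iff.2 (show y / 2 ≤ 0 by linarith)
    rw [abs_of_nonpos h, abs_of_nonpos (by linarith)]
    linarith

lemma two_sinh_le_exp (y : ℝ) : |2 * sinh (y / 2)| ≤ exp |y| := by
  rw [Real.sinh_eq, mul_div_cancel₀ _ two_ne_zero]
  have h1 : exp (y / 2) ≤ exp |y| :=
    Real.exp_le_exp.2 (by linarith [le_abs_self y, abs_nonneg y])
  have h2 : exp (-(y / 2)) ≤ exp |y| :=
    Real.exp_le_exp.2 (by linarith [neg_abs_le y, abs_nonneg y])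
  exact abs_le.2 ⟨by linarith [Real.exp_pos (y / 2)], by linarith [Real.exp_pos (-(y / 2))]⟩

lemma log_sinh_le (y : ℝ) : log |2 * sinh (y / 2)| ≤ |y| := by
  rcases eq_or_ne y 0 with rfl | hy
  · simp
  rw [← Real.log_exp |y|]
  exact Real.log_le_log ((abs_pos.2 hy).trans_le (abs_le_two_sinh y)) (two_sinh_le_exp y)

lemma log_abs_le_log_sinh (y : ℝ) : log |y| ≤ log |2 * sinh (y / 2)| := by
  rcases eq_or_ne y 0 with rfl | hy
  · simp
  exact Real.log_le_log (abs_pos.2 hy) (abs_le_two_sinh y)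

lemma abs_log_sinh_le (y : ℝ) : |(log |2 * sinh (y / 2)|)| ≤ |y| + 2 * invSqrt y :=
  abs_le.2 ⟨by linarith [neg_log_abs_le y, abs_nonneg y, log_abs_le_log_sinh y],
    by linarith [log_sinh_le y, invSqrt_nonneg y]⟩

lemma ell_neg (y : ℝ) : ell (-y) = ell y := by
  rw [ell, ell, abs_neg, neg_div, Real.sinh_neg, mul_neg, abs_neg]

lemma abs_ell_le (y : ℝ) : |ell y| ≤ 2 * |y| + 4 * invSqrt y :=
  (abs_add_le _ _).trans (by linarith [abs_log_abs_le y, abs_log_sinh_le y])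

lemma measurable_ell : Measurable ell := by
  have h : Measurable fun y : ℝ => 2 * sinh (y / 2) := by
    have := Real.continuous_sinh
    exact (by fun_prop : Continuous fun y : ℝ => 2 * sinh (y / 2)).measurable
  exact (Real.measurable_log.comp measurable_norm).add (Real.measurable_log.comp h.norm)

lemma exp_sub_exp_eq (t x : ℝ) :
    exp t - exp x = exp ((t + x) / 2) * (2 * sinh ((t - x) / 2)) := by
  rw [Real.sinh_eq, mul_div_cancel₀ _ two_ne_zero, mul_sub, ← Real.exp_add, ← Real.exp_add]
  ring_nf

lemma log_exp_sub_exp {t x : ℝ} (h : t ≠ x) :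
    log |exp t - exp x| = log |2 * sinh ((t - x) / 2)| + (t + x) / 2 := by
  have h1 : (2 * sinh ((t - x) / 2)) ≠ 0 := by
    refine mul_ne_zero two_ne_zero (Real.sinh_ne_zero.2 ?_)
    exact div_ne_zero (sub_ne_zero.2 h) two_ne_zero
  rw [exp_sub_exp_eq, abs_mul, Real.log_mul (abs_ne_zero.2 (Real.exp_ne_zero _))
    (abs_ne_zero.2 h1), abs_of_pos (Real.exp_pos _), Real.log_exp, add_comm]

lemma log_add_log_exp {t x : ℝ} (h : t ≠ x) :
    log |t - x| + log |exp t - exp x| = ell (t - x) + (t + x) / 2 := by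
  rw [log_exp_sub_exp h, ell, add_assoc]

lemma sinh_mul_sinh (u d : ℝ) : (2 * sinh ((u + d) / 2)) * (2 * sinh ((u - d) / 2)) =
    (2 * sinh (u / 2)) ^ 2 - (2 * sinh (d / 2)) ^ 2 := by
  rw [add_div, sub_div, Real.sinh_add, Real.sinh_sub]
  have h1 := Real.cosh_sq (u / 2)
  have h2 := Real.cosh_sq (d / 2)
  linear_combination (4 * sinh (u / 2) ^ 2) * h2 - (4 * sinh (d / 2) ^ 2) * h1

lemma sinh_half_pos {u : ℝ} (hu : 0 < u) : 0 < 2 * sinh (u / 2) :=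
  mul_pos two_pos (Real.sinh_pos_iff.2 (by linarith))

lemma ell_add_ell {u d : ℝ} (hu : 0 < u + d) (hd : u ≠ d) : ell (u + d) + ell (u - d) =
    log |u ^ 2 - d ^ 2| + log |(2 * sinh (u / 2)) ^ 2 - (2 * sinh (d / 2)) ^ 2| := by
  have h1 := sinh_half_pos hu
  have h2 : 2 * sinh ((u - d) / 2) ≠ 0 :=
    mul_ne_zero two_ne_zero (Real.sinh_ne_zero.2 (div_ne_zero (sub_ne_zero.2 hd) two_ne_zero))
  rw [← sinh_mul_sinh, sq_sub_sq, abs_mul, abs_mul, Real.log_mul (abs_ne_zero.2 hu.ne')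
    (abs_ne_zero.2 (sub_ne_zero.2 hd)), Real.log_mul (abs_ne_zero.2 h1.ne') (abs_ne_zero.2 h2), ell,
    ell]
  ring

lemma two_mul_ell {u : ℝ} (hu : 0 < u) :
    2 * ell u = log (u ^ 2) + log ((2 * sinh (u / 2)) ^ 2) := by
  rw [Real.log_pow, Real.log_pow, ell, abs_of_pos hu, abs_of_pos (sinh_half_pos hu)]
  push_cast
  ring

/-- Midpoint concavity of the kernel on the half line. -/
lemma ell_add_ell_le {u d : ℝ} (hd : 0 ≤ d) (hu : d < u) : ell (u + d) + ell (u - d) ≤ 2 * ell u := by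
  have hs : 2 * sinh (d / 2) < 2 * sinh (u / 2) := by
    have := Real.sinh_lt_sinh.2 (show d / 2 < u / 2 by linarith)
    linarith
  have hs0 : 0 ≤ 2 * sinh (d / 2) := by
    have := Real.sinh_nonneg_iff.2 (show 0 ≤ d / 2 by linarith)
    linarith
  have p1 : 0 < u ^ 2 - d ^ 2 := by nlinarith
  have p2 : 0 < (2 * sinh (u / 2)) ^ 2 - (2 * sinh (d / 2)) ^ 2 := by nlinarith
  rw [ell_add_ell (by linarith) hu.ne', two_mul_ell (by linarith), abs_of_pos p1, abs_of_pos p2]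
  exact add_le_add (Real.log_le_log p1 (by nlinarith)) (Real.log_le_log p2 (by nlinarith))

/-- Near the singularity the second difference of the kernel is controlled by a square root. -/
lemma ell_add_ell_le' {u d : ℝ} (hu : 0 < u) (hud : u < d) (hd : d ≤ 1) :
    ell (u + d) + ell (u - d) - 2 * ell u ≤ 12 * √(d / u) := by
  have hd0 : 0 < d := hu.trans hud
  have hsu := sinh_half_pos hu
  have hsu' : u ≤ 2 * sinh (u / 2) := by
    have := Real.self_le_sinh_iff.2 (show 0 ≤ u / 2 by linarith)
    linarith
  have hs : 2 * sinh (u / 2) < 2 * sinh (d / 2) := by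
    have := Real.sinh_lt_sinh.2 (show u / 2 < d / 2 by linarith)
    linarith
  have hsd : 2 * sinh (d / 2) ≤ 2 * d := by
    have h1 := Real.abs_exp_sub_one_le (x := d / 2) (by rw [abs_of_pos (by linarith)]; linarith)
    have h2 := Real.add_one_le_exp (-(d / 2))
    rw [abs_of_pos (by linarith : 0 < d / 2)] at h1
    rw [Real.sinh_eq]
    linarith [le_abs_self (exp (d / 2) - 1)]
  have p1 : u ^ 2 - d ^ 2 < 0 := by nlinarith
  have p2 : (2 * sinh (u / 2)) ^ 2 - (2 * sinh (d / 2)) ^ 2 < 0 := by nlinarith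
  rw [ell_add_ell (by linarith) hud.ne, two_mul_ell hu, abs_of_neg p1, abs_of_neg p2]
  have q1 : log (-(u ^ 2 - d ^ 2)) - log (u ^ 2) ≤ 4 * √(d / u) := by
    rw [← Real.log_div (by linarith) (by positivity)]
    have h1 : -(u ^ 2 - d ^ 2) / u ^ 2 ≤ (d / u) ^ 2 := by
      rw [div_pow]; gcongr; nlinarith
    have h2 := Real.log_le_log (div_pos (by linarith) (by positivity)) h1
    rw [Real.log_pow] at h2
    push_cast at h2
    linarith [log_le_two_sqrt (v := d / u) (by positivity)]
  have q2 : log (-((2 * sinh (u / 2)) ^ 2 - (2 * sinh (d / 2)) ^ 2)) -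
      log ((2 * sinh (u / 2)) ^ 2) ≤ 8 * √(d / u) := by
    rw [← Real.log_div (by linarith) (by positivity)]
    have h1 : -((2 * sinh (u / 2)) ^ 2 - (2 * sinh (d / 2)) ^ 2) /
        (2 * sinh (u / 2)) ^ 2 ≤ (2 ^ 2 * (d / u)) ^ 2 := by
      rw [div_le_iff₀ (by positivity)]
      have h3 : 1 ≤ (2 * sinh (u / 2)) / u := (one_le_div hu).2 hsu'
      have h4 : (2 ^ 2 * (d / u)) ^ 2 * (2 * sinh (u / 2)) ^ 2 =
          (4 * d) ^ 2 * ((2 * sinh (u / 2)) / u) ^ 2 := by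
        field_simp
        ring
      rw [h4]
      have h5 : 1 ≤ ((2 * sinh (u / 2)) / u) ^ 2 := one_le_pow₀ h3
      nlinarith [sq_nonneg (4 * d)]
    have h2 := Real.log_le_log (div_pos (by linarith) (by positivity)) h1
    rw [Real.log_pow] at h2
    push_cast at h2
    have h6 := log_le_two_sqrt (v := 2 ^ 2 * (d / u)) (by positivity)
    rw [Real.sqrt_mul (by positivity), Real.sqrt_sq (by norm_num)] at h6
    linarith
  linarith

lemma abs_log_sub_log_le {A B y y' : ℝ} (hy : y ≠ 0) (hy' : y' ≠ 0) (hA : |y| ≤ |A|)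
    (hB : |y'| ≤ |B|) : |(log |A| - log |B|)| ≤
      2 * √|A - B| * (2 + invSqrt y + invSqrt y') := by
  have key : ∀ A B y' : ℝ, 0 < |A| → y' ≠ 0 → |y'| ≤ |B| →
      log |A| - log |B| ≤ 2 * √|A - B| * (1 + invSqrt y') := by
    intro A B y' hA hy' hB
    have hB0 : 0 < |B| := (abs_pos.2 hy').trans_le hB
    have hn := invSqrt_nonneg y'
    rcases le_total |A| |B| with h | h
    · have : log |A| - log |B| ≤ 0 := by linarith [Real.log_le_log hA h]
      exact this.trans (by positivity)
    rw [← Real.log_div hA.ne' hB0.ne']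
    have hr : √|A| ≤ √|A - B| + √|B| := by
      have h1 : |A| ≤ |A - B| + |B| := by
        have := abs_add_le (A - B) B; rwa [sub_add_cancel] at this
      exact (Real.sqrt_le_sqrt h1).trans (Real.sqrt_le_iff.2
        ⟨by positivity, by
          rw [add_sq, Real.sq_sqrt (abs_nonneg _), Real.sq_sqrt (abs_nonneg _)]
          have : 0 ≤ 2 * √|A - B| * √|B| := by positivity
          linarith⟩)
    have h2 := Real.log_le_sub_one_of_pos (Real.sqrt_pos.2 (div_pos hA hB0))
    rw [Real.log_sqrt (by positivity), Real.sqrt_div (abs_nonneg _)] at h2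
    have hsB : 0 < √|B| := Real.sqrt_pos.2 hB0
    have h3 : √|A| / √|B| - 1 ≤ √|A - B| * (√|B|)⁻¹ := by
      rw [div_sub_one hsB.ne', ← div_eq_mul_inv]
      gcongr
      linarith
    have h4 : (√|B|)⁻¹ ≤ 1 + invSqrt y' :=
      (inv_anti₀ (Real.sqrt_pos.2 (abs_pos.2 hy')) (Real.sqrt_le_sqrt hB)).trans inv_sqrt_le
    have h5 := mul_le_mul_of_nonneg_left h4 (Real.sqrt_nonneg |A - B|)
    linarith
  have h1 := key A B y' ((abs_pos.2 hy).trans_le hA) hy' hB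
  have h2 := key B A y ((abs_pos.2 hy').trans_le hB) hy hA
  rw [abs_sub_comm B A] at h2
  have n1 := mul_nonneg (mul_nonneg two_pos.le (Real.sqrt_nonneg |A - B|))
    (add_nonneg zero_le_one (invSqrt_nonneg y))
  have n2 := mul_nonneg (mul_nonneg two_pos.le (Real.sqrt_nonneg |A - B|))
    (add_nonneg zero_le_one (invSqrt_nonneg y'))
  exact abs_le.2 ⟨by linarith, by linarith⟩

/-! ### Potentials of bounded densities -/

/-- A bounded density which vanishes outside `(a,b)`. -/
structure IsBoundedDensity (ρ : ℝ → ℝ) (a b M : ℝ) : Prop where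
  measurable : Measurable ρ
  nonneg : ∀ x, 0 ≤ ρ x
  le : ∀ x, ρ x ≤ M
  eq_zero : ∀ x, x ∉ Ioo a b → ρ x = 0
  lt : a < b

/-- The symmetrized logarithmic potential. -/
def ellPot (ρ : ℝ → ℝ) (x : ℝ) : ℝ := ∫ t, ρ t * ell (t - x)

namespace IsBoundedDensity

variable {ρ : ℝ → ℝ} {a b M : ℝ}

lemma bound_nonneg (h : IsBoundedDensity ρ a b M) : 0 ≤ M := (h.nonneg 0).trans (h.le 0)

lemma integrable_mul (h : IsBoundedDensity ρ a b M) {f : ℝ → ℝ} (hf : IntegrableOn f (Ioo a b)) :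
    Integrable fun t => ρ t * f t := by
  have h1 : IntegrableOn (fun t => ρ t * f t) (Ioo a b) :=
    Integrable.bdd_mul (c := M) hf h.measurable.aestronglyMeasurable
      (.of_forall fun x => by rw [Real.norm_of_nonneg (h.nonneg x)]; exact h.le x)
  refine (integrableOn_iff_integrable_of_support_subset fun t ht => ?_).1 h1
  by_contra hc
  exact ht (by simp only [h.eq_zero t hc, zero_mul])

lemma integrable_mul_of_continuous (h : IsBoundedDensity ρ a b M) {f : ℝ → ℝ} (hf : Continuous f) :
    Integrable fun t => ρ t * f t :=
  h.integrable_mul ((hf.integrableOn_Icc).mono_set Ioo_subset_Icc_self)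

lemma integrable_dom (h : IsBoundedDensity ρ a b M) {f : ℝ → ℝ} (hf : Measurable f) {C x : ℝ}
    (hC : ∀ t, |f t| ≤ C * (|t - x| + invSqrt (t - x))) : Integrable fun t => ρ t * f t := by
  have h1 : IntegrableOn (fun t : ℝ => |t - x|) (Ioo a b) :=
    (by fun_prop : Continuous fun t : ℝ => |t - x|).integrableOn_Icc.mono_set Ioo_subset_Icc_self
  have h2 := (integrable_invSqrt.comp_sub_right x).integrableOn (s := Ioo a b)
  exact h.integrable_mul (((h1.add h2).const_mul C).mono' hf.aestronglyMeasurable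
    (.of_forall hC))

lemma integrable_ell (h : IsBoundedDensity ρ a b M) (x : ℝ) :
    Integrable fun t => ρ t * ell (t - x) :=
  h.integrable_dom (measurable_ell.comp (measurable_id.sub_const x)) (C := 4) (x := x) fun t => by
    have := abs_ell_le (t - x)
    refine this.trans ?_
    linarith [abs_nonneg (t - x)]

lemma integrable_log (h : IsBoundedDensity ρ a b M) (x : ℝ) :
    Integrable fun t => ρ t * log |t - x| :=
  h.integrable_dom (f := fun t => log |t - x|)
    (Real.measurable_log.comp (measurable_id.sub_const x).norm) (C := 2) (x := x)
    fun t => by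
      have := abs_log_abs_le (t - x)
      linarith [abs_nonneg (t - x)]

lemma integrable_log_sinh (h : IsBoundedDensity ρ a b M) (x : ℝ) :
    Integrable fun t => ρ t * log |2 * sinh ((t - x) / 2)| := by
  have e : (fun t => ρ t * log |2 * sinh ((t - x) / 2)|) =
      fun t => ρ t * ell (t - x) - ρ t * log |t - x| := by
    ext t
    rw [ell]
    ring
  rw [e]
  exact (h.integrable_ell x).sub (h.integrable_log x)

lemma ae_ne (x : ℝ) : ∀ᵐ t : ℝ, t ≠ x := by simp [ae_iff, measure_singleton]

lemma integrable_log_exp (h : IsBoundedDensity ρ a b M) (x : ℝ) :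
    Integrable fun t => ρ t * log |exp t - exp x| := by
  refine ((h.integrable_log_sinh x).add
    (h.integrable_mul_of_continuous (f := fun t => (t + x) / 2) (by fun_prop))).congr ?_
  filter_upwards [ae_ne x] with t ht
  rw [log_exp_sub_exp ht]
  simp only [Pi.add_apply]
  ring

/-- The two logarithmic potentials in terms of the symmetrized one. -/
lemma integral_log_add (h : IsBoundedDensity ρ a b M) (x : ℝ) :
    (∫ t, ρ t * log |t - x|) + ∫ t, ρ t * log |exp t - exp x| =
      ellPot ρ x + ((∫ t, ρ t * t) + (∫ t, ρ t) * x) / 2 := by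
  have i1 := h.integrable_mul_of_continuous (f := fun t => t) continuous_id
  have i2 := h.integrable_mul_of_continuous (f := fun _ => x) continuous_const
  have i3 : Integrable fun t => (ρ t * t + ρ t * x) / 2 := (i1.add i2).div_const 2
  rw [← integral_add (h.integrable_log x) (h.integrable_log_exp x), ellPot, ← integral_mul_const,
    ← integral_add i1 i2, ← integral_div, ← integral_add (h.integrable_ell x) i3]
  refine integral_congr_ae ?_
  filter_upwards [ae_ne x] with t ht
  have := log_add_log_exp ht
  rw [← mul_add, this]
  ring

lemma neg (h : IsBoundedDensity ρ a b M) : IsBoundedDensity (fun t => ρ (-t)) (-b) (-a) M where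
  measurable := h.measurable.comp measurable_neg
  nonneg x := h.nonneg _
  le x := h.le _
  eq_zero x hx := h.eq_zero _ fun hc => hx ⟨by linarith [hc.2], by linarith [hc.1]⟩
  lt := by linarith [h.lt]

lemma ellPot_neg (ρ : ℝ → ℝ) (x : ℝ) : ellPot (fun t => ρ (-t)) (-x) = ellPot ρ x := by
  rw [ellPot, ellPot, ← integral_neg_eq_self]
  refine integral_congr_ae (.of_forall fun t => ?_)
  simp only [neg_neg]
  rw [← ell_neg (t - x), neg_sub]
  congr 2
  ring

lemma integral_mul_le (h : IsBoundedDensity ρ a b M) {f g : ℝ → ℝ} (hf : Integrable fun t => ρ t * f t)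
    (hg : Integrable g) (hg0 : ∀ t, 0 ≤ g t) {K : ℝ}
    (hfg : ∀ᵐ t, t ∈ Ioo a b → |f t| ≤ K + g t) :
    |∫ t, ρ t * f t| ≤ M * (K * (b - a) + ∫ t, g t) := by
  have hi : Integrable ((Ioo a b).indicator fun _ : ℝ => M * K) :=
    (integrable_indicator_iff measurableSet_Ioo).2 (integrableOn_const measure_Ioo_lt_top.ne)
  calc |∫ t, ρ t * f t| ≤ ∫ t, ‖ρ t * f t‖ := norm_integral_le_integral_norm (fun t => ρ t * f t)
    _ ≤ ∫ t, ((Ioo a b).indicator (fun _ => M * K) t + M * g t) := by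
        refine integral_mono_ae hf.norm (hi.add (hg.const_mul M)) ?_
        filter_upwards [hfg] with t ht
        rw [norm_mul, Real.norm_of_nonneg (h.nonneg t), Real.norm_eq_abs]
        by_cases hc : t ∈ Ioo a b
        · rw [indicator_of_mem hc, ← mul_add]
          exact mul_le_mul (h.le t) (ht hc) (abs_nonneg _) h.bound_nonneg
        · rw [indicator_of_notMem hc, h.eq_zero t hc, zero_mul, zero_add]
          exact mul_nonneg h.bound_nonneg (hg0 t)
    _ = M * (K * (b - a) + ∫ t, g t) := by
        rw [integral_add hi (hg.const_mul M), integral_indicator measurableSet_Ioo,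
          setIntegral_const, integral_const_mul]
        simp only [Real.volume_real_Ioo_of_le h.lt.le, smul_eq_mul]
        ring

/-- The potential is Hölder continuous on `[a,b]`. -/
lemma continuousOn_ellPot (h : IsBoundedDensity ρ a b M) : ContinuousOn (ellPot ρ) (Icc a b) := by
  -- `2 sinh (y/2)` is Lipschitz on `[-(b-a), b-a]`, and the logarithm costs half of the exponent
  set K := Real.cosh (b - a) with hK
  have hK0 : 0 < K := Real.cosh_pos _
  set N := ∫ t, invSqrt t with hN
  have hlip : ∀ y ∈ Icc (-(b - a)) (b - a), ∀ y' ∈ Icc (-(b - a)) (b - a),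
      |2 * sinh (y / 2) - 2 * sinh (y' / 2)| ≤ K * |y - y'| := by
    intro y hy y' hy'
    have hd : ∀ z ∈ Icc (-(b - a)) (b - a),
        HasDerivWithinAt (fun z => 2 * sinh (z / 2)) (Real.cosh (z / 2)) (Icc (-(b - a)) (b - a)) z :=
      fun z _ => by
        have := (((Real.hasDerivAt_sinh (z / 2)).comp z ((hasDerivAt_id z).div_const 2)).const_mul 2)
        refine HasDerivAt.hasDerivWithinAt (this.congr_deriv ?_)
        ring
    refine (convex_Icc _ _).norm_image_sub_le_of_norm_hasDerivWithin_le hd (fun z hz => ?_) hy' hy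
    rw [Real.norm_of_nonneg (Real.cosh_pos _).le]
    refine Real.cosh_le_cosh.2 ?_
    rw [abs_of_pos (by linarith [h.lt] : 0 < b - a)]
    have := abs_le.2 ⟨hz.1, hz.2⟩
    rw [abs_div, abs_two]
    linarith [abs_nonneg z]
  have hdiff : ∀ x ∈ Icc a b, ∀ x' ∈ Icc a b, |ellPot ρ x - ellPot ρ x'| ≤
      M * (2 * (1 + √K) * √|x - x'| * (2 * (b - a) + 2 * N)) := by
    intro x hx x' hx'
    have i1 := h.integrable_ell x
    have i2 := h.integrable_ell x'
    set D := 2 * (1 + √K) * √|x - x'| with hD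
    have hD0 : 0 ≤ D := by positivity
    have g1 := integrable_invSqrt.comp_sub_right x
    have g2 := integrable_invSqrt.comp_sub_right x'
    rw [ellPot, ellPot, ← integral_sub i1 i2]
    have e : ∀ t, ρ t * ell (t - x) - ρ t * ell (t - x') = ρ t * (ell (t - x) - ell (t - x')) :=
      fun t => by ring
    have i3 := i1.sub i2
    simp only [Pi.sub_def, e] at i3
    simp only [e]
    have := h.integral_mul_le i3 ((g1.add g2).const_mul D)
      (fun t => mul_nonneg hD0 (add_nonneg (invSqrt_nonneg _) (invSqrt_nonneg _)))
      (K := D * 2) ?_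
    · refine this.trans_eq ?_
      have e2 : ∫ t, D * ((fun t => invSqrt (t - x)) + fun t => invSqrt (t - x')) t = D * (2 * N) := by
        rw [integral_const_mul]
        simp only [Pi.add_apply]
        rw [integral_add g1 g2, integral_sub_right_eq_self, integral_sub_right_eq_self]
        ring
      rw [e2]
      ring
    filter_upwards [ae_ne x, ae_ne x'] with t h1 h2 ht
    have hy := sub_ne_zero.2 h1
    have hy' := sub_ne_zero.2 h2
    have b1 := abs_log_sub_log_le hy hy' le_rfl le_rfl
    have b2 := abs_log_sub_log_le hy hy' (abs_le_two_sinh (t - x)) (abs_le_two_sinh (t - x'))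
    have hl := hlip (t - x) ⟨by linarith [ht.1, hx.2], by linarith [ht.2, hx.1]⟩ (t - x')
      ⟨by linarith [ht.1, hx'.2], by linarith [ht.2, hx'.1]⟩
    have ex : t - x - (t - x') = -(x - x') := by ring
    rw [ex, abs_neg] at b1 hl
    have b3 := Real.sqrt_le_sqrt hl
    rw [Real.sqrt_mul hK0.le] at b3
    have hn : 0 ≤ 2 + invSqrt (t - x) + invSqrt (t - x') := by
      linarith [invSqrt_nonneg (t - x), invSqrt_nonneg (t - x')]
    have b4 := mul_le_mul_of_nonneg_right (mul_le_mul_of_nonneg_left b3 two_pos.le) hn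
    have e3 : ell (t - x) - ell (t - x') = (log |t - x| - log |t - x'|) +
        (log |2 * sinh ((t - x) / 2)| - log |2 * sinh ((t - x') / 2)|) := by
      rw [ell, ell]; ring
    rw [e3]
    refine (abs_add_le _ _).trans ((add_le_add b1 (b2.trans b4)).trans_eq ?_)
    simp only [Pi.add_apply, hD]
    ring
  intro x hx
  rw [ContinuousWithinAt, tendsto_iff_norm_sub_tendsto_zero]
  refine squeeze_zero' (.of_forall fun _ => norm_nonneg _)
    (eventually_mem_nhdsWithin.mono fun x' hx' => hdiff x' hx' x hx) ?_
  have hc : Continuous fun x' =>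
      M * (2 * (1 + √K) * √|x' - x| * (2 * (b - a) + 2 * N)) := by fun_prop
  have := hc.tendsto x
  simp only [sub_self, abs_zero, Real.sqrt_zero, mul_zero, zero_mul] at this
  exact this.mono_left nhdsWithin_le_nhds

end IsBoundedDensity


/-! ### Positivity outside the support -/

lemma IsBoundedDensity.secondDiff_eq {ρ : ℝ → ℝ} {a b M : ℝ} (h : IsBoundedDensity ρ a b M)
    (x d : ℝ) : ellPot ρ (x + d) + ellPot ρ (x - d) - 2 * ellPot ρ x =
      ∫ t, ρ t * (ell (x - t + d) + ell (x - t - d) - 2 * ell (x - t)) := by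
  have i1 := h.integrable_ell (x + d)
  have i2 := h.integrable_ell (x - d)
  have i3 := (h.integrable_ell x).const_mul 2
  have i4 : Integrable fun t => ρ t * ell (t - (x + d)) + ρ t * ell (t - (x - d)) := i1.add i2
  rw [ellPot, ellPot, ellPot, ← integral_const_mul, ← integral_add i1 i2, ← integral_sub i4 i3]
  refine integral_congr_ae (.of_forall fun t => ?_)
  simp only
  rw [← ell_neg (t - (x + d)), ← ell_neg (t - (x - d)), ← ell_neg (t - x)]
  ring_nf

/-- The potential is midpoint concave to the right of the support. -/
lemma IsBoundedDensity.secondDiff_nonpos {ρ : ℝ → ℝ} {a b M : ℝ} (h : IsBoundedDensity ρ a b M)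
    {x d : ℝ} (hd : 0 ≤ d) (hx : b ≤ x - d) :
    ellPot ρ (x + d) + ellPot ρ (x - d) - 2 * ellPot ρ x ≤ 0 := by
  rw [h.secondDiff_eq]
  refine integral_nonpos fun t => ?_
  by_cases ht : t ∈ Ioo a b
  · have := ell_add_ell_le (u := x - t) hd (by linarith [ht.2])
    exact mul_nonpos_of_nonneg_of_nonpos (h.nonneg t) (by linarith)
  · simp [h.eq_zero t ht]

/-- If the density vanishes like a square root at `b`, the potential has no convex corner there. -/
lemma IsBoundedDensity.secondDiff_le {ρ : ℝ → ℝ} {a b M : ℝ} (h : IsBoundedDensity ρ a b M)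
    {C d : ℝ} (hC : 0 ≤ C) (hd : 0 < d) (hd1 : d ≤ 1)
    (hρ : ∀ t ∈ Ioo (b - d) b, ρ t ≤ C * √(b - t)) :
    ellPot ρ (b + d) + ellPot ρ (b - d) - 2 * ellPot ρ b ≤ 12 * C * √d * d := by
  have hi : Integrable ((Ioo (b - d) b).indicator fun _ : ℝ => 12 * C * √d) :=
    (integrable_indicator_iff measurableSet_Ioo).2 (integrableOn_const measure_Ioo_lt_top.ne)
  have e : ∫ t, (Ioo (b - d) b).indicator (fun _ => 12 * C * √d) t =
      12 * C * √d * d := by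
    rw [integral_indicator measurableSet_Ioo, setIntegral_const, smul_eq_mul,
      Real.volume_real_Ioo_of_le (by linarith)]
    ring
  rw [h.secondDiff_eq, ← e]
  have hint : Integrable fun t => ρ t * (ell (b - t + d) + ell (b - t - d) - 2 * ell (b - t)) := by
    refine (((h.integrable_ell (b + d)).add (h.integrable_ell (b - d))).sub
      ((h.integrable_ell b).const_mul 2)).congr (.of_forall fun t => ?_)
    simp only [Pi.sub_apply, Pi.add_apply]
    rw [← ell_neg (t - (b + d)), ← ell_neg (t - (b - d)), ← ell_neg (t - b)]
    ring_nf
  refine integral_mono_ae hint hi ?_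
  filter_upwards [IsBoundedDensity.ae_ne (b - d)] with t ht
  by_cases hab : t ∈ Ioo a b
  swap
  · rw [h.eq_zero t hab, zero_mul]
    exact indicator_nonneg (fun _ _ => by positivity) t
  by_cases hm : t ∈ Ioo (b - d) b
  · rw [indicator_of_mem hm]
    have hu : 0 < b - t := by linarith [hm.2]
    have h1 := ell_add_ell_le' hu (by linarith [hm.1] : b - t < d) hd1
    have h2 : √(d / (b - t)) * √(b - t) = √d := by
      rw [← Real.sqrt_mul (by positivity), div_mul_cancel₀ _ hu.ne']
    calc ρ t * (ell (b - t + d) + ell (b - t - d) - 2 * ell (b - t)) ≤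
          ρ t * (12 * √(d / (b - t))) := mul_le_mul_of_nonneg_left h1 (h.nonneg t)
      _ ≤ C * √(b - t) * (12 * √(d / (b - t))) :=
          mul_le_mul_of_nonneg_right (hρ t hm) (by positivity)
      _ = 12 * C * (√(d / (b - t)) * √(b - t)) := by ring
      _ = _ := by rw [h2]
  · rw [indicator_of_notMem hm]
    have hlt : d < b - t := by
      rcases lt_or_gt_of_ne ht with h1 | h1
      · linarith
      · exact absurd ⟨h1, hab.2⟩ hm
    have := ell_add_ell_le hd.le hlt
    exact mul_nonpos_of_nonneg_of_nonpos (h.nonneg t) (by linarith)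

lemma le_of_secondDiff {f : ℕ → ℝ} {A B : ℝ} (h0 : f 0 = 0) (h1 : A ≤ f 1)
    (h2 : ∀ k, B ≤ f (k + 2) + f k - 2 * f (k + 1)) (n : ℕ) :
    n * A + B * (n * (n - 1) / 2) ≤ f n := by
  have key : ∀ n : ℕ, n * A + B * (n * (n - 1) / 2) ≤ f n ∧ A + n * B ≤ f (n + 1) - f n := by
    intro n
    induction n with
    | zero => simp [h0, h1]
    | succ n ih =>
      push_cast
      refine ⟨by linarith [ih.1, ih.2], by linarith [ih.2, h2 n]⟩
  exact (key n).1

/-- A potential difference that is constant near the end point `b` inside the support is strictly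
larger outside. -/
theorem IsBoundedDensity.lt_of_right {ρ : ℝ → ℝ} {a b M : ℝ} (h : IsBoundedDensity ρ a b M)
    {C δ c : ℝ} (hC : 0 ≤ C) (hδ : 0 < δ) (hρ : ∀ t ∈ Ioo (b - δ) b, ρ t ≤ C * √(b - t))
    (hc : 0 < c) {W : ℝ → ℝ} (hW : ∀ x d, 0 ≤ d → c * d ^ 2 ≤ W (x + d) + W (x - d) - 2 * W x)
    (hconst : ∀ x ∈ Icc a b, W x - ellPot ρ x = W b - ellPot ρ b) {x : ℝ} (hx : b < x) :
    W b - ellPot ρ b < W x - ellPot ρ x := by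
  -- `D = n d`; convexity gains order `D²` over the `n` steps, the corner at `b` costs `O(√d D)`
  set D := x - b with hD
  have hD0 : 0 < D := sub_pos.2 hx
  have hlim : Tendsto (fun n : ℕ => D / n) atTop (𝓝 0) := tendsto_const_div_atTop_nhds_zero_nat D
  have hlim2 : Tendsto (fun n : ℕ => -(12 * C * √(D / n) * D) + c * (D * (D - D / n) / 2))
      atTop (𝓝 (-(12 * C * √0 * D) + c * (D * (D - 0) / 2))) :=
    (((hlim.sqrt.const_mul _).mul_const _).neg).add
      ((((tendsto_const_nhds.sub hlim).const_mul _).div_const _).const_mul _)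
  have hpos : 0 < -(12 * C * √0 * D) + c * (D * (D - 0) / 2) := by
    rw [Real.sqrt_zero, mul_zero, zero_mul, neg_zero, zero_add, sub_zero]
    positivity
  obtain ⟨n, h1, h2, h3⟩ := ((hlim2.eventually_const_lt hpos).and
    ((hlim.eventually_lt_const (show 0 < min (min δ 1) (b - a) from
      lt_min (lt_min hδ one_pos) (sub_pos.2 h.lt))).and (eventually_gt_atTop 0))).exists
  have hn : (0 : ℝ) < n := by exact_mod_cast h3
  set d := D / n with hd
  have hd0 : 0 < d := by positivity
  have hdδ : d < δ := h2.trans_le ((min_le_left _ _).trans (min_le_left _ _))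
  have hd1 : d < 1 := h2.trans_le ((min_le_left _ _).trans (min_le_right _ _))
  have hdab : d < b - a := h2.trans_le (min_le_right _ _)
  set f : ℕ → ℝ := fun k => (W (b + k * d) - ellPot ρ (b + k * d)) - (W b - ellPot ρ b) with hf
  have f0 : f 0 = 0 := by simp [hf]
  have f1 : -(12 * C * √d * d) ≤ f 1 := by
    have g1 := h.secondDiff_le hC hd0 hd1.le
      fun t ht => hρ t ⟨by linarith [ht.1], ht.2⟩
    have g2 := hW b d hd0.le
    have g3 := hconst (b - d) ⟨by linarith, by linarith⟩
    simp only [hf, Nat.cast_one, one_mul]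
    have : 0 ≤ c * d ^ 2 := by positivity
    linarith
  have f2 : ∀ k, c * d ^ 2 ≤ f (k + 2) + f k - 2 * f (k + 1) := by
    intro k
    have hk : (0 : ℝ) ≤ k * d := by positivity
    have g1 := h.secondDiff_nonpos (x := b + (k + 1) * d) hd0.le (by linarith)
    have g2 := hW (b + (k + 1) * d) d hd0.le
    have e1 : b + (k + 1 : ℝ) * d + d = b + (k + 2) * d := by ring
    have e2 : b + (k + 1 : ℝ) * d - d = b + k * d := by ring
    rw [e1, e2] at g1 g2
    simp only [hf]
    push_cast
    linarith
  have hfin := le_of_secondDiff f0 f1 f2 n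
  have en : (n : ℝ) * d = D := by rw [hd]; field_simp
  have e3 : (n : ℝ) * -(12 * C * √d * d) + c * d ^ 2 * (n * (n - 1) / 2) =
      -(12 * C * √d * D) + c * (D * (D - d) / 2) := by
    rw [← en]
    ring
  rw [e3] at hfin
  have e4 : f n = (W x - ellPot ρ x) - (W b - ellPot ρ b) := by
    simp only [hf, en, hD]
    ring_nf
  linarith

/-- The mirror image of `IsBoundedDensity.lt_of_right`. -/
theorem IsBoundedDensity.lt_of_left {ρ : ℝ → ℝ} {a b M : ℝ} (h : IsBoundedDensity ρ a b M)
    {C δ c : ℝ} (hC : 0 ≤ C) (hδ : 0 < δ) (hρ : ∀ t ∈ Ioo a (a + δ), ρ t ≤ C * √(t - a))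
    (hc : 0 < c) {W : ℝ → ℝ} (hW : ∀ x d, 0 ≤ d → c * d ^ 2 ≤ W (x + d) + W (x - d) - 2 * W x)
    (hconst : ∀ x ∈ Icc a b, W x - ellPot ρ x = W a - ellPot ρ a) {x : ℝ} (hx : x < a) :
    W a - ellPot ρ a < W x - ellPot ρ x := by
  have e := IsBoundedDensity.ellPot_neg ρ
  have key := h.neg.lt_of_right (C := C) (δ := δ) (c := c) (W := fun x => W (-x)) hC hδ
    (fun t ht => ?_) hc (fun x d hd => ?_) (fun y hy => ?_) (x := -x) (by linarith)
  · simpa only [e, neg_neg] using key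
  · have := hρ (-t) ⟨by linarith [ht.2], by linarith [ht.1]⟩
    rwa [show -t - a = -a - t by ring] at this
  · have := hW (-x) d hd
    rw [show -(x + d) = -x - d by ring, show -(x - d) = -x + d by ring]
    linarith
  · have := hconst (-y) ⟨by linarith [hy.2], by linarith [hy.1]⟩
    rw [e, neg_neg, ← e (-y), neg_neg] at *
    exact this

/-- Strong convexity in terms of second differences. -/
lemma IsField.secondDiff_ge (h : IsField V c) (x : ℝ) {d : ℝ} (hd : 0 ≤ d) :
    c * d ^ 2 ≤ V (x + d) + V (x - d) - 2 * V x := by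
  have hder : ∀ s, HasDerivAt (fun s => V (x + s) + V (x - s) - c * s ^ 2)
      (deriv V (x + s) - deriv V (x - s) - 2 * c * s) s := by
    intro s
    have h1 := (h.hasDerivAt (x + s)).comp_const_add x s
    have h2 := (h.hasDerivAt (x - s)).comp_const_sub x s
    have h3 := ((hasDerivAt_id s).pow 2).const_mul c
    refine ((h1.add h2).sub h3).congr_deriv ?_
    simp
    ring
  have hmono : MonotoneOn (fun s => V (x + s) + V (x - s) - c * s ^ 2) (Ici 0) := by
    refine monotoneOn_of_deriv_nonneg (convex_Ici 0)
      (fun s _ => (hder s).continuousAt.continuousWithinAt)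
      (fun s _ => (hder s).differentiableAt.differentiableWithinAt) fun s hs => ?_
    rw [interior_Ici] at hs
    rw [(hder s).deriv]
    have := h.deriv_sub_ge (x := x - s) (y := x + s) (by linarith [mem_Ioi.1 hs])
    linarith
  have := hmono (mem_Ici.2 le_rfl) (mem_Ici.2 hd) hd
  simp only [add_zero, sub_zero] at this
  linarith


/-! ### The equilibrium density -/

/-- The density in the original variable, extended by zero. -/
def psi (V : ℝ → ℝ) (c₁ c₀ : ℝ) : ℝ → ℝ :=
  (Ioo (c₀ - radius c₁) (c₀ + radius c₁)).indicator fun x =>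
    dens c₁ (fun τ => deriv (deriv V) (c₀ + τ)) (x - c₀)

lemma sub_mem_Ioo {c₀ w x : ℝ} (hx : x ∈ Ioo (c₀ - w) (c₀ + w)) : x - c₀ ∈ Ioo (-w) w :=
  ⟨by linarith [hx.1], by linarith [hx.2]⟩

lemma continuous_weight (h : IsField V c) (c₀ : ℝ) :
    Continuous fun τ => deriv (deriv V) (c₀ + τ) :=
  h.continuous_deriv2.comp (by fun_prop)

lemma psi_pos (h : IsField V c) (hc : 0 < c₁) (c₀ : ℝ)
    {x : ℝ} (hx : x ∈ Ioo (c₀ - radius c₁) (c₀ + radius c₁)) :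
    0 < psi V c₁ c₀ x := by
  rw [psi, indicator_of_mem hx]
  exact dens_pos hc (continuous_weight h c₀) h.pos (fun τ => h.le _) (sub_mem_Ioo hx)

lemma isBoundedDensity_psi (h : IsField V c) (hc : 0 < c₁) (c₀ : ℝ) :
    ∃ M, IsBoundedDensity (psi V c₁ c₀) (c₀ - radius c₁) (c₀ + radius c₁) M := by
  obtain ⟨M, hM, hle⟩ := exists_dens_le hc (continuous_weight h c₀)
  have hw := radius_pos hc
  refine ⟨M * (1 / 2 + 1 / √c₁),
    ((measurable_dens hc (continuous_weight h c₀)).comp (measurable_id.sub_const c₀)).indicator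
      measurableSet_Ioo, fun x => ?_, fun x => ?_, fun x hx => indicator_of_notMem hx _, by linarith⟩
  · by_cases hx : x ∈ Ioo (c₀ - radius c₁) (c₀ + radius c₁)
    · exact (psi_pos h hc c₀ hx).le
    · exact (indicator_of_notMem hx _).ge
  · by_cases hx : x ∈ Ioo (c₀ - radius c₁) (c₀ + radius c₁)
    · rw [psi, indicator_of_mem hx]
      refine (hle _ (sub_mem_Ioo hx)).trans ?_
      gcongr
      exact (Complex.im_le_norm _).trans (norm_bp_le hc _)
    · rw [psi, indicator_of_notMem hx]
      positivity

lemma integral_psi_mul (hc : 0 < c₁) (c₀ : ℝ)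
    (f : ℝ → ℝ) : ∫ t, psi V c₁ c₀ t * f t =
    ∫ σ in (-radius c₁)..(radius c₁),
      dens c₁ (fun τ => deriv (deriv V) (c₀ + τ)) σ * f (c₀ + σ) := by
  have hw := radius_pos hc
  have h1 := intervalIntegral.integral_comp_add_left (a := -radius c₁) (b := radius c₁)
    (fun x => dens c₁ (fun τ => deriv (deriv V) (c₀ + τ)) (x - c₀) * f x) c₀
  simp only [add_sub_cancel_left] at h1
  rw [h1, intervalIntegral.integral_of_le (by linarith), integral_Ioc_eq_integral_Ioo,
    ← integral_indicator measurableSet_Ioo, ← sub_eq_add_neg]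
  congr 1
  ext t
  rw [psi, indicator_mul_left]

lemma integral_psi (h : IsField V c) (hc : 0 < c₁) (c₀ : ℝ)
    (hs : meanStiffness V c₁ c₀ = π / c₁) : ∫ t, psi V c₁ c₀ t = 1 := by
  have h1 := integral_psi_mul (V := V) hc c₀ fun _ => 1
  simp only [mul_one] at h1
  rw [h1, integral_dens hc (continuous_weight h c₀)]
  rw [meanStiffness] at hs
  rw [hs]
  have := Real.pi_pos
  field_simp

lemma integral_weight_mul_max (h : IsField V c) (c₀ : ℝ) {s : ℝ} (hs : s ∈ Icc (-radius c₁) (radius c₁)) :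
    ∫ τ in (-radius c₁)..(radius c₁), deriv (deriv V) (c₀ + τ) * max s τ =
      V (c₀ + s) - s * deriv V (c₀ - radius c₁) +
        (radius c₁ * deriv V (c₀ + radius c₁) - V (c₀ + radius c₁)) := by
  set w := radius c₁
  have hcont : Continuous fun τ => deriv (deriv V) (c₀ + τ) * max s τ :=
    (continuous_weight h c₀).mul (by fun_prop)
  have e1 : ∫ τ in (-w)..s, deriv (deriv V) (c₀ + τ) * max s τ =
      ∫ τ in (-w)..s, deriv (deriv V) (c₀ + τ) * s :=
    intervalIntegral.integral_congr fun τ hτ => by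
      rw [uIcc_of_le hs.1] at hτ
      simp only [max_eq_left hτ.2]
  have e2 : ∫ τ in s..w, deriv (deriv V) (c₀ + τ) * max s τ =
      ∫ τ in s..w, deriv (deriv V) (c₀ + τ) * τ :=
    intervalIntegral.integral_congr fun τ hτ => by
      rw [uIcc_of_le hs.2] at hτ
      simp only [max_eq_right hτ.1]
  have d1 : ∀ τ, HasDerivAt (fun τ => deriv V (c₀ + τ)) (deriv (deriv V) (c₀ + τ)) τ := fun τ =>
    (h.hasDerivAt_deriv (c₀ + τ)).comp_const_add c₀ τ
  have d2 : ∀ τ, HasDerivAt (fun τ => deriv V (c₀ + τ) * τ - V (c₀ + τ))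
      (deriv (deriv V) (c₀ + τ) * τ) τ := fun τ => by
    refine (((d1 τ).mul (hasDerivAt_id τ)).sub
      ((h.hasDerivAt (c₀ + τ)).comp_const_add c₀ τ)).congr_deriv ?_
    simp
  have i1 := intervalIntegral.integral_eq_sub_of_hasDerivAt (a := -w) (b := s) (fun τ _ => d1 τ)
    ((continuous_weight h c₀).intervalIntegrable _ _)
  have i2 := intervalIntegral.integral_eq_sub_of_hasDerivAt (a := s) (b := w) (fun τ _ => d2 τ)
    (((continuous_weight h c₀).mul continuous_id).intervalIntegrable _ _)
  rw [← intervalIntegral.integral_add_adjacent_intervals (hcont.intervalIntegrable _ _)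
    (hcont.intervalIntegrable _ _) (b := s), e1, e2, intervalIntegral.integral_mul_const, i1, i2,
    ← sub_eq_add_neg]
  ring

lemma intervalIntegrable_ell (s a b : ℝ) : IntervalIntegrable (fun σ => ell (σ - s)) volume a b := by
  have h1 : IntervalIntegrable (fun σ => 2 * |σ - s| + 4 * invSqrt (σ - s)) volume a b :=
    ((by fun_prop : Continuous fun σ : ℝ => 2 * |σ - s|).intervalIntegrable _ _).add
      (((integrable_invSqrt.comp_sub_right s).intervalIntegrable).const_mul 4)
  exact h1.mono_fun' (measurable_ell.comp (measurable_id.sub_const s)).aestronglyMeasurable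
    (.of_forall fun σ => abs_ell_le _)

/-- The Euler-Lagrange equation inside the support, in terms of differences. -/
lemma ellPot_psi_sub (h : IsField V c) (hc : 0 < c₁) (c₀ : ℝ)
    (hs : meanStiffness V c₁ c₀ = π / c₁) (hf : meanForce V c₁ c₀ = 0)
    {x x' : ℝ} (hx : x ∈ Ioo (c₀ - radius c₁) (c₀ + radius c₁))
    (hx' : x' ∈ Ioo (c₀ - radius c₁) (c₀ + radius c₁)) (hlt : x' < x) :
    ellPot (psi V c₁ c₀) x - ellPot (psi V c₁ c₀) x' = V x - V x' - (x - x') / 2 := by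
  obtain ⟨M, hM⟩ := isBoundedDensity_psi h hc c₀
  set w := radius c₁ with hwd
  have hw : 0 < w := radius_pos hc
  have hπ := Real.pi_pos
  have hq := continuous_weight h c₀
  obtain ⟨s, rfl⟩ : ∃ s, x = c₀ + s := ⟨x - c₀, by ring⟩
  obtain ⟨s', rfl⟩ : ∃ s, x' = c₀ + s := ⟨x' - c₀, by ring⟩
  have hsI := sub_mem_Ioo hx
  have hsI' := sub_mem_Ioo hx'
  rw [add_sub_cancel_left] at hsI hsI'
  have hss : s' < s := by linarith
  set g : ℝ → ℝ := fun σ => ell (σ - s) - ell (σ - s') + (s - s') / 2 with hg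
  have hgi : IntervalIntegrable g volume (-w) w :=
    ((intervalIntegrable_ell s _ _).sub (intervalIntegrable_ell s' _ _)).add intervalIntegrable_const
  have hgm : Measurable g :=
    ((measurable_ell.comp (measurable_id.sub_const s)).sub
      (measurable_ell.comp (measurable_id.sub_const s'))).add_const _
  -- the left hand side is an integral against the centred density
  have e1 : ellPot (psi V c₁ c₀) (c₀ + s) - ellPot (psi V c₁ c₀) (c₀ + s') + (s - s') / 2 =
      ∫ σ in (-w)..w, dens c₁ (fun τ => deriv (deriv V) (c₀ + τ)) σ * g σ := by
    have h1 := integral_psi_mul (V := V) hc c₀ fun t => g (t - c₀)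
    simp only [add_sub_cancel_left] at h1
    rw [← hwd] at h1
    rw [← h1]
    have i1 := hM.integrable_ell (c₀ + s)
    have i2 := hM.integrable_ell (c₀ + s')
    have i3 := hM.integrable_mul_of_continuous (f := fun _ => (s - s') / 2) continuous_const
    have e3 : (s - s') / 2 = ∫ t, psi V c₁ c₀ t * ((s - s') / 2) := by
      rw [integral_mul_const, integral_psi h hc c₀ hs, one_mul]
    have i4 : Integrable fun t => psi V c₁ c₀ t * ell (t - (c₀ + s)) -
      psi V c₁ c₀ t * ell (t - (c₀ + s')) := i1.sub i2
    rw [e3, ellPot, ellPot, ← integral_sub i1 i2, ← integral_add i4 i3]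
    congr 1
    ext t
    simp only [hg]
    rw [sub_sub t c₀ s, sub_sub t c₀ s']
    ring
  -- the inner integral is given by the potential identity for the kernel
  have e2 : ∫ τ in (-w)..w, deriv (deriv V) (c₀ + τ) * ∫ σ in (-w)..w, Gk c₁ σ τ * g σ =
      ∫ τ in (-w)..w, (2 * π ^ 2 * (deriv (deriv V) (c₀ + τ) * max s τ -
        deriv (deriv V) (c₀ + τ) * max s' τ) -
          π * (s - s') * (deriv (deriv V) (c₀ + τ) * angle c₁ τ)) := by
    refine intervalIntegral.integral_congr_ae ?_
    filter_upwards [IsBoundedDensity.ae_ne w] with τ h1 h2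
    rw [uIoc_of_le (by linarith)] at h2
    have h3 := (integral_Gk_potential hc ⟨h2.1, lt_of_le_of_ne h2.2 h1⟩ hsI hsI' hss).2
    have h4 : ∫ σ in (-w)..w, Gk c₁ σ τ * g σ = ∫ σ in (-w)..w, Gk c₁ σ τ * lamQ s s' σ := by
      refine intervalIntegral.integral_congr_ae ?_
      filter_upwards [IsBoundedDensity.ae_ne s, IsBoundedDensity.ae_ne s'] with σ g1 g2 _
      have k1 := log_add_log_exp g1
      have k2 := log_add_log_exp g2
      have n1 : ∀ y, σ ≠ y → exp σ - exp y ≠ 0 := fun y hy =>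
        sub_ne_zero.2 fun hh => hy (Real.exp_injective hh)
      simp only [hg, lamQ, abs_div]
      rw [Real.log_div (abs_ne_zero.2 (sub_ne_zero.2 g1)) (abs_ne_zero.2 (sub_ne_zero.2 g2)),
        Real.log_div (abs_ne_zero.2 (n1 _ g1)) (abs_ne_zero.2 (n1 _ g2))]
      congr 1
      linarith
    rw [h4, h3]
    ring
  have c1 : ∀ s, Continuous fun τ => deriv (deriv V) (c₀ + τ) * max s τ := fun s =>
    hq.mul (by fun_prop)
  have c2 : Continuous fun τ => deriv (deriv V) (c₀ + τ) * angle c₁ τ := hq.mul (continuous_angle hc)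
  have e3 := integral_dens_mul hc hq hgi hgm
  have c3 : Continuous fun τ => 2 * π ^ 2 * (deriv (deriv V) (c₀ + τ) * max s τ -
    deriv (deriv V) (c₀ + τ) * max s' τ) := ((c1 s).sub (c1 s')).const_mul _
  rw [e2, intervalIntegral.integral_sub (c3.intervalIntegrable _ _) ((c2.const_mul _).intervalIntegrable _ _),
    intervalIntegral.integral_const_mul, intervalIntegral.integral_const_mul,
    intervalIntegral.integral_sub ((c1 s).intervalIntegrable _ _) ((c1 s').intervalIntegrable _ _),
    integral_weight_mul_max h c₀ (Ioo_subset_Icc_self hsI),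
    integral_weight_mul_max h c₀ (Ioo_subset_Icc_self hsI')] at e3
  rw [meanForce_eq h hc] at hf
  rw [← hwd] at hf e3
  have e4 : 1 / (2 * π ^ 2) * (π * (s - s') *
      ∫ τ in (-w)..w, deriv (deriv V) (c₀ + τ) * angle c₁ τ) = -((s - s') * deriv V (c₀ - w)) := by
    have : deriv V (c₀ - w) = -(1 / (2 * π) *
      ∫ τ in (-w)..w, deriv (deriv V) (c₀ + τ) * angle c₁ τ) := by linarith
    rw [this]
    field_simp
  have e5 : ∀ A B : ℝ, 1 / (2 * π ^ 2) * (2 * π ^ 2 * A - B) =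
      A - 1 / (2 * π ^ 2) * B := fun A B => by field_simp
  rw [e5, e4] at e3
  linarith

lemma psi_euler_lagrange (h : IsField V c) (hc : 0 < c₁) (c₀ : ℝ)
    (hs : meanStiffness V c₁ c₀ = π / c₁) (hf : meanForce V c₁ c₀ = 0) :
    ∃ l, ∀ x ∈ Icc (c₀ - radius c₁) (c₀ + radius c₁),
      V x - x / 2 - ellPot (psi V c₁ c₀) x = l := by
  obtain ⟨M, hM⟩ := isBoundedDensity_psi h hc c₀
  have hw := radius_pos hc
  have h0 : c₀ ∈ Ioo (c₀ - radius c₁) (c₀ + radius c₁) := ⟨by linarith, by linarith⟩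
  refine ⟨V c₀ - c₀ / 2 - ellPot (psi V c₁ c₀) c₀, ?_⟩
  have hcont : ContinuousOn (fun x => V x - x / 2 - ellPot (psi V c₁ c₀) x)
      (Icc (c₀ - radius c₁) (c₀ + radius c₁)) :=
    (h.continuous.sub (by fun_prop)).continuousOn.sub hM.continuousOn_ellPot
  refine EqOn.of_subset_closure (s := Ioo (c₀ - radius c₁) (c₀ + radius c₁)) (fun x hx => ?_)
    hcont continuousOn_const Ioo_subset_Icc_self (closure_Ioo hM.lt.ne).ge
  rcases lt_trichotomy x c₀ with hlt | rfl | hlt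
  · have := ellPot_psi_sub h hc c₀ hs hf h0 hx hlt
    linarith
  · rfl
  · have := ellPot_psi_sub h hc c₀ hs hf hx h0 hlt
    linarith

lemma tendsto_psi_right (h : IsField V c) (hc : 0 < c₁) (c₀ : ℝ) : ∃ L, L ≠ 0 ∧ Tendsto
    (fun x => psi V c₁ c₀ x / √(c₀ + radius c₁ - x)) (𝓝[<] (c₀ + radius c₁)) (𝓝 L) := by
  obtain ⟨L, hL, ht⟩ := tendsto_dens_div_sqrt hc (continuous_weight h c₀) h.pos fun τ => h.le _
  refine ⟨L, hL, (ht.comp (f := fun x => x - c₀) (tendsto_nhdsWithin_iff.2 ⟨?_, ?_⟩)).congr' ?_⟩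
  · have : Tendsto (fun x => x - c₀) (𝓝 (c₀ + radius c₁)) (𝓝 (c₀ + radius c₁ - c₀)) :=
      (by fun_prop : Continuous fun x => x - c₀).tendsto _
    rw [add_sub_cancel_left] at this
    exact this.mono_left nhdsWithin_le_nhds
  · filter_upwards [self_mem_nhdsWithin] with x hx
    exact sub_left_lt_of_lt_add (mem_Iio.1 hx)
  · have hw := radius_pos hc
    filter_upwards [Ioo_mem_nhdsLT (show c₀ - radius c₁ < c₀ + radius c₁ by linarith)] with x hx
    rw [psi, indicator_of_mem hx, Function.comp_apply, sub_sub_eq_add_sub, add_comm c₀]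

lemma psi_reflect (hc : 0 < c₁) (c₀ x : ℝ) : psi (fun x => V (-x)) c₁ (-c₀) (-x) = psi V c₁ c₀ x := by
  have e : deriv (deriv fun x => V (-x)) = fun x => deriv (deriv V) (-x) := by
    have h1 : (deriv fun x => V (-x)) = fun x => -deriv V (-x) := funext fun x => deriv_comp_neg V x
    rw [h1]
    ext x
    rw [deriv.fun_neg, deriv_comp_neg, neg_neg]
  by_cases hx : x ∈ Ioo (c₀ - radius c₁) (c₀ + radius c₁)
  · have hx' : -x ∈ Ioo (-c₀ - radius c₁) (-c₀ + radius c₁) :=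
      ⟨by linarith [hx.2], by linarith [hx.1]⟩
    rw [psi, psi, indicator_of_mem hx, indicator_of_mem hx', e]
    have h1 := dens_neg hc (fun τ => deriv (deriv V) (c₀ + -τ)) (Ioo_subset_Icc_self (sub_mem_Ioo hx))
    simp only [neg_neg] at h1
    rw [← h1]
    congr 1
    · ext τ
      simp only [neg_add, neg_neg]
    · ring
  · have hx' : -x ∉ Ioo (-c₀ - radius c₁) (-c₀ + radius c₁) := fun hh =>
      hx ⟨by linarith [hh.2], by linarith [hh.1]⟩
    rw [psi, psi, indicator_of_notMem hx, indicator_of_notMem hx']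

lemma IsField.reflect (h : IsField V c) : IsField (fun x => V (-x)) c where
  contDiff := h.contDiff.comp contDiff_neg
  pos := h.pos
  le x := by
    have h1 : (deriv fun x => V (-x)) = fun x => -deriv V (-x) := funext fun x => deriv_comp_neg V x
    rw [h1, deriv.fun_neg, deriv_comp_neg, neg_neg]
    exact h.le _

lemma tendsto_psi_left (h : IsField V c) (hc : 0 < c₁) (c₀ : ℝ) : ∃ L, L ≠ 0 ∧ Tendsto
    (fun x => psi V c₁ c₀ x / √(x - (c₀ - radius c₁)))
    (𝓝[>] (c₀ - radius c₁)) (𝓝 L) := by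
  obtain ⟨L, hL, ht⟩ := tendsto_psi_right h.reflect hc (-c₀)
  have e : -c₀ + radius c₁ = -(c₀ - radius c₁) := by ring
  rw [e] at ht
  refine ⟨L, hL, (ht.comp tendsto_neg_nhdsGT).congr fun x => ?_⟩
  rw [Function.comp_apply, psi_reflect hc]
  congr 2
  ring

lemma exists_le_sqrt {f g : ℝ → ℝ} {l : Filter ℝ} {L : ℝ} (hg : ∀ᶠ x in l, 0 < g x)
    (h : Tendsto (fun x => f x / g x) l (𝓝 L)) :
    ∃ C, 0 ≤ C ∧ ∀ᶠ x in l, f x ≤ C * g x := by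
  refine ⟨|L| + 1, by positivity, ?_⟩
  filter_upwards [hg, h.eventually_lt_const (show L < |L| + 1 by linarith [le_abs_self L])]
    with x h1 h2
  exact ((div_lt_iff₀ h1).1 h2).le


lemma integral_densityMeasure {ρ : ℝ → ℝ} (hm : Measurable ρ) (h0 : ∀ x, 0 ≤ ρ x) (f : ℝ → ℝ) :
    ∫ t, f t ∂densityMeasure ρ = ∫ t, ρ t * f t := by
  rw [densityMeasure, integral_withDensity_eq_integral_toReal_smul hm.ennreal_ofReal
    (.of_forall fun _ => ENNReal.ofReal_lt_top)]
  simp only [ENNReal.toReal_ofReal (h0 _), smul_eq_mul]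

lemma integrable_densityMeasure {ρ : ℝ → ℝ} (hm : Measurable ρ) (h0 : ∀ x, 0 ≤ ρ x) {f : ℝ → ℝ} :
    Integrable f (densityMeasure ρ) ↔ Integrable fun t => ρ t * f t := by
  rw [densityMeasure, integrable_withDensity_iff_integrable_smul' hm.ennreal_ofReal
    (.of_forall fun _ => ENNReal.ofReal_lt_top)]
  simp only [ENNReal.toReal_ofReal (h0 _), smul_eq_mul]

lemma IsBoundedDensity.integrable {ρ : ℝ → ℝ} {a b M : ℝ} (h : IsBoundedDensity ρ a b M) :
    Integrable ρ := by
  simpa using h.integrable_mul_of_continuous (f := fun _ => 1) continuous_const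

lemma IsBoundedDensity.isProbabilityMeasure {ρ : ℝ → ℝ} {a b M : ℝ} (h : IsBoundedDensity ρ a b M)
    (h1 : ∫ t, ρ t = 1) : IsProbabilityMeasure (densityMeasure ρ) := by
  refine ⟨?_⟩
  rw [densityMeasure, withDensity_apply _ MeasurableSet.univ, setLIntegral_univ,
    ← ofReal_integral_eq_lintegral_ofReal h.integrable (.of_forall h.nonneg), h1,
    ENNReal.ofReal_one]

lemma IsBoundedDensity.support_eq {ρ : ℝ → ℝ} {a b M : ℝ} (h : IsBoundedDensity ρ a b M)
    (hpos : ∀ x ∈ Ioo a b, 0 < ρ x) : (densityMeasure ρ).support = Icc a b := by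
  ext x
  rw [Measure.mem_support_iff_forall]
  constructor
  · intro hx
    by_contra hc
    have h1 := hx _ (isClosed_Icc.isOpen_compl.mem_nhds hc)
    rw [densityMeasure, withDensity_apply _ measurableSet_Icc.compl] at h1
    refine h1.ne' (setLIntegral_eq_zero measurableSet_Icc.compl fun t ht => ?_)
    simp only [h.eq_zero t fun hh => ht (Ioo_subset_Icc_self hh), ENNReal.ofReal_zero, Pi.zero_apply]
  · intro hx U hU
    rw [← closure_Ioo h.lt.ne] at hx
    have hne : (interior U ∩ Ioo a b).Nonempty :=
      mem_closure_iff.1 hx _ isOpen_interior (mem_interior_iff_mem_nhds.2 hU)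
    have ho : IsOpen (interior U ∩ Ioo a b) := isOpen_interior.inter isOpen_Ioo
    refine lt_of_lt_of_le ?_ (measure_mono ((inter_subset_left (t := Ioo a b)).trans interior_subset))
    rw [densityMeasure, withDensity_apply _ ho.measurableSet,
      setLIntegral_pos_iff h.measurable.ennreal_ofReal]
    refine (ho.measure_pos volume hne).trans_le (measure_mono fun t ht => ⟨?_, ht⟩)
    rw [Function.mem_support]
    exact (ENNReal.ofReal_pos.2 (hpos t ht.2)).ne'

lemma IsBoundedDensity.effectivePotential_eq {ρ : ℝ → ℝ} {a b M : ℝ} (h : IsBoundedDensity ρ a b M)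
    (h1 : ∫ t, ρ t = 1) (V : ℝ → ℝ) (x : ℝ) : effectivePotential V (densityMeasure ρ) x =
      V x - x / 2 - ellPot ρ x - (∫ t, ρ t * t) / 2 := by
  have h2 := h.integral_log_add x
  rw [h1] at h2
  rw [effectivePotential, integral_densityMeasure h.measurable h.nonneg,
    integral_densityMeasure h.measurable h.nonneg]
  simp only [Real.log_inv, mul_neg, integral_neg]
  linarith

/-- The density obtained from a solution of the two equations satisfies the variational
conditions. -/
theorem isOneCutDensity_psi (h : IsField V c) (hc : 0 < c₁) (c₀ : ℝ)
    (hs : meanStiffness V c₁ c₀ = π / c₁) (hf : meanForce V c₁ c₀ = 0) :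
    IsOneCutDensity V (c₀ - radius c₁) (c₀ + radius c₁) (psi V c₁ c₀) := by
  obtain ⟨M, hM⟩ := isBoundedDensity_psi h hc c₀
  have h1 := integral_psi h hc c₀ hs
  have hw := radius_pos hc
  obtain ⟨l, hl⟩ := psi_euler_lagrange h hc c₀ hs hf
  set a := c₀ - radius c₁ with ha
  set b := c₀ + radius c₁ with hb
  have hW : ∀ x d, 0 ≤ d → c * d ^ 2 ≤ (V (x + d) - (x + d) / 2) + (V (x - d) - (x - d) / 2) -
      2 * (V x - x / 2) := fun x d hd => by linarith [h.secondDiff_ge x hd]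
  have hla := hl a (left_mem_Icc.2 hM.lt.le)
  have hlb := hl b (right_mem_Icc.2 hM.lt.le)
  have hright : ∀ x, b < x → l < V x - x / 2 - ellPot (psi V c₁ c₀) x := by
    obtain ⟨L, -, ht⟩ := tendsto_psi_right h hc c₀
    obtain ⟨C, hC, hev⟩ := exists_le_sqrt (by
      filter_upwards [self_mem_nhdsWithin] with x hx
      exact Real.sqrt_pos.2 (sub_pos.2 (mem_Iio.1 hx))) ht
    obtain ⟨p, hp, hp2⟩ := (mem_nhdsLT_iff_exists_Ioo_subset).1 hev
    intro x hx
    rw [← hlb]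
    refine hM.lt_of_right (W := fun x => V x - x / 2) (δ := b - p) hC (sub_pos.2 hp) (fun t ht => hp2 ?_) h.pos hW
      (fun y hy => ?_) hx
    · rwa [sub_sub_cancel] at ht
    · rw [hl y hy, hlb]
  have hleft : ∀ x, x < a → l < V x - x / 2 - ellPot (psi V c₁ c₀) x := by
    obtain ⟨L, -, ht⟩ := tendsto_psi_left h hc c₀
    obtain ⟨C, hC, hev⟩ := exists_le_sqrt (by
      filter_upwards [self_mem_nhdsWithin] with x hx
      exact Real.sqrt_pos.2 (sub_pos.2 (mem_Ioi.1 hx))) ht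
    obtain ⟨p, hp, hp2⟩ := (mem_nhdsGT_iff_exists_Ioo_subset).1 hev
    intro x hx
    rw [← hla]
    refine hM.lt_of_left (W := fun x => V x - x / 2) (δ := p - a) hC (sub_pos.2 hp) (fun t ht => hp2 ?_) h.pos hW
      (fun y hy => ?_) hx
    · rwa [add_sub_cancel] at ht
    · rw [hl y hy, hla]
  refine ⟨hM.measurable, hM.nonneg, hM.lt, hM.support_eq fun x => psi_pos h hc c₀,
    hM.isProbabilityMeasure h1, fun x => psi_pos h hc c₀, tendsto_psi_left h hc c₀,
    tendsto_psi_right h hc c₀, fun x => ?_, fun x => ?_,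
    (∫ t, psi V c₁ c₀ t * t) / 2 - l, fun x hx => ?_, fun x hx => ?_⟩
  · rw [integrable_densityMeasure hM.measurable hM.nonneg]
    simpa only [Real.log_inv, mul_neg] using (hM.integrable_log x).fun_neg
  · rw [integrable_densityMeasure hM.measurable hM.nonneg]
    simpa only [Real.log_inv, mul_neg] using (hM.integrable_log_exp x).fun_neg
  · rw [hM.effectivePotential_eq h1, hl x hx]
    ring
  · rw [hM.effectivePotential_eq h1]
    have : l < V x - x / 2 - ellPot (psi V c₁ c₀) x := by
      by_contra hcon
      refine hx ⟨?_, ?_⟩ <;> by_contra! hlt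
      · exact hcon (hleft x hlt)
      · exact hcon (hright x hlt)
    linarith


open ProbabilityTheory

/-! ### Positive definiteness of the logarithmic energy -/

/-- The superposition of the tents `(1 - |x|/ρ)₊` for `0 < ρ < R`, with weight `dρ/ρ`. -/
def tentSum (R x : ℝ) : ℝ := ∫ ρ in Ioo 0 R, max (ρ - |x|) 0 / ρ ^ 2

lemma integrableOn_tent {x : ℝ} (hx : x ≠ 0) {R : ℝ} (hR : 0 < R) :
    IntegrableOn (fun ρ => max (ρ - |x|) 0 / ρ ^ 2) (Ioo 0 R) ∧
    tentSum R x = if |x| < R then log R - log |x| - 1 + |x| / R else 0 := by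
  have hx0 := abs_pos.2 hx
  set y := |x|
  -- the integrand has no singularity
  have e : (fun ρ => max (ρ - y) 0 / ρ ^ 2) = fun ρ => max (ρ - y) 0 / (max ρ y) ^ 2 := by
    ext ρ
    rcases le_total ρ y with h | h
    · rw [max_eq_right (sub_nonpos.2 h), zero_div, zero_div]
    · rw [max_eq_left h]
  have hcont : Continuous fun ρ : ℝ => max (ρ - y) 0 / ρ ^ 2 := by
    rw [e]
    exact (by fun_prop : Continuous fun ρ : ℝ => max (ρ - y) 0).div (by fun_prop)
      fun ρ => pow_ne_zero 2 (hx0.trans_le (le_max_right _ _)).ne'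
  refine ⟨hcont.integrableOn_Icc.mono_set Ioo_subset_Icc_self, ?_⟩
  have z : ∀ r ≤ y, 0 ≤ r → ∫ ρ in (0 : ℝ)..r, max (ρ - y) 0 / ρ ^ 2 = 0 := fun r hr h0 => by
    rw [intervalIntegral.integral_congr (g := fun _ => 0), intervalIntegral.integral_zero]
    intro ρ hρ
    rw [uIcc_of_le h0] at hρ
    simp only [max_eq_right (sub_nonpos.2 (hρ.2.trans hr)), zero_div]
  rw [tentSum, ← integral_Ioc_eq_integral_Ioo, ← intervalIntegral.integral_of_le hR.le]
  split_ifs with h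
  · rw [← intervalIntegral.integral_add_adjacent_intervals (b := y) (hcont.intervalIntegrable _ _)
      (hcont.intervalIntegrable _ _), z y le_rfl hx0.le, zero_add]
    have hd : ∀ ρ ∈ uIcc y R, HasDerivAt (fun ρ => log ρ + y / ρ) (max (ρ - y) 0 / ρ ^ 2) ρ := by
      intro ρ hρ
      rw [uIcc_of_le h.le] at hρ
      have hρ0 : ρ ≠ 0 := (hx0.trans_le hρ.1).ne'
      refine ((Real.hasDerivAt_log hρ0).add ((hasDerivAt_inv hρ0).const_mul y)).congr_deriv ?_
      rw [max_eq_left (sub_nonneg.2 hρ.1)]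
      field_simp
      ring
    rw [intervalIntegral.integral_eq_sub_of_hasDerivAt hd (hcont.intervalIntegrable _ _),
      div_self hx0.ne']
    ring
  · exact z R (not_lt.1 h) hR.le

/-- The indicator function of `τ < t ≤ τ + ρ`, where `q = (ρ, τ)`. -/
def window (q : ℝ × ℝ) (t : ℝ) : ℝ := (Ioc q.2 (q.2 + q.1)).indicator 1 t

lemma measurable_window : Measurable fun p : (ℝ × ℝ) × ℝ => window p.1 p.2 := by
  have hs : MeasurableSet {p : (ℝ × ℝ) × ℝ | p.1.2 < p.2 ∧ p.2 ≤ p.1.2 + p.1.1} := by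
    measurability
  exact (measurable_const.indicator hs : Measurable
    ({p : (ℝ × ℝ) × ℝ | p.1.2 < p.2 ∧ p.2 ≤ p.1.2 + p.1.1}.indicator fun _ => (1 : ℝ)))

lemma window_mul_window (ρ τ t s : ℝ) : window (ρ, τ) t * window (ρ, τ) s =
    (Ico (max t s - ρ) (min t s)).indicator 1 τ := by
  simp only [window, indicator, mem_Ioc, mem_Ico, Pi.one_apply]
  simp only [lt_min_iff, sub_le_iff_le_add, max_le_iff]
  split_ifs <;> grind

lemma integral_window (ν : Measure ℝ) [IsProbabilityMeasure ν] {q : ℝ × ℝ} (hq : 0 < q.1) :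
    ∫ t, window q t ∂ν = cdf ν (q.2 + q.1) - cdf ν q.2 := by
  simp only [window]
  rw [integral_indicator_one measurableSet_Ioc, cdf_eq_real, cdf_eq_real,
    ← measureReal_sdiff (Iic_subset_Iic.2 (by linarith)) measurableSet_Iic, Iic_sdiff_Iic]

/-- The parameter space of positions and scales below `R`. -/
def scales (R : ℝ) : Measure (ℝ × ℝ) := (volume.restrict (Ioo 0 R)).prod volume

instance (R : ℝ) : SFinite (scales R) := by unfold scales; infer_instance

lemma tentSum_eq_integral {R x y : ℝ} (hR : 0 < R) (hxy : x ≠ y) :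
    Integrable (fun q => window q x * window q y / q.1 ^ 2) (scales R) ∧
    ∫ q, window q x * window q y / q.1 ^ 2 ∂scales R = tentSum R (x - y) := by
  have hm : Measurable fun q : ℝ × ℝ => window q x * window q y / q.1 ^ 2 :=
    ((measurable_window.comp (measurable_id.prodMk measurable_const)).mul
      (measurable_window.comp (measurable_id.prodMk measurable_const))).div (by fun_prop)
  have hsec : ∀ ρ : ℝ, Integrable (fun τ => window (ρ, τ) x * window (ρ, τ) y / ρ ^ 2) ∧
      ∫ τ, window (ρ, τ) x * window (ρ, τ) y / ρ ^ 2 = max (ρ - |x - y|) 0 / ρ ^ 2 := fun ρ => by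
    simp only [window_mul_window]
    constructor
    · exact ((integrable_indicator_iff measurableSet_Ico).2
        (integrableOn_const measure_Ico_lt_top.ne)).div_const _
    · rw [integral_div, integral_indicator_one measurableSet_Ico, Real.volume_real_Ico,
        ← max_sub_min_eq_abs']
      congr 2
      ring
  have hi : Integrable (fun q => window q x * window q y / q.1 ^ 2) (scales R) := by
    refine (integrable_prod_iff hm.aestronglyMeasurable).2
      ⟨Eventually.of_forall fun ρ => (hsec ρ).1, ?_⟩
    refine (integrableOn_tent (sub_ne_zero.2 hxy) hR).1.congr (.of_forall fun ρ => ?_)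
    simp only
    rw [← (hsec ρ).2]
    congr 1
    ext τ
    rw [window_mul_window, Real.norm_of_nonneg]
    exact div_nonneg (indicator_nonneg (fun _ _ => zero_le_one) _) (sq_nonneg _)
  refine ⟨hi, ?_⟩
  rw [scales, integral_prod _ hi, tentSum]
  simp only [(hsec _).2]

/-- The mutual energy for the truncated kernel as a quadratic form in the distribution functions. -/
lemma integral_tentSum {ν μ : Measure ℝ} [IsProbabilityMeasure ν] [IsProbabilityMeasure μ] {R : ℝ}
    (hR : 0 < R) (hd : ∀ᵐ p ∂ν.prod μ, p.1 ≠ p.2)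
    (hi : Integrable (fun p => tentSum R (p.1 - p.2)) (ν.prod μ)) :
    Integrable (fun q => (cdf ν (q.2 + q.1) - cdf ν q.2) * (cdf μ (q.2 + q.1) - cdf μ q.2) / q.1 ^ 2)
      (scales R) ∧
    ∫ q, (cdf ν (q.2 + q.1) - cdf ν q.2) * (cdf μ (q.2 + q.1) - cdf μ q.2) / q.1 ^ 2 ∂scales R =
      ∫ p, tentSum R (p.1 - p.2) ∂ν.prod μ := by
  set G : (ℝ × ℝ) × (ℝ × ℝ) → ℝ := fun z => window z.2 z.1.1 * window z.2 z.1.2 / z.2.1 ^ 2 with hG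
  have hm : Measurable G :=
    ((measurable_window.comp (measurable_snd.prodMk measurable_fst.fst)).mul
      (measurable_window.comp (measurable_snd.prodMk measurable_fst.snd))).div (by fun_prop)
  have h0 : ∀ z, 0 ≤ G z := fun z => div_nonneg (mul_nonneg
    (indicator_nonneg (fun _ _ => zero_le_one) _) (indicator_nonneg (fun _ _ => zero_le_one) _))
    (sq_nonneg _)
  have hGi : Integrable G ((ν.prod μ).prod (scales R)) := by
    refine (integrable_prod_iff hm.aestronglyMeasurable).2 ⟨?_, hi.congr ?_⟩
    · filter_upwards [hd] with p hp using (tentSum_eq_integral hR hp).1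
    · filter_upwards [hd] with p hp
      rw [← (tentSum_eq_integral hR hp).2]
      exact integral_congr_ae (.of_forall fun q => (Real.norm_of_nonneg (h0 (p, q))).symm)
  have hae : ∀ᵐ q ∂scales R, ∫ p, G (p, q) ∂ν.prod μ =
      (cdf ν (q.2 + q.1) - cdf ν q.2) * (cdf μ (q.2 + q.1) - cdf μ q.2) / q.1 ^ 2 := by
    have hpos : ∀ᵐ q ∂scales R, 0 < q.1 := by
      refine Measure.quasiMeasurePreserving_fst.ae (p := fun r => 0 < r) ?_
      filter_upwards [ae_restrict_mem measurableSet_Ioo] with r hr using hr.1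
    filter_upwards [hpos] with q hq
    simp only [hG]
    rw [integral_div, integral_prod_mul, integral_window ν hq, integral_window μ hq]
  refine ⟨hGi.integral_prod_right.congr hae, ?_⟩
  rw [← integral_congr_ae hae, ← integral_prod_symm _ hGi, integral_prod _ hGi]
  refine integral_congr_ae ?_
  filter_upwards [hd] with p hp using (tentSum_eq_integral hR hp).2

/-- After subtraction of constants the truncated kernels converge to the logarithmic kernel. -/
lemma tendsto_integral_tentSum {κ : Measure (ℝ × ℝ)} [IsProbabilityMeasure κ]
    (hd : ∀ᵐ p ∂κ, p.1 ≠ p.2) (hi : Integrable (fun p => log |p.1 - p.2|) κ) :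
    (∀ n : ℕ, Integrable (fun p => tentSum (n + 1) (p.1 - p.2)) κ) ∧
    Tendsto (fun n : ℕ => ∫ p, tentSum (n + 1) (p.1 - p.2) ∂κ - (log (n + 1) - 1)) atTop
      (𝓝 (-∫ p, log |p.1 - p.2| ∂κ)) := by
  set f : ℕ → ℝ × ℝ → ℝ := fun n p => (if |p.1 - p.2| < n + 1 then
    log (n + 1) - log |p.1 - p.2| - 1 + |p.1 - p.2| / (n + 1) else 0) -
      (log (n + 1) - 1) with hf
  have hn : ∀ n : ℕ, (0 : ℝ) < n + 1 := fun n => by positivity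
  have hfm : ∀ n, Measurable (f n) := fun n => by
    have m1 : Measurable fun p : ℝ × ℝ => |p.1 - p.2| := by fun_prop
    have m2 : Measurable fun p : ℝ × ℝ => log |p.1 - p.2| := Real.measurable_log.comp m1
    exact (Measurable.ite (measurableSet_lt m1 measurable_const)
      (((m2.const_sub _).sub_const _).add (m1.div_const _)) measurable_const).sub_const _
  have hb : ∀ n p, ‖f n p‖ ≤ |(log |p.1 - p.2|)| + 1 := fun n p => by
    rw [Real.norm_eq_abs]
    simp only [hf]
    split_ifs with h
    · have h1 : |p.1 - p.2| / (n + 1) ≤ 1 := (div_le_one (hn n)).2 h.le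
      have h2 : 0 ≤ |p.1 - p.2| / (n + 1) := div_nonneg (abs_nonneg _) (hn n).le
      refine abs_le.2 ⟨?_, ?_⟩
      · linarith [le_abs_self (log |p.1 - p.2|)]
      · linarith [neg_abs_le (log |p.1 - p.2|)]
    · have h1 := Real.log_le_log (hn n) (not_lt.1 h)
      have h2 : 0 ≤ log ((n : ℝ) + 1) := Real.log_nonneg (by linarith [n.cast_nonneg (α := ℝ)])
      refine abs_le.2 ⟨?_, ?_⟩
      · linarith [le_abs_self (log |p.1 - p.2|)]
      · linarith [abs_nonneg (log |p.1 - p.2|)]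
  have hbi : Integrable (fun p => |(log |p.1 - p.2|)| + 1) κ := hi.abs.add (integrable_const _)
  have hfi : ∀ n, Integrable (f n) κ := fun n =>
    hbi.mono' (hfm n).aestronglyMeasurable (.of_forall (hb n))
  have e : ∀ n : ℕ, (fun p => f n p + (log (n + 1) - 1)) =ᵐ[κ]
      fun p => tentSum (n + 1) (p.1 - p.2) := fun n => by
    filter_upwards [hd] with p hp
    rw [(integrableOn_tent (sub_ne_zero.2 hp) (hn n)).2]
    simp only [hf]
    ring
  have hlim : Tendsto (fun n => ∫ p, f n p ∂κ) atTop (𝓝 (∫ p, -log |p.1 - p.2| ∂κ)) := by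
    refine tendsto_integral_of_dominated_convergence _ (fun n => (hfm n).aestronglyMeasurable) hbi
      (fun n => .of_forall (hb n)) (.of_forall fun p => ?_)
    have h1 : Tendsto (fun n : ℕ => |p.1 - p.2| / ((n : ℝ) + 1)) atTop (𝓝 0) :=
      tendsto_const_nhds.div_atTop (tendsto_atTop_add_const_right _ _ tendsto_natCast_atTop_atTop)
    have h2 := (tendsto_const_nhds (x := -log |p.1 - p.2|)).add h1
    rw [add_zero] at h2
    refine h2.congr' ?_
    filter_upwards [eventually_gt_atTop ⌈|p.1 - p.2|⌉₊] with n hN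
    have h3 : |p.1 - p.2| < n + 1 := by
      have := Nat.lt_of_ceil_lt hN
      linarith
    simp only [hf, if_pos h3]
    ring
  refine ⟨fun n => ((hfi n).add (integrable_const _)).congr (e n), ?_⟩
  rw [← integral_neg]
  refine hlim.congr fun n => ?_
  rw [← integral_congr_ae (e n), integral_add (hfi n) (integrable_const _), integral_const,
    probReal_univ, one_smul, add_sub_cancel_right]

/-- Two distribution functions whose increments agree are equal. -/
lemma eq_of_cdf_increments {ν μ : Measure ℝ} [IsProbabilityMeasure ν] [IsProbabilityMeasure μ]
    (h : ∀ n : ℕ, ∀ᵐ q ∂scales (n + 1), cdf ν (q.2 + q.1) - cdf ν q.2 = cdf μ (q.2 + q.1) - cdf μ q.2) :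
    ν = μ := by
  have h1 : ∀ n : ℕ, ∃ ρ ∈ Ioo (n : ℝ) (n + 1), ∀ᵐ τ : ℝ,
      cdf ν (τ + ρ) - cdf ν τ = cdf μ (τ + ρ) - cdf μ τ := fun n => by
    have h2 := Measure.ae_ae_of_ae_prod (h n)
    have h3 := ae_restrict_of_ae_restrict_of_subset
      (Ioo_subset_Ioo_left (n.cast_nonneg : (0 : ℝ) ≤ n)) h2
    have hne : NeBot (ae (volume.restrict (Ioo (n : ℝ) (n + 1)))) := by
      rw [ae_neBot, Ne, Measure.restrict_eq_zero, Real.volume_Ioo]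
      simp
    obtain ⟨ρ, hρ, hρ2⟩ := (h3.and (ae_restrict_mem measurableSet_Ioo)).exists
    exact ⟨ρ, hρ2, hρ⟩
  choose ρ hρ hρ2 using h1
  have hρt : Tendsto ρ atTop atTop :=
    tendsto_atTop_mono (fun n => (hρ n).1.le) tendsto_natCast_atTop_atTop
  have h3 : ∀ᵐ τ : ℝ, cdf ν τ = cdf μ τ := by
    filter_upwards [ae_all_iff.2 hρ2] with τ hτ
    have t1 := tendsto_atTop_add_const_left _ τ hρt
    have t2 := ((tendsto_cdf_atTop ν).comp t1).sub_const (cdf ν τ)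
    have t3 := ((tendsto_cdf_atTop μ).comp t1).sub_const (cdf μ τ)
    have := tendsto_nhds_unique t2 (t3.congr fun n => (hτ n).symm)
    linarith
  refine Measure.eq_of_cdf ν μ (StieltjesFunction.ext fun x => ?_)
  have t1 := ((cdf ν).right_continuous x).mono_left (nhdsWithin_mono x Ioi_subset_Ici_self)
  have t2 := ((cdf μ).right_continuous x).mono_left (nhdsWithin_mono x Ioi_subset_Ici_self)
  refine tendsto_nhds_unique_of_frequently_eq t1 t2 ?_
  rw [frequently_iff]
  intro U hU
  obtain ⟨p, hp, hpU⟩ := mem_nhdsGT_iff_exists_Ioo_subset.1 hU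
  have hne : NeBot (ae (volume.restrict (Ioo x p))) := by
    rw [ae_neBot, Ne, Measure.restrict_eq_zero, Real.volume_Ioo]
    simpa using hp
  obtain ⟨τ, hτ, hτ2⟩ := ((ae_restrict_of_ae (s := Ioo x p) h3).and
    (ae_restrict_mem measurableSet_Ioo)).exists
  exact ⟨τ, hpU hτ2, hτ⟩

/-- The logarithmic energy is positive definite on differences of probability measures. -/
theorem logEnergy_nonneg {ν μ : Measure ℝ} [IsProbabilityMeasure ν] [IsProbabilityMeasure μ]
    (dν : ∀ᵐ p ∂ν.prod ν, p.1 ≠ p.2) (dm : ∀ᵐ p ∂ν.prod μ, p.1 ≠ p.2)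
    (dμ : ∀ᵐ p ∂μ.prod μ, p.1 ≠ p.2)
    (iν : Integrable (fun p : ℝ × ℝ => log |p.1 - p.2|) (ν.prod ν))
    (im : Integrable (fun p : ℝ × ℝ => log |p.1 - p.2|) (ν.prod μ))
    (iμ : Integrable (fun p : ℝ × ℝ => log |p.1 - p.2|) (μ.prod μ)) :
    0 ≤ 2 * (∫ p, log |p.1 - p.2| ∂ν.prod μ) - (∫ p, log |p.1 - p.2| ∂ν.prod ν) -
      ∫ p, log |p.1 - p.2| ∂μ.prod μ ∧
    (2 * (∫ p, log |p.1 - p.2| ∂ν.prod μ) - (∫ p, log |p.1 - p.2| ∂ν.prod ν) -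
      ∫ p, log |p.1 - p.2| ∂μ.prod μ = 0 → ν = μ) := by
  obtain ⟨j1, l1⟩ := tendsto_integral_tentSum dν iν
  obtain ⟨j2, l2⟩ := tendsto_integral_tentSum dm im
  obtain ⟨j3, l3⟩ := tendsto_integral_tentSum dμ iμ
  set d : ℝ × ℝ → ℝ := fun q =>
    (cdf ν (q.2 + q.1) - cdf ν q.2) - (cdf μ (q.2 + q.1) - cdf μ q.2) with hd
  have hn : ∀ n : ℕ, (0 : ℝ) < n + 1 := fun n => by positivity
  have key : ∀ n : ℕ, Integrable (fun q => d q ^ 2 / q.1 ^ 2) (scales (n + 1)) ∧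
      ∫ q, d q ^ 2 / q.1 ^ 2 ∂scales (n + 1) =
        (∫ p, tentSum (n + 1) (p.1 - p.2) ∂ν.prod ν - (log (n + 1) - 1)) -
        2 * (∫ p, tentSum (n + 1) (p.1 - p.2) ∂ν.prod μ - (log (n + 1) - 1)) +
        (∫ p, tentSum (n + 1) (p.1 - p.2) ∂μ.prod μ - (log (n + 1) - 1)) := fun n => by
    obtain ⟨a1, b1⟩ := integral_tentSum (hn n) dν (j1 n)
    obtain ⟨a2, b2⟩ := integral_tentSum (hn n) dm (j2 n)
    obtain ⟨a3, b3⟩ := integral_tentSum (hn n) dμ (j3 n)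
    rw [← b1, ← b2, ← b3]
    have e := funext fun q : ℝ × ℝ => show d q ^ 2 / q.1 ^ 2 =
      ((cdf ν (q.2 + q.1) - cdf ν q.2) * (cdf ν (q.2 + q.1) - cdf ν q.2) / q.1 ^ 2 -
      2 * ((cdf ν (q.2 + q.1) - cdf ν q.2) * (cdf μ (q.2 + q.1) - cdf μ q.2) / q.1 ^ 2)) +
      (cdf μ (q.2 + q.1) - cdf μ q.2) * (cdf μ (q.2 + q.1) - cdf μ q.2) / q.1 ^ 2 by
        simp only [hd]
        ring
    rw [e]
    refine ⟨(a1.sub (a2.const_mul 2)).add a3, ?_⟩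
    rw [integral_add (f := fun q : ℝ × ℝ => _ - _) (a1.sub (a2.const_mul 2)) a3,
      integral_sub a1 (a2.const_mul 2), integral_const_mul]
    ring
  have hlim := ((l1.sub (l2.const_mul 2)).add l3).congr fun n => ((key n).2).symm
  have h0 : ∀ q : ℝ × ℝ, 0 ≤ d q ^ 2 / q.1 ^ 2 := fun q => by positivity
  have e2 : ∀ A B C : ℝ, -A - 2 * -B + -C = 2 * B - A - C := fun A B C => by ring
  rw [e2] at hlim
  refine ⟨ge_of_tendsto' hlim fun n => integral_nonneg h0, fun hz => eq_of_cdf_increments fun n => ?_⟩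
  rw [hz] at hlim
  have hle : ∫ q, d q ^ 2 / q.1 ^ 2 ∂scales (n + 1) ≤ 0 := by
    refine ge_of_tendsto hlim ?_
    filter_upwards [eventually_ge_atTop n] with m hm
    refine integral_mono_measure ?_ (.of_forall h0) (key m).1
    refine Measure.prod_mono (Measure.restrict_mono (Ioo_subset_Ioo_right ?_) le_rfl) le_rfl
    have : (n : ℝ) ≤ m := by exact_mod_cast hm
    linarith
  have hz2 := (integral_eq_zero_iff_of_nonneg h0 (key n).1).1 (le_antisymm hle (integral_nonneg h0))
  have hpos : ∀ᵐ q ∂scales ((n : ℝ) + 1), 0 < q.1 := by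
    refine Measure.quasiMeasurePreserving_fst.ae (p := fun r => 0 < r) ?_
    filter_upwards [ae_restrict_mem measurableSet_Ioo] with r hr using hr.1
  filter_upwards [hz2, hpos] with q h1 h2
  have h3 : d q ^ 2 = 0 := by
    have := (div_eq_zero_iff.1 h1).resolve_right (pow_ne_zero 2 h2.ne')
    exact this
  exact sub_eq_zero.1 (pow_eq_zero_iff two_ne_zero |>.1 h3)


/-! ### The minimization problem -/

lemma IsField.ge_of_nonneg (h : IsField V c) {t : ℝ} (ht : 0 ≤ t) :
    V 0 + deriv V 0 * t + c / 2 * t ^ 2 ≤ V t := by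
  have hd : ∀ s, HasDerivAt (fun s => V s - (deriv V 0 * s + c / 2 * s ^ 2))
      (deriv V s - (deriv V 0 + c * s)) s := fun s => by
    refine ((h.hasDerivAt s).sub (((hasDerivAt_id s).const_mul _).add
      (((hasDerivAt_id s).pow 2).const_mul _))).congr_deriv ?_
    simp
    ring
  have hm : MonotoneOn (fun s => V s - (deriv V 0 * s + c / 2 * s ^ 2)) (Ici 0) := by
    refine monotoneOn_of_deriv_nonneg (convex_Ici 0)
      (fun s _ => (hd s).continuousAt.continuousWithinAt)
      (fun s _ => (hd s).differentiableAt.differentiableWithinAt) fun s hs => ?_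
    rw [interior_Ici] at hs
    rw [(hd s).deriv]
    linarith [h.deriv_sub_ge (le_of_lt (mem_Ioi.1 hs))]
  have := hm (mem_Ici.2 le_rfl) (mem_Ici.2 ht) ht
  simp only [mul_zero, ne_eq, OfNat.ofNat_ne_zero, not_false_eq_true, zero_pow, add_zero,
    sub_zero] at this
  linarith

/-- The external field grows faster than every linear function. -/
lemma IsField.exists_linear_le (h : IsField V c) (K : ℝ) :
    ∃ C, ∀ t, K * |t| ≤ V t + C := by
  set V' := fun x => V (-x)
  set B := |deriv V 0| + |deriv V' 0| + |K|
  have hc := h.pos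
  have key : ∀ t, V 0 - (B - |K|) * |t| + c / 2 * |t| ^ 2 ≤ V t := by
    intro t
    rcases le_total 0 t with ht | ht
    · have h1 := h.ge_of_nonneg ht
      have h2 := mul_le_mul_of_nonneg_right
        (show -(B - |K|) ≤ deriv V 0 by linarith [neg_abs_le (deriv V 0), abs_nonneg (deriv V' 0)]) ht
      rw [abs_of_nonneg ht]
      linarith
    · have ht' : 0 ≤ -t := by linarith
      have h1 := h.reflect.ge_of_nonneg ht'
      have h2 := mul_le_mul_of_nonneg_right
        (show -(B - |K|) ≤ deriv V' 0 by linarith [neg_abs_le (deriv V' 0), abs_nonneg (deriv V 0)]) ht'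
      simp only [neg_neg, neg_zero] at h1
      rw [abs_of_nonpos ht]
      linarith
  refine ⟨B ^ 2 / (2 * c) - V 0, fun t => ?_⟩
  have h1 := key t
  have h2 : 0 ≤ c / 2 * (|t| - B / c) ^ 2 := by positivity
  have h3 : c / 2 * (|t| - B / c) ^ 2 = c / 2 * |t| ^ 2 - B * |t| + B ^ 2 / (2 * c) := by
    field_simp
    ring
  have h4 := mul_le_mul_of_nonneg_right (le_abs_self K) (abs_nonneg t)
  linarith

/-- The integrability needed to split the energy into its parts. -/
structure LogInt (κ : Measure (ℝ × ℝ)) : Prop where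
  ne : ∀ᵐ p ∂κ, p.1 ≠ p.2
  fst : Integrable (fun p => p.1) κ
  snd : Integrable (fun p => p.2) κ
  log : Integrable (fun p => Real.log |p.1 - p.2|) κ
  sinh : Integrable (fun p => Real.log |2 * Real.sinh ((p.1 - p.2) / 2)|) κ

lemma measurable_log_sub : Measurable fun p : ℝ × ℝ => Real.log |p.1 - p.2| :=
  Real.measurable_log.comp (by fun_prop)

lemma measurable_ell_sub : Measurable fun p : ℝ × ℝ => ell (p.1 - p.2) :=
  measurable_ell.comp (by fun_prop)

namespace LogInt

variable {κ : Measure (ℝ × ℝ)}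

lemma ell (h : LogInt κ) : Integrable (fun p => ell (p.1 - p.2)) κ := h.log.add h.sinh

lemma of_ell (ne : ∀ᵐ p ∂κ, p.1 ≠ p.2) (fst : Integrable (fun p => p.1) κ)
    (snd : Integrable (fun p => p.2) κ) (he : Integrable (fun p => EquiSource.ell (p.1 - p.2)) κ) :
    LogInt κ := by
  have hl : Integrable (fun p => Real.log |p.1 - p.2|) κ := by
    refine (he.abs.add (fst.abs.add snd.abs)).mono' measurable_log_sub.aestronglyMeasurable
      (.of_forall fun p => ?_)
    have h1 := log_abs_le (p.1 - p.2)
    have h2 := log_sinh_le (p.1 - p.2)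
    have h3 : |p.1 - p.2| ≤ |p.1| + |p.2| := abs_sub _ _
    have h4 : EquiSource.ell (p.1 - p.2) = Real.log |p.1 - p.2| +
      Real.log |2 * Real.sinh ((p.1 - p.2) / 2)| := rfl
    have h5 := abs_nonneg (EquiSource.ell (p.1 - p.2))
    have h6 := neg_abs_le (EquiSource.ell (p.1 - p.2))
    simp only [Pi.add_apply]
    exact abs_le.2 ⟨by linarith, by linarith⟩
  refine ⟨ne, fst, snd, hl, (he.sub hl).congr (.of_forall fun p => ?_)⟩
  simp only [Pi.sub_apply, EquiSource.ell]
  ring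

lemma exp (h : LogInt κ) :
    Integrable (fun p => Real.log |Real.exp p.1 - Real.exp p.2|) κ ∧
    ∫ p, Real.log |Real.exp p.1 - Real.exp p.2| ∂κ = (∫ p, Real.log |2 * Real.sinh ((p.1 - p.2) / 2)| ∂κ) +
      ((∫ p, p.1 ∂κ) + ∫ p, p.2 ∂κ) / 2 := by
  have e : (fun p : ℝ × ℝ => Real.log |2 * Real.sinh ((p.1 - p.2) / 2)| + (p.1 + p.2) / 2) =ᵐ[κ]
      fun p => Real.log |Real.exp p.1 - Real.exp p.2| := by
    filter_upwards [h.ne] with p hp using (log_exp_sub_exp hp).symm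
  have i : Integrable (fun p : ℝ × ℝ => (p.1 + p.2) / 2) κ := (h.fst.add h.snd).div_const 2
  refine ⟨(h.sinh.add i).congr e, ?_⟩
  rw [← integral_congr_ae e, integral_add h.sinh i, integral_div, integral_add h.fst h.snd]

end LogInt

/-- Positive definiteness of the kernel `-ell`, as a sum of two logarithmic kernels. -/
theorem ellEnergy_nonneg {ν μ : Measure ℝ} [IsProbabilityMeasure ν] [IsProbabilityMeasure μ]
    (h1 : LogInt (ν.prod ν)) (h2 : LogInt (ν.prod μ)) (h3 : LogInt (μ.prod μ)) :
    0 ≤ 2 * (∫ p, ell (p.1 - p.2) ∂ν.prod μ) - (∫ p, ell (p.1 - p.2) ∂ν.prod ν) -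
      ∫ p, ell (p.1 - p.2) ∂μ.prod μ ∧
    (2 * (∫ p, ell (p.1 - p.2) ∂ν.prod μ) - (∫ p, ell (p.1 - p.2) ∂ν.prod ν) -
      ∫ p, ell (p.1 - p.2) ∂μ.prod μ = 0 → ν = μ) := by
  obtain ⟨k1, k2⟩ := logEnergy_nonneg h1.ne h2.ne h3.ne h1.log h2.log h3.log
  -- the same inequality for the images under the exponential function
  have hE : MeasurableEmbedding fun p : ℝ × ℝ => (exp p.1, exp p.2) :=
    have := Real.continuous_exp.measurableEmbedding Real.exp_injective
    this.prodMap this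
  have hmap : ∀ ν μ : Measure ℝ, IsProbabilityMeasure ν → IsProbabilityMeasure μ →
      (ν.map exp).prod (μ.map exp) =
        (ν.prod μ).map fun p => (exp p.1, exp p.2) := fun ν μ _ _ =>
    Measure.map_prod_map ν μ Real.measurable_exp Real.measurable_exp
  have hd : ∀ ν μ : Measure ℝ, IsProbabilityMeasure ν → IsProbabilityMeasure μ → LogInt (ν.prod μ) →
      (∀ᵐ p ∂(ν.map exp).prod (μ.map exp), p.1 ≠ p.2) ∧
      Integrable (fun p : ℝ × ℝ => log |p.1 - p.2|) ((ν.map exp).prod (μ.map exp)) ∧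
      ∫ p, log |p.1 - p.2| ∂(ν.map exp).prod (μ.map exp) =
        (∫ p, log |2 * sinh ((p.1 - p.2) / 2)| ∂ν.prod μ) +
          ((∫ x, x ∂ν) + ∫ x, x ∂μ) / 2 := fun ν μ i1 i2 hL => by
    rw [hmap ν μ i1 i2]
    refine ⟨hE.ae_map_iff.2 ?_, (hE.integrable_map_iff).2 hL.exp.1, ?_⟩
    · filter_upwards [hL.ne] with p hp using fun hh => hp (Real.exp_injective hh)
    · rw [hE.integral_map, hL.exp.2, integral_fun_fst (fun x => x), integral_fun_snd (fun x => x),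
        probReal_univ, probReal_univ, one_smul, one_smul]
  have p1 : IsProbabilityMeasure (ν.map exp) :=
    Measure.isProbabilityMeasure_map Real.measurable_exp.aemeasurable
  have p2 : IsProbabilityMeasure (μ.map exp) :=
    Measure.isProbabilityMeasure_map Real.measurable_exp.aemeasurable
  obtain ⟨a1, b1, e1⟩ := hd ν ν inferInstance inferInstance h1
  obtain ⟨a2, b2, e2⟩ := hd ν μ inferInstance inferInstance h2
  obtain ⟨a3, b3, e3⟩ := hd μ μ inferInstance inferInstance h3
  have k3 := (logEnergy_nonneg a1 a2 a3 b1 b2 b3).1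
  rw [e1, e2, e3] at k3
  have hadd : ∀ {κ : Measure (ℝ × ℝ)}, LogInt κ → ∫ p, ell (p.1 - p.2) ∂κ =
      (∫ p, log |p.1 - p.2| ∂κ) + ∫ p, log |2 * sinh ((p.1 - p.2) / 2)| ∂κ :=
    fun h => integral_add h.log h.sinh
  rw [hadd h1, hadd h2, hadd h3]
  exact ⟨by linarith, fun hz => k2 (by linarith)⟩

/-- The energy kernel off the diagonal. -/
def realKernel (V : ℝ → ℝ) (p : ℝ × ℝ) : ℝ :=
  1 / 2 * ((V p.1 - p.1 / 2) + (V p.2 - p.2 / 2) - ell (p.1 - p.2))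

lemma energyKernel_eq (V : ℝ → ℝ) {p : ℝ × ℝ} (hp : p.1 ≠ p.2) :
    energyKernel V p.1 p.2 = (realKernel V p : EReal) := by
  have := log_add_log_exp hp
  rw [energyKernel, if_neg hp, realKernel, Real.log_inv, Real.log_inv]
  congr 1
  linarith

lemma energy_eq_integral {ν : Measure ℝ} (hne : ∀ᵐ p ∂ν.prod ν, p.1 ≠ p.2)
    (hi : Integrable (realKernel V) (ν.prod ν)) :
    energy V ν = ((∫ p, realKernel V p ∂ν.prod ν : ℝ) : EReal) := by
  have hr : ∀ x : ℝ, (x : EReal).toENNReal = ENNReal.ofReal x := fun x => by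
    rw [EReal.toENNReal_of_ne_top (EReal.coe_ne_top x), EReal.toReal_coe]
  have e1 : ∫⁻ p, (energyKernel V p.1 p.2).toENNReal ∂ν.prod ν =
      ∫⁻ p, ENNReal.ofReal (realKernel V p) ∂ν.prod ν := lintegral_congr_ae (by
    filter_upwards [hne] with p hp
    rw [energyKernel_eq V hp, hr])
  have e2 : ∫⁻ p, (-energyKernel V p.1 p.2).toENNReal ∂ν.prod ν =
      ∫⁻ p, ENNReal.ofReal (-realKernel V p) ∂ν.prod ν := lintegral_congr_ae (by
    filter_upwards [hne] with p hp
    rw [energyKernel_eq V hp, ← EReal.coe_neg, hr])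
  rw [energy, e1, e2, integral_eq_lintegral_pos_part_sub_lintegral_neg_part hi, EReal.coe_sub,
    EReal.coe_ennreal_toReal hi.lintegral_lt_top.ne,
    EReal.coe_ennreal_toReal hi.fun_neg.lintegral_lt_top.ne]

/-- The energy in terms of the symmetrized kernel. -/
lemma LogInt.energy_eq {ν : Measure ℝ} [IsProbabilityMeasure ν] (h : LogInt (ν.prod ν))
    (hx : Integrable (fun x => x) ν) (hV : Integrable V ν) : energy V ν =
      ((∫ x, (V x - x / 2) ∂ν - 1 / 2 * ∫ p, EquiSource.ell (p.1 - p.2) ∂ν.prod ν : ℝ) : EReal) := by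
  have hW : Integrable (fun x => V x - x / 2) ν := hV.sub (hx.div_const 2)
  have i1 := hW.comp_fst ν
  have i2 := hW.comp_snd ν
  have i3 : Integrable (fun p : ℝ × ℝ => (V p.1 - p.1 / 2) + (V p.2 - p.2 / 2)) (ν.prod ν) := i1.add i2
  rw [energy_eq_integral h.ne ((i3.sub h.ell).const_mul _)]
  simp only [realKernel]
  rw [integral_const_mul, integral_sub i3 h.ell, integral_add i1 i2,
    integral_fun_fst (fun x => V x - x / 2), integral_fun_snd (fun x => V x - x / 2), probReal_univ,
    one_smul]
  congr 1
  ring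

/-- Finite energy implies all the integrability needed, since the kernel is bounded below by a sum of
two functions that control the external field. -/
theorem IsField.logInt_of_energy (h : IsField V c) {ν : Measure ℝ}
    [IsProbabilityMeasure ν] (he : energy V ν ≠ ⊤) :
    LogInt (ν.prod ν) ∧ Integrable (fun x => x) ν ∧ Integrable V ν := by
  obtain ⟨C₀, hC₀⟩ := h.exists_linear_le 0
  obtain ⟨C₁, hC₁⟩ := h.exists_linear_le 5
  set g : ℝ → ℝ := fun t => V t / 2 - 3 / 2 * |t| with hg
  set C := 2 * |C₀| + 3 * C₁
  have hVg : ∀ t, |V t| + |t| ≤ 8 * g t + C := fun t => by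
    have h1 := hC₀ t
    have h2 := hC₁ t
    have : |V t| ≤ V t + 2 * |C₀| :=
      abs_le.2 ⟨by linarith [le_abs_self C₀], by linarith [abs_nonneg C₀]⟩
    simp only [hg]
    linarith [abs_nonneg t]
  have hg0 : ∀ t, 0 ≤ g t + C / 8 := fun t => by
    linarith [hVg t, abs_nonneg (V t), abs_nonneg t]
  have hlow : ∀ p : ℝ × ℝ, g p.1 + g p.2 ≤ realKernel V p := fun p => by
    have h1 := log_abs_le (p.1 - p.2)
    have h2 := log_sinh_le (p.1 - p.2)
    have h3 : |p.1 - p.2| ≤ |p.1| + |p.2| := abs_sub _ _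
    simp only [hg, realKernel, ell]
    linarith [le_abs_self p.1, le_abs_self p.2, abs_nonneg p.1, abs_nonneg p.2]
  have hkm : Measurable (realKernel V) := by
    have h1 := h.continuous.measurable
    exact (((h1.comp measurable_fst).sub (by fun_prop)).add
      ((h1.comp measurable_snd).sub (by fun_prop))).sub measurable_ell_sub |>.const_mul _
  have hKm : Measurable fun p : ℝ × ℝ => (energyKernel V p.1 p.2).toENNReal := by
    have e : (fun p : ℝ × ℝ => energyKernel V p.1 p.2) =
        fun p => if p.1 = p.2 then ⊤ else (realKernel V p : EReal) := by
      ext p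
      split_ifs with hp
      · rw [energyKernel, if_pos hp]
      · exact energyKernel_eq V hp
    have hm : Measurable fun p : ℝ × ℝ => energyKernel V p.1 p.2 := by
      rw [e]
      exact Measurable.ite (measurableSet_eq_fun measurable_fst measurable_snd) measurable_const
        hkm.coe_real_ereal
    exact hm.ereal_toENNReal
  set P := ∫⁻ p, (energyKernel V p.1 p.2).toENNReal ∂ν.prod ν with hP
  -- the negative part of the energy is finite, hence so is the positive part
  have hPt : P ≠ ⊤ := by
    intro hcon
    refine he ?_
    rw [energy, ← hP, hcon, EReal.coe_ennreal_top, EReal.top_sub]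
    rw [Ne, EReal.coe_ennreal_eq_top_iff]
    have hle : ∫⁻ p, (-energyKernel V p.1 p.2).toENNReal ∂ν.prod ν ≤
        ∫⁻ _, ENNReal.ofReal (C / 4) ∂ν.prod ν := by
      refine lintegral_mono fun p => ?_
      by_cases hp : p.1 = p.2
      · rw [energyKernel, if_pos hp]
        simp
      · rw [energyKernel_eq V hp, ← EReal.coe_neg, EReal.toENNReal_of_ne_top (EReal.coe_ne_top _),
          EReal.toReal_coe]
        exact ENNReal.ofReal_le_ofReal (by linarith [hlow p, hg0 p.1, hg0 p.2])
    rw [lintegral_const, measure_univ, mul_one] at hle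
    exact (hle.trans_lt ENNReal.ofReal_lt_top).ne
  have hne : ∀ᵐ p ∂ν.prod ν, p.1 ≠ p.2 := by
    filter_upwards [ae_lt_top hKm hPt] with p hp hh
    rw [energyKernel, if_pos hh, EReal.toENNReal_top] at hp
    exact lt_irrefl _ hp
  have hk0 : ∀ p, 0 ≤ realKernel V p + C / 4 := fun p => by
    linarith [hlow p, hg0 p.1, hg0 p.2]
  have hki : Integrable (realKernel V) (ν.prod ν) := by
    have h1 : Integrable (fun p => realKernel V p + C / 4) (ν.prod ν) := by
      refine ⟨(hkm.add_const _).aestronglyMeasurable,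
        (hasFiniteIntegral_iff_ofReal (.of_forall hk0)).2 ?_⟩
      calc ∫⁻ p, ENNReal.ofReal (realKernel V p + C / 4) ∂ν.prod ν ≤
            ∫⁻ p, (energyKernel V p.1 p.2).toENNReal + ENNReal.ofReal (C / 4) ∂ν.prod ν := by
            refine lintegral_mono_ae ?_
            filter_upwards [hne] with p hp
            rw [energyKernel_eq V hp, EReal.toENNReal_of_ne_top (EReal.coe_ne_top _), EReal.toReal_coe]
            exact ENNReal.ofReal_add_le
        _ = P + ENNReal.ofReal (C / 4) := by
            rw [lintegral_add_right _ measurable_const, lintegral_const, measure_univ, mul_one]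
        _ < ⊤ := ENNReal.add_lt_top.2 ⟨hPt.lt_top, ENNReal.ofReal_lt_top⟩
    exact (h1.sub (integrable_const (C / 4))).congr (.of_forall fun p => by simp)
  have hgc : Continuous g := (h.continuous.div_const 2).sub (by fun_prop)
  have hgi : Integrable g ν := by
    have h1 : Integrable (fun p : ℝ × ℝ => g p.1 + g p.2) (ν.prod ν) := by
      refine (hki.abs.add (integrable_const |C / 4|)).mono'
        (by fun_prop : Continuous fun p : ℝ × ℝ => g p.1 + g p.2).aestronglyMeasurable
        (.of_forall fun p => ?_)
      have := hlow p
      refine abs_le.2 ⟨?_, ?_⟩ <;> simp only [Pi.add_apply]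
      · linarith [hg0 p.1, hg0 p.2, abs_nonneg (realKernel V p), le_abs_self (C / 4)]
      · linarith [le_abs_self (realKernel V p), abs_nonneg (C / 4)]
    obtain ⟨y, hy⟩ := h1.prod_left_ae.exists
    exact (hy.sub (integrable_const (g y))).congr (.of_forall fun x => by simp)
  have hdom : Integrable (fun t => 8 * g t + C) ν := (hgi.const_mul 8).add (integrable_const C)
  have hx : Integrable (fun x : ℝ => x) ν := hdom.mono' continuous_id.aestronglyMeasurable
    (.of_forall fun t => by
      rw [Real.norm_eq_abs]; linarith [hVg t, abs_nonneg (V t)])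
  have hV : Integrable V ν := hdom.mono' h.continuous.aestronglyMeasurable
    (.of_forall fun t => by
      rw [Real.norm_eq_abs]; linarith [hVg t, abs_nonneg t])
  refine ⟨LogInt.of_ell hne (hx.comp_fst ν) (hx.comp_snd ν) ?_, hx, hV⟩
  have hW : Integrable (fun x => V x - x / 2) ν := hV.sub (hx.div_const 2)
  refine (((hW.comp_fst ν).add (hW.comp_snd ν)).sub (hki.const_mul 2)).congr
    (.of_forall fun p => ?_)
  simp only [realKernel, Pi.sub_apply, Pi.add_apply]
  ring

/-- Logarithmic integrability against a bounded density. -/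
lemma IsBoundedDensity.logInt {ρ : ℝ → ℝ} {a b M : ℝ} (h : IsBoundedDensity ρ a b M)
    (h1 : ∫ t, ρ t = 1) {ν : Measure ℝ} [IsProbabilityMeasure ν] (hx : Integrable (fun x => x) ν) :
    LogInt (ν.prod (densityMeasure ρ)) := by
  have := h.isProbabilityMeasure h1
  have hm : Measurable fun p : ℝ × ℝ => invSqrt (p.1 - p.2) := by
    have : Measurable invSqrt := Measurable.indicator
      (measurable_norm.pow_const _) measurableSet_Icc
    exact this.comp (by fun_prop)
  have hy : Integrable (fun x => x) (densityMeasure ρ) :=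
    (integrable_densityMeasure h.measurable h.nonneg).2 (h.integrable_mul_of_continuous continuous_id)
  have hne : ∀ᵐ p ∂ν.prod (densityMeasure ρ), p.1 ≠ p.2 := by
    have hs : MeasurableSet {p : ℝ × ℝ | p.1 = p.2} := measurableSet_eq_fun measurable_fst measurable_snd
    have : (ν.prod (densityMeasure ρ)) {p : ℝ × ℝ | p.1 = p.2} = 0 := by
      rw [Measure.measure_prod_null hs]
      refine .of_forall fun x => withDensity_absolutelyContinuous _ _ ?_
      have e : Prod.mk x ⁻¹' {p : ℝ × ℝ | p.1 = p.2} = {x} := by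
        ext y
        simp [eq_comm]
      rw [e, Real.volume_singleton]
    simpa [ae_iff] using this
  have hint : ∀ x, Integrable (fun t => ρ t * invSqrt (x - t)) ∧
      ∫ t, ρ t * invSqrt (x - t) ≤ M * ∫ t, invSqrt t := fun x => by
    have i1 := integrable_invSqrt.comp_sub_left x
    have i2 : Integrable fun t => ρ t * invSqrt (x - t) := h.integrable_mul i1.integrableOn
    refine ⟨i2, ?_⟩
    rw [← integral_sub_left_eq_self invSqrt volume x, ← integral_const_mul]
    exact integral_mono i2 (i1.const_mul M)
      fun t => mul_le_mul_of_nonneg_right (h.le t) (invSqrt_nonneg _)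
  have hi : Integrable (fun p : ℝ × ℝ => invSqrt (p.1 - p.2)) (ν.prod (densityMeasure ρ)) := by
    refine (integrable_prod_iff hm.aestronglyMeasurable).2 ⟨Eventually.of_forall fun x =>
      (integrable_densityMeasure h.measurable h.nonneg).2 (hint x).1, ?_⟩
    refine Integrable.of_bound hm.norm.stronglyMeasurable.integral_prod_right'.aestronglyMeasurable
      (M * ∫ t, invSqrt t) (.of_forall fun x => ?_)
    rw [Real.norm_of_nonneg (integral_nonneg fun _ => norm_nonneg _)]
    simp only [Real.norm_of_nonneg (invSqrt_nonneg _)]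
    rw [integral_densityMeasure h.measurable h.nonneg]
    exact (hint x).2
  have i1 := hx.comp_fst (densityMeasure ρ)
  have i2 := hy.comp_snd ν
  refine LogInt.of_ell hne i1 i2 ((((i1.abs.add i2.abs).const_mul 2).add (hi.const_mul 4)).mono'
    measurable_ell_sub.aestronglyMeasurable (.of_forall fun p => ?_))
  have h3 : |p.1 - p.2| ≤ |p.1| + |p.2| := abs_sub _ _
  have h4 := abs_ell_le (p.1 - p.2)
  simp only [Pi.add_apply, Real.norm_eq_abs]
  linarith

/-- A bounded density satisfying the variational conditions is the unique minimizer. -/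
theorem isEquilibriumMeasure_iff (hV : IsField V c) {ρ : ℝ → ℝ} {a b M l : ℝ}
    (h : IsBoundedDensity ρ a b M) (h1 : ∫ t, ρ t = 1)
    (heq : ∀ x ∈ Icc a b, V x - x / 2 - ellPot ρ x = l)
    (hle : ∀ x, l ≤ V x - x / 2 - ellPot ρ x) (ν : Measure ℝ) :
    IsEquilibriumMeasure V ν ↔ ν = densityMeasure ρ := by
  set μ := densityMeasure ρ with hμ
  have hpμ : IsProbabilityMeasure μ := h.isProbabilityMeasure h1
  have hxμ : Integrable (fun x => x) μ :=
    (integrable_densityMeasure h.measurable h.nonneg).2 (h.integrable_mul_of_continuous continuous_id)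
  have hVμ : Integrable V μ :=
    (integrable_densityMeasure h.measurable h.nonneg).2 (h.integrable_mul_of_continuous hV.continuous)
  have hL := h.logInt h1 hxμ
  have hpot : ∀ x, ∫ t, ell (x - t) ∂μ = ellPot ρ x := fun x => by
    rw [hμ, integral_densityMeasure h.measurable h.nonneg, ellPot]
    congr 1
    ext t
    rw [← ell_neg, neg_sub]
  -- the energy gap is the sum of a quadratic form and of an integral of the effective potential
  have gap : ∀ ν : Measure ℝ, IsProbabilityMeasure ν → energy V ν ≠ ⊤ →
      ∃ A B : ℝ, energy V ν = (A : EReal) ∧ energy V μ = (B : EReal) ∧ B ≤ A ∧ (A ≤ B → ν = μ) := by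
    intro ν hpν hfin
    obtain ⟨hν, hxν, hVν⟩ := hV.logInt_of_energy hfin
    have hνμ := h.logInt h1 hxν
    obtain ⟨d1, d2⟩ := ellEnergy_nonneg hν hνμ hL
    refine ⟨_, _, hν.energy_eq hxν hVν, hL.energy_eq hxμ hVμ, ?_⟩
    have f1 : ∀ {ν : Measure ℝ}, IsProbabilityMeasure ν → LogInt (ν.prod μ) →
        Integrable (fun x => x) ν → Integrable V ν →
        Integrable (fun x => V x - x / 2 - ellPot ρ x) ν ∧
        ∫ x, (V x - x / 2 - ellPot ρ x) ∂ν =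
          ∫ x, (V x - x / 2) ∂ν - ∫ p, ell (p.1 - p.2) ∂ν.prod μ := by
      intro ν _ hL hx hV
      have j1 : Integrable (fun x => V x - x / 2) ν := hV.sub (hx.div_const 2)
      have j2 := hL.ell.integral_prod_left
      simp only [hpot] at j2
      rw [integral_prod _ hL.ell]
      simp only [hpot]
      exact ⟨j1.sub j2, integral_sub j1 j2⟩
    obtain ⟨g1, g2⟩ := f1 hpν hνμ hxν hVν
    obtain ⟨-, g3⟩ := f1 hpμ hL hxμ hVμ
    have g4 : l ≤ ∫ x, (V x - x / 2 - ellPot ρ x) ∂ν := by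
      have := integral_mono (integrable_const l) g1 hle
      rwa [integral_const, probReal_univ, one_smul] at this
    have g5 : ∫ x, (V x - x / 2 - ellPot ρ x) ∂μ = l := by
      rw [hμ, integral_densityMeasure h.measurable h.nonneg]
      have e : ∀ t, ρ t * (V t - t / 2 - ellPot ρ t) = ρ t * l := fun t => by
        by_cases ht : t ∈ Ioo a b
        · rw [heq t (Ioo_subset_Icc_self ht)]
        · rw [h.eq_zero t ht, zero_mul, zero_mul]
      simp only [e]
      rw [integral_mul_const, h1, one_mul]
    exact ⟨by linarith, fun hA => d2 (by linarith)⟩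
  have hμfin : energy V μ ≠ ⊤ := by
    rw [hL.energy_eq hxμ hVμ]
    exact EReal.coe_ne_top _
  constructor
  · rintro ⟨hp, hmin⟩
    have hle := hmin μ hpμ
    obtain ⟨A, B, hA, hB, -, hAB⟩ := gap ν hp (ne_top_of_le_ne_top hμfin hle)
    rw [hA, hB] at hle
    exact hAB (EReal.coe_le_coe_iff.1 hle)
  · rintro rfl
    refine ⟨hpμ, fun ν hν => ?_⟩
    by_cases hfin : energy V ν = ⊤
    · rw [hfin]
      exact le_top
    obtain ⟨A, B, hA, hB, hBA, -⟩ := gap ν hν hfin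
    rw [hA, hB]
    exact EReal.coe_le_coe_iff.2 hBA


/-! ### The equilibrium measure of a strongly convex field -/

lemma IsField.tendsto_div (h : IsField V c) {l : Filter ℝ}
    (hl : Tendsto (fun x : ℝ => |x|) l atTop) : Tendsto (fun x => V x / (|x| + 1)) l atTop := by
  refine tendsto_atTop.2 fun K => ?_
  obtain ⟨C, hC⟩ := h.exists_linear_le (K + 1)
  filter_upwards [hl.eventually_ge_atTop (K + C)] with x hx
  rw [le_div_iff₀ (by positivity)]
  linarith [hC x]

lemma Gk_eq_densityIntegrand {c₁ c₀ x u : ℝ} (hc : 0 < c₁)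
    (hx : x ∈ Icc (c₀ - radius c₁) (c₀ + radius c₁))
    (hu : u ∈ Icc (c₀ - radius c₁) (c₀ + radius c₁)) :
    densityIntegrand V c₁ c₀ x u = deriv (deriv V) u * Gk c₁ (u - c₀) (x - c₀) := by
  rw [← leftEnd_eq hc, ← rightEnd_eq hc] at hx hu
  rw [densityIntegrand, Iplus_eq hc hx, Iplus_eq hc hu, Iminus_eq hc hx, Gk]

/-- The density formula. -/
lemma psi_eq_integral (h : IsField V c) (hc : 0 < c₁) (c₀ : ℝ) {x : ℝ}
    (hx : x ∈ Ioo (c₀ - radius c₁) (c₀ + radius c₁)) :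
    IntervalIntegrable (densityIntegrand V c₁ c₀ x) volume (c₀ - radius c₁) (c₀ + radius c₁) ∧
    psi V c₁ c₀ x = 1 / (2 * π ^ 2) *
      ∫ u in (c₀ - radius c₁)..(c₀ + radius c₁), densityIntegrand V c₁ c₀ x u := by
  have hw := radius_pos hc
  have e : EqOn (fun u => deriv (deriv V) u * Gk c₁ (u - c₀) (x - c₀)) (densityIntegrand V c₁ c₀ x)
      (uIcc (c₀ - radius c₁) (c₀ + radius c₁)) := fun u hu => by
    rw [uIcc_of_le (by linarith)] at hu
    exact (Gk_eq_densityIntegrand hc (Ioo_subset_Icc_self hx) hu).symm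
  have i1 := (intervalIntegrable_mul_Gk hc (continuous_weight h c₀) (sub_mem_Ioo hx)).comp_sub_right c₀
  simp only [add_sub_cancel] at i1
  rw [add_comm (-_), add_comm (radius c₁), ← sub_eq_add_neg] at i1
  refine ⟨i1.congr fun u hu => e (uIoc_subset_uIcc hu), ?_⟩
  have h1 := intervalIntegral.integral_comp_add_left (a := -radius c₁) (b := radius c₁)
    (fun u => deriv (deriv V) u * Gk c₁ (u - c₀) (x - c₀)) c₀
  simp only [add_sub_cancel_left] at h1
  rw [psi, indicator_of_mem hx, dens, h1, ← intervalIntegral.integral_congr e,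
    ← sub_eq_add_neg c₀ (radius c₁)]

/-- Every solution of the two equations yields the equilibrium measure. -/
lemma isEquilibriumMeasure_iff_psi (h : IsField V c) (hc : 0 < c₁) (c₀ : ℝ)
    (hs : meanStiffness V c₁ c₀ = π / c₁) (hf : meanForce V c₁ c₀ = 0) (ν : Measure ℝ) :
    IsEquilibriumMeasure V ν ↔ ν = densityMeasure (psi V c₁ c₀) := by
  obtain ⟨M, hM⟩ := isBoundedDensity_psi h hc c₀
  have h1 := integral_psi h hc c₀ hs
  obtain ⟨l, heq, hlt⟩ := (isOneCutDensity_psi h hc c₀ hs hf).variational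
  simp only [hM.effectivePotential_eq h1] at heq hlt
  refine isEquilibriumMeasure_iff h hM h1 (l := (∫ t, psi V c₁ c₀ t * t) / 2 - l)
    (fun x hx => by linarith [heq x hx]) (fun x => ?_) ν
  by_cases hx : x ∈ Icc (c₀ - radius c₁) (c₀ + radius c₁)
  · linarith [heq x hx]
  · linarith [hlt x hx]

/-- The two equations have at most one solution, since the support of the equilibrium measure
determines the parameters. -/
lemma solution_unique {c c₁ c₀ x₁ x₀ : ℝ} (h : IsField V c) (hc : 0 < c₁) (hx : 0 < x₁)
    (hs : meanStiffness V c₁ c₀ = π / c₁) (hf : meanForce V c₁ c₀ = 0)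
    (hs' : meanStiffness V x₁ x₀ = π / x₁) (hf' : meanForce V x₁ x₀ = 0) :
    x₁ = c₁ ∧ x₀ = c₀ := by
  have h1 := isOneCutDensity_psi h hc c₀ hs hf
  have h2 := isOneCutDensity_psi h hx x₀ hs' hf'
  have e := (isEquilibriumMeasure_iff_psi h hc c₀ hs hf _).1
    ((isEquilibriumMeasure_iff_psi h hx x₀ hs' hf' _).2 rfl)
  have e2 := h2.support_eq
  rw [e, h1.support_eq] at e2
  obtain ⟨e3, e4⟩ := (Icc_eq_Icc_iff h1.lt.le).1 e2
  have hw : radius c₁ = radius x₁ := by linarith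
  refine ⟨?_, by linarith⟩
  rcases lt_trichotomy x₁ c₁ with hlt | rfl | hlt
  · exact absurd hw (radius_lt hx hlt).ne'
  · rfl
  · exact absurd hw (radius_lt hc hlt).ne

end

end EquiSource

theorem theorem1p4 (V : ℝ → ℝ) (hV : AnalyticOnNhd ℝ V Set.univ)
    (hconv : ∃ c : ℝ, 0 < c ∧ ∀ x : ℝ, c ≤ deriv (deriv V) x) :
    IsOneCutRegular V ∧
    ∃ (c₁ c₀ a b : ℝ) (ψ : ℝ → ℝ),
      -- `ψ` is the density of the unique equilibrium measure, which has support `[a,b]`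
      IsOneCutDensity V a b ψ ∧
      (∀ μ : Measure ℝ, IsEquilibriumMeasure V μ ↔ μ = densityMeasure ψ) ∧
      -- `c₁ > 0` and `c₀` are related to the endpoints `a`, `b`
      0 < c₁ ∧
      c₀ = (b + a) / 2 ∧
      c₁ * Real.sqrt (1 / 4 + 1 / c₁)
        - Real.log ((Real.sqrt (1 / 4 + 1 / c₁) - 1 / 2) / (Real.sqrt (1 / 4 + 1 / c₁) + 1 / 2))
        = (b - a) / 2 ∧
      -- they are the solution of the pair of equations, and they determine `a` and `b`
      (∀ x₁ x₀ : ℝ, 0 < x₁ → (SolvesEndpointEquations V x₁ x₀ ↔ x₁ = c₁ ∧ x₀ = c₀)) ∧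
      (a : ℂ) = J c₁ c₀ (sA c₁ : ℂ) ∧
      (b : ℂ) = J c₁ c₀ (sB c₁ : ℂ) ∧
      -- the inverse `I₁` and its boundary values `I₊`, `I₋` are well defined
      Set.BijOn (J c₁ c₀) (closure (region c₁ c₀))ᶜ (realSet (Set.Icc a b))ᶜ ∧
      (∀ x ∈ Set.Ioo a b,
        Tendsto (fun ε : ℝ => I₁ c₁ c₀ ((x : ℂ) + Complex.I * (ε : ℂ))) (𝓝[>] 0)
          (𝓝 (Iplus c₁ c₀ x)) ∧
        Tendsto (fun ε : ℝ => I₁ c₁ c₀ ((x : ℂ) - Complex.I * (ε : ℂ))) (𝓝[>] 0)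
          (𝓝 (Iminus c₁ c₀ x))) ∧
      -- the density formula
      (∀ x ∈ Set.Ioo a b,
        IntervalIntegrable (densityIntegrand V c₁ c₀ x) volume a b ∧
        ψ x = 1 / (2 * Real.pi ^ 2) * ∫ u in a..b, densityIntegrand V c₁ c₀ x u) := by
  obtain ⟨c, hc0, hc⟩ := hconv
  have h : IsField V c := ⟨(contDiffOn_univ.1 (hV.contDiffOn uniqueDiffOn_univ)), hc0, hc⟩
  obtain ⟨c₁, c₀, hc₁, hs, hf⟩ := exists_solution h
  have hd := isOneCutDensity_psi h hc₁ c₀ hs hf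
  refine ⟨⟨hV, h.tendsto_div tendsto_abs_atTop_atTop, h.tendsto_div tendsto_abs_atBot_atTop,
    _, _, _, hd⟩, c₁, c₀, c₀ - radius c₁, c₀ + radius c₁, psi V c₁ c₀, hd,
    isEquilibriumMeasure_iff_psi h hc₁ c₀ hs hf, hc₁, by ring, ?_, fun x₁ x₀ hx₁ => ⟨fun hx => ?_, ?_⟩,
    (J_sA hc₁ c₀).symm, (J_sB hc₁ c₀).symm, ?_, fun x hx => ?_, fun x hx => psi_eq_integral h hc₁ c₀ hx⟩
  · have e : c₀ + radius c₁ - (c₀ - radius c₁) = 2 * radius c₁ := by ring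
    rw [e, mul_div_cancel_left₀ _ two_ne_zero]
    rfl
  · obtain ⟨hs', hf'⟩ := (solves_iff h.contDiff hx₁).1 hx
    exact solution_unique h hc₁ hx₁ hs hf hs' hf'
  · rintro ⟨rfl, rfl⟩
    exact (solves_iff h.contDiff hx₁).2 ⟨hs, hf⟩
  · rw [← leftEnd_eq hc₁, ← rightEnd_eq hc₁]
    exact J_bijOn hc₁ c₀
  · rw [← leftEnd_eq hc₁, ← rightEnd_eq hc₁] at hx
    have hx' := Ioo_subset_Icc_self hx
    rw [Iplus_eq hc₁ hx', Iminus_eq hc₁ hx']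
    exact ⟨tendsto_I₁ hc₁ hx', tendsto_I₁' hc₁ hx'⟩
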